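/- **Setting.** Let $g>0$ and $0<\rho_{\mathrm{st}}<\bar\rho_0$, and let $p$ be a pressure law that is $C^2$ near every $\rho\ge\rho_{\mathrm{st}}$, with $p(\bar\rho_0)=0$, and $p'(\rho)>0$ and $2p'(\rho)+\rho p''(\rho)>0$ for all $\rho\ge\rho_{\mathrm{st}}$. Put $h(\rho)=\int_{\bar\rho_0}^{\rho}\frac{p'(s)}{s}\,ds$ and $y^{\mathrm{st}}=\frac{p'(\bar\rho_0)}{2g}$, and assume $\frac{p'(\rho_{\mathrm{st}})}2+h(\rho_{\mathrm{st}})=0$, so that $\rho_{\mathrm{st}}$ is the critical density at height $y^{\mathrm{st}}$. The critical density $\rho_{\mathrm{cr},y}$ at height $y$ is the solution $\rho\ge\rho_{\mathrm{st}}$ of $\frac{p'(\rho)}{2}+h(\rho)+gy=\frac{p'(\bar\rho_0)}{2}$. The density $\rho(t;y)$ is the solution $\rho>\rho_{\mathrm{cr},y}$ of $2\rho^2\big(\frac{p'(\bar\rho_0)}2-gy-h(\rho)\big)=t$. (Both are unique where they exist.) Set $H(t;s)=\rho(2\bar\rho_0^2gt;\,y^{\mathrm{st}}-s)$, $H_0=H(0;0)=\bar\rho_0$,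 $F(t;s)=\int_0^t\frac{d\tau}{H(\tau;s)}$, $\Lambda(t;s)=2t\,\partial_1F(t;s)-F(t;s)$ and $\lambda(s)=\Lambda(s;s)$. Let $\Omega\subset\mathbb R^2$ be a bounded domain meeting $\{x_2=0\}$. A function $u\in W^{1,2}_{\mathrm{loc}}(\Omega)$ is a *subsonic variational solution* of $$\operatorname{div}\Big(\frac{\nabla u}{H(|\nabla u|^2;x_2)}\Big)=0\ \text{ in }\Omega\cap\{u>0\},\qquad |\nabla u|^2=x_2\ \text{ on }\Omega\cap\partial\{u>0\},$$ if - $u\ge0$ in $\Omega$, and $u=0$ in $\Omega\cap\{x_2\le0\}$; - $u\in C^0(\Omega)\cap C^2(\Omega\cap\{u>0\})$; - for some $\varepsilon_0>0$, $H(|\nabla u|^2;x_2)-\rho_{\mathrm{cr},\,y^{\mathrm{st}}-x_2}\ge\varepsilon_0$ a.e. in $\Omega\cap\{u>0\}$; - for every $\phi\in C^1_0(\Omega;\mathbb R^2)$, $$\int_\Omega\Big[\big(F(|\nabla u|^2;x_2)+\lambda(x_2)\chi_{\{u>0\}}\big)\operatorname{div}\phi-2\partial_1F(|\nabla u|^2;x_2)\,\nabla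 u\,D\phi\,\nabla u+\big(\lambda'(x_2)\chi_{\{u>0\}}+\partial_2F(|\nabla u|^2;x_2)\big)\phi_2\Big]dx=0 .$$ For $x^\circ\in\Omega$ with $x^\circ_2=0$ put $$\Phi(x^\circ,u;r)=r^{-3}\int_{B_r(x^\circ)}\big(F(|\nabla u|^2;x_2)+\lambda(x_2)\chi_{\{u>0\}}\big)dx-\frac32\,r^{-4}\int_{\partial B_r(x^\circ)}\frac{u^2}{H_0}\,d\mathcal H^1 .$$ **Proposition.** Let $u$ be a subsonic variational solution in $\Omega\subset\mathbb R^2$ such that locally in $\Omega$, i.e. on each compact subset with some constant $C$, $|\nabla u|^2\le C\,x_2^+$ a.e. Let $x^\circ\in\Omega$ satisfy $u(x^\circ)=0$ and $x^\circ_2=0$. Suppose that $\chi_{\{u>0\}}$ is locally of bounded variation in $\Omega\cap\{x_2>0\}$, and that for some constant $C_0$ $$r^{-3/2}\int_{B_r(x^\circ)\cap\{x_2>0\}}\sqrt{x_2}\;|\nabla\chi_{\{u>0\}}|\,dx\le C_0\qquad\text{for all } r>0\text{ with } \overline{B_r(x^\circ)}\subset\Omega,$$ where $|\nabla\chi_{\{u>0\}}|$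 is the total variation measure. Then the limit $\Phi(x^\circ,u;0^+)=\lim_{r\to0^+}\Phi(x^\circ,u;r)$ exists and: 1. $\Phi(x^\circ,u;0^+)\in\Big\{0,\ \frac{\sqrt3}{3H_0},\ \frac{2}{3H_0}\Big\}$. 2. If $\Phi(x^\circ,u;0^+)=\frac{\sqrt3}{3H_0}$, then, with $x=(R\cos\theta,R\sin\theta)$ and $\theta\in(-\pi,\pi]$, $$\frac{u(x^\circ+rx)}{r^{3/2}}\to\frac{\sqrt2}{3}R^{3/2}\cos\Big(\frac32\Big(\min\Big\{\max\Big\{\theta,\frac\pi6\Big\},\frac{5\pi}6\Big\}-\frac\pi2\Big)\Big)\quad\text{as }r\to0^+,$$ strongly in $W^{1,2}_{\mathrm{loc}}(\mathbb R^2)$ and locally uniformly in $\mathbb R^2$. 3. If $\Phi(x^\circ,u;0^+)=0$, then $\frac{u(x^\circ+rx)}{r^{3/2}}\to0$ as $r\to0^+$, strongly in $W^{1,2}_{\mathrm{loc}}(\mathbb R^2)$ and locally uniformly in $\mathbb R^2$. -/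

import Mathlib

open Set Filter Topology MeasureTheory
open scoped ContDiff

namespace StokesWave

noncomputable section

/-- The Euclidean plane; `x 0`, `x 1` are the coordinates `x₁`, `x₂`. -/
abbrev Plane : Type := EuclideanSpace ℝ (Fin 2)

/-! ### The liquid: pressure law, critical density, density on the subsonic branch -/

/-- The enthalpy `∫_{ρ₀}^{ρ} p'(s)/s ds`. -/
def enthalpy (p : ℝ → ℝ) (ρ₀ ρ : ℝ) : ℝ :=
  ∫ s in ρ₀..ρ, deriv p s / s

/-- A liquid under gravity `g`, with density `ρ₀ > 0` on the free surface and pressure law `p`.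
`ρst` is the critical density at the height of the stagnation points; the constitutive
conditions are required for all densities `ρ ≥ ρst` (where `ρst < ρ₀`). -/
structure Liquid where
  p : ℝ → ℝ
  g : ℝ
  ρ₀ : ℝ
  ρst : ℝ
  g_pos : 0 < g
  ρst_pos : 0 < ρst
  ρst_lt : ρst < ρ₀
  smooth : ∀ ρ, ρst ≤ ρ → ContDiffAt ℝ 2 p ρ
  p_surface : p ρ₀ = 0
  deriv_pos : ∀ ρ, ρst ≤ ρ → 0 < deriv p ρ
  genuine : ∀ ρ, ρst ≤ ρ → 0 < 2 * deriv p ρ + ρ * deriv (deriv p) ρ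
  critical_st : deriv p ρst / 2 + enthalpy p ρ₀ ρst = 0

namespace Liquid

variable (L : Liquid)

/-- The enthalpy `h`. -/
def h (ρ : ℝ) : ℝ := enthalpy L.p L.ρ₀ ρ

/-- The height of the stagnation points, `p'(ρ₀) / (2 g)`. -/
def yst : ℝ := deriv L.p L.ρ₀ / (2 * L.g)

/-- `c` is a critical (sonic) density at height `y`. There is at most one such `c`, because
`ρ ↦ p'(ρ)/2 + h(ρ)` is strictly increasing on `[ρst, ∞)`. -/
def IsCritical (y c : ℝ) : Prop :=
  L.ρst ≤ c ∧ deriv L.p c / 2 + L.h c + L.g * y = deriv L.p L.ρ₀ / 2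

/-- The critical density at height `y` (the only element of the set, if there is one; the set is
nonempty in particular for `0 ≤ y ≤ yst`). -/
def critDensity (y : ℝ) : ℝ := sInf {c | L.IsCritical y c}

/-- The Bernoulli function: `|∇ψ|² = bernoulli ρ y`. -/
def bernoulli (ρ y : ℝ) : ℝ := 2 * ρ ^ 2 * (deriv L.p L.ρ₀ / 2 - L.g * y - L.h ρ)

/-- The density `ρ(t; y)` on the subsonic branch, as a function of `t = |∇ψ|²` and of the height
`y`: the solution `ρ` of `bernoulli ρ y = t` that exceeds the critical density at height `y`.
It is unique, because `ρ ↦ bernoulli ρ y` is strictly decreasing above the critical density. -/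
def density (t y : ℝ) : ℝ :=
  sInf {ρ | (∃ c, L.IsCritical y c ∧ c < ρ) ∧ L.bernoulli ρ y = t}

/-- `H(t; s) = ρ(2 ρ₀² g t; yst - s)`. -/
def H (t s : ℝ) : ℝ := L.density (2 * L.ρ₀ ^ 2 * L.g * t) (L.yst - s)

/-- `F(t; s) = ∫₀ᵗ dτ / H(τ; s)`. -/
def F (t s : ℝ) : ℝ := ∫ τ in (0 : ℝ)..t, 1 / L.H τ s

/-- `∂₂F(t; s)`. -/
def dF₂ (t s : ℝ) : ℝ := deriv (fun s' => L.F t s') s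

/-- `Λ(t; s) = 2 t ∂₁F(t; s) - F(t; s)`, with `∂₁F = 1 / H`. -/
def bigLam (t s : ℝ) : ℝ := 2 * t * (1 / L.H t s) - L.F t s

/-- `λ(s) = Λ(s; s)`. -/
def lam (s : ℝ) : ℝ := L.bigLam s s

end Liquid

/-! ### Weak gradients, `W^{1,2}_loc`, divergence, variation measure -/

/-- `u ∈ W^{1,2}_loc(U)` with weak gradient `Du`. -/
structure MemW12Loc (U : Set Plane) (u : Plane → ℝ) (Du : Plane → Plane) : Prop where
  memLp : ∀ K ⊆ U, IsCompact K → MemLp u 2 (volume.restrict K)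
  memLp_grad : ∀ K ⊆ U, IsCompact K → MemLp Du 2 (volume.restrict K)
  weak : ∀ η : Plane → ℝ, ContDiff ℝ ∞ η → HasCompactSupport η → tsupport η ⊆ U →
    ∀ i : Fin 2, ∫ x, u x * fderiv ℝ η x (EuclideanSpace.single i 1) = - ∫ x, Du x i * η x

/-- The divergence of a (differentiable) vector field. -/
def divergence (φ : Plane → Plane) (x : Plane) : ℝ :=
  ∑ i : Fin 2, fderiv ℝ φ x (EuclideanSpace.single i 1) i

/-- `φ ∈ C¹₀(U; ℝ²)`. -/
def IsTestField (U : Set Plane) (φ : Plane → Plane) : Prop :=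
  ContDiff ℝ 1 φ ∧ HasCompactSupport φ ∧ tsupport φ ⊆ U

/-- `χ_{u > 0}`. -/
def chi (u : Plane → ℝ) (x : Plane) : ℝ := {y | 0 < u y}.indicator (fun _ => (1 : ℝ)) x

/-- `f` is locally of bounded variation in the open set `U`, and `μ` (restricted to `U`) is its
total variation measure `|∇f|`: `μ` is a Radon measure on `U` and the distributional gradient
of `f` in `U` is `σ μ` with `|σ| = 1`. -/
structure IsVariationMeasure (U : Set Plane) (f : Plane → ℝ) (μ : Measure Plane) : Prop where
  locallyIntegrable : LocallyIntegrableOn f U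
  finite_on_compact : ∀ K ⊆ U, IsCompact K → μ K < ⊤
  polar : ∃ σ : Plane → Plane, Measurable σ ∧ (∀ᵐ x ∂(μ.restrict U), ‖σ x‖ = 1) ∧
    ∀ φ, IsTestField U φ →
      ∫ x in U, f x * divergence φ x = - ∫ x in U, inner ℝ (φ x) (σ x) ∂μ

/-! ### Subsonic variational solutions and the weighted density -/

/-- `u` (with weak gradient `Du`) is a subsonic variational solution, in the bounded plane
domain `Ω`, of
`div (∇u / H(|∇u|²; x₂)) = 0` in `{u > 0}`, `|∇u|² = x₂` on `∂{u > 0}`. -/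
structure IsSubsonicVariationalSolution (L : Liquid) (Ω : Set Plane) (u : Plane → ℝ)
    (Du : Plane → Plane) : Prop where
  isOpen : IsOpen Ω
  isConnected : IsConnected Ω
  isBounded : Bornology.IsBounded Ω
  meets_line : ∃ x ∈ Ω, x 1 = 0
  sobolev : MemW12Loc Ω u Du
  nonneg : ∀ x ∈ Ω, 0 ≤ u x
  eq_zero : ∀ x ∈ Ω, x 1 ≤ 0 → u x = 0
  continuousOn : ContinuousOn u Ω
  contDiffOn : ContDiffOn ℝ 2 u {x ∈ Ω | 0 < u x}
  subsonic : ∃ ε₀ > 0, ∀ᵐ x ∂(volume.restrict {x ∈ Ω | 0 < u x}),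
    ε₀ ≤ L.H (‖Du x‖ ^ 2) (x 1) - L.critDensity (L.yst - x 1)
  domain_variation : ∀ φ, IsTestField Ω φ →
    ∫ x in Ω,
      ((L.F (‖Du x‖ ^ 2) (x 1) + L.lam (x 1) * chi u x) * divergence φ x
        - 2 * (1 / L.H (‖Du x‖ ^ 2) (x 1)) * inner ℝ (Du x) (fderiv ℝ φ x (Du x))
        + (deriv L.lam (x 1) * chi u x + L.dF₂ (‖Du x‖ ^ 2) (x 1)) * φ x 1) = 0

/-- The growth condition `|∇u|² ≤ C x₂⁺` locally in `Ω`. -/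
def GrowthBound (Ω : Set Plane) (Du : Plane → Plane) : Prop :=
  ∀ K ⊆ Ω, IsCompact K →
    ∃ C : ℝ, ∀ᵐ x ∂(volume.restrict K), ‖Du x‖ ^ 2 ≤ C * max (x 1) 0

/-- The point `(cos θ, sin θ)`. -/
def unitVec (θ : ℝ) : Plane := !₂[Real.cos θ, Real.sin θ]

/-- The integral of `f` over the circle `∂B_r(x₀)` with respect to arc length. -/
def circleIntegral (f : Plane → ℝ) (x₀ : Plane) (r : ℝ) : ℝ :=
  ∫ θ in (0 : ℝ)..(2 * Real.pi), f (x₀ + r • unitVec θ) * r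

/-- `U(x₀, u; r)` in dimension two. -/
def energyU (L : Liquid) (u : Plane → ℝ) (Du : Plane → Plane) (x₀ : Plane) (r : ℝ) : ℝ :=
  (r ^ 3)⁻¹ * ∫ x in Metric.ball x₀ r,
    (L.F (‖Du x‖ ^ 2) (x 1) + L.lam (x 1) * chi u x)

/-- `W(x₀, u; r)` in dimension two. -/
def energyW (L : Liquid) (u : Plane → ℝ) (x₀ : Plane) (r : ℝ) : ℝ :=
  (r ^ 4)⁻¹ * circleIntegral (fun x => u x ^ 2 / L.ρ₀) x₀ r

/-- `Φ(x₀, u; r) = U(x₀, u; r) - (3/2) W(x₀, u; r)`. -/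
def Phi (L : Liquid) (u : Plane → ℝ) (Du : Plane → Plane) (x₀ : Plane) (r : ℝ) : ℝ :=
  energyU L u Du x₀ r - 3 / 2 * energyW L u x₀ r

/-! ### Blow-ups -/

/-- The rescaling `x ↦ u(x₀ + r x) / r^{3/2}`. -/
def blowUp (u : Plane → ℝ) (x₀ : Plane) (r : ℝ) (x : Plane) : ℝ :=
  u (x₀ + r • x) / r ^ (3 / 2 : ℝ)

/-- The Stokes corner profile in polar coordinates `x = (R cos θ, R sin θ)`. -/
def stokesProfile (x : Plane) : ℝ :=
  Real.sqrt 2 / 3 * ‖x‖ ^ (3 / 2 : ℝ) *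
    Real.cos (3 / 2 *
      (min (max (Complex.arg ⟨x 0, x 1⟩) (Real.pi / 6)) (5 * Real.pi / 6) - Real.pi / 2))

/-- `v r → v₀` as `r → 0⁺`, strongly in `W^{1,2}_loc(ℝ²)`; on each disc, `v r` need only be a
Sobolev function for all sufficiently small `r`. -/
def TendstoW12Loc (v : ℝ → Plane → ℝ) (v₀ : Plane → ℝ) : Prop :=
  ∃ (Dv : ℝ → Plane → Plane) (Dv₀ : Plane → Plane), MemW12Loc univ v₀ Dv₀ ∧
    ∀ R : ℝ, 0 < R →
      (∀ᶠ r in 𝓝[>] (0 : ℝ), MemW12Loc (Metric.ball 0 R) (v r) (Dv r)) ∧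
      Tendsto (fun r => eLpNorm (fun x => v r x - v₀ x) 2 (volume.restrict (Metric.ball 0 R)))
        (𝓝[>] 0) (𝓝 0) ∧
      Tendsto (fun r => eLpNorm (fun x => Dv r x - Dv₀ x) 2 (volume.restrict (Metric.ball 0 R)))
        (𝓝[>] 0) (𝓝 0)

end

end StokesWave

/-!
The proof compares `u` near a stagnation point with a solution of the incompressible Stokes wave
problem `Δw = 0` in `{w > 0}`, `|∇w|² = x₂` on `∂{w > 0}`, and classifies the blow-up limits of the
latter by a monotonicity formula and domain variations.

*Reduction.* Near speed and height zero the constitutive functions are those of a fluid of constant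
density `ρ₀` up to errors of one order higher (`Liquid.exists_localLaw`). Hence the translate `w`
of `u`, cut off outside a disc, satisfies the incompressible equations up to errors which are
multiplied by `r` under the rescaling `w(r x) / r^{3/2}`
(`IsSubsonicVariationalSolution.exists_almostSolution`, `AlmostSolution.rescale`). That `w` is
harmonic in `{w > 0}` up to such errors is not assumed; it follows from domain variations in the
direction `η ∇w` (`LawSolution.integral_weak_eq_zero`).

*Monotonicity.* The Weiss energy, with a smooth cutoff in place of the indicator function of a disc,
is increasing in `r` up to a multiple of `r`, so that it has a limit
(`AlmostSolution.exists_tendsto_weissEnergy`). Its derivative controls the defect of homogeneity,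
and every sequence of blow-ups has a subsequence that converges uniformly to a function `U` which is
homogeneous of degree `3/2` (`AlmostSolution.exists_isBlowUpLimit`). The energy identity improves
this to convergence of the gradients in `L²` (`IsBlowUpLimit.tendsto_integral_norm_sub_sq`).

*Classification.* `U` is harmonic where it is positive, so its angular part solves `f'' = -9/4 f`
there. An arch of a solution has length `2π/3`, and only one of them fits into `(0, π)`; thus `U` is
zero or a wedge `A sin (3/2 (θ - α))` (`IsBlowUpLimit.eq_zero_or_isWedge`). In open sets where `U`
vanishes the distributional gradients of `χ_{w > 0}` tend to zero, and since the variation is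
bounded the characteristic functions converge there to a constant, which can only be `0` or `1`
(`IsBlowUpLimit.exists_isPhaseLimit`). Domain variations by rotations, with a constant weight and
with the weight `x₁`, give two equations for the phases, the angle and the amplitude
(`IsPhaseLimit.sin_balance`, `IsPhaseLimit.cos_balance`). They leave only the symmetric Stokes corner
with `α = π/6`, `A = √2/3` and empty phase outside (`IsPhaseLimit.eq_of_isWedge`).

*Conclusion.* By homogeneity the energy of a limit is a multiple of the integral of `sin θ` over its
phase. This integral is `√3` for the corner, and `0` or `2` for `U = 0`. As the energy has a limit,
its value is one of the three and decides between the corner and zero; the convergence of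
subsequences thus becomes convergence (`AlmostSolution.trichotomy`). Finally `Φ` differs from the
energy of the blow-ups of `w`, divided by `ρ₀`, by a term that vanishes with `r`
(`AlmostSolution.tendsto_Phi`), and the blow-ups of `u` and of `w` agree on every disc for small `r`
(`AlmostSolution.tendsto_blowUp`).
-/

namespace StokesWave

open Metric (ball closedBall isOpen_ball ball_subset_ball ball_subset_closedBall closedBall_subset_ball
  closedBall_subset_closedBall isClosed_closedBall mem_closedBall mem_closedBall_self mem_ball mem_ball_self
  cthickening mem_cthickening_of_dist_le pos_of_mem_ball)
open Real (sin cos norm_of_nonneg norm_eq_abs dist_eq rpow_pos_of_pos mul_rpow sq_sqrt coe_toNNReal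
  toNNReal sqrt_nonneg pi_pos rpow_add sqrt_pos)
open EuclideanSpace (single proj)
open scoped Real Gradient RealInnerProductSpace Convolution

variable {x : Plane} {u w U η ψ : Plane → ℝ} {v : ℕ → Plane → ℝ} {κ : ℕ → ℝ} {φ Du : Plane → Plane}
  {K : NNReal} {C r : ℝ} {L : Liquid}

/-! ### The constitutive relation near the stagnation density -/

namespace Liquid

variable (L : Liquid)

lemma ρ₀_pos : 0 < L.ρ₀ := L.ρst_pos.trans L.ρst_lt

lemma contDiffAt_deriv {ρ : ℝ} (hρ : L.ρst ≤ ρ) : ContDiffAt ℝ 1 (deriv L.p) ρ :=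
  (L.smooth ρ hρ).derivWithin (by norm_num)

lemma continuousAt_deriv_div {ρ : ℝ} (hρ : L.ρst ≤ ρ) :
    ContinuousAt (fun s => deriv L.p s / s) ρ :=
  (L.contDiffAt_deriv hρ).continuousAt.div continuousAt_id (L.ρst_pos.trans_le hρ).ne'

lemma hasDerivAt_deriv {ρ : ℝ} (hρ : L.ρst ≤ ρ) :
    HasDerivAt (deriv L.p) (deriv (deriv L.p) ρ) ρ :=
  ((L.contDiffAt_deriv hρ).differentiableAt (by norm_num)).hasDerivAt

lemma hasDerivAt_h {ρ : ℝ} (hρ : L.ρst ≤ ρ) : HasDerivAt L.h (deriv L.p ρ / ρ) ρ := by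
  have hint : IntervalIntegrable (fun s => deriv L.p s / s) volume L.ρ₀ ρ := by
    apply ContinuousOn.intervalIntegrable
    intro s hs
    exact (L.continuousAt_deriv_div
      ((le_min L.ρst_lt.le hρ).trans hs.1)).continuousWithinAt
  have hmeas : StronglyMeasurableAtFilter (fun s => deriv L.p s / s) (𝓝 ρ) volume := by
    have hev : ∀ᶠ x in 𝓝 ρ, ContinuousAt (fun s => deriv L.p s / s) x := by
      filter_upwards [(L.contDiffAt_deriv hρ).eventually (by norm_num),
        lt_mem_nhds (L.ρst_pos.trans_le hρ)] with x hx hx0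
      exact hx.continuousAt.div continuousAt_id hx0.ne'
    obtain ⟨U, hU, hUo, hρU⟩ := eventually_nhds_iff.1 hev
    exact ContinuousOn.stronglyMeasurableAtFilter hUo
      (fun x hx => (hU x hx).continuousWithinAt) ρ hρU
  exact intervalIntegral.integral_hasDerivAt_right hint hmeas (L.continuousAt_deriv_div hρ)

lemma h_ρ₀ : L.h L.ρ₀ = 0 := by simp [h, enthalpy]

lemma strictMonoOn_critical : StrictMonoOn (fun ρ => deriv L.p ρ / 2 + L.h ρ) (Ici L.ρst) := by
  have hd : ∀ ρ ∈ Ici L.ρst, HasDerivAt (fun ρ => deriv L.p ρ / 2 + L.h ρ)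
      (deriv (deriv L.p) ρ / 2 + deriv L.p ρ / ρ) ρ := fun ρ hρ =>
    ((L.hasDerivAt_deriv hρ).div_const 2).add (L.hasDerivAt_h hρ)
  refine strictMonoOn_of_deriv_pos (convex_Ici _)
    (fun ρ hρ => (hd ρ hρ).continuousAt.continuousWithinAt) fun ρ hρ => ?_
  have hρ' : ρ ∈ Ici L.ρst := interior_subset hρ
  rw [(hd ρ hρ').deriv]
  have h0 : 0 < ρ := L.ρst_pos.trans_le hρ'
  have := L.genuine ρ hρ'
  have : deriv (deriv L.p) ρ / 2 + deriv L.p ρ / ρ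
      = (2 * deriv L.p ρ + ρ * deriv (deriv L.p) ρ) / (2 * ρ) := by field_simp; ring
  rw [this]; positivity

lemma g_mul_yst : L.g * L.yst = deriv L.p L.ρ₀ / 2 := by
  have := L.g_pos.ne'
  unfold yst; field_simp

lemma isCritical_iff (s c : ℝ) : L.IsCritical (L.yst - s) c ↔
    L.ρst ≤ c ∧ deriv L.p c / 2 + L.h c = L.g * s := by
  unfold IsCritical
  have := L.g_mul_yst
  constructor <;> rintro ⟨h1, h2⟩ <;> refine ⟨h1, ?_⟩ <;> linarith [mul_sub L.g L.yst s]

lemma bernoulli_eq (ρ s : ℝ) : L.bernoulli ρ (L.yst - s) = 2 * ρ ^ 2 * (L.g * s - L.h ρ) := by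
  unfold bernoulli
  linear_combination (-2 * ρ ^ 2) * L.g_mul_yst

/-- Above the critical density the Bernoulli function is strictly decreasing. -/
lemma strictAntiOn_bernoulli {s c : ℝ} (hc : L.IsCritical (L.yst - s) c) :
    StrictAntiOn (fun ρ => 2 * ρ ^ 2 * (L.g * s - L.h ρ)) (Ici c) := by
  rw [isCritical_iff] at hc
  have hd : ∀ ρ ∈ Ici c, HasDerivAt (fun ρ => 2 * ρ ^ 2 * (L.g * s - L.h ρ))
      (2 * (2 * ρ) * (L.g * s - L.h ρ) + 2 * ρ ^ 2 * (- (deriv L.p ρ / ρ))) ρ := by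
    intro ρ hρ
    have h1 : HasDerivAt (fun ρ : ℝ => 2 * ρ ^ 2) (2 * (2 * ρ)) ρ := by
      simpa using (hasDerivAt_pow 2 ρ).const_mul 2
    exact h1.mul ((L.hasDerivAt_h (hc.1.trans hρ)).const_sub _)
  refine strictAntiOn_of_deriv_neg (convex_Ici _)
    (fun ρ hρ => (hd ρ hρ).continuousAt.continuousWithinAt) fun ρ hρ => ?_
  rw [interior_Ici] at hρ
  have hρ' : c < ρ := hρ
  rw [(hd ρ hρ'.le).deriv]
  have h0 : 0 < ρ := L.ρst_pos.trans_le (hc.1.trans hρ'.le)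
  have hk := L.strictMonoOn_critical hc.1 (hc.1.trans hρ'.le) hρ'
  simp only [hc.2] at hk
  have : 2 * (2 * ρ) * (L.g * s - L.h ρ) + 2 * ρ ^ 2 * (- (deriv L.p ρ / ρ))
      = 4 * ρ * (L.g * s - (deriv L.p ρ / 2 + L.h ρ)) := by field_simp; ring
  rw [this]
  exact mul_neg_of_pos_of_neg (by positivity) (by linarith)

/-- A root of the Bernoulli equation on the subsonic branch is the density. -/
lemma H_eq {t s ρ : ℝ} (hs : 0 ≤ s) (hs' : L.g * s < deriv L.p ρ / 2 + L.h ρ)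
    (hρ : L.ρst ≤ ρ) (hroot : ρ ^ 2 * (L.g * s - L.h ρ) = L.ρ₀ ^ 2 * L.g * t) :
    L.H t s = ρ := by
  have hcont : ContinuousOn (fun ρ => deriv L.p ρ / 2 + L.h ρ) (Icc L.ρst ρ) := fun x hx =>
    (((L.hasDerivAt_deriv hx.1).div_const 2).add (L.hasDerivAt_h hx.1)).continuousAt.continuousWithinAt
  obtain ⟨c, hc, hceq⟩ := intermediate_value_Icc hρ hcont
    (show L.g * s ∈ Icc _ _ from ⟨by
      have := L.critical_st
      have h2 : 0 ≤ L.g * s := mul_nonneg L.g_pos.le hs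
      simp only [h]; linarith, hs'.le⟩)
  have hcrit : L.IsCritical (L.yst - s) c := (L.isCritical_iff s c).2 ⟨hc.1, hceq⟩
  have hcρ : c < ρ := by grind
  unfold H density
  have : {ρ | (∃ c, L.IsCritical (L.yst - s) c ∧ c < ρ) ∧
      L.bernoulli ρ (L.yst - s) = 2 * L.ρ₀ ^ 2 * L.g * t} = {ρ} := by
    ext ρ'
    simp only [mem_ofPred_eq, mem_singleton_iff, bernoulli_eq]
    constructor
    · rintro ⟨⟨c', hc', hc'ρ⟩, heq⟩
      have hcc : c' = c := by
        rw [isCritical_iff] at hc'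
        exact L.strictMonoOn_critical.injOn hc'.1 hc.1 (by grind)
      subst hcc
      apply (L.strictAntiOn_bernoulli hcrit).injOn hc'ρ.le hcρ.le
      simp only
      rw [heq]; linear_combination (-2) * hroot
    · grind
  rw [this, csInf_singleton]

lemma contDiffAt_h : ContDiffAt ℝ 1 L.h L.ρ₀ := by
  rw [contDiffAt_one_iff]
  refine ⟨fun ρ => ContinuousLinearMap.toSpanSingleton ℝ (deriv L.p ρ / ρ), Ioi L.ρst,
    Ioi_mem_nhds L.ρst_lt, ?_, fun ρ hρ => (L.hasDerivAt_h (le_of_lt hρ)).hasFDerivAt⟩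
  intro ρ hρ
  have h1 := (L.continuousAt_deriv_div (le_of_lt hρ)).continuousWithinAt (s := Ioi L.ρst)
  exact (ContinuousLinearMap.toSpanSingletonCLE (𝕜 := ℝ) (E := ℝ)).continuous.continuousAt.comp_continuousWithinAt h1

/-- The implicit function theorem: near `(0, 0)` the specific volume `1 / H` is the restriction of
a continuously differentiable function with compact support. -/
lemma exists_specificVolume : ∃ d > 0, ∃ J : ℝ × ℝ → ℝ, ContDiff ℝ 1 J ∧ HasCompactSupport J ∧
    J (0, 0) = 1 / L.ρ₀ ∧ ∀ t s, |t| < d → 0 ≤ s → s < d → 1 / L.H t s = J (t, s) := by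
  set f : (ℝ × ℝ) × ℝ → ℝ := fun q =>
    q.2 ^ 2 * (L.g * q.1.2 - L.h q.2) - L.ρ₀ ^ 2 * L.g * q.1.1 with hf
  set u : (ℝ × ℝ) × ℝ := ((0, 0), L.ρ₀) with hu
  have hfu : f u = 0 := by simp [hf, hu, h_ρ₀]
  have hh : ContDiffAt ℝ 1 (fun q : (ℝ × ℝ) × ℝ => L.h q.2) u :=
    ContDiffAt.comp (g := L.h) u L.contDiffAt_h contDiffAt_snd
  have cdf : ContDiffAt ℝ 1 f u := by fun_prop
  have hpart : fderiv ℝ f u ∘SL ContinuousLinearMap.inr ℝ (ℝ × ℝ) ℝ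
      = ContinuousLinearMap.toSpanSingleton ℝ (- (L.ρ₀ * deriv L.p L.ρ₀)) := by
    have h1 : HasFDerivAt (fun ρ : ℝ => f ((0, 0), ρ))
        (fderiv ℝ f u ∘SL ContinuousLinearMap.inr ℝ (ℝ × ℝ) ℝ) L.ρ₀ :=
      HasFDerivAt.comp L.ρ₀ (cdf.differentiableAt (by norm_num)).hasFDerivAt
        (by fun_prop)
    have h2 : HasDerivAt (fun ρ : ℝ => f ((0, 0), ρ)) (- (L.ρ₀ * deriv L.p L.ρ₀)) L.ρ₀ := by
      have h3 := (((hasDerivAt_pow 2 L.ρ₀).mul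
        ((L.hasDerivAt_h L.ρst_lt.le).const_sub (L.g * 0))).sub_const (L.ρ₀ ^ 2 * L.g * 0))
      convert! h3 using 1
      have := L.ρ₀_pos.ne'
      simp only [h_ρ₀]; field_simp; simp
    exact h1.unique h2.hasFDerivAt
  have hne : - (L.ρ₀ * deriv L.p L.ρ₀) ≠ 0 :=
    neg_ne_zero.2 (mul_pos L.ρ₀_pos (L.deriv_pos _ L.ρst_lt.le)).ne'
  have hinv : (fderiv ℝ f u ∘SL ContinuousLinearMap.inr ℝ (ℝ × ℝ) ℝ).IsInvertible := by
    rw [hpart]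
    refine ⟨ContinuousLinearEquiv.unitsEquivAut ℝ (Units.mk0 _ hne), ?_⟩
    ext; simp
  set ψ := cdf.implicitFunction one_ne_zero hinv
  have hψ0 : ψ (0, 0) = L.ρ₀ := cdf.implicitFunction_apply_self one_ne_zero hinv
  have hψc : ContDiffAt ℝ 1 ψ (0, 0) := cdf.contDiffAt_implicitFunction one_ne_zero hinv
  have hψr : ∀ᶠ x in 𝓝 (0, 0), f (x, ψ x) = f u :=
    cdf.eventually_apply_implicitFunction one_ne_zero hinv
  have e1 : ∀ᶠ x in 𝓝 (0, 0), L.ρst < ψ x :=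
    hψc.continuousAt.eventually (lt_mem_nhds (by rw [hψ0]; exact L.ρst_lt))
  have e2 : ∀ᶠ x in 𝓝 (0, 0), L.g * x.2 < deriv L.p (ψ x) / 2 + L.h (ψ x) := by
    have c1 : ContinuousAt (fun ρ => deriv L.p ρ / 2 + L.h ρ) (ψ (0, 0)) := by
      rw [hψ0]
      exact (((L.hasDerivAt_deriv L.ρst_lt.le).div_const 2).add
        (L.hasDerivAt_h L.ρst_lt.le)).continuousAt
    have c2 : ContinuousAt (fun x : ℝ × ℝ => deriv L.p (ψ x) / 2 + L.h (ψ x)) (0, 0) :=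
      ContinuousAt.comp c1 hψc.continuousAt
    have c3 : ContinuousAt (fun x : ℝ × ℝ => L.g * x.2) (0, 0) := by fun_prop
    refine c3.eventually_lt c2 ?_
    simp only [hψ0, h_ρ₀]
    have := L.deriv_pos _ L.ρst_lt.le
    simp; exact this
  have hJc : ContDiffAt ℝ 1 (fun x => 1 / ψ x) (0, 0) :=
    contDiffAt_const.div hψc (by grind)
  obtain ⟨ε, hε, hball⟩ := Metric.eventually_nhds_iff_ball.1
    (hψr.and (e1.and (e2.and (hJc.eventually (by norm_num)))))
  set b : ContDiffBump ((0 : ℝ), (0 : ℝ)) := ⟨ε / 4, ε / 2, by positivity, by linarith⟩ with hb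
  refine ⟨ε / 4, by positivity, fun x => b x * (1 / ψ x), ?_, b.hasCompactSupport.mul_right, ?_, ?_⟩
  · rw [contDiff_iff_contDiffAt]
    intro x
    by_cases hx : x ∈ ball ((0 : ℝ), (0 : ℝ)) ε
    · exact b.contDiff.contDiffAt.mul (hball x hx).2.2.2
    · have hx' : x ∉ tsupport b := by
        rw [b.tsupport_eq]
        intro h1
        apply hx
        rw [mem_closedBall] at h1
        rw [mem_ball]
        exact h1.trans_lt (by grind)
      have h0 : (fun x => b x * (1 / ψ x)) =ᶠ[𝓝 x] fun _ => 0 := by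
        filter_upwards [notMem_tsupport_iff_eventuallyEq.1 hx'] with y hy
        simp only [hy, Pi.zero_apply, zero_mul]
      exact contDiffAt_const.congr_of_eventuallyEq h0
  · simp only
    rw [b.one_of_mem_closedBall (mem_closedBall_self (by grind)),
      hψ0, one_mul]
  · intro t s ht hs hsε
    have hmem : (t, s) ∈ closedBall (0, 0) (ε / 4) := by
      rw [mem_closedBall, Prod.dist_eq]
      simp only [dist_eq, sub_zero]
      exact max_le ht.le (by grind)
    have hmem' : (t, s) ∈ ball (0, (0 : ℝ)) ε :=
      closedBall_subset_ball (by linarith) hmem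
    obtain ⟨h1, h2, h3, -⟩ := hball _ hmem'
    simp only
    rw [b.one_of_mem_closedBall hmem, one_mul, L.H_eq hs h3 h2.le]
    rw [hfu] at h1
    simp only [hf] at h1
    linarith

/-- Averaging a function along the segments from `(0, s)` to `(t, s)`. -/
lemma contDiff_segmentAverage {J : ℝ × ℝ → ℝ} (hJ : ContDiff ℝ 1 J) (hJs : HasCompactSupport J) :
    ContDiff ℝ 1 (fun x : ℝ × ℝ => ∫ σ in 0..1, J (x.1 * σ, x.2)) := by
  set A : ℝ → (ℝ × ℝ →L[ℝ] ℝ × ℝ) := fun σ =>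
    (σ • ContinuousLinearMap.fst ℝ ℝ ℝ).prod (ContinuousLinearMap.snd ℝ ℝ ℝ) with hA
  have hAc : Continuous A := by
    have : A = fun σ => (ContinuousLinearMap.prodMapL ℝ ℝ ℝ ℝ ℝ)
        (σ • ContinuousLinearMap.id ℝ ℝ, ContinuousLinearMap.id ℝ ℝ) := by
      ext σ <;> simp [hA]
    rw [this]; fun_prop
  have hfd : Continuous (fderiv ℝ J) := by fun_prop
  obtain ⟨K, hK⟩ := (hJs.fderiv (𝕜 := ℝ)).exists_bound_of_continuous hfd
  have hcont : Continuous (Function.uncurry fun (x : ℝ × ℝ) (σ : ℝ) =>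
      (fderiv ℝ J (x.1 * σ, x.2)).comp (A σ)) := by fun_prop
  have hder : ∀ x : ℝ × ℝ, HasFDerivAt (fun x : ℝ × ℝ => ∫ σ in 0..1, J (x.1 * σ, x.2))
      (∫ σ in (0 : ℝ)..1, (fderiv ℝ J (x.1 * σ, x.2)).comp (A σ)) x := by
    intro x
    refine intervalIntegral.hasFDerivAt_integral_of_dominated_of_fderiv_le
      (bound := fun σ => K * ‖A σ‖) (F' := fun x σ => (fderiv ℝ J (x.1 * σ, x.2)).comp (A σ))
      univ_mem ?_ ?_ ?_ ?_ ?_ ?_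
    · exact .of_forall fun y =>
        (hJ.continuous.comp (by fun_prop)).aestronglyMeasurable
    · exact (hJ.continuous.comp (by fun_prop)).intervalIntegrable _ _
    · fun_prop
    · refine .of_forall fun σ _ y _ => ?_
      exact (ContinuousLinearMap.opNorm_comp_le _ _).trans
        (mul_le_mul_of_nonneg_right (hK _) (norm_nonneg _))
    · exact (continuous_const.mul hAc.norm).intervalIntegrable _ _
    · refine .of_forall fun σ _ y _ => ?_
      have h1 : HasFDerivAt (fun x : ℝ × ℝ => (x.1 * σ, x.2)) (A σ) y := by fun_prop
      exact ((hJ.differentiable (by norm_num)).differentiableAt.hasFDerivAt).comp y h1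
  rw [contDiff_one_iff_fderiv]
  refine ⟨fun x => (hder x).differentiableAt, ?_⟩
  have : fderiv ℝ (fun x : ℝ × ℝ => ∫ σ in 0..1, J (x.1 * σ, x.2))
      = fun x => ∫ σ in 0..1, (fderiv ℝ J (x.1 * σ, x.2)).comp (A σ) :=
    funext fun x => (hder x).fderiv
  rw [this]
  exact intervalIntegral.continuous_parametric_intervalIntegral_of_continuous' hcont 0 1

/-- Near `(0, 0)` the constitutive functions `1 / H`, `F`, `λ` agree with continuously
differentiable functions, and up to higher order terms they are those of an incompressible fluid of
density `ρ₀`: `F ≈ t / ρ₀`, `λ ≈ s / ρ₀`. -/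
structure LocalLaw (d C : ℝ) (J Fg : ℝ × ℝ → ℝ) (lg : ℝ → ℝ) : Prop where
  d_pos : 0 < d
  C_nonneg : 0 ≤ C
  contDiff_J : ContDiff ℝ 1 J
  contDiff_F : ContDiff ℝ 1 Fg
  contDiff_lam : ContDiff ℝ 1 lg
  J_eq : ∀ t s, |t| < d → 0 ≤ s → s < d → 1 / L.H t s = J (t, s)
  F_eq : ∀ t s, |t| < d → 0 ≤ s → s < d → L.F t s = Fg (t, s)
  dF₁_eq : ∀ t s, fderiv ℝ Fg (t, s) (1, 0) = J (t, s)
  dF₂_eq : ∀ t s, |t| < d → 0 < s → s < d → L.dF₂ t s = fderiv ℝ Fg (t, s) (0, 1)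
  lam_eq : ∀ s, 0 ≤ s → s < d → L.lam s = lg s
  deriv_lam_eq : ∀ s, 0 < s → s < d → deriv L.lam s = deriv lg s
  J_bound : ∀ t s, |J (t, s) - 1 / L.ρ₀| ≤ C * (|t| + |s|)
  F_bound : ∀ t s, |Fg (t, s) - t / L.ρ₀| ≤ C * |t| * (|t| + |s|)
  dF₂_bound : ∀ t s, |fderiv ℝ Fg (t, s) (0, 1)| ≤ C * |t|
  lam_bound : ∀ s, |lg s - s / L.ρ₀| ≤ C * s ^ 2
  deriv_lam_bound : ∀ s, |deriv lg s - 1 / L.ρ₀| ≤ C * |s|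

lemma exists_localLaw : ∃ d C J Fg lg, L.LocalLaw d C J Fg lg := by
  obtain ⟨d, hd, J, hJ, hJs, hJ0, hJH⟩ := L.exists_specificVolume
  obtain ⟨K, hK⟩ := hJ.lipschitzWith_of_hasCompactSupport hJs (by norm_num)
  set N : ℝ × ℝ → ℝ := fun x => ∫ σ in 0..1, J (x.1 * σ, x.2) with hN
  have hNc : ContDiff ℝ 1 N := contDiff_segmentAverage hJ hJs
  have hFint : ∀ t s, t * N (t, s) = ∫ τ in (0 : ℝ)..t, J (τ, s) := by
    intro t s
    have := intervalIntegral.mul_integral_comp_mul_left (a := 0) (b := 1)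
      (f := fun τ => J (τ, s)) t
    simpa using this
  have hNL : LipschitzWith K N := by
    refine LipschitzWith.of_dist_le_mul fun x y => ?_
    rw [dist_eq]
    simp only [hN]
    have hi : ∀ x : ℝ × ℝ, IntervalIntegrable (fun σ => J (x.1 * σ, x.2)) volume 0 1 := fun x =>
      (hJ.continuous.comp (by fun_prop)).intervalIntegrable _ _
    rw [← intervalIntegral.integral_sub (hi x) (hi y)]
    have := intervalIntegral.norm_integral_le_of_norm_le_const (a := 0) (b := 1)
      (f := fun σ => J (x.1 * σ, x.2) - J (y.1 * σ, y.2)) (C := K * dist x y) ?_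
    · simpa using this
    · intro σ hσ
      rw [uIoc_of_le zero_le_one] at hσ
      rw [← dist_eq_norm]
      refine (hK.dist_le_mul _ _).trans (mul_le_mul_of_nonneg_left ?_ K.2)
      rw [Prod.dist_eq, Prod.dist_eq]
      refine max_le_max ?_ le_rfl
      simp only [dist_eq]
      rw [← sub_mul, abs_mul, abs_of_pos hσ.1]
      exact mul_le_of_le_one_right (abs_nonneg _) hσ.2
  have hN0 : N (0, 0) = 1 / L.ρ₀ := by simp [hN, hJ0]
  have hdist : ∀ t s : ℝ, dist (t, s) (0, 0) ≤ |t| + |s| := by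
    intro t s
    rw [Prod.dist_eq]
    simp only [dist_eq, sub_zero]
    exact max_le (by simp) (by simp)
  have hJb : ∀ t s, |J (t, s) - 1 / L.ρ₀| ≤ K * (|t| + |s|) := by
    intro t s
    rw [← hJ0, ← dist_eq]
    exact (hK.dist_le_mul _ _).trans (mul_le_mul_of_nonneg_left (hdist t s) K.2)
  have hNb : ∀ t s, |N (t, s) - 1 / L.ρ₀| ≤ K * (|t| + |s|) := by
    intro t s
    rw [← hN0, ← dist_eq]
    exact (hNL.dist_le_mul _ _).trans (mul_le_mul_of_nonneg_left (hdist t s) K.2)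
  set Fg : ℝ × ℝ → ℝ := fun x => x.1 * N x with hFg
  have hFgc : ContDiff ℝ 1 Fg := contDiff_fst.mul hNc
  set m : ℝ → ℝ := fun s => 2 * J (s, s) - N (s, s) with hm
  have hmc : ContDiff ℝ 1 m := by fun_prop
  have hm0 : m 0 = 1 / L.ρ₀ := by grind
  have hmL : LipschitzWith (3 * K) m := by
    refine LipschitzWith.of_dist_le_mul fun x y => ?_
    have h1 := hK.dist_le_mul (x, x) (y, y)
    have h2 := hNL.dist_le_mul (x, x) (y, y)
    rw [Prod.dist_eq] at h1 h2
    simp only [max_self, dist_eq] at h1 h2 ⊢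
    push_cast
    rw [abs_le] at *
    constructor <;> simp only [hm] <;> linarith [h1.1, h1.2, h2.1, h2.2]
  have hmb : ∀ s, |m s - 1 / L.ρ₀| ≤ 3 * K * |s| := by
    intro s
    have := hmL.dist_le_mul s 0
    rw [hm0] at this
    simpa [dist_eq] using this
  have hmd : ∀ s, |deriv m s| ≤ 3 * K := by
    intro s
    have := norm_deriv_le_of_lipschitz hmL (x₀ := s)
    simpa using this
  have hFeq : ∀ t s, |t| < d → 0 ≤ s → s < d → L.F t s = Fg (t, s) := by
    intro t s ht hs hsd
    simp only [hFg, hFint]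
    unfold F
    refine intervalIntegral.integral_congr fun τ hτ => ?_
    refine hJH τ s ?_ hs hsd
    have h1 := abs_sub_left_of_mem_uIcc hτ
    simp only [sub_zero] at h1
    exact h1.trans_lt ht
  have hdF2 : ∀ t s, fderiv ℝ Fg (t, s) (0, 1) = t * fderiv ℝ N (t, s) (0, 1) := by
    intro t s
    have h1 : HasFDerivAt Fg _ (t, s) := (hasFDerivAt_fst).mul
      (hNc.differentiable (by norm_num) (t, s)).hasFDerivAt
    rw [h1.fderiv]
    simp
  have hlam : ∀ s, 0 ≤ s → s < d → L.lam s = s * m s := by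
    intro s hs hsd
    have h1 : |s| < d := by rwa [abs_of_nonneg hs]
    unfold lam bigLam
    rw [hJH s s h1 hs hsd, hFeq s s h1 hs hsd]
    simp only [hFg, hm]; ring
  have hlgd : ∀ s, HasDerivAt (fun s => s * m s) (m s + s * deriv m s) s := by
    intro s
    have := (hasDerivAt_id s).mul ((hmc.differentiable (by norm_num)) s).hasDerivAt
    simp only [id, one_mul] at this
    exact this
  refine ⟨d, 6 * K, J, Fg, fun s => s * m s, hd, by positivity, hJ, hFgc, contDiff_id.mul hmc, hJH,
    hFeq, ?_, ?_, hlam, ?_, ?_, ?_, ?_, ?_, ?_⟩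
  · intro t s
    have h1 : HasDerivAt (fun t => Fg (t, s)) (J (t, s)) t := by
      have h2 : (fun t => Fg (t, s)) = fun t => ∫ τ in 0..t, J (τ, s) :=
        funext fun t => hFint t s
      rw [h2]
      have hc : Continuous fun τ => J (τ, s) := by fun_prop
      exact intervalIntegral.integral_hasDerivAt_right (hc.intervalIntegrable _ _)
        (hc.stronglyMeasurableAtFilter _ _) hc.continuousAt
    have h2 : HasDerivAt (fun t => Fg (t, s)) (fderiv ℝ Fg (t, s) (1, 0)) t :=
      HasFDerivAt.comp_hasDerivAt (l := Fg) t
        (hFgc.differentiable (by norm_num) (t, s)).hasFDerivAt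
        ((hasDerivAt_id t).prodMk (hasDerivAt_const t s))
    exact h2.unique h1
  · intro t s ht hs hsd
    unfold dF₂
    have h1 : (fun s' => L.F t s') =ᶠ[𝓝 s] fun s' => Fg (t, s') := by
      filter_upwards [lt_mem_nhds hs, gt_mem_nhds hsd] with s' h2 h3
      exact hFeq t s' ht h2.le h3
    rw [h1.deriv_eq]
    exact (HasFDerivAt.comp_hasDerivAt s
        (hFgc.differentiable (by norm_num) (t, s)).hasFDerivAt
        ((hasDerivAt_const s t).prodMk (hasDerivAt_id s))).deriv
  · intro s hs hsd
    have h1 : L.lam =ᶠ[𝓝 s] fun s => s * m s := by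
      filter_upwards [lt_mem_nhds hs, gt_mem_nhds hsd] with s' h2 h3
      exact hlam s' h2.le h3
    exact h1.deriv_eq
  · intro t s
    refine (hJb t s).trans ?_
    have : 0 ≤ (K : ℝ) := K.2
    have : 0 ≤ K * (|t| + |s|) := by positivity
    linarith
  · intro t s
    have h1 : Fg (t, s) - t / L.ρ₀ = t * (N (t, s) - 1 / L.ρ₀) := by simp only [hFg]; ring
    rw [h1, abs_mul]
    have h2 := mul_le_mul_of_nonneg_left (hNb t s) (abs_nonneg t)
    have : 0 ≤ (K : ℝ) := K.2
    have : 0 ≤ |t| * (K * (|t| + |s|)) := by positivity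
    linarith
  · intro t s
    rw [hdF2, abs_mul]
    have h1 : |fderiv ℝ N (t, s) (0, 1)| ≤ K := by
      have h2 := (fderiv ℝ N (t, s)).le_opNorm (0, 1)
      have h3 := norm_fderiv_le_of_lipschitz ℝ hNL (x₀ := (t, s))
      have h4 : ‖((0 : ℝ), (1 : ℝ))‖ = 1 := by simp [Prod.norm_def]
      rw [h4, mul_one] at h2
      exact h2.trans h3
    have h2 := mul_le_mul_of_nonneg_left h1 (abs_nonneg t)
    have : 0 ≤ (K : ℝ) := K.2
    have : 0 ≤ |t| * K := by positivity
    linarith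
  · intro s
    have h1 : s * m s - s / L.ρ₀ = s * (m s - 1 / L.ρ₀) := by ring
    rw [h1, abs_mul]
    have h2 := mul_le_mul_of_nonneg_left (hmb s) (abs_nonneg s)
    have : 0 ≤ (K : ℝ) := K.2
    have h3 : |s| * (3 * K * |s|) = 3 * K * s ^ 2 := by rw [← sq_abs s]; ring
    have : 0 ≤ K * s ^ 2 := by positivity
    linarith
  · intro s
    rw [(hlgd s).deriv]
    have h1 := hmb s
    have h2 := mul_le_mul_of_nonneg_left (hmd s) (abs_nonneg s)
    rw [← abs_mul] at h2
    have h3 : m s + s * deriv m s - 1 / L.ρ₀ = (m s - 1 / L.ρ₀) + s * deriv m s := by ring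
    rw [h3]
    refine (abs_add_le _ _).trans ?_
    linarith

end Liquid

/-! ### Lipschitz functions and weak gradients in the plane -/

lemma inner_plane (a b : Plane) : ⟪a, b⟫ = a 0 * b 0 + a 1 * b 1 := by
  simp [PiLp.inner_apply, Fin.sum_univ_two, mul_comm]

lemma inner_gradient (f : Plane → ℝ) (x v : Plane) : ⟪∇ f x, v⟫ = fderiv ℝ f x v := by
  simp [gradient]

lemma gradient_apply (f : Plane → ℝ) (x : Plane) (i : Fin 2) :
    ∇ f x i = fderiv ℝ f x (single i 1) := by
  rw [← inner_gradient, EuclideanSpace.inner_single_right]; simp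

lemma norm_gradient (f : Plane → ℝ) (x : Plane) : ‖∇ f x‖ = ‖fderiv ℝ f x‖ := by
  simp [gradient]

@[fun_prop] lemma measurable_gradient (f : Plane → ℝ) : Measurable (∇ f) :=
  (InnerProductSpace.toDual ℝ Plane).symm.continuous.measurable.comp (by fun_prop)

lemma gradient_congr {f g : Plane → ℝ} (h : f =ᶠ[𝓝 x] g) :
    ∇ f x = ∇ g x := by
  simp only [gradient, h.fderiv_eq]

lemma integrable_mul_of_integrableOn_tsupport {f g : Plane → ℝ} (hf : IntegrableOn f (tsupport g))
    (hg : Continuous g) (hc : HasCompactSupport g) : Integrable (fun x => f x * g x) := by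
  rw [← integrableOn_iff_integrable_of_support_subset]
  · exact hf.mul_continuousOn hg.continuousOn hc
  · exact (Function.support_mul_subset_right _ _).trans (subset_tsupport g)

lemma MemW12Loc.integrableOn {U K : Set Plane}
    (h : MemW12Loc U u Du) (hK : IsCompact K) (hKU : K ⊆ U) : IntegrableOn u K := by
  have : IsFiniteMeasure (volume.restrict K) := ⟨by simpa using hK.measure_lt_top⟩
  exact (h.memLp K hKU hK).integrable (by norm_num)

lemma MemW12Loc.integrableOn_grad {U K : Set Plane}
    (h : MemW12Loc U u Du) (hK : IsCompact K) (hKU : K ⊆ U) : IntegrableOn Du K := by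
  have : IsFiniteMeasure (volume.restrict K) := ⟨by simpa using hK.measure_lt_top⟩
  exact (h.memLp_grad K hKU hK).integrable (by norm_num)

lemma eq_sum_single (v : Plane) :
    v = v 0 • single 0 1 + v 1 • single 1 1 := by
  ext i; fin_cases i <;> simp

lemma MemW12Loc.weak_dir {U : Set Plane}
    (h : MemW12Loc U u Du) (hη : ContDiff ℝ ∞ η) (hc : HasCompactSupport η)
    (hs : tsupport η ⊆ U) (v : Plane) :
    ∫ x, u x * fderiv ℝ η x v = - ∫ x, ⟪Du x, v⟫ * η x := by
  have hd : ∀ i : Fin 2, Integrable fun x => u x * fderiv ℝ η x (single i 1) := by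
    intro i
    have hts : tsupport (fun x => fderiv ℝ η x (single i 1)) ⊆ tsupport η :=
      tsupport_fderiv_apply_subset ℝ _
    refine integrable_mul_of_integrableOn_tsupport
      ((h.integrableOn hc hs).mono_set hts) ?_ (hc.fderiv_apply (𝕜 := ℝ) _)
    exact (hη.continuous_fderiv (by simp)).clm_apply continuous_const
  have hD : ∀ i : Fin 2, Integrable fun x => Du x i * η x := by
    intro i
    refine integrable_mul_of_integrableOn_tsupport ?_ hη.continuous hc
    exact (proj (𝕜 := ℝ) i).integrable_comp (h.integrableOn_grad hc hs)
  have e1 : ∀ x, u x * fderiv ℝ η x v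
      = v 0 * (u x * fderiv ℝ η x (single 0 1))
        + v 1 * (u x * fderiv ℝ η x (single 1 1)) := by
    intro x
    conv_lhs => rw [eq_sum_single v]
    simp only [map_add, map_smul, smul_eq_mul]; ring
  have e2 : ∀ x, ⟪Du x, v⟫ * η x = v 0 * (Du x 0 * η x) + v 1 * (Du x 1 * η x) := by
    intro x
    rw [inner_plane]; ring
  simp only [e1, e2]
  rw [integral_add ((hd 0).const_mul _) ((hd 1).const_mul _),
    integral_add ((hD 0).const_mul _) ((hD 1).const_mul _)]
  simp only [integral_const_mul]
  rw [h.weak η hη hc hs 0, h.weak η hη hc hs 1]; ring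

/-- A continuous function whose weak gradient is bounded by `M` on a convex open set is
`M`-Lipschitz there: the mollified functions are. -/
lemma MemW12Loc.abs_sub_le {U : Set Plane} (hUo : IsOpen U) (hUc : Convex ℝ U)
    (h : MemW12Loc U u Du) (huc : ContinuousOn u U) {M : ℝ}
    (hb : ∀ᵐ x ∂(volume.restrict U), ‖Du x‖ ≤ M) {y : Plane} (hx : x ∈ U) (hy : y ∈ U) :
    |u x - u y| ≤ M * ‖x - y‖ := by
  refine le_of_forall_pos_le_add fun ε hε => ?_
  have hSc : IsCompact (segment ℝ x y) := by
    rw [segment_eq_image_lineMap]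
    exact isCompact_Icc.image (by fun_prop)
  have hSU : segment ℝ x y ⊆ U := hUc.segment_subset hx hy
  obtain ⟨δ, hδ, hδU⟩ := hSc.exists_cthickening_subset_open hUo hSU
  set K := cthickening δ (segment ℝ x y)
  have hKc : IsCompact K := hSc.cthickening
  have hballK : ∀ z ∈ segment ℝ x y, closedBall z δ ⊆ K := fun z hz =>
    Metric.closedBall_subset_cthickening hz δ
  set u' := K.indicator u with hu'
  have hu'i : Integrable u' := (integrable_indicator_iff hKc.measurableSet).2
    (h.integrableOn hKc hδU)
  have hcont : ∀ z ∈ segment ℝ x y, ∃ r > 0, ∀ w ∈ ball z r, dist (u' w) (u' z) ≤ ε / 2 := by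
    intro z hz
    have h1 : ContinuousAt u z := huc.continuousAt (hUo.mem_nhds (hSU hz))
    obtain ⟨r, hr, hrb⟩ := Metric.continuousAt_iff.1 h1 (ε / 2) (by positivity)
    refine ⟨min r δ, lt_min hr hδ, fun w hw => ?_⟩
    have hw1 : dist w z < r := by simp_all
    have hw2 : dist w z < δ := by simp_all
    rw [hu', indicator_of_mem (hballK z hz (mem_closedBall.2 hw2.le)),
      indicator_of_mem (hballK z hz (mem_closedBall_self hδ.le))]
    exact (hrb hw1).le
  obtain ⟨r1, hr1, hx1⟩ := hcont x (left_mem_segment ℝ x y)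
  obtain ⟨r2, hr2, hy1⟩ := hcont y (right_mem_segment ℝ x y)
  set r := min (min r1 r2) δ with hr
  have hrpos : 0 < r := lt_min (lt_min hr1 hr2) hδ
  set ϕ : ContDiffBump (0 : Plane) := ⟨r / 2, r, by positivity, by linarith⟩ with hϕ
  set v := (ϕ.normed volume) ⋆[ContinuousLinearMap.lsmul ℝ ℝ, volume] u' with hv
  have hvx : dist (v x) (u' x) ≤ ε / 2 := ϕ.dist_normed_convolution_le hu'i.aestronglyMeasurable
    fun w hw => hx1 w (ball_subset_ball
      ((min_le_left _ _).trans (min_le_left _ _)) hw)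
  have hvy : dist (v y) (u' y) ≤ ε / 2 := ϕ.dist_normed_convolution_le hu'i.aestronglyMeasurable
    fun w hw => hy1 w (ball_subset_ball
      ((min_le_left _ _).trans (min_le_right _ _)) hw)
  have hρs : HasCompactSupport (ϕ.normed volume) := ϕ.hasCompactSupport_normed
  have hρc : ContDiff ℝ ∞ (ϕ.normed volume) := ϕ.contDiff_normed
  have hvd : ∀ z, HasFDerivAt v _ z := fun z =>
    hρs.hasFDerivAt_convolution_left (ContinuousLinearMap.lsmul ℝ ℝ) (hρc.of_le (by simp))
      hu'i.locallyIntegrable z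
  have hbound : ∀ z ∈ segment ℝ x y, ‖fderiv ℝ v z‖ ≤ M := by
    intro z hz
    have hM : 0 ≤ M := by
      have h1 : volume.restrict U ≠ 0 := by
        rw [Ne, Measure.restrict_eq_zero]
        exact (hUo.measure_pos volume ⟨x, hx⟩).ne'
      have : NeZero (volume.restrict U) := ⟨h1⟩
      obtain ⟨w, hw⟩ := hb.exists
      exact (norm_nonneg _).trans hw
    refine ContinuousLinearMap.opNorm_le_bound _ hM fun e => ?_
    rw [(hvd z).fderiv]
    rw [convolution_eq_swap]
    have hint : Integrable (fun t => (((ContinuousLinearMap.lsmul ℝ ℝ).precompL Plane)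
        (fderiv ℝ (ϕ.normed volume) (z - t))) (u' t)) := by
      apply ConvolutionExistsAt.integrable_swap
      exact (hρs.fderiv (𝕜 := ℝ)).convolutionExists_left _
        (hρc.continuous_fderiv (by simp)) hu'i.locallyIntegrable z
    rw [ContinuousLinearMap.integral_apply hint e]
    set η : Plane → ℝ := fun t => ϕ.normed volume (z - t) with hη
    have hηc : ContDiff ℝ ∞ η := hρc.comp (by fun_prop)
    have hηs : HasCompactSupport η := hρs.comp_homeomorph (Homeomorph.subLeft z)
    have hηt : tsupport η ⊆ K := by
      refine subset_trans (closure_minimal ?_ isClosed_closedBall)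
        (hballK z hz)
      intro t ht
      have h1 : z - t ∈ Function.support (ϕ.normed volume) := ht
      rw [ϕ.support_normed_eq, mem_ball_zero_iff] at h1
      rw [mem_closedBall, dist_eq_norm, ← norm_neg, neg_sub]
      exact h1.le.trans (min_le_right _ _)
    have hηd : ∀ t, fderiv ℝ η t e = - fderiv ℝ (ϕ.normed volume) (z - t) e := by
      intro t
      have h1 : HasFDerivAt η _ t :=
        ((hρc.differentiable (by simp)) (z - t)).hasFDerivAt.comp t
          (by fun_prop)
      rw [h1.fderiv]; simp
    have h1 : ∫ t, (((ContinuousLinearMap.lsmul ℝ ℝ).precompL Plane)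
        (fderiv ℝ (ϕ.normed volume) (z - t))) (u' t) e = ∫ t, - (u t * fderiv ℝ η t e) := by
      refine integral_congr_ae (.of_forall fun t => ?_)
      simp only [ContinuousLinearMap.precompL_apply, ContinuousLinearMap.lsmul_apply, smul_eq_mul,
        hηd]
      by_cases ht : t ∈ K
      · rw [hu', indicator_of_mem ht]; ring
      · have h2 : t ∉ tsupport (fderiv ℝ η) := fun h3 => ht (hηt (tsupport_fderiv_subset ℝ h3))
        have h3 : fderiv ℝ η t e = 0 := by rw [image_eq_zero_of_notMem_tsupport h2]; simp
        rw [hηd] at h3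
        rw [hu', indicator_of_notMem ht, neg_eq_zero.1 h3]; simp
    rw [h1, integral_neg, h.weak_dir hηc hηs (hηt.trans hδU) e, neg_neg]
    have hηint : ∫ t, η t = 1 := by
      rw [hη, integral_sub_left_eq_self (fun t => ϕ.normed volume t) volume z]
      exact ϕ.integral_normed
    calc ‖∫ t, ⟪Du t, e⟫ * η t‖ ≤ ∫ t, M * ‖e‖ * η t := by
          refine norm_integral_le_of_norm_le ((hηc.continuous.integrable_of_hasCompactSupport
            hηs).const_mul _) ?_
          have hb' := (ae_restrict_iff' hUo.measurableSet).1 hb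
          filter_upwards [hb'] with t ht
          by_cases htU : t ∈ U
          · rw [norm_mul, norm_of_nonneg (ϕ.nonneg_normed (z - t))]
            refine mul_le_mul_of_nonneg_right ?_ (ϕ.nonneg_normed (z - t))
            exact (norm_inner_le_norm _ _).trans
              (mul_le_mul_of_nonneg_right (ht htU) (norm_nonneg _))
          · have : η t = 0 := image_eq_zero_of_notMem_tsupport
              fun h3 => htU (hδU (hηt h3))
            simp [this]
      _ = M * ‖e‖ := by rw [integral_const_mul, hηint, mul_one]
  have hfin := (convex_segment x y).norm_image_sub_le_of_norm_fderiv_le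
    (fun z _ => (hvd z).differentiableAt) hbound (right_mem_segment ℝ x y)
    (left_mem_segment ℝ x y)
  have hux : u' x = u x := indicator_of_mem
    (hballK x (left_mem_segment ℝ x y) (mem_closedBall_self hδ.le)) _
  have huy : u' y = u y := indicator_of_mem
    (hballK y (right_mem_segment ℝ x y) (mem_closedBall_self hδ.le)) _
  rw [hux, dist_eq] at hvx
  rw [huy, dist_eq] at hvy
  rw [norm_eq_abs] at hfin
  rw [abs_le] at *
  constructor <;> linarith [hvx.1, hvx.2, hvy.1, hvy.2, hfin.1, hfin.2]

/-- Integration by parts for a Lipschitz function against a Lipschitz test function. -/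
lemma integral_fderiv_mul {K' : NNReal} (hw : LipschitzWith K w)
    (hη : LipschitzWith K' η) (hc : HasCompactSupport η) (v : Plane) :
    ∫ x, fderiv ℝ w x v * η x = - ∫ x, w x * fderiv ℝ η x v := by
  have h1 := hw.integral_lineDeriv_mul_eq (μ := volume) hη hc v
  have e1 : ∫ x, lineDeriv ℝ w x v * η x = ∫ x, fderiv ℝ w x v * η x := by
    refine integral_congr_ae ?_
    filter_upwards [hw.ae_differentiableAt] with x hx
    rw [hx.lineDeriv_eq_fderiv]
  have e2 : ∫ x, lineDeriv ℝ η x (-v) * w x = - ∫ x, w x * fderiv ℝ η x v := by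
    rw [← integral_neg]
    refine integral_congr_ae ?_
    filter_upwards [hη.ae_differentiableAt] with x hx
    rw [hx.lineDeriv_eq_fderiv]; simp [mul_comm]
  rw [← e1, h1, e2]

/-- A Lipschitz function is a Sobolev function whose weak gradient is its gradient. -/
lemma memW12Loc_of_lipschitzWith (hw : LipschitzWith K w)
    (U : Set Plane) : MemW12Loc U w (∇ w) where
  memLp S _ hS := by
    have : IsFiniteMeasure (volume.restrict S) := ⟨by simpa using hS.measure_lt_top⟩
    obtain ⟨C, hC⟩ := hS.exists_bound_of_continuousOn hw.continuous.continuousOn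
    refine MemLp.of_bound hw.continuous.aestronglyMeasurable C ?_
    exact (ae_restrict_iff' hS.measurableSet).2 (.of_forall hC)
  memLp_grad S _ hS := by
    have : IsFiniteMeasure (volume.restrict S) := ⟨by simpa using hS.measure_lt_top⟩
    refine MemLp.of_bound (measurable_gradient w).aestronglyMeasurable K ?_
    refine .of_forall fun x => ?_
    rw [norm_gradient]
    exact norm_fderiv_le_of_lipschitz ℝ hw
  weak η hη hc _ i := by
    obtain ⟨K', hK'⟩ := hη.lipschitzWith_of_hasCompactSupport hc (by simp)
    have := integral_fderiv_mul hw hK' hc (single i 1)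
    simp only [gradient_apply]
    rw [this, neg_neg]

/-- The weak gradient is determined almost everywhere by the function. -/
lemma MemW12Loc.ae_eq {U : Set Plane} (hU : IsOpen U) {Dw : Plane → Plane}
    (hu : MemW12Loc U u Du) (hw : MemW12Loc U w Dw) (huw : EqOn u w U) :
    ∀ᵐ x, x ∈ U → Du x = Dw x := by
  have hloc : ∀ i : Fin 2, LocallyIntegrableOn (fun x => Du x i - Dw x i) U := by
    intro i
    rw [locallyIntegrableOn_iff hU.isLocallyClosed]
    intro k hk hkc
    exact ((proj (𝕜 := ℝ) i).integrable_comp (hu.integrableOn_grad hkc hk)).sub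
      ((proj (𝕜 := ℝ) i).integrable_comp (hw.integrableOn_grad hkc hk))
  have key : ∀ i : Fin 2, ∀ᵐ x, x ∈ U → Du x i - Dw x i = 0 := by
    intro i
    refine hU.ae_eq_zero_of_integral_contDiff_smul_eq_zero (hloc i) fun η hη hc hs => ?_
    have h1 := hu.weak η hη hc hs i
    have h2 := hw.weak η hη hc hs i
    have h3 : ∫ x, u x * fderiv ℝ η x (single i 1)
        = ∫ x, w x * fderiv ℝ η x (single i 1) := by
      refine integral_congr_ae (.of_forall fun x => ?_)
      by_cases hx : x ∈ U
      · simp only [huw hx]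
      · have h4 : fderiv ℝ η x = 0 := image_eq_zero_of_notMem_tsupport
          fun h5 => hx (hs (tsupport_fderiv_subset ℝ h5))
        simp [h4]
    have hi : ∀ {f : Plane → ℝ} {Df : Plane → Plane}, MemW12Loc U f Df →
        Integrable fun x => Df x i * η x := fun hf =>
      integrable_mul_of_integrableOn_tsupport
        ((proj (𝕜 := ℝ) i).integrable_comp (hf.integrableOn_grad hc hs))
        hη.continuous hc
    have h5 : ∫ x, η x • (Du x i - Dw x i) = ∫ x, (Du x i * η x - Dw x i * η x) := by
      congr 1; ext x; simp only [smul_eq_mul]; ring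
    rw [h5, integral_sub (hi hu) (hi hw)]
    linarith
  filter_upwards [key 0, key 1] with x h0 h1 hx
  ext i
  fin_cases i
  · exact sub_eq_zero.1 (h0 hx)
  · exact sub_eq_zero.1 (h1 hx)

lemma gradient_eq_zero_of_nonneg (hw : ∀ x, 0 ≤ w x) (hx : w x = 0) :
    ∇ w x = 0 := by
  have : IsLocalMin w x := .of_forall fun y => by rw [hx]; exact hw y
  rw [gradient, this.fderiv_eq_zero, map_zero]

/-! ### Almost solutions of the incompressible problem -/

/-- The integrand of the first domain variation, in direction `φ`, of the incompressible energy
`∫ |∇w|² + x₂ χ_{w > 0}`. -/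
noncomputable def varIntegrand (w : Plane → ℝ) (φ : Plane → Plane) (x : Plane) : ℝ :=
  (‖∇ w x‖ ^ 2 + x 1 * chi w x) * divergence φ x
    - 2 * ⟪∇ w x, fderiv ℝ φ x (∇ w x)⟫ + chi w x * φ x 1

/-- `w` is harmonic in `U ∩ {w > 0}` up to an error which is small of order `3/2` at the
origin. -/
def AlmostHarmonic (U : Set Plane) (κ : ℝ) (w : Plane → ℝ) : Prop :=
  ∀ ψ : Plane → ℝ, ContDiff ℝ 1 ψ → HasCompactSupport ψ → tsupport ψ ⊆ {x | x ∈ U ∧ 0 < w x} →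
    |∫ x, ⟪∇ w x, ∇ ψ x⟫|
      ≤ κ * ∫ x, ‖x‖ ^ (3 / 2 : ℝ) * ‖∇ ψ x‖

/-- An almost solution, in the disc of radius `R` about the origin, of the incompressible problem
`Δw = 0` in `{w > 0}`, `|∇w|² = x₂` on `∂{w > 0}`. The number `κ` measures the failure to be a
solution; the powers of `‖x‖` in the error terms are those that turn `κ` into `κ r` under the
rescaling `w(r x) / r^{3/2}`. The field `bv` bounds the variation of `χ_{w > 0}` with the weight
`√x₂`. -/
structure AlmostSolution (R C κ : ℝ) (w : Plane → ℝ) : Prop where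
  R_pos : 0 < R
  C_nonneg : 0 ≤ C
  κ_nonneg : 0 ≤ κ
  lip : ∃ K, LipschitzWith K w
  nonneg : ∀ x, 0 ≤ w x
  lower : ∀ x ∈ ball 0 R, x 1 ≤ 0 → w x = 0
  grad : ∀ᵐ x, x ∈ ball 0 R → ‖∇ w x‖ ^ 2 ≤ C * max (x 1) 0
  smooth : ContDiffOn ℝ 1 w {x | x ∈ ball 0 R ∧ 0 < w x}
  var : ∀ φ, IsTestField (ball 0 R) φ →
    |∫ x, varIntegrand w φ x| ≤ κ * ∫ x, (‖x‖ ^ 2 * ‖fderiv ℝ φ x‖ + ‖x‖ * ‖φ x‖)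
  pde : AlmostHarmonic (ball 0 R) κ w
  bv : ∀ φ M ρ, 0 < ρ → IsTestField (ball 0 ρ ∩ {x | 0 < x 1}) φ → ρ ≤ R →
    (∀ x, ‖φ x‖ ≤ M * √(x 1)) →
    |∫ x, chi w x * divergence φ x| ≤ M * (C * ρ ^ (3 / 2 : ℝ))

lemma rpow_three_halves (hr : 0 ≤ r) : r ^ (3 / 2 : ℝ) = r * √r := by
  rw [Real.sqrt_eq_rpow, ← Real.rpow_one_add' hr (by norm_num)]; norm_num

lemma blowUp_zero_apply (w : Plane → ℝ) (r : ℝ) (x : Plane) :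
    blowUp w 0 r x = w (r • x) / r ^ (3 / 2 : ℝ) := by simp [blowUp]

lemma gradient_blowUp (w : Plane → ℝ) (r : ℝ) (x : Plane) :
    ∇ (blowUp w 0 r) x = (r / r ^ (3 / 2 : ℝ)) • ∇ w (r • x) := by
  have h1 : blowUp w 0 r = fun x => (r ^ (3 / 2 : ℝ))⁻¹ • w (r • x) := by
    ext x; rw [blowUp_zero_apply, smul_eq_mul]; ring
  have h2 : fderiv ℝ (blowUp w 0 r) x = (r / r ^ (3 / 2 : ℝ)) • fderiv ℝ w (r • x) := by
    rw [h1, show (fun x => (r ^ (3 / 2 : ℝ))⁻¹ • w (r • x))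
      = (r ^ (3 / 2 : ℝ))⁻¹ • (fun x => w (r • x)) from rfl, fderiv_const_smul_field, Pi.smul_apply,
      fderiv_comp_smul, smul_smul]
    congr 1; ring
  simp only [gradient, h2, map_smul]

lemma sq_div_rpow (hr : 0 < r) : (r / r ^ (3 / 2 : ℝ)) ^ 2 = r⁻¹ := by
  rw [rpow_three_halves hr.le]
  have h := sq_sqrt hr.le
  field_simp
  exact h.symm

lemma chi_blowUp (hr : 0 < r) (x : Plane) :
    chi (blowUp w 0 r) x = chi w (r • x) := by
  have h : 0 < r ^ (3 / 2 : ℝ) := rpow_pos_of_pos hr _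
  have : 0 < blowUp w 0 r x ↔ 0 < w (r • x) := by
    rw [blowUp_zero_apply]
    exact ⟨fun h1 => by simpa [h.ne'] using mul_pos h1 h, fun h1 => div_pos h1 h⟩
  unfold chi
  by_cases h1 : 0 < w (r • x)
  · simp_all
  · simp_all

lemma integral_comp_smul_plane (f : Plane → ℝ) (hr : 0 < r) :
    ∫ x, f x = r ^ 2 * ∫ x, f (r • x) := by
  rw [Measure.integral_comp_smul]
  simp only [finrank_euclideanSpace, Fintype.card_fin, smul_eq_mul]
  rw [abs_of_pos (by positivity)]
  field_simp

lemma isTestField_comp_smul {U : Set Plane} (hr : 0 < r)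
    (hφ : IsTestField ((fun x => r • x) ⁻¹' U) φ) : IsTestField U (fun y => φ (r⁻¹ • y)) := by
  refine ⟨hφ.1.comp (by fun_prop), hφ.2.1.comp_smul (inv_ne_zero hr.ne'), ?_⟩
  intro y hy
  have h1 := tsupport_comp_subset_preimage φ (by fun_prop) hy
  have h2 := hφ.2.2 h1
  simpa [smul_smul, hr.ne'] using h2

lemma divergence_comp_smul (φ : Plane → Plane) (c : ℝ) (y : Plane) :
    divergence (fun y => φ (c • y)) y = c * divergence φ (c • y) := by
  simp only [divergence, fderiv_comp_smul, Fin.sum_univ_two]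
  simp; ring

/-- Almost solutions are stable under blow-up, and the error is multiplied by the scale. -/
lemma AlmostSolution.rescale {R κ : ℝ} (h : AlmostSolution R C κ w)
    (hr : 0 < r) : AlmostSolution (R / r) C (κ * r) (blowUp w 0 r) := by
  have hs : 0 < r ^ (3 / 2 : ℝ) := rpow_pos_of_pos hr _
  have hball : ∀ x : Plane, x ∈ ball 0 (R / r) ↔ r • x ∈ ball 0 R := by
    intro x
    rw [mem_ball_zero_iff, mem_ball_zero_iff, norm_smul, norm_of_nonneg hr.le, lt_div_iff₀ hr,
      mul_comm]
  have hsm : ∀ x : Plane, r⁻¹ • r • x = x := inv_smul_smul₀ hr.ne'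
  have hrr : r / r ^ (3 / 2 : ℝ) * r ^ (3 / 2 : ℝ) = r := by field_simp
  refine ⟨div_pos h.R_pos hr, h.C_nonneg, mul_nonneg h.κ_nonneg hr.le, ?_, ?_, ?_, ?_, ?_, ?_, ?_,
    ?_⟩
  · obtain ⟨K, hK⟩ := h.lip
    refine ⟨toNNReal (K * r / r ^ (3 / 2 : ℝ)), LipschitzWith.of_dist_le_mul fun x y => ?_⟩
    rw [coe_toNNReal _ (by positivity), blowUp_zero_apply, blowUp_zero_apply, dist_eq,
      ← sub_div, abs_div, abs_of_pos hs]
    have := hK.dist_le_mul (r • x) (r • y)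
    rw [dist_eq, dist_smul₀, norm_of_nonneg hr.le] at this
    rw [show K * r / r ^ (3 / 2 : ℝ) * dist x y = (K * (r * dist x y)) / r ^ (3 / 2 : ℝ) by ring]
    exact div_le_div_of_nonneg_right this hs.le
  · intro x
    rw [blowUp_zero_apply]
    exact div_nonneg (h.nonneg _) hs.le
  · intro x hx hx1
    rw [blowUp_zero_apply, h.lower _ ((hball x).1 hx) (by simpa using mul_nonpos_of_nonneg_of_nonpos hr.le hx1), zero_div]
  · have h1 : ∀ᵐ x : Plane, r • x ∈ ball 0 R →
        ‖∇ w (r • x)‖ ^ 2 ≤ C * max ((r • x) 1) 0 := by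
      have hq : Measure.QuasiMeasurePreserving (fun x : Plane => r • x) volume volume :=
        ⟨(by fun_prop), by
          rw [Measure.map_addHaar_smul volume hr.ne']
          exact Measure.smul_absolutelyContinuous⟩
      exact hq.ae h.grad
    filter_upwards [h1] with x hx hxb
    have h2 := hx ((hball x).1 hxb)
    rw [gradient_blowUp, norm_smul, mul_pow, norm_eq_abs, sq_abs, sq_div_rpow hr]
    have h3 : max ((r • x) 1) 0 = r * max (x 1) 0 := by
      rw [mul_max_of_nonneg _ _ hr.le]; simp
    rw [h3] at h2
    rw [inv_mul_le_iff₀ hr]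
    linarith
  · have h1 : ContDiffOn ℝ 1 (fun x => w (r • x))
        {x | x ∈ ball 0 (R / r) ∧ 0 < blowUp w 0 r x} := by
      refine h.smooth.comp (contDiff_const_smul r).contDiffOn fun x hx => ?_
      refine ⟨(hball x).1 hx.1, ?_⟩
      have := hx.2
      rw [blowUp_zero_apply] at this
      simpa [hs.ne'] using mul_pos this hs
    have h2 : blowUp w 0 r = fun x => w (r • x) / r ^ (3 / 2 : ℝ) := by
      ext x; rw [blowUp_zero_apply]
    rw [h2] at h1 ⊢
    exact h1.div_const _
  · intro φ hφ
    have hφ' : IsTestField (ball 0 R) (fun y => φ (r⁻¹ • y)) := by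
      refine isTestField_comp_smul hr ?_
      convert hφ using 1
      ext x; exact (hball x).symm
    have h1 := h.var _ hφ'
    rw [integral_comp_smul_plane _ hr, integral_comp_smul_plane (fun x => _ + _) hr] at h1
    have e1 : ∀ x, varIntegrand w (fun y => φ (r⁻¹ • y)) (r • x)
        = varIntegrand (blowUp w 0 r) φ x := by
      intro x
      have hr1 : (r / r ^ (3 / 2 : ℝ)) * (r / r ^ (3 / 2 : ℝ)) = r⁻¹ := by
        rw [← sq, sq_div_rpow hr]
      have hg : ‖∇ w (r • x)‖ ^ 2 * r⁻¹ = ‖∇ (blowUp w 0 r) x‖ ^ 2 := by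
        rw [gradient_blowUp, norm_smul, mul_pow, norm_eq_abs, sq_abs, sq_div_rpow hr, mul_comm]
      unfold varIntegrand
      rw [divergence_comp_smul, fderiv_comp_smul, chi_blowUp hr, ← hg, gradient_blowUp]
      simp only [hsm]
      simp only [PiLp.smul_apply, smul_eq_mul, _root_.smul_apply, map_smul,
        inner_smul_left, inner_smul_right, RCLike.conj_to_real]
      have h3 : r⁻¹ * r = 1 := inv_mul_cancel₀ hr.ne'
      linear_combination (x 1 * chi w (r • x) * divergence φ x) * h3
        + 2 * ⟪∇ w (r • x), fderiv ℝ φ x (∇ w (r • x))⟫ * hr1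
    have e2 : ∀ x, ‖r • x‖ ^ 2 * ‖fderiv ℝ (fun y => φ (r⁻¹ • y)) (r • x)‖
        + ‖r • x‖ * ‖φ (r⁻¹ • r • x)‖ = r * (‖x‖ ^ 2 * ‖fderiv ℝ φ x‖ + ‖x‖ * ‖φ x‖) := by
      intro x
      rw [fderiv_comp_smul, hsm, norm_smul, norm_smul, norm_inv, norm_of_nonneg hr.le]
      field_simp
    simp only [e1, e2, integral_const_mul] at h1
    rw [abs_mul, abs_of_pos (by positivity : 0 < r ^ 2)] at h1
    have h2 : 0 < r ^ 2 := by positivity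
    refine le_of_mul_le_mul_left (h1.trans (le_of_eq ?_)) h2
    ring
  · intro ψ hψ hψc hψs
    have hψ' : ContDiff ℝ 1 (fun y => ψ (r⁻¹ • y)) := by fun_prop
    have hψs' : tsupport (fun y => ψ (r⁻¹ • y)) ⊆ {x | x ∈ ball 0 R ∧ 0 < w x} := by
      intro y hy
      have h1 := tsupport_comp_subset_preimage ψ (by fun_prop) hy
      have h2 := hψs h1
      have h3 := smul_inv_smul₀ hr.ne' y
      have h4 := h2.2
      rw [blowUp_zero_apply, h3] at h4
      exact ⟨by simpa [h3] using (hball _).1 h2.1, by simpa [hs.ne'] using mul_pos h4 hs⟩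
    have h1 := h.pde _ hψ' (hψc.comp_smul (inv_ne_zero hr.ne')) hψs'
    rw [integral_comp_smul_plane _ hr, integral_comp_smul_plane (fun x => _ * _) hr] at h1
    have e0 : ∀ x : Plane, ∇ (fun y => ψ (r⁻¹ • y)) (r • x) = r⁻¹ • ∇ ψ x := by
      intro x
      simp only [gradient, fderiv_comp_smul, hsm, map_smul]
    have e1 : ∀ x, ⟪∇ w (r • x), ∇ (fun y => ψ (r⁻¹ • y)) (r • x)⟫
        = (r ^ (3 / 2 : ℝ) / r ^ 2) *
          ⟪∇ (blowUp w 0 r) x, ∇ ψ x⟫ := by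
      intro x
      rw [e0, gradient_blowUp, inner_smul_left, inner_smul_right]
      simp only [RCLike.conj_to_real]
      field_simp
    have e2 : ∀ x, ‖r • x‖ ^ (3 / 2 : ℝ) * ‖∇ (fun y => ψ (r⁻¹ • y)) (r • x)‖
        = (r ^ (3 / 2 : ℝ) / r) * (‖x‖ ^ (3 / 2 : ℝ) * ‖∇ ψ x‖) := by
      intro x
      rw [e0, norm_smul, norm_smul, norm_inv, norm_of_nonneg hr.le,
        mul_rpow hr.le (norm_nonneg _)]
      ring
    simp only [e1, e2, integral_const_mul] at h1
    rw [abs_mul, abs_mul, abs_of_pos (by positivity : 0 < r ^ 2),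
      abs_of_pos (by positivity : 0 < r ^ (3 / 2 : ℝ) / r ^ 2)] at h1
    refine le_of_mul_le_mul_left ?_ hs
    have e3 : r ^ 2 * (r ^ (3 / 2 : ℝ) / r ^ 2) = r ^ (3 / 2 : ℝ) := by field_simp
    rw [← mul_assoc, e3] at h1
    refine h1.trans (le_of_eq ?_)
    field_simp
  · intro φ M ρ hρ hφ hρR hM
    have hφ' : IsTestField (ball 0 (r * ρ) ∩ {x | 0 < x 1})
        (fun y => φ (r⁻¹ • y)) := by
      refine isTestField_comp_smul hr ?_
      convert hφ using 1
      ext x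
      simp only [mem_preimage, mem_inter_iff, mem_ball_zero_iff, norm_smul,
        norm_of_nonneg hr.le, mem_ofPred_eq, PiLp.smul_apply, smul_eq_mul]
      rw [mul_lt_mul_iff_right₀ hr, mul_pos_iff_of_pos_left hr]
    have hM' : ∀ y, ‖φ (r⁻¹ • y)‖ ≤ (M / √r) * √(y 1) := by
      intro y
      refine (hM _).trans (le_of_eq ?_)
      have : (r⁻¹ • y) 1 = y 1 / r := by
        rw [PiLp.smul_apply, smul_eq_mul]; ring
      rw [this, Real.sqrt_div' _ hr.le]; ring
    have h1 := h.bv _ _ _ (mul_pos hr hρ) hφ' (by rw [le_div_iff₀ hr] at hρR; linarith) hM'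
    rw [integral_comp_smul_plane _ hr] at h1
    have e1 : ∀ x, chi w (r • x) * divergence (fun y => φ (r⁻¹ • y)) (r • x)
        = r⁻¹ * (chi (blowUp w 0 r) x * divergence φ x) := by
      intro x
      rw [divergence_comp_smul, hsm, chi_blowUp hr]; ring
    simp only [e1, integral_const_mul] at h1
    rw [← mul_assoc, abs_mul, abs_of_pos (by positivity : 0 < r ^ 2 * r⁻¹),
      mul_rpow hr.le hρ.le, rpow_three_halves hr.le] at h1
    refine le_of_mul_le_mul_left ?_ hr
    have e2 : r ^ 2 * r⁻¹ = r := by field_simp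
    rw [e2] at h1
    refine h1.trans (le_of_eq ?_)
    field_simp

/-! ### Truncation and the energy identity -/

/-- A continuous approximation of the indicator function of `(0, ∞)`. -/
noncomputable def ramp (δ t : ℝ) : ℝ := min (max ((t - δ) / δ) 0) 1

/-- The primitive of `ramp δ`: a `C¹` approximation of `t ↦ t` on `[0, ∞)` which vanishes for
`t ≤ δ`. -/
noncomputable def trunc (δ t : ℝ) : ℝ := ∫ τ in 0..t, ramp δ τ

@[fun_prop] lemma continuous_ramp (δ : ℝ) : Continuous (ramp δ) := by unfold ramp; fun_prop

lemma ramp_nonneg (δ t : ℝ) : 0 ≤ ramp δ t := le_min (le_max_right _ _) zero_le_one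

lemma ramp_le_one (δ t : ℝ) : ramp δ t ≤ 1 := min_le_right _ _

lemma ramp_eq_zero {δ t : ℝ} (hδ : 0 < δ) (ht : t ≤ δ) : ramp δ t = 0 := by
  unfold ramp
  rw [max_eq_right (div_nonpos_of_nonpos_of_nonneg (by linarith) hδ.le)]
  exact min_eq_left zero_le_one

lemma ramp_eq_one {δ t : ℝ} (hδ : 0 < δ) (ht : 2 * δ ≤ t) : ramp δ t = 1 := by
  unfold ramp
  refine min_eq_right (le_max_of_le_left ?_)
  rw [le_div_iff₀ hδ]; linarith

lemma hasDerivAt_trunc (δ t : ℝ) : HasDerivAt (trunc δ) (ramp δ t) t :=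
  intervalIntegral.integral_hasDerivAt_right ((continuous_ramp δ).intervalIntegrable _ _)
    ((continuous_ramp δ).stronglyMeasurableAtFilter _ _) (continuous_ramp δ).continuousAt

@[fun_prop] lemma contDiff_trunc (δ : ℝ) : ContDiff ℝ 1 (trunc δ) := by
  rw [contDiff_one_iff_deriv]
  refine ⟨fun t => (hasDerivAt_trunc δ t).differentiableAt, ?_⟩
  rw [show deriv (trunc δ) = ramp δ from funext fun t => (hasDerivAt_trunc δ t).deriv]
  exact continuous_ramp δ

lemma trunc_eq_zero {δ t : ℝ} (hδ : 0 < δ) (ht : t ≤ δ) : trunc δ t = 0 := by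
  unfold trunc
  have h : ∫ τ in 0..t, ramp δ τ = ∫ τ in 0..t, 0 :=
    intervalIntegral.integral_congr fun τ hτ => ramp_eq_zero hδ (hτ.2.trans (max_le hδ.le ht))
  rw [h, intervalIntegral.integral_zero]

lemma trunc_nonneg (δ : ℝ) {t : ℝ} (ht : 0 ≤ t) : 0 ≤ trunc δ t :=
  intervalIntegral.integral_nonneg ht fun _ _ => ramp_nonneg _ _

lemma trunc_le (δ : ℝ) {t : ℝ} (ht : 0 ≤ t) : trunc δ t ≤ t := by
  have := intervalIntegral.integral_mono_on ht ((continuous_ramp δ).intervalIntegrable 0 t)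
    (intervalIntegrable_const (c := (1 : ℝ)) (μ := volume)) fun x _ => ramp_le_one δ x
  simpa [trunc] using this

lemma sub_trunc_le {δ t : ℝ} (hδ : 0 < δ) (ht : 0 ≤ t) : t - trunc δ t ≤ 2 * δ := by
  rcases le_total t (2 * δ) with h | h
  · linarith [trunc_nonneg δ ht]
  · have h1 : trunc δ t = trunc δ (2 * δ) + ∫ τ in (2 * δ)..t, ramp δ τ :=
      (intervalIntegral.integral_add_adjacent_intervals
        ((continuous_ramp δ).intervalIntegrable _ _)
        ((continuous_ramp δ).intervalIntegrable _ _)).symm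
    have h2 : ∫ τ in (2 * δ)..t, ramp δ τ = ∫ τ in (2 * δ)..t, 1 := by
      refine intervalIntegral.integral_congr fun τ hτ => ?_
      rw [uIcc_of_le h] at hτ
      exact ramp_eq_one hδ hτ.1
    rw [h1, h2]
    simp only [intervalIntegral.integral_const, smul_eq_mul, mul_one]
    linarith [trunc_nonneg δ (by positivity : 0 ≤ 2 * δ)]

lemma gradient_mul_of_differentiableAt {f g : Plane → ℝ} (hf : DifferentiableAt ℝ f x)
    (hg : DifferentiableAt ℝ g x) :
    ∇ (fun x => f x * g x) x = g x • ∇ f x + f x • ∇ g x := by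
  have h : fderiv ℝ (fun x => f x * g x) x = f x • fderiv ℝ g x + g x • fderiv ℝ f x :=
    fderiv_mul hf hg
  simp only [gradient, h, map_add, map_smul]
  rw [add_comm]

/-- Cutting a nonnegative function off near its zero set produces admissible test functions. -/
lemma truncMul_spec {U : Set Plane} (hU : IsOpen U)
    (hw : Continuous w) (hs : ContDiffOn ℝ 1 w {x | x ∈ U ∧ 0 < w x})
    (hη : ContDiff ℝ 1 η) (hηU : tsupport η ⊆ U) {δ : ℝ} (hδ : 0 < δ) :
    ContDiff ℝ 1 (fun x => trunc δ (w x) * η x) ∧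
    tsupport (fun x => trunc δ (w x) * η x) ⊆ tsupport η ∩ {x | δ ≤ w x} ∧
    ∀ x, ∇ (fun x => trunc δ (w x) * η x) x
      = (ramp δ (w x) * η x) • ∇ w x + trunc δ (w x) • ∇ η x := by
  have hts : tsupport (fun x => trunc δ (w x) * η x) ⊆ tsupport η ∩ {x | δ ≤ w x} := by
    refine closure_minimal ?_ ((isClosed_tsupport η).inter (isClosed_le continuous_const hw))
    intro x hx
    refine ⟨subset_tsupport η fun h => hx (by simp [h]), ?_⟩
    by_contra h
    exact hx (by simp only [trunc_eq_zero hδ (not_le.1 h).le, zero_mul])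
  have hopen : IsOpen {x | x ∈ U ∧ 0 < w x} := hU.inter (isOpen_lt continuous_const hw)
  have hin : ∀ x, x ∈ U → 0 < w x → ContDiffAt ℝ 1 w x := fun x hx hx0 =>
    hs.contDiffAt (hopen.mem_nhds ⟨hx, hx0⟩)
  refine ⟨contDiff_iff_contDiffAt.2 fun x => ?_, hts, fun x => ?_⟩
  · by_cases hx : x ∈ tsupport (fun x => trunc δ (w x) * η x)
    · have h1 := hts hx
      exact ((contDiff_trunc δ).contDiffAt.comp x
        (hin x (hηU h1.1) (hδ.trans_le h1.2))).mul hη.contDiffAt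
    · exact contDiffAt_const.congr_of_eventuallyEq (notMem_tsupport_iff_eventuallyEq.1 hx)
  · by_cases hxU : x ∈ U
    · by_cases hx0 : 0 < w x
      · have hd := (hin x hxU hx0).differentiableAt (by norm_num)
        have ht : HasFDerivAt (fun x => trunc δ (w x)) (ramp δ (w x) • fderiv ℝ w x) x :=
          (hasDerivAt_trunc δ (w x)).comp_hasFDerivAt x hd.hasFDerivAt
        rw [gradient_mul_of_differentiableAt ht.differentiableAt
          (hη.differentiable (by norm_num) x)]
        congr 1
        simp only [gradient, ht.fderiv, map_smul, smul_smul]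
        rw [mul_comm]
      · have hx1 : w x < δ := (not_lt.1 hx0).trans_lt hδ
        have h1 : x ∉ tsupport (fun x => trunc δ (w x) * η x) := fun h => absurd (hts h).2
          (not_le.2 hx1)
        rw [gradient_congr (notMem_tsupport_iff_eventuallyEq.1 h1)]
        rw [ramp_eq_zero hδ hx1.le, trunc_eq_zero hδ hx1.le]
        simp [gradient]
    · have h1 : x ∉ tsupport (fun x => trunc δ (w x) * η x) := fun h => hxU (hηU (hts h).1)
      have h2 : x ∉ tsupport η := fun h => hxU (hηU h)
      rw [gradient_congr (notMem_tsupport_iff_eventuallyEq.1 h1),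
        gradient_congr (notMem_tsupport_iff_eventuallyEq.1 h2), image_eq_zero_of_notMem_tsupport h2]
      simp [gradient]

@[fun_prop] lemma continuous_gradient (hη : ContDiff ℝ 1 η) : Continuous (∇ η) :=
  (InnerProductSpace.toDual ℝ Plane).symm.continuous.comp (by fun_prop)

lemma hasCompactSupport_gradient (hη : HasCompactSupport η) :
    HasCompactSupport (∇ η) :=
  (hη.fderiv (𝕜 := ℝ)).comp_left (map_zero _)

lemma norm_gradient_le (hw : LipschitzWith K w) (x : Plane) :
    ‖∇ w x‖ ≤ K := by
  rw [norm_gradient]; exact norm_fderiv_le_of_lipschitz ℝ hw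

/-- The energy identity, with an error: it comes from testing with `trunc δ w * η` and letting
`δ → 0`. -/
lemma AlmostHarmonic.energy {U : Set Plane} (hU : IsOpen U) {κ : ℝ} (hκ : 0 ≤ κ)
    (h : AlmostHarmonic U κ w) (hw : LipschitzWith K w) (h0 : ∀ x, 0 ≤ w x)
    (hs : ContDiffOn ℝ 1 w {x | x ∈ U ∧ 0 < w x}) (hη : ContDiff ℝ 1 η)
    (hc : HasCompactSupport η) (hηU : tsupport η ⊆ U) :
    |∫ x, (‖∇ w x‖ ^ 2 * η x + w x * ⟪∇ w x, ∇ η x⟫)|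
      ≤ κ * ∫ x, ‖x‖ ^ (3 / 2 : ℝ) * (‖∇ w x‖ * |η x| + w x * ‖∇ η x‖) := by
  set δ : ℕ → ℝ := fun n => 1 / ((n : ℝ) + 1)
  have hδ0 : ∀ n, 0 < δ n := fun n => by positivity
  have hδl : Tendsto δ atTop (𝓝 0) := tendsto_one_div_add_atTop_nhds_zero_nat
  have hηg := continuous_gradient hη
  have hηgc := hasCompactSupport_gradient hc
  have hgK := norm_gradient_le hw
  set G : Plane → ℝ := fun x => K ^ 2 * |η x| + w x * (K * ‖∇ η x‖)
  have hGi : Integrable G := by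
    have h1 : Integrable fun x => |η x| :=
      (hη.continuous.abs).integrable_of_hasCompactSupport hc.norm
    have h2 : Integrable fun x => w x * (K * ‖∇ η x‖) := by
      refine (hw.continuous.mul (continuous_const.mul hηg.norm)).integrable_of_hasCompactSupport ?_
      exact (hηgc.norm.mul_left).mul_left
    exact (h1.const_mul _).add h2
  have hRi : Integrable fun x =>
      ‖x‖ ^ (3 / 2 : ℝ) * (‖∇ w x‖ * |η x| + w x * ‖∇ η x‖) := by
    have hdom : Integrable fun x : Plane =>
        ‖x‖ ^ (3 / 2 : ℝ) * (K * |η x| + w x * ‖∇ η x‖) := by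
      have hp : Continuous fun x : Plane => ‖x‖ ^ (3 / 2 : ℝ) :=
        continuous_norm.rpow_const fun _ => Or.inr (by norm_num)
      refine (hp.mul ((continuous_const.mul hη.continuous.abs).add
        (hw.continuous.mul hηg.norm))).integrable_of_hasCompactSupport ?_
      exact ((hc.norm.mul_left).add (hηgc.norm.mul_left)).mul_left
    refine hdom.mono' ?_ (.of_forall fun x => ?_)
    · have hp : Measurable fun x : Plane => ‖x‖ ^ (3 / 2 : ℝ) := measurable_norm.pow_const _
      have := hw.continuous.measurable
      have := hη.continuous.measurable
      have := hηg.measurable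
      exact (hp.mul (by fun_prop)).aestronglyMeasurable
    · have h1 : 0 ≤ w x * ‖∇ η x‖ := mul_nonneg (h0 x) (norm_nonneg _)
      have h2 : ‖∇ w x‖ * |η x| ≤ K * |η x| :=
        mul_le_mul_of_nonneg_right (hgK x) (abs_nonneg _)
      rw [norm_of_nonneg (by positivity)]
      gcongr
  set T : ℕ → Plane → ℝ := fun n x =>
    ⟪∇ w x, ∇ (fun x => trunc (δ n) (w x) * η x) x⟫ with hT
  have hTe : ∀ n x, T n x = ramp (δ n) (w x) * η x * ‖∇ w x‖ ^ 2
      + trunc (δ n) (w x) * ⟪∇ w x, ∇ η x⟫ := by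
    intro n x
    simp only [hT, (truncMul_spec hU hw.continuous hs hη hηU (hδ0 n)).2.2 x, inner_add_right,
      inner_smul_right, real_inner_self_eq_norm_sq]
  have hlim : Tendsto (fun n => ∫ x, T n x) atTop (𝓝 (∫ x, (‖∇ w x‖ ^ 2 * η x
      + w x * ⟪∇ w x, ∇ η x⟫))) := by
    refine tendsto_integral_of_dominated_convergence G (fun n => ?_) hGi (fun n => ?_) ?_
    · fun_prop
    · refine .of_forall fun x => ?_
      rw [hTe, norm_eq_abs]
      refine (abs_add_le _ _).trans (add_le_add ?_ ?_)
      · rw [abs_mul, abs_mul, abs_of_nonneg (ramp_nonneg _ _),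
          abs_of_nonneg (sq_nonneg ‖∇ w x‖)]
        have h1 : ‖∇ w x‖ ^ 2 ≤ K ^ 2 := by gcongr; exact hgK x
        have h2 := ramp_le_one (δ n) (w x)
        calc ramp (δ n) (w x) * |η x| * ‖∇ w x‖ ^ 2 ≤ 1 * |η x| * K ^ 2 := by gcongr
          _ = K ^ 2 * |η x| := by ring
      · rw [abs_mul, abs_of_nonneg (trunc_nonneg _ (h0 x))]
        refine mul_le_mul (trunc_le _ (h0 x)) ?_ (abs_nonneg _) (h0 x)
        exact (abs_real_inner_le_norm _ _).trans
          (mul_le_mul_of_nonneg_right (hgK x) (norm_nonneg _))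
    · refine .of_forall fun x => ?_
      simp only [hTe]
      rcases (h0 x).eq_or_lt with hx | hx
      · have h1 := gradient_eq_zero_of_nonneg h0 hx.symm
        simp [h1]
      · have e1 : Tendsto (fun n => ramp (δ n) (w x)) atTop (𝓝 1) := by
          have h2 : ∀ᶠ n in atTop, 2 * δ n < w x :=
            (hδl.const_mul 2).eventually (gt_mem_nhds (by simpa using hx))
          exact tendsto_const_nhds.congr' (h2.mono fun n hn => (ramp_eq_one (hδ0 n) hn.le).symm)
        have e2 : Tendsto (fun n => trunc (δ n) (w x)) atTop (𝓝 (w x)) := by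
          refine tendsto_of_tendsto_of_tendsto_of_le_of_le (g := fun n => w x - 2 * δ n)
            (h := fun _ => w x) ?_ tendsto_const_nhds (fun n => ?_) (fun n => ?_)
          · simpa using tendsto_const_nhds.sub (hδl.const_mul 2)
          · have := sub_trunc_le (hδ0 n) (h0 x)
            simp only; linarith
          · exact trunc_le _ (h0 x)
        have := ((e1.mul_const (η x)).mul_const (‖∇ w x‖ ^ 2)).add
          (e2.mul_const ⟪∇ w x, ∇ η x⟫)
        convert! this using 2
        ring
  refine le_of_tendsto hlim.abs (.of_forall fun n => ?_)
  obtain ⟨p1, p2, p3⟩ := truncMul_spec hU hw.continuous hs hη hηU (hδ0 n)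
  have hcs : HasCompactSupport (fun x => trunc (δ n) (w x) * η x) := hc.mul_left
  refine (h _ p1 hcs ?_).trans (mul_le_mul_of_nonneg_left ?_ hκ)
  · intro x hx
    have := p2 hx
    exact ⟨hηU this.1, (hδ0 n).trans_le this.2⟩
  · have hp : Continuous fun x : Plane => ‖x‖ ^ (3 / 2 : ℝ) :=
      continuous_norm.rpow_const fun _ => Or.inr (by norm_num)
    refine integral_mono ?_ hRi fun x => ?_
    · refine (hp.mul (continuous_gradient p1).norm).integrable_of_hasCompactSupport ?_
      exact (hasCompactSupport_gradient hcs).norm.mul_left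
    · refine mul_le_mul_of_nonneg_left ?_ (by positivity)
      rw [p3 x]
      refine (norm_add_le _ _).trans ?_
      rw [norm_smul, norm_smul, norm_mul, norm_of_nonneg (ramp_nonneg _ _),
        norm_of_nonneg (trunc_nonneg _ (h0 x)), norm_eq_abs]
      have h1 := ramp_le_one (δ n) (w x)
      have h2 := trunc_le (δ n) (h0 x)
      have h3 : ramp (δ n) (w x) * |η x| * ‖∇ w x‖ ≤ 1 * |η x| * ‖∇ w x‖ := by
        gcongr
      have h4 : trunc (δ n) (w x) * ‖∇ η x‖ ≤ w x * ‖∇ η x‖ := by gcongr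
      linarith

/-! ### Bounds for almost solutions -/

namespace AlmostSolution

variable {R κ : ℝ}

lemma mono (h : AlmostSolution R C κ w) {R' : ℝ} (hR' : 0 < R') (hR : R' ≤ R) :
    AlmostSolution R' C κ w := by
  have hb : ball (0 : Plane) R' ⊆ ball 0 R := ball_subset_ball hR
  refine ⟨hR', h.C_nonneg, h.κ_nonneg, h.lip, h.nonneg, fun x hx => h.lower x (hb hx), ?_,
    h.smooth.mono fun x hx => ⟨hb hx.1, hx.2⟩,
    fun φ hφ => h.var φ ⟨hφ.1, hφ.2.1, hφ.2.2.trans hb⟩,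
    fun ψ h1 h2 h3 => h.pde ψ h1 h2 fun x hx => ⟨hb (h3 hx).1, (h3 hx).2⟩,
    fun φ M ρ hρ hφ hρR => h.bv φ M ρ hρ hφ (hρR.trans hR)⟩
  filter_upwards [h.grad] with x hx hxb
  exact hx (hb hxb)

lemma norm_gradient_le_sqrt (h : AlmostSolution R C κ w) {ρ : ℝ} (hρ : ρ ≤ R) :
    ∀ᵐ x, x ∈ ball 0 ρ → ‖∇ w x‖ ≤ √(C * ρ) := by
  filter_upwards [h.grad] with x hx hxb
  refine Real.le_sqrt_of_sq_le ((hx (ball_subset_ball hρ hxb)).trans ?_)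
  refine mul_le_mul_of_nonneg_left (max_le ?_ ?_) h.C_nonneg
  · rw [mem_ball_zero_iff] at hxb
    exact ((le_abs_self _).trans (PiLp.norm_apply_le x 1)).trans hxb.le
  · exact (pos_of_mem_ball hxb).le

lemma abs_sub_le (h : AlmostSolution R C κ w) {ρ : ℝ} (hρ : ρ ≤ R) {y : Plane}
    (hx : x ∈ ball 0 ρ) (hy : y ∈ ball 0 ρ) :
    |w x - w y| ≤ √(C * ρ) * ‖x - y‖ := by
  obtain ⟨K, hK⟩ := h.lip
  refine (memW12Loc_of_lipschitzWith hK (ball 0 ρ)).abs_sub_le isOpen_ball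
    (convex_ball _ _) hK.continuous.continuousOn ?_ hx hy
  exact (ae_restrict_iff' measurableSet_ball).2 (h.norm_gradient_le_sqrt hρ)

lemma apply_zero (h : AlmostSolution R C κ w) : w 0 = 0 :=
  h.lower 0 (mem_ball_self h.R_pos) (by simp)

lemma le_on_ball (h : AlmostSolution R C κ w) {ρ : ℝ} (hρ : ρ ≤ R)
    (hx : x ∈ ball 0 ρ) : w x ≤ √(C * ρ) * ρ := by
  have h1 := h.abs_sub_le hρ hx (mem_ball_self (pos_of_mem_ball hx))
  rw [h.apply_zero, sub_zero, sub_zero, abs_of_nonneg (h.nonneg x)] at h1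
  rw [mem_ball_zero_iff] at hx
  exact h1.trans (mul_le_mul_of_nonneg_left hx.le (sqrt_nonneg _))

lemma continuous (h : AlmostSolution R C κ w) : Continuous w := h.lip.choose_spec.continuous

/-- The energy identity in the disc of radius `4`, where the error is bounded by `κ` times a
number depending only on the cutoff function and on `C`. -/
lemma energy_le (h : AlmostSolution 4 C κ w) (hη : ContDiff ℝ 1 η)
    (hc : HasCompactSupport η) (hηU : tsupport η ⊆ ball 0 4) :
    |∫ x, (‖∇ w x‖ ^ 2 * η x + w x * ⟪∇ w x, ∇ η x⟫)|
      ≤ κ * ∫ x, 8 * √(C * 4) * (|η x| + 4 * ‖∇ η x‖) := by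
  obtain ⟨K, hK⟩ := h.lip
  refine (h.pde.energy isOpen_ball h.κ_nonneg hK h.nonneg h.smooth hη hc hηU).trans
    (mul_le_mul_of_nonneg_left ?_ h.κ_nonneg)
  have hi : Integrable fun x => 8 * √(C * 4) * (|η x| + 4 * ‖∇ η x‖) := by
    refine (((hη.continuous.abs).integrable_of_hasCompactSupport hc.norm).add
      (((continuous_gradient hη).norm.integrable_of_hasCompactSupport
        (hasCompactSupport_gradient hc).norm).const_mul 4)).const_mul _
  refine integral_mono_of_nonneg (.of_forall fun x => ?_) hi ?_
  · have := h.nonneg x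
    positivity
  · filter_upwards [h.norm_gradient_le_sqrt le_rfl] with x hx
    by_cases hxb : x ∈ ball 0 4
    · have h1 : ‖x‖ ^ (3 / 2 : ℝ) ≤ 8 := by
        have h2 : ‖x‖ ≤ 4 := (mem_ball_zero_iff.1 hxb).le
        calc ‖x‖ ^ (3 / 2 : ℝ) ≤ 4 ^ (3 / 2 : ℝ) := by gcongr
          _ = 8 := by
            rw [rpow_three_halves (by norm_num), show (4 : ℝ) = 2 ^ 2 by norm_num,
              Real.sqrt_sq (by norm_num)]; norm_num
      have h3 := h.le_on_ball le_rfl hxb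
      have h4 := hx hxb
      have h5 := h.nonneg x
      calc ‖x‖ ^ (3 / 2 : ℝ) * (‖∇ w x‖ * |η x| + w x * ‖∇ η x‖)
          ≤ 8 * (√(C * 4) * |η x| + √(C * 4) * 4 * ‖∇ η x‖) := by gcongr
        _ = 8 * √(C * 4) * (|η x| + 4 * ‖∇ η x‖) := by ring
    · have h2 : x ∉ tsupport η := fun h => hxb (hηU h)
      have h3 : ∇ η x = 0 := by
        rw [gradient_congr (notMem_tsupport_iff_eventuallyEq.1 h2)]; simp [gradient]
      simp [image_eq_zero_of_notMem_tsupport h2, h3]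

end AlmostSolution

/-! ### Integration by parts against vector fields -/

lemma lipschitzWith_mul_test {v c : Plane → ℝ} (hv : LipschitzWith K v)
    (hc : ContDiff ℝ 1 c) (hcs : HasCompactSupport c) : ∃ K', LipschitzWith K' fun x => v x * c x := by
  obtain ⟨L, hL⟩ := hc.lipschitzWith_of_hasCompactSupport hcs (by norm_num)
  obtain ⟨B, hB⟩ := hcs.exists_bound_of_continuous hc.continuous
  obtain ⟨A, hA⟩ := hcs.isCompact.exists_bound_of_continuousOn hv.continuous.continuousOn
  have hB0 : 0 ≤ B := (norm_nonneg _).trans (hB 0)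
  have key : ∀ x y, x ∈ tsupport c → |v x * c x - v y * c y| ≤ (K * B + |A| * L) * dist x y := by
    intro x y hx
    have e : v x * c x - v y * c y = v x * (c x - c y) + (v x - v y) * c y := by ring
    rw [e]
    have h1 := hL.dist_le_mul x y
    have h2 := hv.dist_le_mul x y
    rw [dist_eq] at h1 h2
    calc |v x * (c x - c y) + (v x - v y) * c y|
        ≤ |v x| * |c x - c y| + |v x - v y| * |c y| := by
          rw [← abs_mul, ← abs_mul]; exact abs_add_le _ _
      _ ≤ |A| * (L * dist x y) + (K * dist x y) * B := by
          have h3 : |v x| ≤ |A| := (hA x hx).trans (le_abs_self _)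
          have h4 : |c y| ≤ B := hB y
          gcongr
      _ = (K * B + |A| * L) * dist x y := by ring
  refine ⟨toNNReal (K * B + |A| * L), LipschitzWith.of_dist_le_mul fun x y => ?_⟩
  rw [coe_toNNReal _ (by positivity), dist_eq]
  by_cases hx : x ∈ tsupport c
  · exact key x y hx
  by_cases hy : y ∈ tsupport c
  · rw [abs_sub_comm, dist_comm]; exact key y x hy
  · rw [image_eq_zero_of_notMem_tsupport hx, image_eq_zero_of_notMem_tsupport hy]
    simp only [mul_zero, sub_zero, abs_zero]
    positivity

@[fun_prop] lemma contDiff_coord {n : ℕ∞ω} (hφ : ContDiff ℝ n φ) (i : Fin 2) :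
    ContDiff ℝ n fun x => φ x i :=
  (proj (𝕜 := ℝ) i).contDiff.comp hφ

lemma fderiv_coord (hφ : DifferentiableAt ℝ φ x) (i : Fin 2)
    (v : Plane) : fderiv ℝ (fun x => φ x i) x v = fderiv ℝ φ x v i := by
  have : HasFDerivAt (fun x => φ x i) ((proj (𝕜 := ℝ) i).comp (fderiv ℝ φ x)) x :=
    (proj (𝕜 := ℝ) i).hasFDerivAt.comp x hφ.hasFDerivAt
  rw [this.fderiv]; rfl

lemma hasCompactSupport_coord (hφ : HasCompactSupport φ) (i : Fin 2) :
    HasCompactSupport fun x => φ x i :=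
  hφ.comp_left (g := fun v : Plane => v i) (by simp)

/-- A measurable function with a continuous bound, times a continuous function with compact support,
is integrable. -/
lemma integrable_mul_test {f g G : Plane → ℝ} (hf : Measurable f) (hG : Continuous G)
    (hb : ∀ x, |f x| ≤ G x) (hg : Continuous g) (hgs : HasCompactSupport g) :
    Integrable fun x => f x * g x := by
  have h1 : Integrable fun x => G x * ‖g x‖ :=
    (hG.mul hg.norm).integrable_of_hasCompactSupport hgs.norm.mul_left
  refine h1.mono' (hf.mul hg.measurable).aestronglyMeasurable (.of_forall fun x => ?_)
  rw [norm_mul]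
  exact mul_le_mul_of_nonneg_right (hb x) (norm_nonneg _)

lemma abs_fderiv_apply_le (hw : LipschitzWith K w) (x v : Plane) :
    |fderiv ℝ w x v| ≤ K * ‖v‖ :=
  ((fderiv ℝ w x).le_opNorm v).trans
    (mul_le_mul_of_nonneg_right (norm_fderiv_le_of_lipschitz ℝ hw) (norm_nonneg _))

lemma integral_inner_gradient (hw : LipschitzWith K w)
    (hφ : ContDiff ℝ 1 φ) (hc : HasCompactSupport φ) :
    ∫ x, ⟪∇ w x, φ x⟫ = - ∫ x, w x * divergence φ x := by
  have h1 : ∀ i : Fin 2, ∫ x, fderiv ℝ w x (single i 1) * φ x i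
      = - ∫ x, w x * fderiv ℝ φ x (single i 1) i := by
    intro i
    obtain ⟨L, hL⟩ := (contDiff_coord hφ i).lipschitzWith_of_hasCompactSupport
      (hasCompactSupport_coord hc i) (by norm_num)
    rw [integral_fderiv_mul hw hL (hasCompactSupport_coord hc i)]
    simp only [fderiv_coord (hφ.differentiable (by norm_num) _)]
  have i1 : ∀ i : Fin 2, Integrable fun x => fderiv ℝ w x (single i 1) * φ x i :=
    fun i => integrable_mul_test (by fun_prop) continuous_const
      (fun x => abs_fderiv_apply_le hw x _) (contDiff_coord hφ i).continuous
      (hasCompactSupport_coord hc i)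
  have i2 : ∀ i : Fin 2, Integrable fun x => w x * fderiv ℝ φ x (single i 1) i := by
    intro i
    have hcont : Continuous fun x => fderiv ℝ φ x (single i 1) i := by fun_prop
    refine (hw.continuous.mul hcont).integrable_of_hasCompactSupport ?_
    exact (hasCompactSupport_coord (hc.fderiv_apply (𝕜 := ℝ) _) i).mul_left
  simp only [inner_plane, gradient_apply, divergence, Fin.sum_univ_two, mul_add]
  rw [integral_add (i1 0) (i1 1), integral_add (i2 0) (i2 1), h1, h1]; ring

lemma integral_inner_gradient_sq (hw : LipschitzWith K w)
    (hφ : ContDiff ℝ 1 φ) (hc : HasCompactSupport φ) :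
    ∫ x, 2 * w x * ⟪∇ w x, φ x⟫ = - ∫ x, w x ^ 2 * divergence φ x := by
  have h1 : ∀ i : Fin 2, ∫ x, 2 * w x * (fderiv ℝ w x (single i 1) * φ x i)
      = - ∫ x, w x ^ 2 * fderiv ℝ φ x (single i 1) i := by
    intro i
    have hci := contDiff_coord hφ i
    have hcc := hasCompactSupport_coord hc i
    obtain ⟨L, hL⟩ := lipschitzWith_mul_test hw hci hcc
    have h2 := integral_fderiv_mul hw hL hcc.mul_left (single i 1)
    have hcont : Continuous fun x => fderiv ℝ φ x (single i 1) i := by fun_prop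
    have h3 : ∫ x, w x * fderiv ℝ (fun x => w x * φ x i) x (single i 1)
        = ∫ x, (w x ^ 2 * fderiv ℝ φ x (single i 1) i
          + fderiv ℝ w x (single i 1) * (w x * φ x i)) := by
      refine integral_congr_ae ?_
      filter_upwards [hw.ae_differentiableAt (μ := volume)] with x hx
      have h4 : HasFDerivAt (fun x => w x * φ x i) _ x :=
        hx.hasFDerivAt.mul (hci.differentiable (by norm_num) x).hasFDerivAt
      rw [h4.fderiv]
      simp only [_root_.add_apply, _root_.smul_apply, smul_eq_mul,
        fderiv_coord (hφ.differentiable (by norm_num) x)]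
      ring
    have i1 : Integrable fun x =>
        fderiv ℝ w x (single i 1) * (w x * φ x i) :=
      integrable_mul_test (by fun_prop) continuous_const
        (fun x => abs_fderiv_apply_le hw x _) (hw.continuous.mul hci.continuous) hcc.mul_left
    have i2 : Integrable fun x => w x ^ 2 * fderiv ℝ φ x (single i 1) i := by
      refine ((hw.continuous.pow 2).mul hcont).integrable_of_hasCompactSupport ?_
      exact (hasCompactSupport_coord (hc.fderiv_apply (𝕜 := ℝ) _) i).mul_left
    rw [h3, integral_add i2 i1] at h2
    have h5 : ∫ x, 2 * w x * (fderiv ℝ w x (single i 1) * φ x i)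
        = 2 * ∫ x, fderiv ℝ w x (single i 1) * (w x * φ x i) := by
      rw [← integral_const_mul]; congr 1; ext x; ring
    rw [h5]; linarith
  have i1 : ∀ i : Fin 2, Integrable fun x =>
      2 * w x * (fderiv ℝ w x (single i 1) * φ x i) := by
    intro i
    have := integrable_mul_test (measurable_fderiv_apply_const ℝ w (single i 1))
      continuous_const
      (fun x => abs_fderiv_apply_le hw x _)
      ((continuous_const (y := (2 : ℝ))).mul (hw.continuous.mul (contDiff_coord hφ i).continuous))
      ((hasCompactSupport_coord hc i).mul_left (f := w)).mul_left
    refine this.congr (.of_forall fun x => ?_)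
    simp only [Pi.mul_apply]
    ring
  have i2 : ∀ i : Fin 2, Integrable fun x => w x ^ 2 * fderiv ℝ φ x (single i 1) i := by
    intro i
    have hcont : Continuous fun x => fderiv ℝ φ x (single i 1) i := by fun_prop
    refine ((hw.continuous.pow 2).mul hcont).integrable_of_hasCompactSupport ?_
    exact (hasCompactSupport_coord (hc.fderiv_apply (𝕜 := ℝ) _) i).mul_left
  simp only [inner_plane, gradient_apply, divergence, Fin.sum_univ_two, mul_add]
  rw [integral_add (i1 0) (i1 1), integral_add (i2 0) (i2 1), h1, h1]; ring

/-! ### A radial cutoff -/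

lemma hasDerivAt_max_pow (n : ℕ) (s : ℝ) :
    HasDerivAt (fun s : ℝ => max s 0 ^ (n + 2)) ((n + 2) * max s 0 ^ (n + 1)) s := by
  rcases lt_trichotomy s 0 with hs | rfl | hs
  · have h1 : (fun s : ℝ => max s 0 ^ (n + 2)) =ᶠ[𝓝 s] fun _ => 0 := by
      filter_upwards [gt_mem_nhds hs] with t ht
      simp [max_eq_right (le_of_lt ht)]
    rw [max_eq_right hs.le]
    simpa using (hasDerivAt_const s 0).congr_of_eventuallyEq h1
  · simp only [max_self, ne_eq, Nat.add_eq_zero_iff, one_ne_zero, and_false, not_false_eq_true,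
      zero_pow, mul_zero]
    rw [hasDerivAt_iff_isLittleO_nhds_zero]
    have h2 : (fun h : ℝ => max h 0 ^ (n + 2)) =o[𝓝 0] fun h => h := by
      refine Asymptotics.IsBigO.trans_isLittleO (g := fun h : ℝ => h ^ (n + 2)) ?_ ?_
      · refine Asymptotics.IsBigO.of_bound 1 (.of_forall fun h => ?_)
        rw [norm_pow, norm_pow, one_mul]
        refine pow_le_pow_left₀ (norm_nonneg _) ?_ _
        rw [norm_of_nonneg (le_max_right _ _)]
        exact max_le (le_abs_self h) (abs_nonneg h)
      · simpa using Asymptotics.isLittleO_pow_id (by omega)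
    simpa using h2
  · have h1 : (fun s : ℝ => max s 0 ^ (n + 2)) =ᶠ[𝓝 s] fun s => s ^ (n + 2) := by
      filter_upwards [lt_mem_nhds hs] with t ht
      simp [max_eq_left (le_of_lt ht)]
    rw [max_eq_left hs.le]
    have := (hasDerivAt_pow (n + 2) s).congr_of_eventuallyEq h1
    convert! this using 1
    push_cast; rfl

/-- The radial cutoff `(1 - |x|²)₊`, whose powers localize to the unit disc. -/
noncomputable def cut (x : Plane) : ℝ := max (1 - ‖x‖ ^ 2) 0

@[fun_prop] lemma continuous_cut : Continuous cut := by unfold cut; fun_prop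

lemma cut_nonneg (x : Plane) : 0 ≤ cut x := le_max_right _ _

lemma cut_le_one (x : Plane) : cut x ≤ 1 := max_le (by simp) zero_le_one

lemma cut_eq_zero (hx : 1 ≤ ‖x‖) : cut x = 0 := max_eq_right (by nlinarith)

lemma cut_pos (hx : ‖x‖ < 1) : 0 < cut x :=
  lt_max_of_lt_left (by nlinarith [norm_nonneg x])

lemma tsupport_cut_pow (n : ℕ) :
    tsupport (fun x => cut x ^ (n + 1)) ⊆ closedBall 0 1 := by
  refine closure_minimal (fun x hx => ?_) isClosed_closedBall
  rw [mem_closedBall_zero_iff]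
  by_contra h
  exact hx (by simp [cut_eq_zero (not_le.1 h).le])

lemma hasCompactSupport_cut_pow (n : ℕ) : HasCompactSupport fun x => cut x ^ (n + 1) :=
  HasCompactSupport.of_support_subset_isCompact (isCompact_closedBall 0 1)
    ((subset_tsupport _).trans (tsupport_cut_pow n))

lemma hasFDerivAt_cut_pow (n : ℕ) (x : Plane) : HasFDerivAt (fun x => cut x ^ (n + 2))
    ((-(2 * (n + 2) * cut x ^ (n + 1))) • innerSL ℝ x) x := by
  have h1 : HasFDerivAt (fun x => 1 - ‖x‖ ^ 2) (-((2 : ℝ) • innerSL ℝ x)) x := by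
    have := ((hasStrictFDerivAt_norm_sq x).hasFDerivAt).const_sub (1 : ℝ)
    convert! this using 1
    ext v; simp
  have h2 := (hasDerivAt_max_pow n (1 - ‖x‖ ^ 2)).comp_hasFDerivAt x h1
  convert! h2 using 1
  ext v; simp [cut]; ring

lemma contDiff_cut_pow (n : ℕ) : ContDiff ℝ 1 fun x => cut x ^ (n + 2) := by
  rw [contDiff_one_iff_fderiv]
  refine ⟨fun x => (hasFDerivAt_cut_pow n x).differentiableAt, ?_⟩
  rw [show fderiv ℝ (fun x => cut x ^ (n + 2)) = fun x =>
    (-(2 * (n + 2) * cut x ^ (n + 1))) • innerSL ℝ x from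
    funext fun x => (hasFDerivAt_cut_pow n x).fderiv]
  have := continuous_cut
  fun_prop

lemma gradient_cut_pow (n : ℕ) (x : Plane) : ∇ (fun x => cut x ^ (n + 2)) x
    = (-(2 * (n + 2) * cut x ^ (n + 1))) • x := by
  have h : ∇ (fun x => cut x ^ (n + 2)) x = (InnerProductSpace.toDual ℝ Plane).symm
      ((-(2 * (n + 2) * cut x ^ (n + 1))) • (InnerProductSpace.toDual ℝ Plane x)) := by
    rw [gradient, (hasFDerivAt_cut_pow n x).fderiv]; rfl
  rw [h, map_smul, LinearIsometryEquiv.symm_apply_apply]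

/-- Derivative and divergence of a radial vector field `c(x) x`. -/
lemma fderiv_smul_id {c : Plane → ℝ} (hc : DifferentiableAt ℝ c x) (v : Plane) :
    fderiv ℝ (fun x => c x • x) x v = c x • v + (fderiv ℝ c x v) • x := by
  have h : HasFDerivAt (fun x => c x • x) _ x := hc.hasFDerivAt.smul (hasFDerivAt_id x)
  rw [h.fderiv]; simp

lemma divergence_smul {c : Plane → ℝ} (hc : DifferentiableAt ℝ c x)
    (hφ : DifferentiableAt ℝ φ x) :
    divergence (fun x => c x • φ x) x = c x * divergence φ x + fderiv ℝ c x (φ x) := by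
  have h : HasFDerivAt (fun x => c x • φ x) _ x := hc.hasFDerivAt.smul hφ.hasFDerivAt
  have h2 : fderiv ℝ c x (φ x) = φ x 0 * fderiv ℝ c x (single 0 1)
      + φ x 1 * fderiv ℝ c x (single 1 1) := by
    conv_lhs => rw [eq_sum_single (φ x)]
    simp
  rw [h2]
  simp only [divergence, h.fderiv, Fin.sum_univ_two]
  simp
  ring

lemma divergence_smul_id {c : Plane → ℝ} (hc : DifferentiableAt ℝ c x) :
    divergence (fun x => c x • x) x = 2 * c x + fderiv ℝ c x x := by
  rw [divergence_smul hc differentiableAt_fun_id]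
  simp [divergence, mul_comm]

/-! ### Almost monotonicity of the Weiss energy -/

@[fun_prop] lemma measurable_chi (hw : Continuous w) : Measurable (chi w) :=
  measurable_const.indicator (isOpen_lt continuous_const hw).measurableSet

lemma chi_nonneg (w : Plane → ℝ) (x : Plane) : 0 ≤ chi w x :=
  indicator_nonneg (fun _ _ => zero_le_one) x

lemma chi_le_one (w : Plane → ℝ) (x : Plane) : chi w x ≤ 1 :=
  indicator_le_self' (fun _ _ => zero_le_one) x

/-- The density of the incompressible energy. -/
noncomputable def energyDensity (w : Plane → ℝ) (x : Plane) : ℝ :=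
  ‖∇ w x‖ ^ 2 + x 1 * chi w x

@[fun_prop] lemma measurable_coord (i : Fin 2) : Measurable fun x : Plane => x i :=
  (proj (𝕜 := ℝ) i).continuous.measurable

@[fun_prop] lemma continuous_coord (i : Fin 2) : Continuous fun x : Plane => x i :=
  (proj (𝕜 := ℝ) i).continuous

@[fun_prop] lemma continuous_divergence (hφ : ContDiff ℝ 1 φ) : Continuous (divergence φ) := by
  unfold divergence
  fun_prop

@[fun_prop] lemma measurable_fderiv_apply {g : Plane → Plane} (hg : Measurable g) :
    Measurable fun x => fderiv ℝ φ x (g x) :=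
  ContinuousLinearMap.measurable_apply₂.comp ((measurable_fderiv ℝ φ).prodMk hg)

@[fun_prop] lemma measurable_fderiv_apply_real {g : Plane → Plane} (hg : Measurable g) :
    Measurable fun x => fderiv ℝ w x (g x) :=
  ContinuousLinearMap.measurable_apply₂.comp ((measurable_fderiv ℝ w).prodMk hg)

@[fun_prop] lemma measurable_energyDensity (hw : Continuous w) :
    Measurable (energyDensity w) :=
  ((measurable_gradient w).norm.pow_const 2).add (by fun_prop)

lemma abs_coord_mul_chi_le (w : Plane → ℝ) (x : Plane) : |x 1 * chi w x| ≤ |x 1| := by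
  rw [abs_mul, abs_of_nonneg (chi_nonneg w x)]
  exact mul_le_of_le_one_right (abs_nonneg _) (chi_le_one w x)

lemma abs_energyDensity_le (hw : LipschitzWith K w) (x : Plane) :
    |energyDensity w x| ≤ K ^ 2 + |x 1| := by
  refine (abs_add_le _ _).trans (add_le_add ?_ (abs_coord_mul_chi_le w x))
  rw [abs_of_nonneg (sq_nonneg ‖∇ w x‖)]
  have := norm_gradient_le hw x
  gcongr

/-- The Weiss energy at scale one, localized with the cutoff `cut`. -/
noncomputable def weissEnergy (w : Plane → ℝ) : ℝ :=
  (∫ x, energyDensity w x * cut x ^ 3) - 9 * ∫ x, w x ^ 2 * cut x ^ 2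

/-- The defect of homogeneity of degree `3/2` at scale one. -/
noncomputable def homogeneityDefect (w : Plane → ℝ) : ℝ :=
  ∫ x, (⟪∇ w x, x⟫ - 3 / 2 * w x) ^ 2 * cut x ^ 2

/-- Differentiation of an integral along dilations. -/
lemma hasDerivAt_integral_dilation {f G k : Plane → ℝ} {F : ℝ → Plane → ℝ} {p : ℝ}
    (hf : Measurable f) (hG : Continuous G) (hb : ∀ x, |f x| ≤ G x) (hk : ContDiff ℝ 1 k)
    (hkc : HasCompactSupport k) (hF : ∀ r x, 0 < r → f (r • x) = r ^ (p - 2) * F r x)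
    (hr : 0 < r) :
    HasDerivAt (fun r => ∫ x, F r x * k x)
      (r⁻¹ * (- p * (∫ x, F r x * k x) - ∫ x, F r x * fderiv ℝ k x x)) r := by
  have hconv : ∀ (g : Plane → ℝ) {s : ℝ}, 0 < s →
      ∫ x, F s x * g x = s ^ (-p) * ∫ y, f y * g (s⁻¹ • y) := by
    intro g s hs
    rw [integral_comp_smul_plane (fun y => f y * g (s⁻¹ • y)) hs]
    have h1 : ∀ x, f (s • x) * g (s⁻¹ • s • x) = s ^ (p - 2) * (F s x * g x) := by
      intro x
      rw [hF s x hs, smul_smul, inv_mul_cancel₀ hs.ne', one_smul]; ring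
    simp only [h1, integral_const_mul]
    have h2 : s ^ (-p) * (s ^ 2 * s ^ (p - 2)) = 1 := by
      rw [← Real.rpow_natCast, ← rpow_add hs, ← rpow_add hs]
      norm_num
    linear_combination -(∫ x, F s x * g x) * h2
  obtain ⟨ρ, hρ⟩ := hkc.isCompact.isBounded.subset_closedBall 0
  have hkd : Continuous (fderiv ℝ k) := by fun_prop
  have hDc : Continuous fun z => fderiv ℝ k z z := hkd.clm_apply continuous_id
  have hDs : HasCompactSupport fun z => fderiv ℝ k z z :=
    (hkc.fderiv (𝕜 := ℝ)).mono fun x hx => by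
      intro h; exact hx (by simp [h])
  obtain ⟨B, hB⟩ := hDs.exists_bound_of_continuous hDc
  have hmain : HasDerivAt (fun r => ∫ y, f y * k (r⁻¹ • y))
      (∫ y, f y * (- r⁻¹ * fderiv ℝ k (r⁻¹ • y) (r⁻¹ • y))) r := by
    refine (hasDerivAt_integral_of_dominated_loc_of_deriv_le (s := Ioo (r / 2) (2 * r))
      (F' := fun r y => f y * (- r⁻¹ * fderiv ℝ k (r⁻¹ • y) (r⁻¹ • y)))
      (bound := (closedBall 0 (2 * r * |ρ|)).indicator
        fun y => G y * (2 / r * B))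
      (Ioo_mem_nhds (by linarith) (by linarith)) ?_ ?_ ?_ ?_ ?_ ?_).2
    · exact .of_forall fun s =>
        (hf.mul (hk.continuous.comp (continuous_const_smul _)).measurable).aestronglyMeasurable
    · exact integrable_mul_test hf hG hb (by fun_prop)
        (hkc.comp_smul (inv_ne_zero hr.ne'))
    · exact (hf.mul ((continuous_const.mul
        (hDc.comp (continuous_const_smul _))).measurable)).aestronglyMeasurable
    · refine .of_forall fun y s hs => ?_
      have hs0 : 0 < s := by linarith [hs.1]
      by_cases hy : y ∈ closedBall 0 (2 * r * |ρ|)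
      · rw [indicator_of_mem hy, norm_mul, norm_mul, norm_neg, norm_inv, norm_of_nonneg hs0.le]
        have h1 : s⁻¹ ≤ 2 / r := by
          rw [inv_le_comm₀ hs0 (by positivity), inv_div]; linarith [hs.1]
        have h2 := hB (s⁻¹ • y)
        have h3 := hb y
        have h4 : 0 ≤ G y := (abs_nonneg _).trans h3
        rw [norm_eq_abs]
        gcongr
      · rw [indicator_of_notMem hy]
        have h1 : s⁻¹ • y ∉ tsupport (fderiv ℝ k) := by
          intro h
          have h2 := hρ (tsupport_fderiv_subset ℝ h)
          apply hy
          rw [mem_closedBall_zero_iff] at h2 ⊢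
          rw [norm_smul, norm_inv, norm_of_nonneg hs0.le, inv_mul_le_iff₀ hs0] at h2
          calc ‖y‖ ≤ s * ρ := h2
            _ ≤ s * |ρ| := mul_le_mul_of_nonneg_left (le_abs_self _) hs0.le
            _ ≤ 2 * r * |ρ| := mul_le_mul_of_nonneg_right hs.2.le (abs_nonneg _)
        rw [image_eq_zero_of_notMem_tsupport h1]
        simp
    · exact (integrable_indicator_iff measurableSet_closedBall).2
        ((hG.mul continuous_const).continuousOn.integrableOn_compact (isCompact_closedBall _ _))
    · refine .of_forall fun y s hs => ?_
      have hs0 : 0 < s := by linarith [hs.1]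
      have h1 : HasDerivAt (fun s : ℝ => s⁻¹ • y) ((-(s ^ 2)⁻¹) • y) s :=
        (hasDerivAt_inv hs0.ne').smul_const y
      have h2 : HasDerivAt (fun s : ℝ => k (s⁻¹ • y)) (fderiv ℝ k (s⁻¹ • y) ((-(s ^ 2)⁻¹) • y)) s :=
        ((hk.differentiable (by norm_num) (s⁻¹ • y)).hasFDerivAt).comp_hasDerivAt s h1
      refine (h2.const_mul (f y)).congr_deriv ?_
      simp only [map_smul, smul_eq_mul]
      field_simp
  have hpow : HasDerivAt (fun r : ℝ => r ^ (-p)) (-p * r ^ (-p - 1)) r :=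
    Real.hasDerivAt_rpow_const (Or.inl hr.ne')
  have h2 := hpow.mul hmain
  have h3 : (fun r => ∫ x, F r x * k x) =ᶠ[𝓝 r]
      ((fun r : ℝ => r ^ (-p)) * fun r => ∫ y, f y * k (r⁻¹ • y)) := by
    filter_upwards [lt_mem_nhds hr] with s hs
    exact hconv k hs
  refine (h2.congr_of_eventuallyEq h3).congr_deriv ?_
  have h4 := hconv (fun x => fderiv ℝ k x x) hr
  rw [hconv k hr, h4]
  have h5 : ∫ y, f y * (- r⁻¹ * fderiv ℝ k (r⁻¹ • y) (r⁻¹ • y))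
      = - r⁻¹ * ∫ y, f y * fderiv ℝ k (r⁻¹ • y) (r⁻¹ • y) := by
    rw [← integral_const_mul]; congr 1; ext y; ring
  rw [h5, Real.rpow_sub_one hr.ne']
  ring

lemma isTestField_cut : IsTestField (ball 0 4) fun x => cut x ^ 3 • x := by
  refine ⟨(contDiff_cut_pow 1).smul contDiff_id, (hasCompactSupport_cut_pow 2).smul_right, ?_⟩
  refine (closure_mono (Function.support_smul_subset_left (fun x => cut x ^ 3) fun x => x)).trans ?_
  exact (tsupport_cut_pow 2).trans (closedBall_subset_ball (by norm_num))

/-- The error constant in the almost monotonicity formula. -/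
noncomputable def monotonicityConst (C : ℝ) : ℝ :=
  (∫ x : Plane, (‖x‖ ^ 2 * ‖fderiv ℝ (fun x => cut x ^ 3 • x) x‖ + ‖x‖ * ‖cut x ^ 3 • x‖))
    + 3 * (8 * √(C * 4) * ∫ x, (|cut x ^ 3| + 4 * ‖∇ (fun x => cut x ^ 3) x‖))

namespace AlmostSolution

variable {κ : ℝ}

/-- The derivative of the Weiss energy along dilations is, up to an error, twelve times the
homogeneity defect: combine the domain variation in direction `cut³ x`, the energy identity with
`η = cut³`, and the divergence theorem for `w² cut² x`. -/
lemma abs_dilation_identity_le (h : AlmostSolution 4 C κ w) :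
    |(-3 * (∫ x, energyDensity w x * cut x ^ 3)
        - ∫ x, energyDensity w x * fderiv ℝ (fun x => cut x ^ 3) x x)
      - 9 * (-5 * (∫ x, w x ^ 2 * cut x ^ 2) - ∫ x, w x ^ 2 * fderiv ℝ (fun x => cut x ^ 2) x x)
      - 12 * homogeneityDefect w| ≤ κ * monotonicityConst C := by
  obtain ⟨K, hK⟩ := h.lip
  have hwc := hK.continuous
  have hgm := measurable_gradient w
  have hip : Measurable fun x => ⟪∇ w x, x⟫ := hgm.inner measurable_id
  have hipb : ∀ x, |⟪∇ w x, x⟫| ≤ K * ‖x‖ := fun x =>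
    (abs_real_inner_le_norm _ _).trans
      (mul_le_mul_of_nonneg_right (norm_gradient_le hK x) (norm_nonneg _))
  have hd3 : ∀ x, fderiv ℝ (fun x => cut x ^ 3) x x = -(6 * (cut x ^ 2 * ‖x‖ ^ 2)) := by
    intro x
    rw [(hasFDerivAt_cut_pow 1 x).fderiv]
    simp; ring
  have hd2 : ∀ x, fderiv ℝ (fun x => cut x ^ 2) x x = -(4 * (cut x * ‖x‖ ^ 2)) := by
    intro x
    rw [(hasFDerivAt_cut_pow 0 x).fderiv]
    simp; ring
  have hn2 : Continuous fun x : Plane => ‖x‖ ^ 2 := by fun_prop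
  have hc3 := (contDiff_cut_pow 1).continuous
  have hc2 := (contDiff_cut_pow 0).continuous
  have hc1 := continuous_cut
  have hs3 : HasCompactSupport fun x => cut x ^ 3 := hasCompactSupport_cut_pow 2
  have hs2 : HasCompactSupport fun x => cut x ^ 2 := hasCompactSupport_cut_pow 1
  have hs1 : HasCompactSupport fun x => cut x := by simpa using hasCompactSupport_cut_pow 0
  have hcoord := continuous_coord 1
  -- the six integrals that occur
  have i1 : Integrable fun x => energyDensity w x * (cut x ^ 2 * ‖x‖ ^ 2) :=
    integrable_mul_test (by fun_prop)
      (by fun_prop : Continuous fun x => (K : ℝ) ^ 2 + |x 1|)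
      (abs_energyDensity_le hK) (hc2.mul hn2) hs2.mul_right
  have i2 : Integrable fun x => ⟪∇ w x, x⟫ ^ 2 * cut x ^ 2 :=
    integrable_mul_test (hip.pow_const 2)
      (by fun_prop : Continuous fun x => (K * ‖x‖) ^ 2)
      (fun x => by rw [abs_pow]; gcongr; exact hipb x) hc2 hs2
  have i3 : Integrable fun x => (x 1 * chi w x) * cut x ^ 3 :=
    integrable_mul_test (by fun_prop) hcoord.abs
      (abs_coord_mul_chi_le w) hc3 hs3
  have i4 : Integrable fun x => ‖∇ w x‖ ^ 2 * cut x ^ 3 :=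
    integrable_mul_test (by fun_prop) (continuous_const (y := (K : ℝ) ^ 2))
      (fun x => by rw [abs_pow, abs_norm]; gcongr; exact norm_gradient_le hK x) hc3 hs3
  have i5 : Integrable fun x => ⟪∇ w x, x⟫ * (w x * cut x ^ 2) :=
    integrable_mul_test hip (by fun_prop : Continuous fun x => K * ‖x‖) hipb
      (hwc.mul hc2) hs2.mul_left
  have i6 : Integrable fun x => w x ^ 2 * (cut x * ‖x‖ ^ 2) :=
    ((hwc.pow 2).mul (hc1.mul hn2)).integrable_of_hasCompactSupport hs1.mul_right.mul_left
  have i7 : Integrable fun x => w x ^ 2 * cut x ^ 2 :=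
    ((hwc.pow 2).mul hc2).integrable_of_hasCompactSupport hs2.mul_left
  -- the domain variation
  have v1 := h.var _ isTestField_cut
  have e1 : ∀ x, varIntegrand w (fun x => cut x ^ 3 • x) x
      = -6 * (energyDensity w x * (cut x ^ 2 * ‖x‖ ^ 2))
        + 12 * (⟪∇ w x, x⟫ ^ 2 * cut x ^ 2)
        + 3 * ((x 1 * chi w x) * cut x ^ 3) := by
    intro x
    have hd := (contDiff_cut_pow 1).differentiable (by norm_num) x
    simp only [varIntegrand, energyDensity]
    rw [divergence_smul_id hd, fderiv_smul_id hd]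
    simp only [inner_add_right, inner_smul_right, real_inner_self_eq_norm_sq]
    rw [hd3 x, show fderiv ℝ (fun x => cut x ^ (1 + 2)) x (∇ w x)
        = -(6 * cut x ^ 2 * ⟪∇ w x, x⟫) by
      rw [(hasFDerivAt_cut_pow 1 x).fderiv]
      rw [real_inner_comm]
      simp only [_root_.smul_apply, innerSL_apply_apply, smul_eq_mul]
      push_cast; ring]
    simp only [PiLp.smul_apply, smul_eq_mul]
    ring
  simp only [e1] at v1
  have i12 : Integrable fun x => -6 * (energyDensity w x * (cut x ^ 2 * ‖x‖ ^ 2))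
      + 12 * (⟪∇ w x, x⟫ ^ 2 * cut x ^ 2) := by fun_prop
  rw [integral_add i12 (i3.const_mul _), integral_add (i1.const_mul _) (i2.const_mul _)] at v1
  simp only [integral_const_mul] at v1
  -- the energy identity
  have v2 := h.energy_le (contDiff_cut_pow 1) hs3
    ((tsupport_cut_pow 2).trans (closedBall_subset_ball (by norm_num)))
  have e2 : ∀ x, ‖∇ w x‖ ^ 2 * cut x ^ (1 + 2)
      + w x * ⟪∇ w x, ∇ (fun x => cut x ^ (1 + 2)) x⟫
      = ‖∇ w x‖ ^ 2 * cut x ^ 3 + -6 * (⟪∇ w x, x⟫ * (w x * cut x ^ 2)) := by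
    intro x
    rw [gradient_cut_pow, inner_smul_right]
    push_cast; ring
  simp only [e2] at v2
  rw [integral_add i4 (i5.const_mul _)] at v2
  simp only [integral_const_mul] at v2
  -- the divergence theorem
  have v3 := integral_inner_gradient_sq hK (φ := fun x => cut x ^ 2 • x)
    ((contDiff_cut_pow 0).smul contDiff_id) hs2.smul_right
  have e3 : ∀ x, 2 * w x * ⟪∇ w x, cut x ^ 2 • x⟫
      = 2 * (⟪∇ w x, x⟫ * (w x * cut x ^ 2)) := by
    intro x; rw [inner_smul_right]; ring
  have e4 : ∀ x, w x ^ 2 * divergence (fun x => cut x ^ 2 • x) x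
      = 2 * (w x ^ 2 * cut x ^ 2) + -4 * (w x ^ 2 * (cut x * ‖x‖ ^ 2)) := by
    intro x
    rw [divergence_smul_id ((contDiff_cut_pow 0).differentiable (by norm_num) x), hd2]; ring
  simp only [e3, e4] at v3
  rw [integral_add (i7.const_mul _) (i6.const_mul _)] at v3
  simp only [integral_const_mul] at v3
  -- the terms of the claim
  have e5 : ∫ x, energyDensity w x * cut x ^ 3
      = (∫ x, ‖∇ w x‖ ^ 2 * cut x ^ 3) + ∫ x, (x 1 * chi w x) * cut x ^ 3 := by
    rw [← integral_add i4 i3]; congr 1; ext x; simp only [energyDensity]; ring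
  have e6 : homogeneityDefect w = (∫ x, ⟪∇ w x, x⟫ ^ 2 * cut x ^ 2)
      - 3 * (∫ x, ⟪∇ w x, x⟫ * (w x * cut x ^ 2))
      + 9 / 4 * ∫ x, w x ^ 2 * cut x ^ 2 := by
    have i25 : Integrable fun x => ⟪∇ w x, x⟫ ^ 2 * cut x ^ 2
        - 3 * (⟪∇ w x, x⟫ * (w x * cut x ^ 2)) := i2.sub (i5.const_mul _)
    rw [← integral_const_mul, ← integral_const_mul, ← integral_sub i2 (i5.const_mul _),
      ← integral_add i25 (i7.const_mul _)]
    unfold homogeneityDefect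
    congr 1; ext x; ring
  have e7 : ∫ x, energyDensity w x * fderiv ℝ (fun x => cut x ^ 3) x x
      = -6 * ∫ x, energyDensity w x * (cut x ^ 2 * ‖x‖ ^ 2) := by
    rw [← integral_const_mul]; congr 1; ext x; rw [hd3]; ring
  have e8 : ∫ x, w x ^ 2 * fderiv ℝ (fun x => cut x ^ 2) x x
      = -4 * ∫ x, w x ^ 2 * (cut x * ‖x‖ ^ 2) := by
    rw [← integral_const_mul]; congr 1; ext x; rw [hd2]; ring
  rw [e5, e6, e7, e8, monotonicityConst, mul_add]
  simp only [show (1 + 2 : ℕ) = 3 from rfl] at v2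
  rw [abs_le] at *
  constructor <;> linarith [v1.1, v1.2, v2.1, v2.2]

/-- Blow-ups at scales `r ≤ 1` are again almost solutions in the disc of radius four. -/
lemma blowUp_four (h : AlmostSolution 4 C κ w) (hr : 0 < r) (hr1 : r ≤ 1) :
    AlmostSolution 4 C (κ * r) (blowUp w 0 r) :=
  (h.rescale hr).mono (by norm_num) (by rw [le_div_iff₀ hr]; linarith)

lemma energyDensity_smul (w : Plane → ℝ) (hr : 0 < r) (x : Plane) :
    energyDensity w (r • x) = r * energyDensity (blowUp w 0 r) x := by
  simp only [energyDensity, gradient_blowUp, chi_blowUp hr, norm_smul, mul_pow, norm_eq_abs,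
    sq_abs, sq_div_rpow hr, PiLp.smul_apply, smul_eq_mul]
  field_simp

lemma apply_smul (w : Plane → ℝ) (hr : 0 < r) (x : Plane) :
    w (r • x) = r ^ (3 / 2 : ℝ) * blowUp w 0 r x := by
  rw [blowUp_zero_apply]
  have := (rpow_pos_of_pos hr (3 / 2)).ne'
  field_simp

/-- The Weiss energy of the blow-ups is almost monotone in the scale. -/
lemma exists_hasDerivAt_weissEnergy (h : AlmostSolution 4 C κ w) (hr : 0 < r)
    (hr1 : r ≤ 1) : ∃ d, HasDerivAt (fun r => weissEnergy (blowUp w 0 r)) d r ∧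
      12 * homogeneityDefect (blowUp w 0 r)
        ≤ r * (d + κ * monotonicityConst C) := by
  obtain ⟨K, hK⟩ := h.lip
  have h1 := hasDerivAt_integral_dilation (p := 3)
    (F := fun r => energyDensity (blowUp w 0 r))
    (measurable_energyDensity hK.continuous)
    (by have := continuous_coord 1; fun_prop : Continuous fun x : Plane => (K : ℝ) ^ 2 + |x 1|)
    (abs_energyDensity_le hK)
    (contDiff_cut_pow 1) (hasCompactSupport_cut_pow 2)
    (fun r x hr => by rw [energyDensity_smul w hr]; norm_num) hr
  have h2 := hasDerivAt_integral_dilation (p := 5) (f := fun x => w x ^ 2)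
    (F := fun r x => blowUp w 0 r x ^ 2)
    (hK.continuous.measurable.pow_const 2) (hK.continuous.pow 2)
    (by simp)
    (contDiff_cut_pow 0) (hasCompactSupport_cut_pow 1)
    (fun r x hr => by
      rw [apply_smul w hr, mul_pow, ← Real.rpow_natCast, ← Real.rpow_mul hr.le]; norm_num) hr
  have h3 := h1.sub (h2.const_mul 9)
  refine ⟨_, h3, ?_⟩
  have h4 := (abs_le.1 (h.blowUp_four hr hr1).abs_dilation_identity_le).1
  simp only [show (1 + 2 : ℕ) = 3 from rfl, show (0 + 2 : ℕ) = 2 from rfl] at h4 ⊢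
  have hrr : r * r⁻¹ = 1 := mul_inv_cancel₀ hr.ne'
  set A := ∫ x, energyDensity (blowUp w 0 r) x * cut x ^ 3
  set B := ∫ x, energyDensity (blowUp w 0 r) x * fderiv ℝ (fun x => cut x ^ 3) x x
  set D := ∫ x, blowUp w 0 r x ^ 2 * cut x ^ 2
  set E := ∫ x, blowUp w 0 r x ^ 2 * fderiv ℝ (fun x => cut x ^ 2) x x
  have h5 : r * (r⁻¹ * (-3 * A - B) - 9 * (r⁻¹ * (-5 * D - E)) + κ * monotonicityConst C)
      = (-3 * A - B) - 9 * (-5 * D - E) + κ * r * monotonicityConst C := by grind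
  rw [h5]
  linarith

lemma homogeneityDefect_nonneg (w : Plane → ℝ) : 0 ≤ homogeneityDefect w :=
  integral_nonneg fun x => by positivity

lemma monotoneOn_weissEnergy (h : AlmostSolution 4 C κ w) :
    MonotoneOn (fun r => weissEnergy (blowUp w 0 r) + κ * monotonicityConst C * r)
      (Ioc 0 1) := by
  have hd : ∀ r ∈ Ioc 0 1, ∃ d,
      HasDerivAt (fun r => weissEnergy (blowUp w 0 r) + κ * monotonicityConst C * r)
        d r ∧ 0 ≤ d := by
    intro r hr
    obtain ⟨d, hd, hle⟩ := h.exists_hasDerivAt_weissEnergy hr.1 hr.2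
    refine ⟨_, hd.add ((hasDerivAt_id r).const_mul (κ * monotonicityConst C)), ?_⟩
    have h1 := homogeneityDefect_nonneg (blowUp w 0 r)
    rw [mul_one]
    exact nonneg_of_mul_nonneg_right (by grind) hr.1
  refine monotoneOn_of_deriv_nonneg (convex_Ioc _ _) ?_ ?_ ?_
  · intro r hr
    obtain ⟨d, hd, -⟩ := hd r hr
    exact hd.continuousAt.continuousWithinAt
  · intro r hr
    obtain ⟨d, hd, -⟩ := hd r (interior_subset hr)
    exact hd.differentiableAt.differentiableWithinAt
  · intro r hr
    obtain ⟨d, hd, h0⟩ := hd r (interior_subset hr)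
    rw [hd.deriv]; exact h0

lemma weissEnergy_ge (h : AlmostSolution 4 C κ w) :
    (∫ x : Plane, - (|x 1| * cut x ^ 3)) - 9 * ∫ x, (√(C * 4) * 4) ^ 2 * cut x ^ 2
      ≤ weissEnergy w := by
  obtain ⟨K, hK⟩ := h.lip
  have hc3 := (contDiff_cut_pow 1).continuous
  have hc2 := (contDiff_cut_pow 0).continuous
  have hs3 : HasCompactSupport fun x => cut x ^ 3 := hasCompactSupport_cut_pow 2
  have hs2 : HasCompactSupport fun x => cut x ^ 2 := hasCompactSupport_cut_pow 1
  have hcoord := continuous_coord 1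
  refine sub_le_sub ?_ (mul_le_mul_of_nonneg_left ?_ (by norm_num))
  · refine integral_mono ?_ ?_ fun x => ?_
    · exact ((hcoord.abs.mul hc3).integrable_of_hasCompactSupport hs3.mul_left).neg
    · exact integrable_mul_test (measurable_energyDensity hK.continuous)
        (by fun_prop : Continuous fun x : Plane => (K : ℝ) ^ 2 + |x 1|)
        (abs_energyDensity_le hK) hc3 hs3
    · have h1 := (abs_le.1 (abs_coord_mul_chi_le w x)).1
      have h2 : 0 ≤ cut x ^ 3 := pow_nonneg (cut_nonneg x) 3
      have h3 : -|x 1| ≤ energyDensity w x := by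
        unfold energyDensity; linarith [sq_nonneg ‖∇ w x‖]
      have := mul_le_mul_of_nonneg_right h3 h2
      simp only
      linarith
  · refine integral_mono (((hK.continuous.pow 2).mul hc2).integrable_of_hasCompactSupport
      hs2.mul_left) ((continuous_const.mul hc2).integrable_of_hasCompactSupport hs2.mul_left)
      fun x => ?_
    have h2 : 0 ≤ cut x ^ 2 := pow_nonneg (cut_nonneg x) 2
    by_cases hx : x ∈ ball 0 4
    · have h1 := h.le_on_ball le_rfl hx
      have h3 := h.nonneg x
      simp only
      gcongr
    · rw [mem_ball_zero_iff, not_lt] at hx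
      simp [cut_eq_zero (show 1 ≤ ‖x‖ by linarith)]

lemma exists_tendsto_weissEnergy_add (h : AlmostSolution 4 C κ w) :
    ∃ m, Tendsto (fun r => weissEnergy (blowUp w 0 r) + κ * monotonicityConst C * r)
      (𝓝[>] 0) (𝓝 m) := by
  refine ⟨_, MonotoneOn.tendsto_nhdsWithin_Ioo_right ⟨1 / 2, by norm_num⟩
    (h.monotoneOn_weissEnergy.mono Ioo_subset_Ioc_self) ⟨(∫ x : Plane, - (|x 1| * cut x ^ 3))
      - 9 * (∫ x, (√(C * 4) * 4) ^ 2 * cut x ^ 2) - |κ * monotonicityConst C|, ?_⟩⟩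
  rintro _ ⟨r, hr, rfl⟩
  have h1 := (h.blowUp_four hr.1 hr.2.le).weissEnergy_ge
  have h2 : |κ * monotonicityConst C * r| ≤ |κ * monotonicityConst C| := by
    rw [abs_mul, abs_of_pos hr.1]
    exact mul_le_of_le_one_right (abs_nonneg _) hr.2.le
  have h3 := (abs_le.1 h2).1
  simp only
  linarith

/-- The Weiss energy of the blow-ups has a limit. -/
lemma exists_tendsto_weissEnergy (h : AlmostSolution 4 C κ w) :
    ∃ m, Tendsto (fun r => weissEnergy (blowUp w 0 r)) (𝓝[>] 0) (𝓝 m) := by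
  obtain ⟨m, hm⟩ := h.exists_tendsto_weissEnergy_add
  have h1 : Tendsto (fun r : ℝ => κ * monotonicityConst C * r) (𝓝[>] 0) (𝓝 0) :=
    ((continuous_const_mul _).tendsto' 0 0 (mul_zero _)).mono_left nhdsWithin_le_nhds
  refine ⟨m - 0, (hm.sub h1).congr fun r => ?_⟩
  ring

end AlmostSolution

/-! ### Blow-up limits -/

lemma tendsto_const_mul_nhdsGT {b : ℝ} (hb : 0 < b) :
    Tendsto (fun r : ℝ => b * r) (𝓝[>] 0) (𝓝[>] 0) :=
  tendsto_nhdsWithin_iff.2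
    ⟨((continuous_const_mul b).tendsto' 0 0 (mul_zero b)).mono_left nhdsWithin_le_nhds,
      eventually_mem_nhdsWithin.mono fun _ hr => mul_pos hb hr⟩

namespace AlmostSolution

variable {κ : ℝ}

/-- The derivative of `r ↦ ∫ w_r ψ` along the blow-ups `w_r` is controlled by the homogeneity
defect. -/
lemma exists_hasDerivAt_integral_mul (h : AlmostSolution 4 C κ w)
    (hψ : ContDiff ℝ 1 ψ) (hc : HasCompactSupport ψ) {B : ℝ}
    (hB : ∀ x, |ψ x| ≤ B * cut x) {ε : ℝ} (hε : 0 < ε) (hr : 0 < r) :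
    ∃ d, HasDerivAt (fun r => ∫ x, blowUp w 0 r x * ψ x) d r ∧
      r * |d| ≤ B * (ε * (volume (closedBall (0 : Plane) 1)).toReal
        + homogeneityDefect (blowUp w 0 r) / ε) := by
  have hB0 : 0 ≤ B := by
    have := (abs_nonneg _).trans (hB 0)
    exact nonneg_of_mul_nonneg_left this (cut_pos (by simp))
  obtain ⟨K, hK⟩ := h.lip
  have h1 := hasDerivAt_integral_dilation (p := 7 / 2) (f := w)
    (F := fun r x => blowUp w 0 r x) hK.continuous.measurable hK.continuous.abs
    (fun x => le_rfl) hψ hc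
    (fun r x hr => by rw [apply_smul w hr]; norm_num) hr
  refine ⟨_, h1, ?_⟩
  obtain ⟨K', hK'⟩ := (h.rescale hr).lip
  set v := blowUp w 0 r with hv
  have h2 := integral_inner_gradient hK' (φ := fun x => ψ x • x) (hψ.smul contDiff_id)
    hc.smul_right
  have hip : Measurable fun x : Plane => ⟪∇ v x, x⟫ := by fun_prop
  have hipb : ∀ x : Plane, |⟪∇ v x, x⟫| ≤ K' * ‖x‖ := fun x =>
    (abs_real_inner_le_norm _ _).trans
      (mul_le_mul_of_nonneg_right (norm_gradient_le hK' x) (norm_nonneg _))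
  have hgm := measurable_gradient v
  have i1 : Integrable fun x => ⟪∇ v x, x⟫ * ψ x :=
    integrable_mul_test hip (by fun_prop : Continuous fun x : Plane => K' * ‖x‖) hipb hψ.continuous
      hc
  have i2 : Integrable fun x => v x * ψ x :=
    (hK'.continuous.mul hψ.continuous).integrable_of_hasCompactSupport hc.mul_left
  have hψd : Continuous fun x : Plane => fderiv ℝ ψ x x := by fun_prop
  have hψs : HasCompactSupport fun x : Plane => fderiv ℝ ψ x x :=
    (hc.fderiv (𝕜 := ℝ)).mono fun x hx => by
      intro h; exact hx (by simp [h])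
  have i3 : Integrable fun x => v x * fderiv ℝ ψ x x :=
    (hK'.continuous.mul hψd).integrable_of_hasCompactSupport hψs.mul_left
  have h3 : -(7 / 2) * (∫ x, v x * ψ x) - ∫ x, v x * fderiv ℝ ψ x x
      = ∫ x, ψ x * (⟪∇ v x, x⟫ - 3 / 2 * v x) := by
    have e1 : ∀ x, v x * divergence (fun x => ψ x • x) x
        = 2 * (v x * ψ x) + v x * fderiv ℝ ψ x x := by
      intro x
      rw [divergence_smul_id (hψ.differentiable (by norm_num) x)]; ring
    have e2 : ∀ x, ⟪∇ v x, ψ x • x⟫ = ⟪∇ v x, x⟫ * ψ x := by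
      intro x; rw [inner_smul_right]; ring
    simp only [e1, e2] at h2
    rw [integral_add (i2.const_mul _) i3, integral_const_mul] at h2
    have e3 : ∫ x, ψ x * (⟪∇ v x, x⟫ - 3 / 2 * v x)
        = (∫ x, ⟪∇ v x, x⟫ * ψ x) - 3 / 2 * ∫ x, v x * ψ x := by
      rw [← integral_const_mul, ← integral_sub i1 (i2.const_mul _)]
      congr 1; ext x; ring
    rw [e3, h2]; ring
  rw [h3, abs_mul, abs_inv, abs_of_pos hr, ← mul_assoc, mul_inv_cancel₀ hr.ne', one_mul,
    ← norm_eq_abs]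
  have hc2 := (contDiff_cut_pow 0).continuous
  have hs2 : HasCompactSupport fun x => cut x ^ 2 := hasCompactSupport_cut_pow 1
  have i4 : Integrable fun x => (⟪∇ v x, x⟫ - 3 / 2 * v x) ^ 2 * cut x ^ 2 := by
    have hvc := hK'.continuous
    refine integrable_mul_test (by fun_prop)
      (by fun_prop : Continuous fun x : Plane => (K' * ‖x‖ + 3 / 2 * |v x|) ^ 2)
      (fun x => ?_) hc2 hs2
    rw [abs_pow]
    gcongr
    refine (abs_sub _ _).trans (add_le_add (hipb x) ?_)
    rw [abs_mul, abs_of_pos (by norm_num : (0 : ℝ) < 3 / 2)]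
  have i5 : Integrable fun x => (closedBall (0 : Plane) 1).indicator (fun _ => ε) x :=
    (integrable_indicator_iff measurableSet_closedBall).2
      (integrableOn_const (by exact measure_closedBall_lt_top.ne))
  have i6 := (i5.add (i4.div_const ε)).const_mul B
  refine (norm_integral_le_of_norm_le i6 (.of_forall fun x => ?_)).trans (le_of_eq ?_)
  · rw [norm_mul, norm_eq_abs, norm_eq_abs]
    set q := ⟪∇ v x, x⟫ - 3 / 2 * v x
    simp only [Pi.add_apply]
    calc |ψ x| * |q| ≤ B * cut x * |q| := mul_le_mul_of_nonneg_right (hB x) (abs_nonneg _)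
      _ = B * (cut x * |q|) := by ring
      _ ≤ _ := by
        refine mul_le_mul_of_nonneg_left ?_ hB0
        by_cases hx : x ∈ closedBall 0 1
        · rw [indicator_of_mem hx]
          have h5 : (cut x * |q|) * ε ≤ ε * ε + q ^ 2 * cut x ^ 2 := by
            rw [← sq_abs q]
            nlinarith [sq_nonneg (cut x * |q| - ε), sq_nonneg (cut x * |q|), mul_pos hε hε]
          calc cut x * |q| = (cut x * |q|) * ε / ε := by field_simp
            _ ≤ (ε * ε + q ^ 2 * cut x ^ 2) / ε := div_le_div_of_nonneg_right h5 hε.le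
            _ = _ := by rw [add_div, mul_div_cancel_right₀ _ hε.ne']
        · rw [mem_closedBall_zero_iff, not_le] at hx
          rw [cut_eq_zero hx.le, zero_mul]
          refine add_nonneg (indicator_nonneg (fun _ _ => hε.le) _) ?_
          positivity
  · rw [integral_const_mul]
    have := integral_add i5 (i4.div_const ε)
    simp only [Pi.add_apply] at this ⊢
    rw [this, integral_indicator measurableSet_closedBall, setIntegral_const,
      integral_div, smul_eq_mul]
    simp only [homogeneityDefect, Measure.real]
    ring

/-- Blow-ups at comparable scales become equal in the limit, after testing with a function that is
supported in the unit disc. -/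
lemma tendsto_integral_sub (h : AlmostSolution 4 C κ w)
    (hψ : ContDiff ℝ 1 ψ) (hc : HasCompactSupport ψ) {B : ℝ}
    (hB : ∀ x, |ψ x| ≤ B * cut x) {a b : ℝ} (ha : 0 < a) (hab : a ≤ b) :
    Tendsto (fun r => (∫ x, blowUp w 0 (b * r) x * ψ x)
      - ∫ x, blowUp w 0 (a * r) x * ψ x) (𝓝[>] 0) (𝓝 0) := by
  have hB0 : 0 ≤ B := by
    have := (abs_nonneg _).trans (hB 0)
    exact nonneg_of_mul_nonneg_left this (cut_pos (by simp))
  have hb : 0 < b := ha.trans_le hab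
  set P : ℝ → ℝ := fun r => ∫ x, blowUp w 0 r x * ψ x
  set c := κ * monotonicityConst C
  set N : ℝ → ℝ := fun r => weissEnergy (blowUp w 0 r) + c * r
  set V := (volume (closedBall (0 : Plane) 1)).toReal
  have hV0 : 0 ≤ V := ENNReal.toReal_nonneg
  -- monotone majorants of `P` and `-P`
  have hmono : ∀ ε > 0, ∀ s : ℝ, |s| = 1 →
      MonotoneOn (fun r => s * P r + B * (ε * V * Real.log r + N r / (12 * ε))) (Ioc 0 1) := by
    intro ε hε s hs
    have hd : ∀ r ∈ Ioc (0 : ℝ) 1, ∃ d,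
        HasDerivAt (fun r => s * P r + B * (ε * V * Real.log r + N r / (12 * ε))) d r ∧ 0 ≤ d := by
      intro r hr
      obtain ⟨d1, hd1, hle1⟩ := h.exists_hasDerivAt_integral_mul hψ hc hB hε hr.1
      obtain ⟨d2, hd2, hle2⟩ := h.exists_hasDerivAt_weissEnergy hr.1 hr.2
      have hdN : HasDerivAt N (d2 + c * 1) r := hd2.add ((hasDerivAt_id r).const_mul c)
      refine ⟨_, (hd1.const_mul s).add ((((Real.hasDerivAt_log hr.1.ne').const_mul (ε * V)).add
        (hdN.div_const (12 * ε))).const_mul B), ?_⟩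
      have h1 : homogeneityDefect (blowUp w 0 r) / ε ≤ r * (d2 + c) / (12 * ε) := by
        rw [div_le_div_iff₀ hε (by positivity)]
        nlinarith
      have h2 : r * |s * d1| ≤ B * (ε * V + r * (d2 + c) / (12 * ε)) := by
        rw [abs_mul, hs, one_mul]
        exact hle1.trans (mul_le_mul_of_nonneg_left (by linarith) hB0)
      have h3 : r * (s * d1 + B * (ε * V * r⁻¹ + (d2 + c * 1) / (12 * ε)))
          = r * (s * d1) + B * (ε * V + r * (d2 + c) / (12 * ε)) := by grind
      have h4 : -(r * |s * d1|) ≤ r * (s * d1) := by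
        have := mul_le_mul_of_nonneg_left (neg_abs_le (s * d1)) hr.1.le
        linarith
      exact nonneg_of_mul_nonneg_right (by rw [h3]; linarith) hr.1
    refine monotoneOn_of_deriv_nonneg (convex_Ioc _ _) ?_ ?_ ?_
    · intro r hr
      obtain ⟨d, hd, -⟩ := hd r hr
      exact hd.continuousAt.continuousWithinAt
    · intro r hr
      obtain ⟨d, hd, -⟩ := hd r (interior_subset hr)
      exact hd.differentiableAt.differentiableWithinAt
    · intro r hr
      obtain ⟨d, hd, h0⟩ := hd r (interior_subset hr)
      rw [hd.deriv]; exact h0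
  have hbd : ∀ ε > 0, ∀ r, 0 < r → b * r ≤ 1 → |P (b * r) - P (a * r)|
      ≤ B * (ε * V * Real.log (b / a) + (N (b * r) - N (a * r)) / (12 * ε)) := by
    intro ε hε r hr hbr
    have har : a * r ∈ Ioc (0 : ℝ) 1 := ⟨by positivity, by nlinarith⟩
    have hbr' : b * r ∈ Ioc (0 : ℝ) 1 := ⟨by positivity, hbr⟩
    have hle : a * r ≤ b * r := by nlinarith
    have h1 := hmono ε hε 1 (by simp) har hbr' hle
    have h2 := hmono ε hε (-1) (by simp) har hbr' hle
    have h3 : Real.log (b / a) = Real.log (b * r) - Real.log (a * r) := by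
      rw [Real.log_div hb.ne' ha.ne', Real.log_mul hb.ne' hr.ne', Real.log_mul ha.ne' hr.ne']; ring
    have h4 : (N (b * r) - N (a * r)) / (12 * ε) = N (b * r) / (12 * ε) - N (a * r) / (12 * ε) := by
      ring
    simp only at h1 h2
    rw [h3, h4, abs_le]
    constructor <;> nlinarith
  obtain ⟨m, hm⟩ := h.exists_tendsto_weissEnergy_add
  have hscale : ∀ s : ℝ, 0 < s → Tendsto (fun r => N (s * r)) (𝓝[>] 0) (𝓝 m) := fun s hs =>
    hm.comp (tendsto_const_mul_nhdsGT hs)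
  have hlog : 0 ≤ Real.log (b / a) := Real.log_nonneg (by rw [le_div_iff₀ ha]; linarith)
  rw [Metric.tendsto_nhds]
  intro η hη
  -- the choice of `ε` makes the logarithmic term smaller than `η / 2`
  set ε := η / (2 * (B * V * Real.log (b / a) + 1)) with hεdef
  have hε : 0 < ε := by positivity
  have h5 : B * (ε * V * Real.log (b / a)) < η / 2 := by
    have h6 : ε * (B * V * Real.log (b / a) + 1) = η / 2 := by rw [hεdef]; field_simp
    nlinarith
  have h6 : Tendsto (fun r => B * ((N (b * r) - N (a * r)) / (12 * ε))) (𝓝[>] 0) (𝓝 0) := by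
    have := (((hscale b hb).sub (hscale a ha)).div_const (12 * ε)).const_mul B
    simpa using this
  have h7 := (tendsto_const_mul_nhdsGT hb).eventually (mem_nhdsWithin_of_mem_nhds
    (gt_mem_nhds zero_lt_one))
  filter_upwards [self_mem_nhdsWithin, h7, h6.eventually (gt_mem_nhds (half_pos hη))]
    with r hr h7 h8
  rw [dist_eq, sub_zero]
  refine (hbd ε hε r hr h7.le).trans_lt ?_
  rw [mul_add]; linarith

end AlmostSolution

/-- `U` is the limit of almost solutions `v n` whose errors tend to zero, and it is homogeneous
of degree `3/2` in the disc of radius `3`. Outside that disc nothing but Lipschitz continuity and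
nonnegativity is required of `U`. -/
structure IsBlowUpLimit (C : ℝ) (κ : ℕ → ℝ) (v : ℕ → Plane → ℝ) (U : Plane → ℝ) : Prop where
  sol : ∀ n, AlmostSolution 4 C (κ n) (v n)
  error : Tendsto κ atTop (𝓝 0)
  lip : ∃ K, LipschitzWith K U
  nonneg : ∀ x, 0 ≤ U x
  lower : ∀ x ∈ closedBall 0 3, x 1 ≤ 0 → U x = 0
  tendsto : TendstoUniformlyOn v U atTop (closedBall 0 3)
  homogeneous : ∀ x ∈ ball 0 3, ∀ b : ℝ, 0 < b → b ≤ 1 →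
    U (b • x) = b ^ (3 / 2 : ℝ) * U x

lemma exists_subseq_tendstoUniformlyOn
    (h : ∀ n, AlmostSolution 4 C (κ n) (v n)) :
    ∃ U : Plane → ℝ, (∃ K, LipschitzWith K U) ∧ (∀ x, 0 ≤ U x) ∧ ∃ s : ℕ → ℕ, StrictMono s ∧
      TendstoUniformlyOn (fun n => v (s n)) U atTop (closedBall 0 3) := by
  have : CompactSpace (closedBall 0 3) :=
    isCompact_iff_compactSpace.1 (isCompact_closedBall _ _)
  have hsub : closedBall (0 : Plane) 3 ⊆ ball 0 4 :=
    closedBall_subset_ball (by norm_num)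
  let f : ℕ → BoundedContinuousFunction (closedBall (0 : Plane) 3) ℝ := fun n =>
    BoundedContinuousFunction.mkOfCompact ⟨fun x => v n x, by
      have := (h n).continuous
      fun_prop⟩
  set K : NNReal := toNNReal √(C * 4) with hKdef
  have hK : (K : ℝ) = √(C * 4) := by simp_all
  have hlip : ∀ n, LipschitzWith K (f n) := fun n =>
    LipschitzWith.of_dist_le_mul fun x y => by
      rw [hK, dist_eq, Subtype.dist_eq, dist_eq_norm]
      exact (h n).abs_sub_le le_rfl (hsub x.2) (hsub y.2)
  have hcomp : IsCompact (closure (range f)) := by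
    refine BoundedContinuousFunction.arzela_ascoli (Icc 0 (√(C * 4) * 4)) isCompact_Icc _ ?_ ?_
    · rintro _ x ⟨n, rfl⟩
      exact ⟨(h n).nonneg _, (h n).le_on_ball le_rfl (hsub x.2)⟩
    · have hu : UniformEquicontinuous ((↑) : range f → closedBall (0 : Plane) 3 → ℝ) := by
        refine LipschitzWith.uniformEquicontinuous _ K ?_
        rintro ⟨_, n, rfl⟩
        exact hlip n
      exact hu.equicontinuous
  obtain ⟨F, -, s, hs, hF⟩ := hcomp.tendsto_subseq fun n => subset_closure (mem_range_self n)
  have hFu := BoundedContinuousFunction.tendsto_iff_tendstoUniformly.1 hF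
  have hFlip : LipschitzWith K F := by
    refine LipschitzWith.of_dist_le_mul fun x y => ?_
    refine le_of_tendsto ((hFu.tendsto_at x).dist (hFu.tendsto_at y))
      (.of_forall fun n => (hlip (s n)).dist_le_mul x y)
  have hF0 : ∀ x, 0 ≤ F x := fun x =>
    ge_of_tendsto (hFu.tendsto_at x) (.of_forall fun n => (h (s n)).nonneg x)
  classical
  let p : Plane → closedBall (0 : Plane) 3 := fun x =>
    if hx : x ∈ closedBall (0 : Plane) 3 then ⟨x, hx⟩ else ⟨0, by simp⟩
  have hp : ∀ x (hx : x ∈ closedBall (0 : Plane) 3), p x = ⟨x, hx⟩ := fun x hx =>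
    dif_pos hx
  have hon : LipschitzOnWith K (fun x => F (p x)) (closedBall (0 : Plane) 3) := by
    refine LipschitzOnWith.of_dist_le_mul fun x hx y hy => ?_
    simp only [hp x hx, hp y hy]
    exact hFlip.dist_le_mul _ _
  obtain ⟨G, hG, hGF⟩ := hon.extend_real
  refine ⟨fun x => max (G x) 0, ⟨K, ?_⟩, fun x => le_max_right _ _, s, hs, ?_⟩
  · simpa using hG.max_const 0
  · rw [Metric.tendstoUniformlyOn_iff]
    intro ε hε
    filter_upwards [Metric.tendstoUniformly_iff.1 hFu ε hε] with n hn x hx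
    have h1 := hn ⟨x, hx⟩
    have h2 : G x = F ⟨x, hx⟩ := by rw [← hGF hx]; simp only [hp x hx]
    rw [h2, max_eq_left (hF0 _)]
    exact h1

/-- Uniform limits may be taken under the integral against a fixed compactly supported weight. -/
lemma tendsto_integral_mul_of_tendstoUniformlyOn {f : ℕ → Plane → ℝ} {g : Plane → ℝ}
    {S : Set Plane} (hf : ∀ n, Continuous (f n)) (hg : Continuous g) (hψ : Continuous ψ)
    (hc : HasCompactSupport ψ) (hS : tsupport ψ ⊆ S) (h : TendstoUniformlyOn f g atTop S) :
    Tendsto (fun n => ∫ x, f n x * ψ x) atTop (𝓝 (∫ x, g x * ψ x)) := by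
  refine tendsto_integral_filter_of_dominated_convergence (fun x => (|g x| + 1) * |ψ x|)
    (.of_forall fun n => ((hf n).mul hψ).aestronglyMeasurable) ?_ ?_ ?_
  · filter_upwards [Metric.tendstoUniformlyOn_iff.1 h 1 one_pos] with n hn
    refine .of_forall fun x => ?_
    rw [norm_mul, norm_eq_abs, norm_eq_abs]
    by_cases hx : x ∈ tsupport ψ
    · have := hn x (hS hx)
      rw [dist_comm, dist_eq] at this
      refine mul_le_mul_of_nonneg_right ?_ (abs_nonneg _)
      have h2 := abs_sub_abs_le_abs_sub (f n x) (g x)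
      linarith
    · simp [image_eq_zero_of_notMem_tsupport hx]
  · exact (((hg.abs.add continuous_const).mul hψ.abs)).integrable_of_hasCompactSupport
      (hc.norm.mul_left)
  · refine .of_forall fun x => ?_
    by_cases hx : x ∈ tsupport ψ
    · exact (h.tendsto_at (hS hx)).mul_const _
    · simp [image_eq_zero_of_notMem_tsupport hx]

/-- Two continuous functions on an open set agree if their integrals against test functions do. -/
lemma eqOn_of_integral_mul_eq {f g : Plane → ℝ} {O : Set Plane} (hO : IsOpen O)
    (hf : Continuous f) (hg : Continuous g)
    (h : ∀ ψ : Plane → ℝ, ContDiff ℝ ∞ ψ → HasCompactSupport ψ → tsupport ψ ⊆ O →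
      ∫ x, f x * ψ x = ∫ x, g x * ψ x) : EqOn f g O := by
  have h1 : ∀ᵐ x, x ∈ O → f x - g x = 0 := by
    refine hO.ae_eq_zero_of_integral_contDiff_smul_eq_zero
      ((hf.sub hg).locallyIntegrable.locallyIntegrableOn _) fun ψ h1 h2 h3 => ?_
    have i1 : Integrable fun x => f x * ψ x :=
      (hf.mul h1.continuous).integrable_of_hasCompactSupport h2.mul_left
    have i2 : Integrable fun x => g x * ψ x :=
      (hg.mul h1.continuous).integrable_of_hasCompactSupport h2.mul_left
    have h4 := h ψ h1 h2 h3
    rw [← sub_eq_zero, ← integral_sub i1 i2] at h4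
    rw [← h4]
    congr 1; ext x; rw [smul_eq_mul]; ring
  refine Measure.eqOn_open_of_ae_eq (μ := volume) ?_ hO hf.continuousOn hg.continuousOn
  refine (ae_restrict_iff' hO.measurableSet).2 ?_
  filter_upwards [h1] with x hx hxO
  linarith [hx hxO]

lemma exists_abs_le_mul_cut (hψ : Continuous ψ) (hc : HasCompactSupport ψ)
    (hs : tsupport ψ ⊆ ball 0 1) : ∃ B, ∀ x, |ψ x| ≤ B * cut x := by
  have hcont : ContinuousOn (fun x => |ψ x| / cut x) (tsupport ψ) := by
    refine hψ.abs.continuousOn.div continuous_cut.continuousOn fun x hx => ?_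
    exact (cut_pos (by simpa using hs hx)).ne'
  obtain ⟨B, hB⟩ := hc.isCompact.exists_bound_of_continuousOn hcont
  refine ⟨|B|, fun x => ?_⟩
  by_cases hx : x ∈ tsupport ψ
  · have h1 : 0 < cut x := cut_pos (by simpa using hs hx)
    have h2 := (hB x hx).trans (le_abs_self B)
    rw [norm_of_nonneg (by positivity), div_le_iff₀ h1] at h2
    exact h2
  · rw [image_eq_zero_of_notMem_tsupport hx, abs_zero]
    exact mul_nonneg (abs_nonneg _) (cut_nonneg _)

/-- Every sequence of blow-ups has a subsequence with a homogeneous limit. -/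
lemma AlmostSolution.exists_isBlowUpLimit {κ : ℝ} (h : AlmostSolution 4 C κ w)
    {r : ℕ → ℝ} (hr : ∀ n, r n ∈ Ioc 0 1) (hr0 : Tendsto r atTop (𝓝 0)) :
    ∃ (U : Plane → ℝ) (s : ℕ → ℕ), StrictMono s ∧
      IsBlowUpLimit C (fun n => κ * r (s n)) (fun n => blowUp w 0 (r (s n))) U := by
  have hsol : ∀ n, AlmostSolution 4 C (κ * r n) (blowUp w 0 (r n)) := fun n =>
    h.blowUp_four (hr n).1 (hr n).2
  obtain ⟨U, hlip, h0, s, hs, hU⟩ := exists_subseq_tendstoUniformlyOn hsol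
  have hrs : Tendsto (fun n => r (s n)) atTop (𝓝 0) := hr0.comp hs.tendsto_atTop
  have hsub : closedBall (0 : Plane) 3 ⊆ ball 0 4 :=
    closedBall_subset_ball (by norm_num)
  refine ⟨U, s, hs, fun n => hsol _, ?_, hlip, h0, ?_, hU, ?_⟩
  · simpa using hrs.const_mul κ
  · intro x hx hx1
    refine tendsto_nhds_unique (hU.tendsto_at hx) (tendsto_const_nhds.congr fun n => ?_)
    exact ((hsol (s n)).lower x (hsub hx) hx1).symm
  · intro x hx b hb hb1
    obtain ⟨K, hK⟩ := hlip
    have hUc := hK.continuous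
    -- rescaled blow-ups converge to the rescaled limit
    have hlim : ∀ c : ℝ, 0 < c → c ≤ 3 → ∀ ψ : Plane → ℝ, Continuous ψ → HasCompactSupport ψ →
        tsupport ψ ⊆ ball 0 1 →
        Tendsto (fun n => ∫ x, blowUp w 0 (c * r (s n)) x * ψ x) atTop
          (𝓝 (∫ x, (c ^ (3 / 2 : ℝ))⁻¹ * U (c • x) * ψ x)) := by
      intro c hc hc3 ψ hψ hψc hψs
      refine tendsto_integral_mul_of_tendstoUniformlyOn (S := ball 0 1)
        (fun n => ((h.rescale (mul_pos hc (hr (s n)).1))).continuous) (by fun_prop) hψ hψc hψs ?_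
      have hcp : 0 < c ^ (3 / 2 : ℝ) := rpow_pos_of_pos hc _
      rw [Metric.tendstoUniformlyOn_iff] at hU ⊢
      intro ε hε
      filter_upwards [hU (ε * c ^ (3 / 2 : ℝ)) (by positivity)] with n hn y hy
      have hcy : c • y ∈ closedBall 0 3 := by
        rw [mem_ball_zero_iff] at hy
        rw [mem_closedBall_zero_iff, norm_smul, norm_of_nonneg hc.le]
        nlinarith [norm_nonneg y]
      have h1 := hn _ hcy
      have h2 : blowUp w 0 (c * r (s n)) y
          = (c ^ (3 / 2 : ℝ))⁻¹ * blowUp w 0 (r (s n)) (c • y) := by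
        rw [blowUp_zero_apply, blowUp_zero_apply, mul_rpow hc.le (hr (s n)).1.le, smul_smul,
          mul_comm c (r (s n))]
        field_simp
      rw [dist_eq] at h1 ⊢
      rw [h2, ← mul_sub, abs_mul, abs_inv, abs_of_pos hcp, inv_mul_lt_iff₀ hcp]
      linarith
    have heq : EqOn (fun y => ((3 : ℝ) ^ (3 / 2 : ℝ))⁻¹ * U ((3 : ℝ) • y))
        (fun y => ((3 * b) ^ (3 / 2 : ℝ))⁻¹ * U ((3 * b) • y)) (ball 0 1) := by
      refine eqOn_of_integral_mul_eq isOpen_ball (by fun_prop) (by fun_prop)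
        fun ψ h1 h2 h3 => ?_
      obtain ⟨B, hB⟩ := exists_abs_le_mul_cut h1.continuous h2 h3
      have h4 := (h.tendsto_integral_sub (h1.of_le (by simp)) h2 hB
        (a := 3 * b) (b := 3) (by positivity) (by linarith)).comp
        (tendsto_nhdsWithin_iff.2 ⟨hrs, .of_forall fun n => (hr (s n)).1⟩)
      have h5 := (hlim 3 (by norm_num) le_rfl ψ h1.continuous h2 h3).sub
        (hlim (3 * b) (by positivity) (by linarith) ψ h1.continuous h2 h3)
      have := tendsto_nhds_unique h4 h5
      linarith
    have hx3 : (1 / 3 : ℝ) • x ∈ ball 0 1 := by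
      rw [mem_ball_zero_iff] at hx ⊢
      rw [norm_smul, norm_of_nonneg (by norm_num)]
      linarith
    have h6 := heq hx3
    simp only [smul_smul] at h6
    rw [show (3 : ℝ) * (1 / 3) = 1 by norm_num, one_smul,
      show 3 * b * (1 / 3) = b by ring, mul_rpow (by norm_num) hb.le] at h6
    have h7 : 0 < (3 : ℝ) ^ (3 / 2 : ℝ) := by positivity
    have h8 : 0 < b ^ (3 / 2 : ℝ) := by positivity
    field_simp at h6
    linarith

/-! ### Weak convergence of the gradients -/

/-- Weak convergence of the partial derivatives of uniformly Lipschitz functions, tested with an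
integrable function: it suffices to test with smooth functions, which are dense. -/
lemma tendsto_integral_fderiv_mul
    (hv : ∀ n, ∃ K, LipschitzWith K (v n)) (hU : ∃ K, LipschitzWith K U) {M : ℝ}
    (hM : ∀ n, ∀ᵐ x, x ∈ closedBall 0 3 → ‖∇ (v n) x‖ ≤ M)
    (hMU : ∀ x, ‖∇ U x‖ ≤ M)
    (h : TendstoUniformlyOn v U atTop (closedBall 0 3)) {f : Plane → ℝ}
    (hf : Integrable f) (hf0 : ∀ x, x ∉ closedBall 0 2 → f x = 0) (i : Fin 2) :
    Tendsto (fun n => ∫ x, ∇ (v n) x i * f x) atTop (𝓝 (∫ x, ∇ U x i * f x)) := by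
  have hM0 : 0 ≤ M := (norm_nonneg _).trans (hMU 0)
  let χ : ContDiffBump (0 : Plane) := ⟨2, 3, by norm_num, by norm_num⟩
  have hχ1 : ∀ x ∈ closedBall (0 : Plane) 2, χ x = 1 := fun x hx =>
    χ.one_of_mem_closedBall hx
  have hχs : tsupport χ = closedBall (0 : Plane) 3 := χ.tsupport_eq
  -- the error of replacing `f` by a function that is close to it in `L¹`
  have key : ∀ (w : Plane → ℝ) (g : Plane → ℝ) (ε : ℝ), Integrable g → (∃ K, LipschitzWith K w) →
      (∀ᵐ x, x ∈ closedBall 0 3 → ‖∇ w x‖ ≤ M) →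
      ∫ x, ‖f x - g x‖ ≤ ε →
      |(∫ x, ∇ w x i * f x) - ∫ x, ∇ w x i * (χ x * g x)| ≤ M * ε := by
    intro w g ε hg ⟨K, hK⟩ hw hfg
    have hm : Measurable fun x => ∇ w x i := by fun_prop
    have hb : ∀ x, ‖∇ w x i‖ ≤ K := fun x =>
      (PiLp.norm_apply_le _ i).trans (norm_gradient_le hK x)
    have hχg : Integrable fun x => χ x * g x :=
      hg.bdd_mul χ.continuous.aestronglyMeasurable (.of_forall fun x => by
        rw [norm_of_nonneg χ.nonneg]; exact χ.le_one)
    have i1 : Integrable fun x => ∇ w x i * f x :=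
      hf.bdd_mul hm.aestronglyMeasurable (.of_forall hb)
    have i2 : Integrable fun x => ∇ w x i * (χ x * g x) :=
      hχg.bdd_mul hm.aestronglyMeasurable (.of_forall hb)
    rw [← integral_sub i1 i2, ← norm_eq_abs]
    refine (norm_integral_le_of_norm_le ((hf.sub hg).norm.const_mul M) ?_).trans ?_
    · filter_upwards [hw] with x hx
      have e1 : ∇ w x i * f x - ∇ w x i * (χ x * g x)
          = ∇ w x i * (χ x * (f x - g x)) := by
        by_cases hx2 : x ∈ closedBall 0 2
        · rw [hχ1 x hx2]; ring
        · rw [hf0 x hx2]; ring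
      rw [e1, norm_mul, norm_mul, norm_of_nonneg (χ.nonneg), Pi.sub_apply]
      by_cases hx3 : x ∈ closedBall 0 3
      · have h1 := (PiLp.norm_apply_le (∇ w x) i).trans (hx hx3)
        have h2 : χ x * ‖f x - g x‖ ≤ ‖f x - g x‖ :=
          mul_le_of_le_one_left (norm_nonneg _) χ.le_one
        exact mul_le_mul h1 h2 (mul_nonneg χ.nonneg (norm_nonneg _)) hM0
      · rw [← hχs] at hx3
        rw [image_eq_zero_of_notMem_tsupport hx3, zero_mul, mul_zero]
        positivity
    · rw [integral_const_mul]
      exact mul_le_mul_of_nonneg_left hfg hM0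
  -- smooth test functions
  have hsmooth : ∀ g : Plane → ℝ, ContDiff ℝ 1 g → HasCompactSupport g →
      tsupport g ⊆ closedBall 0 3 →
      Tendsto (fun n => ∫ x, ∇ (v n) x i * g x) atTop (𝓝 (∫ x, ∇ U x i * g x)) := by
    intro g hg hgc hgs
    obtain ⟨K', hK'⟩ := hg.lipschitzWith_of_hasCompactSupport hgc (by norm_num)
    have e : ∀ w : Plane → ℝ, (∃ K, LipschitzWith K w) → ∫ x, ∇ w x i * g x
        = - ∫ x, w x * fderiv ℝ g x (single i 1) := by
      rintro w ⟨K, hK⟩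
      simp only [gradient_apply]
      exact integral_fderiv_mul hK hK' hgc _
    rw [e U hU]
    simp only [fun n => e (v n) (hv n)]
    have hgd : Continuous fun x => fderiv ℝ g x (single i 1) := by fun_prop
    refine (tendsto_integral_mul_of_tendstoUniformlyOn (S := closedBall 0 3)
      (fun n => (hv n).choose_spec.continuous) hU.choose_spec.continuous hgd
      (hgc.fderiv_apply (𝕜 := ℝ) _) ?_ h).neg
    refine (closure_minimal (fun x hx => ?_) (isClosed_tsupport g)).trans hgs
    by_contra h1
    have h2 := image_eq_zero_of_notMem_tsupport fun h => h1 (tsupport_fderiv_subset ℝ h)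
    exact hx (by simp [h2])
  rw [Metric.tendsto_nhds]
  intro η hη
  have hfm : MemLp f 1 volume := memLp_one_iff_integrable.2 hf
  obtain ⟨g, hgc, hg, hfg⟩ := hfm.exist_eLpNorm_sub_le (by simp) le_rfl
    (ε := η / (3 * (M + 1))) (by positivity)
  have hgi : Integrable g := hg.continuous.integrable_of_hasCompactSupport hgc
  have hfg' : ∫ x, ‖f x - g x‖ ≤ η / (3 * (M + 1)) := by
    rw [eLpNorm_one_eq_lintegral_enorm] at hfg
    have := ENNReal.toReal_le_of_le_ofReal (by positivity) hfg
    rw [← integral_norm_eq_lintegral_enorm (hf.sub hgi).aestronglyMeasurable] at this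
    exact this
  have hχg := hsmooth (fun x => χ x * g x)
    ((χ.contDiff).mul (hg.of_le (by simp))) hgc.mul_left
    ((tsupport_mul_subset_left).trans hχs.subset)
  have hε : M * (η / (3 * (M + 1))) ≤ η / 3 := by
    rw [← mul_div_assoc, div_le_div_iff₀ (by positivity) (by norm_num)]
    nlinarith
  filter_upwards [Metric.tendsto_nhds.1 hχg (η / 3) (by positivity)] with n hn
  have h1 := key (v n) g _ hgi (hv n) (hM n) hfg'
  have h2 := key U g _ hgi hU (.of_forall fun x _ => hMU x) hfg'
  rw [dist_eq] at hn ⊢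
  rw [abs_le] at h1 h2
  rw [abs_lt] at hn ⊢
  constructor <;> linarith [h1.1, h1.2, h2.1, h2.2, hn.1, hn.2]

namespace IsBlowUpLimit

lemma exists_gradient_bound (h : IsBlowUpLimit C κ v U) : ∃ M : ℝ, 0 ≤ M ∧
    (∀ n, ∀ᵐ x, x ∈ closedBall 0 3 → ‖∇ (v n) x‖ ≤ M) ∧
    ∀ x, ‖∇ U x‖ ≤ M := by
  obtain ⟨K, hK⟩ := h.lip
  refine ⟨max √(C * 4) K, le_max_of_le_left (sqrt_nonneg _), fun n => ?_, fun x =>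
    (norm_gradient_le hK x).trans (le_max_right _ _)⟩
  filter_upwards [(h.sol n).norm_gradient_le_sqrt le_rfl] with x hx hx3
  exact (hx (closedBall_subset_ball (by norm_num) hx3)).trans (le_max_left _ _)

lemma tendsto_integral_inner (h : IsBlowUpLimit C κ v U) {G : Plane → Plane}
    (hG : Integrable G) (hG0 : ∀ x, x ∉ closedBall 0 2 → G x = 0) :
    Tendsto (fun n => ∫ x, ⟪∇ (v n) x, G x⟫) atTop
      (𝓝 (∫ x, ⟪∇ U x, G x⟫)) := by
  obtain ⟨M, hM0, hM, hMU⟩ := h.exists_gradient_bound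
  have hGi : ∀ i : Fin 2, Integrable fun x => G x i := fun i =>
    (proj (𝕜 := ℝ) i).integrable_comp hG
  have h1 : ∀ i : Fin 2, Tendsto (fun n => ∫ x, ∇ (v n) x i * G x i) atTop
      (𝓝 (∫ x, ∇ U x i * G x i)) := fun i =>
    tendsto_integral_fderiv_mul (fun n => (h.sol n).lip) h.lip hM hMU h.tendsto (hGi i)
      (fun x hx => by rw [hG0 x hx]; rfl) i
  have h2 : ∀ w : Plane → ℝ, (∃ K, LipschitzWith K w) → ∫ x, ⟪∇ w x, G x⟫
      = (∫ x, ∇ w x 0 * G x 0) + ∫ x, ∇ w x 1 * G x 1 := by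
    rintro w ⟨K, hK⟩
    have hi : ∀ i : Fin 2, Integrable fun x => ∇ w x i * G x i := fun i =>
      (hGi i).bdd_mul ((measurable_coord i).comp (by fun_prop)).aestronglyMeasurable
        (.of_forall fun x => (PiLp.norm_apply_le _ i).trans (norm_gradient_le hK x))
    simp only [inner_plane]
    exact integral_add (hi 0) (hi 1)
  rw [h2 U h.lip]
  simp only [fun n => h2 (v n) (h.sol n).lip]
  exact (h1 0).add (h1 1)

lemma continuous (h : IsBlowUpLimit C κ v U) : Continuous U := h.lip.choose_spec.continuous

/-- The limit is harmonic in its positivity set. -/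
lemma almostHarmonic (h : IsBlowUpLimit C κ v U) : AlmostHarmonic (ball 0 2) 0 U := by
  intro ψ hψ hc hs
  have hlim := h.tendsto_integral_inner
    ((continuous_gradient hψ).integrable_of_hasCompactSupport (hasCompactSupport_gradient hc)) (by
      intro x hx
      refine image_eq_zero_of_notMem_tsupport fun hx' => hx ?_
      have h1 : tsupport (∇ ψ) ⊆ tsupport ψ := by
        refine (closure_mono fun x hx => ?_).trans (tsupport_fderiv_subset ℝ)
        intro h0; exact hx (by simp [gradient, h0])
      exact ball_subset_closedBall (hs (h1 hx')).1)
  have hpos : ∀ᶠ n in atTop, ∀ x ∈ tsupport ψ, 0 < v n x := by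
    rcases (tsupport ψ).eq_empty_or_nonempty with he | hne
    · simp_all
    · obtain ⟨x₀, hx₀, hmin⟩ := hc.isCompact.exists_isMinOn hne h.continuous.continuousOn
      filter_upwards [Metric.tendstoUniformlyOn_iff.1 h.tendsto (U x₀) (hs hx₀).2] with n hn x hx
      have h1 := hn x (ball_subset_closedBall.trans
        (closedBall_subset_closedBall (by norm_num)) (hs hx).1)
      have h2 : U x₀ ≤ U x := hmin hx
      rw [dist_eq, abs_lt] at h1
      linarith [h1.2]
  have hzero : Tendsto (fun n => κ n * ∫ x, ‖x‖ ^ (3 / 2 : ℝ) * ‖∇ ψ x‖) atTop (𝓝 0) := by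
    simpa using h.error.mul_const (∫ x, ‖x‖ ^ (3 / 2 : ℝ) * ‖∇ ψ x‖)
  rw [zero_mul]
  refine le_of_tendsto_of_tendsto hlim.abs hzero ?_
  filter_upwards [hpos] with n hn
  refine (h.sol n).pde ψ hψ hc fun x hx => ⟨?_, hn x hx⟩
  exact ball_subset_ball (by norm_num) (hs hx).1

end IsBlowUpLimit

/-! ### Polar coordinates -/

/-- Rotation by a right angle. -/
noncomputable def perp : Plane →L[ℝ] Plane :=
  LinearMap.toContinuousLinearMap
    { toFun := fun x => !₂[-x 1, x 0]
      map_add' := fun x y => by ext i; fin_cases i <;> simp; ring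
      map_smul' := fun c x => by ext i; fin_cases i <;> simp }

@[simp] lemma perp_apply_zero (x : Plane) : perp x 0 = -x 1 := rfl

@[simp] lemma perp_apply_one (x : Plane) : perp x 1 = x 0 := rfl

lemma norm_sq_plane (x : Plane) : ‖x‖ ^ 2 = x 0 ^ 2 + x 1 ^ 2 := by
  rw [EuclideanSpace.real_norm_sq_eq, Fin.sum_univ_two]

lemma norm_unitVec (θ : ℝ) : ‖unitVec θ‖ = 1 := by
  have h : ‖unitVec θ‖ ^ 2 = 1 := by
    rw [norm_sq_plane]; simp [unitVec]
  nlinarith [norm_nonneg (unitVec θ)]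

@[simp] lemma unitVec_apply_zero (θ : ℝ) : unitVec θ 0 = cos θ := rfl

@[simp] lemma unitVec_apply_one (θ : ℝ) : unitVec θ 1 = sin θ := rfl

lemma hasDerivAt_unitVec (θ : ℝ) : HasDerivAt unitVec (perp (unitVec θ)) θ := by
  have h := ((Real.hasDerivAt_cos θ).smul_const (single (0 : Fin 2) (1 : ℝ))).add
    ((Real.hasDerivAt_sin θ).smul_const (single (1 : Fin 2) (1 : ℝ)))
  convert! h using 1
  · ext θ i; fin_cases i <;> simp
  · ext i; fin_cases i <;> simp

@[fun_prop] lemma contDiff_unitVec {n : WithTop ℕ∞} : ContDiff ℝ n unitVec := by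
  refine (contDiff_piLp 2).2 fun i => ?_
  fin_cases i
  · simpa using Real.contDiff_cos
  · simpa using Real.contDiff_sin

/-- Decomposition of the inner product into radial and angular parts. -/
lemma norm_sq_mul_inner (x a b : Plane) : ‖x‖ ^ 2 * ⟪a, b⟫
    = ⟪a, x⟫ * ⟪b, x⟫ + ⟪a, perp x⟫ * ⟪b, perp x⟫ := by
  simp only [norm_sq_plane, inner_plane, perp_apply_zero, perp_apply_one]; ring

lemma divergence_smul_perp {c : Plane → ℝ} (hc : DifferentiableAt ℝ c x) :
    divergence (fun x => c x • perp x) x = fderiv ℝ c x (perp x) := by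
  rw [divergence_smul hc perp.differentiableAt]
  simp [divergence]

/-- The complex number with the coordinates of `x`. -/
noncomputable def toComplex (x : Plane) : ℂ := ⟨x 0, x 1⟩

/-- The polar angle in `(-π, π]`. -/
noncomputable def polarAngle (x : Plane) : ℝ := Complex.arg (toComplex x)

lemma toComplex_smul_unitVec (R θ : ℝ) :
    toComplex (R • unitVec θ) = R * (Complex.cos θ + Complex.sin θ * Complex.I) := by
  apply Complex.ext <;>
    simp [toComplex, ← Complex.ofReal_cos, ← Complex.ofReal_sin]

lemma polarAngle_smul_unitVec {R θ : ℝ} (hR : 0 < R) (hθ : θ ∈ Ioc (-π) π) :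
    polarAngle (R • unitVec θ) = θ := by
  rw [polarAngle, toComplex_smul_unitVec, Complex.arg_mul_cos_add_sin_mul_I hR hθ]

lemma norm_toComplex (x : Plane) : ‖toComplex x‖ = ‖x‖ := by
  have h : ‖toComplex x‖ ^ 2 = ‖x‖ ^ 2 := by
    rw [norm_sq_plane, Complex.sq_norm, Complex.normSq_apply]; simp only [toComplex]; ring
  exact (pow_left_inj₀ (norm_nonneg _) (norm_nonneg _) two_ne_zero).1 h

lemma norm_smul_unitVec_polarAngle (x : Plane) : ‖x‖ • unitVec (polarAngle x) = x := by
  have h1 := Complex.norm_mul_cos_arg (toComplex x)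
  have h2 := Complex.norm_mul_sin_arg (toComplex x)
  rw [norm_toComplex] at h1 h2
  ext i
  fin_cases i
  · simpa [toComplex, polarAngle] using h1
  · simpa [toComplex, polarAngle] using h2

lemma polarAngle_mem_Ioo (hx : 0 < x 1) : polarAngle x ∈ Ioo 0 π := by
  have h1 : 0 ≤ polarAngle x := Complex.arg_nonneg_iff.2 hx.le
  have h2 : polarAngle x ≤ π := Complex.arg_le_pi _
  have h3 := congrArg (fun y : Plane => y 1) (norm_smul_unitVec_polarAngle x)
  simp only [PiLp.smul_apply, unitVec_apply_one, smul_eq_mul] at h3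
  refine ⟨lt_of_le_of_ne h1 fun h => ?_, lt_of_le_of_ne h2 fun h => ?_⟩
  · rw [← h, Real.sin_zero, mul_zero] at h3; linarith
  · simp_all

lemma contDiffAt_polarAngle (hx : 0 < x 1) : ContDiffAt ℝ ∞ polarAngle x := by
  have h1 : ContDiff ℝ ∞ toComplex := by
    have : toComplex = fun x => (x 0 : ℂ) + (x 1 : ℂ) * Complex.I := by
      ext x; exact (Complex.mk_eq_add_mul_I _ _)
    rw [this]
    have hc : ∀ i : Fin 2, ContDiff ℝ ∞ fun x : Plane => ((x i : ℝ) : ℂ) := fun i =>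
      Complex.ofRealCLM.contDiff.comp (by fun_prop)
    exact (hc 0).add (by fun_prop)
  have h2 : toComplex x ∈ Complex.slitPlane := Or.inr hx.ne'
  have h3 : ContDiffAt ℝ ∞ Complex.log (toComplex x) :=
    (Complex.contDiffAt_log h2).restrict_scalars ℝ
  have h4 : polarAngle = fun x => Complex.imCLM (Complex.log (toComplex x)) := by
    ext x; simp [polarAngle, Complex.log_im]
  rw [h4]
  exact Complex.imCLM.contDiff.contDiffAt.comp x (by fun_prop)

/-- Integration in polar coordinates. -/
lemma integral_polar (g : Plane → ℝ) :
    ∫ p in Ioi 0 ×ˢ Ioo (-π) π, p.1 * g (p.1 • unitVec p.2) = ∫ x, g x := by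
  have h1 := integral_comp_polarCoord_symm fun q : ℝ × ℝ => g !₂[q.1, q.2]
  have h2 : ∫ q : ℝ × ℝ, g !₂[q.1, q.2] = ∫ x, g x := by
    have e1 := (volume_preserving_finTwoArrow ℝ).integral_comp
      (MeasurableEquiv.measurableEmbedding _) (fun q : ℝ × ℝ => g !₂[q.1, q.2])
    have e2 := (EuclideanSpace.volume_preserving_symm_measurableEquiv_toLp (Fin 2)).integral_comp
      (MeasurableEquiv.measurableEmbedding _)
      (fun y => g !₂[(MeasurableEquiv.finTwoArrow y).1, (MeasurableEquiv.finTwoArrow y).2])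
    rw [← e1, ← e2]
    congr 1; ext x; congr 1; ext i; fin_cases i <;> rfl
  rw [← h2, ← h1]
  have h3 : polarCoord.target = Ioi 0 ×ˢ Ioo (-π) π := rfl
  rw [h3]
  congr 1; ext p; rw [smul_eq_mul]; congr 2
  ext i; fin_cases i <;> simp [polarCoord]

/-! ### The angular equation of a homogeneous harmonic function -/

/-- The function `a(R) b(θ)` in polar coordinates. -/
noncomputable def polarProduct (a b : ℝ → ℝ) (x : Plane) : ℝ := a ‖x‖ * b (polarAngle x)

/-- The part of the annulus `1/2 ≤ R ≤ 3/2` with angles in `S`. -/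
def annularSector (S : Set ℝ) : Set Plane :=
  (fun p : ℝ × ℝ => p.1 • unitVec p.2) '' (Icc (1 / 2) (3 / 2) ×ˢ S)

lemma isCompact_annularSector {S : Set ℝ} (hS : IsCompact S) : IsCompact (annularSector S) := by
  refine (isCompact_Icc.prod hS).image ?_
  have := (contDiff_unitVec (n := 1)).continuous
  fun_prop

lemma pos_of_mem_annularSector {S : Set ℝ} (hS : S ⊆ Ioo 0 π)
    (hx : x ∈ annularSector S) : 0 < x 1 := by
  obtain ⟨⟨R, θ⟩, ⟨hR, hθ⟩, rfl⟩ := hx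
  have h1 := Real.sin_pos_of_mem_Ioo (hS hθ)
  have h2 : 0 < R := by grind
  simpa using mul_pos h2 h1

section PolarProduct

variable {a b : ℝ → ℝ}

lemma polarProduct_eq_zero (ha0 : ∀ R, R ∉ Icc (1 / 2) (3 / 2) → a R = 0)
    (hx : x ∉ annularSector (tsupport b)) : polarProduct a b x = 0 := by
  by_contra h
  have h1 : a ‖x‖ ≠ 0 := left_ne_zero_of_mul h
  have h2 : b (polarAngle x) ≠ 0 := right_ne_zero_of_mul h
  refine hx ⟨(‖x‖, polarAngle x), ⟨?_, subset_tsupport _ h2⟩, norm_smul_unitVec_polarAngle x⟩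
  by_contra h3
  exact h1 (ha0 _ h3)

lemma tsupport_polarProduct (ha0 : ∀ R, R ∉ Icc (1 / 2) (3 / 2) → a R = 0)
    (hb : HasCompactSupport b) :
    tsupport (polarProduct a b) ⊆ annularSector (tsupport b) := by
  refine closure_minimal (fun x hx => ?_) (isCompact_annularSector hb.isCompact).isClosed
  by_contra h
  exact hx (polarProduct_eq_zero ha0 h)

lemma hasCompactSupport_polarProduct (ha0 : ∀ R, R ∉ Icc (1 / 2) (3 / 2) → a R = 0)
    (hb : HasCompactSupport b) : HasCompactSupport (polarProduct a b) :=
  (isCompact_annularSector hb.isCompact).of_isClosed_subset (isClosed_tsupport _)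
    (tsupport_polarProduct ha0 hb)

lemma polarProduct_eventuallyEq_zero (ha0 : ∀ R, R ∉ Icc (1 / 2) (3 / 2) → a R = 0)
    (hb : HasCompactSupport b) (hbs : tsupport b ⊆ Ioo 0 π) (hx : ¬ 0 < x 1) :
    polarProduct a b =ᶠ[𝓝 x] fun _ => 0 :=
  notMem_tsupport_iff_eventuallyEq.1 fun h =>
    hx (pos_of_mem_annularSector hbs (tsupport_polarProduct ha0 hb h))

lemma contDiff_polarProduct {n : WithTop ℕ∞} (hn : n ≤ ∞) (ha : ∀ R, 0 < R → ContDiffAt ℝ n a R)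
    (ha0 : ∀ R, R ∉ Icc (1 / 2) (3 / 2) → a R = 0) (hbd : ContDiff ℝ n b)
    (hb : HasCompactSupport b) (hbs : tsupport b ⊆ Ioo 0 π) :
    ContDiff ℝ n (polarProduct a b) := by
  rw [contDiff_iff_contDiffAt]
  intro x
  by_cases hx : 0 < x 1
  · have hx0 : x ≠ 0 := by rintro rfl; simp at hx
    exact ((ha _ (norm_pos_iff.2 hx0)).comp x (contDiffAt_norm ℝ hx0)).mul
      (hbd.contDiffAt.comp x ((contDiffAt_polarAngle hx).of_le hn))
  · exact contDiffAt_const.congr_of_eventuallyEq (polarProduct_eventuallyEq_zero ha0 hb hbs hx)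

lemma polarProduct_smul_unitVec {R θ : ℝ} (hR : 0 < R) (hθ : θ ∈ Ioc (-π) π) :
    polarProduct a b (R • unitVec θ) = a R * b θ := by
  rw [polarProduct, polarAngle_smul_unitVec hR hθ, norm_smul, norm_unitVec, mul_one,
    norm_of_nonneg hR.le]

lemma fderiv_polarProduct_perp (ha : ∀ R, 0 < R → ContDiffAt ℝ 1 a R)
    (ha0 : ∀ R, R ∉ Icc (1 / 2) (3 / 2) → a R = 0) (hbd : ContDiff ℝ 1 b)
    (hb : HasCompactSupport b) (hbs : tsupport b ⊆ Ioo 0 π) (x : Plane) :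
    fderiv ℝ (polarProduct a b) x (perp x) = polarProduct a (deriv b) x := by
  by_cases hx : 0 < x 1
  · obtain ⟨h1, h2⟩ := polarAngle_mem_Ioo hx
    have hx0 : 0 < ‖x‖ := norm_pos_iff.2 (by rintro rfl; simp at hx)
    have hd := (contDiff_polarProduct (by exact_mod_cast le_top) ha ha0 hbd hb hbs).differentiable
      (by norm_num) x
    have hxe := norm_smul_unitVec_polarAngle x
    have h3 : HasDerivAt (fun t => ‖x‖ • unitVec t) (‖x‖ • perp (unitVec (polarAngle x)))
        (polarAngle x) := (hasDerivAt_unitVec (polarAngle x)).const_smul ‖x‖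
    rw [← map_smul, hxe] at h3
    have h4 := HasFDerivAt.comp_hasDerivAt_of_eq (polarAngle x) hd.hasFDerivAt h3 hxe.symm
    have h5 : ((polarProduct a b) ∘ fun t => ‖x‖ • unitVec t) =ᶠ[𝓝 (polarAngle x)]
        fun t => a ‖x‖ * b t := by
      filter_upwards [Ioo_mem_nhds (by linarith [pi_pos] : -π < polarAngle x) h2]
        with t ht
      exact polarProduct_smul_unitVec hx0 ⟨ht.1, ht.2.le⟩
    have h6 : HasDerivAt (fun t => a ‖x‖ * b t) (a ‖x‖ * deriv b (polarAngle x)) (polarAngle x) :=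
      ((hbd.differentiable (by norm_num) _).hasDerivAt).const_mul _
    exact (h4.congr_of_eventuallyEq h5.symm).unique h6
  · rw [(polarProduct_eventuallyEq_zero ha0 hb hbs hx).fderiv_eq]
    have := polarProduct_eventuallyEq_zero ha0 hb.deriv
      ((tsupport_deriv_subset).trans hbs) hx
    rw [this.self_of_nhds]
    simp

lemma fderiv_polarProduct_self (ha : ∀ R, 0 < R → ContDiffAt ℝ 1 a R)
    (ha0 : ∀ R, R ∉ Icc (1 / 2 : ℝ) (3 / 2) → a R = 0) (hbd : ContDiff ℝ 1 b)
    (hb : HasCompactSupport b) (hbs : tsupport b ⊆ Ioo 0 π) (x : Plane) :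
    fderiv ℝ (polarProduct a b) x x = ‖x‖ * polarProduct (deriv a) b x := by
  by_cases hx : 0 < x 1
  · obtain ⟨h1, h2⟩ := polarAngle_mem_Ioo hx
    have hx0 : 0 < ‖x‖ := norm_pos_iff.2 (by rintro rfl; simp at hx)
    have hd := (contDiff_polarProduct (by exact_mod_cast le_top) ha ha0 hbd hb hbs).differentiable
      (by norm_num) x
    have hxe := norm_smul_unitVec_polarAngle x
    have h3 : HasDerivAt (fun t : ℝ => t • unitVec (polarAngle x))
        ((1 : ℝ) • unitVec (polarAngle x)) ‖x‖ := (hasDerivAt_id _).smul_const _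
    rw [one_smul] at h3
    have h4 := HasFDerivAt.comp_hasDerivAt_of_eq ‖x‖ hd.hasFDerivAt h3 hxe.symm
    have h5 : ((polarProduct a b) ∘ fun t : ℝ => t • unitVec (polarAngle x)) =ᶠ[𝓝 ‖x‖]
        fun t => a t * b (polarAngle x) := by
      filter_upwards [lt_mem_nhds hx0] with t ht
      exact polarProduct_smul_unitVec ht ⟨by linarith [pi_pos], h2.le⟩
    have h6 : HasDerivAt (fun t => a t * b (polarAngle x)) (deriv a ‖x‖ * b (polarAngle x)) ‖x‖ :=
      (((ha _ hx0).differentiableAt (by norm_num)).hasDerivAt).mul_const _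
    have h7 := (h4.congr_of_eventuallyEq h5.symm).unique h6
    calc fderiv ℝ (polarProduct a b) x x
        = fderiv ℝ (polarProduct a b) x (‖x‖ • unitVec (polarAngle x)) := by rw [hxe]
      _ = ‖x‖ * fderiv ℝ (polarProduct a b) x (unitVec (polarAngle x)) := by
        rw [map_smul, smul_eq_mul]
      _ = _ := by rw [h7, polarProduct]
  · rw [(polarProduct_eventuallyEq_zero ha0 hb hbs hx).fderiv_eq]
    have : polarProduct (deriv a) b x = 0 := by
      by_contra h
      have h2 : b (polarAngle x) ≠ 0 := right_ne_zero_of_mul h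
      have h3 := hbs (subset_tsupport _ h2)
      have h4 := Complex.arg_nonneg_iff.1 h3.1.le
      apply hx
      have h5 := congrArg (fun y : Plane => y 1) (norm_smul_unitVec_polarAngle x)
      simp only [PiLp.smul_apply, unitVec_apply_one, smul_eq_mul] at h5
      rw [← h5]
      refine mul_pos (norm_pos_iff.2 ?_) (Real.sin_pos_of_mem_Ioo h3)
      rintro rfl
      simp [polarAngle, toComplex] at h3
      have : (⟨0, 0⟩ : ℂ) = 0 := rfl
      simp [this] at h3
    rw [this]
    simp

end PolarProduct

namespace IsBlowUpLimit

lemma apply_smul (h : IsBlowUpLimit C κ v U) (hx : x ∈ ball 0 3)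
    {b : ℝ} (hb : 0 < b) (hbx : b • x ∈ ball 0 3) :
    U (b • x) = b ^ (3 / 2 : ℝ) * U x := by
  rcases le_total b 1 with h1 | h1
  · exact h.homogeneous x hx b hb h1
  · have h2 := h.homogeneous _ hbx b⁻¹ (by positivity) (inv_le_one_of_one_le₀ h1)
    rw [smul_smul, inv_mul_cancel₀ hb.ne', one_smul, Real.inv_rpow hb.le] at h2
    rw [h2, ← mul_assoc, mul_inv_cancel₀ (by positivity), one_mul]

lemma apply_polar (h : IsBlowUpLimit C κ v U) {R : ℝ} (hR : 0 < R) (hR3 : R < 3) (θ : ℝ) :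
    U (R • unitVec θ) = R ^ (3 / 2 : ℝ) * U (unitVec θ) := by
  refine h.apply_smul ?_ hR ?_
  · rw [mem_ball_zero_iff, norm_unitVec]; norm_num
  · rw [mem_ball_zero_iff, norm_smul, norm_unitVec, norm_of_nonneg hR.le, mul_one]
    exact hR3

/-- Euler's identity. -/
lemma fderiv_self (h : IsBlowUpLimit C κ v U) (hx : x ∈ ball 0 3)
    (hd : DifferentiableAt ℝ U x) : fderiv ℝ U x x = 3 / 2 * U x := by
  have h1 : HasDerivAt (fun t : ℝ => t • x) ((1 : ℝ) • x) 1 := (hasDerivAt_id _).smul_const _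
  rw [one_smul] at h1
  have h2 := HasFDerivAt.comp_hasDerivAt_of_eq 1 hd.hasFDerivAt h1 (one_smul ℝ x).symm
  have h3 : (U ∘ fun t : ℝ => t • x) =ᶠ[𝓝 1] fun t => t ^ (3 / 2 : ℝ) * U x := by
    have hc : Continuous fun t : ℝ => t • x := by fun_prop
    have h4 : ∀ᶠ t in 𝓝 (1 : ℝ), t • x ∈ ball 0 3 :=
      hc.continuousAt.eventually (isOpen_ball.mem_nhds (by simpa using hx))
    filter_upwards [lt_mem_nhds one_pos, h4] with t ht ht3
    exact h.apply_smul hx ht ht3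
  have h5 : HasDerivAt (fun t : ℝ => t ^ (3 / 2 : ℝ) * U x) (3 / 2 * U x) 1 := by
    have := (Real.hasDerivAt_rpow_const (p := 3 / 2) (Or.inl (one_ne_zero (α := ℝ)))).mul_const (U x)
    simpa using this
  exact (h2.congr_of_eventuallyEq h3.symm).unique h5

lemma integral_mul_polarProduct (h : IsBlowUpLimit C κ v U) {a b : ℝ → ℝ}
    (ha0 : ∀ R, R ∉ Icc (1 / 2) (3 / 2) → a R = 0) :
    ∫ x, U x * polarProduct a b x = (∫ R in Ioi 0, R ^ (5 / 2 : ℝ) * a R)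
      * ∫ θ in Ioo (-π) π, U (unitVec θ) * b θ := by
  rw [← integral_polar, ← setIntegral_prod_mul]
  refine setIntegral_congr_fun (measurableSet_Ioi.prod measurableSet_Ioo) fun p hp => ?_
  have hR : 0 < p.1 := hp.1
  rw [polarProduct_smul_unitVec hR ⟨hp.2.1, hp.2.2.le⟩]
  by_cases h3 : p.1 ∈ Icc (1 / 2 : ℝ) (3 / 2)
  · rw [h.apply_polar hR (by linarith [h3.2]),
      show (5 / 2 : ℝ) = 1 + 3 / 2 by norm_num, rpow_add hR, Real.rpow_one]
    ring
  · rw [ha0 _ h3]; ring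

/-- The angular part of the limit satisfies `f'' = -9/4 f` weakly where it is positive: test the
harmonicity with products `a(R) b(θ)`. -/
lemma integral_deriv_deriv (h : IsBlowUpLimit C κ v U) {b : ℝ → ℝ} (hb : ContDiff ℝ ∞ b)
    (hbc : HasCompactSupport b) (hbs : tsupport b ⊆ {θ | θ ∈ Ioo 0 π ∧ 0 < U (unitVec θ)}) :
    ∫ θ in Ioo (-π) π, U (unitVec θ) * deriv (deriv b) θ
      = -(9 / 4) * ∫ θ in Ioo (-π) π, U (unitVec θ) * b θ := by
  obtain ⟨K, hK⟩ := h.lip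
  let a : ContDiffBump (1 : ℝ) := ⟨1 / 4, 1 / 2, by norm_num, by norm_num⟩
  have ha0 : ∀ R, R ∉ Icc (1 / 2 : ℝ) (3 / 2) → a R = 0 := by
    intro R hR
    refine a.zero_of_le_dist (le_of_not_gt fun h1 => hR ?_)
    rw [dist_eq, abs_lt] at h1
    simp only [a] at h1
    exact ⟨by linarith [h1.1], by linarith [h1.2]⟩
  have ha : ContDiff ℝ ∞ a := a.contDiff
  have ha' : ∀ R, R ∉ Icc (1 / 2 : ℝ) (3 / 2) → deriv a R = 0 := by
    intro R hR
    have h1 : a =ᶠ[𝓝 R] fun _ => (0 : ℝ) := by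
      filter_upwards [isClosed_Icc.isOpen_compl.mem_nhds hR] with t ht using ha0 t ht
    rw [h1.deriv_eq, deriv_const]
  have hbs' : tsupport b ⊆ Ioo 0 π := fun θ hθ => (hbs hθ).1
  have hb1 : ContDiff ℝ ∞ (deriv b) := ContDiff.deriv' hb
  have hb1s : tsupport (deriv b) ⊆ Ioo 0 π := (tsupport_deriv_subset).trans hbs'
  have hone : (1 : WithTop ℕ∞) ≤ ∞ := by exact_mod_cast le_top
  -- the three products that occur
  set a₁ : ℝ → ℝ := fun R => deriv a R / R
  set a₂ : ℝ → ℝ := fun R => a R / R ^ 2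
  have ha₁ : ∀ R, R ∉ Icc (1 / 2 : ℝ) (3 / 2) → a₁ R = 0 := by grind
  have ha₂ : ∀ R, R ∉ Icc (1 / 2 : ℝ) (3 / 2) → a₂ R = 0 := by grind
  have ha₁d : ∀ R, 0 < R → ContDiffAt ℝ 1 a₁ R := fun R hR =>
    ((ContDiff.deriv' ha).of_le hone).contDiffAt.div contDiffAt_id hR.ne'
  have ha₂d : ∀ R, 0 < R → ContDiffAt ℝ 1 a₂ R := fun R hR =>
    (ha.of_le hone).contDiffAt.div (contDiffAt_id.pow 2) (by grind)
  have had : ∀ R, 0 < R → ContDiffAt ℝ 1 a R := fun R _ => (ha.of_le hone).contDiffAt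
  have hψ := contDiff_polarProduct hone had ha0 (hb.of_le hone) hbc hbs'
  have hψc := hasCompactSupport_polarProduct (a := a) ha0 hbc
  have hc := contDiff_polarProduct hone ha₂d ha₂ (hb1.of_le hone) hbc.deriv hb1s
  have hcc := hasCompactSupport_polarProduct (a := a₂) ha₂ hbc.deriv
  -- harmonicity
  have h0 : ∫ x, ⟪∇ U x, ∇ (polarProduct a b) x⟫ = 0 := by
    have := h.almostHarmonic _ hψ hψc ?_
    · simp_all
    · intro x hx
      obtain ⟨⟨R, θ⟩, ⟨hR, hθ⟩, rfl⟩ := tsupport_polarProduct ha0 hbc hx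
      have hR1 : 0 < R := by grind
      have hR2 : R < 2 := by grind
      refine ⟨?_, ?_⟩
      · rw [mem_ball_zero_iff, norm_smul, norm_unitVec, norm_of_nonneg hR1.le, mul_one]
        exact hR2
      · simp only
        rw [h.apply_polar hR1 (by linarith)]
        exact mul_pos (by positivity) (hbs hθ).2
  have hae : ∀ᵐ x, ⟪∇ U x, ∇ (polarProduct a b) x⟫
      = 3 / 2 * (U x * polarProduct a₁ b x)
        + ⟪∇ U x, polarProduct a₂ (deriv b) x • perp x⟫ := by
    filter_upwards [hK.ae_differentiableAt (μ := volume), compl_mem_ae_iff.2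
      (measure_singleton (μ := volume) 0)] with x hx hx0
    have hxn : 0 < ‖x‖ := norm_pos_iff.2 hx0
    have e1 := norm_sq_mul_inner x (∇ U x) (∇ (polarProduct a b) x)
    rw [inner_gradient U x x, inner_gradient U x (perp x), inner_gradient _ x x,
      inner_gradient _ x (perp x),
      fderiv_polarProduct_perp had ha0 (hb.of_le hone) hbc hbs',
      fderiv_polarProduct_self had ha0 (hb.of_le hone) hbc hbs'] at e1
    rw [inner_smul_right, inner_gradient U x (perp x)]
    have e3 : polarProduct a₁ b x = polarProduct (deriv a) b x / ‖x‖ := by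
      simp only [polarProduct, a₁]; ring
    have e4 : polarProduct a₂ (deriv b) x = polarProduct a (deriv b) x / ‖x‖ ^ 2 := by
      simp only [polarProduct, a₂]; ring
    rw [e3, e4]
    by_cases hx3 : x ∈ ball 0 3
    · rw [h.fderiv_self hx3 hx] at e1
      field_simp
      linear_combination 2 * e1
    · have hx4 : ‖x‖ ∉ Icc (1 / 2 : ℝ) (3 / 2) := by
        rw [mem_ball_zero_iff, not_lt] at hx3
        intro h4; linarith [h4.2]
      have e5 : polarProduct a (deriv b) x = 0 := by simp [polarProduct, ha0 _ hx4]
      have e6 : polarProduct (deriv a) b x = 0 := by simp [polarProduct, ha' _ hx4]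
      rw [e5, e6] at e1 ⊢
      rw [mul_zero, mul_zero, mul_zero, add_zero] at e1
      rcases mul_eq_zero.1 e1 with e7 | e7
      · grind
      · rw [e7]; ring
  have i1 : Integrable fun x => U x * polarProduct a₁ b x :=
    (hK.continuous.mul (contDiff_polarProduct hone ha₁d ha₁ (hb.of_le hone) hbc
      hbs').continuous).integrable_of_hasCompactSupport
      (hasCompactSupport_polarProduct ha₁ hbc).mul_left
  have i2 : Integrable fun x => ⟪∇ U x, polarProduct a₂ (deriv b) x • perp x⟫ := by
    have := integrable_mul_test (f := fun x => ⟪∇ U x, perp x⟫)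
      (by fun_prop)
      (by fun_prop : Continuous fun x : Plane => K * ‖perp x‖)
      (fun x => (abs_real_inner_le_norm _ _).trans
        (mul_le_mul_of_nonneg_right (norm_gradient_le hK x) (norm_nonneg _)))
      hc.continuous hcc
    refine this.congr (.of_forall fun x => ?_)
    simp only [inner_smul_right]; ring
  have hdiv := integral_inner_gradient hK (φ := fun x => polarProduct a₂ (deriv b) x • perp x)
    (by fun_prop) hcc.smul_right
  have e8 : ∀ x, divergence (fun x => polarProduct a₂ (deriv b) x • perp x) x
      = polarProduct a₂ (deriv (deriv b)) x := fun x => by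
    rw [divergence_smul_perp (hc.differentiable (by norm_num) x),
      fderiv_polarProduct_perp ha₂d ha₂ (hb1.of_le hone) hbc.deriv hb1s]
  simp only [e8] at hdiv
  rw [integral_congr_ae hae, integral_add (i1.const_mul _) i2, hdiv, integral_const_mul,
    h.integral_mul_polarProduct ha₁, h.integral_mul_polarProduct ha₂] at h0
  -- the radial integrals
  have hIoc : ∀ g : ℝ → ℝ, (∀ R, R ∉ Icc (1 / 2 : ℝ) (3 / 2) → g R = 0) →
      ∫ R in Ioi (0 : ℝ), g R = ∫ R in (0 : ℝ)..2, g R := by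
    intro g hg
    rw [intervalIntegral.integral_of_le (by norm_num)]
    refine (setIntegral_eq_of_subset_of_forall_sdiff_eq_zero measurableSet_Ioi
      Ioc_subset_Ioi_self fun R hR => hg R fun h => hR.2 ⟨hR.1, by linarith [h.2]⟩)
  have hac := ha.continuous
  have hac' : Continuous (deriv a) := ha.continuous_deriv (by simp)
  have r1 : ∫ R in Ioi (0 : ℝ), R ^ (5 / 2 : ℝ) * a₁ R
      = ∫ R in (0 : ℝ)..2, R ^ (3 / 2 : ℝ) * deriv a R := by
    rw [← hIoc _ fun R hR => by rw [ha' R hR, mul_zero]]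
    refine setIntegral_congr_fun measurableSet_Ioi fun R (hR : 0 < R) => ?_
    simp only [a₁]
    rw [show (5 / 2 : ℝ) = 3 / 2 + 1 by norm_num, Real.rpow_add_one hR.ne']
    field_simp
  have r2 : ∫ R in Ioi (0 : ℝ), R ^ (5 / 2 : ℝ) * a₂ R
      = ∫ R in (0 : ℝ)..2, R ^ (1 / 2 : ℝ) * a R := by
    rw [← hIoc _ fun R hR => by rw [ha0 R hR, mul_zero]]
    refine setIntegral_congr_fun measurableSet_Ioi fun R (hR : 0 < R) => ?_
    simp only [a₂]
    rw [show (5 / 2 : ℝ) = 1 / 2 + (2 : ℕ) by norm_num, Real.rpow_add_natCast hR.ne']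
    field_simp
  have hc1 : Continuous fun R : ℝ => R ^ (1 / 2 : ℝ) :=
    Real.continuous_rpow_const (by norm_num)
  have hc3 : Continuous fun R : ℝ => R ^ (3 / 2 : ℝ) :=
    Real.continuous_rpow_const (by norm_num)
  have r3 : ∫ R in (0 : ℝ)..2, R ^ (3 / 2 : ℝ) * deriv a R
      = -(3 / 2) * ∫ R in (0 : ℝ)..2, R ^ (1 / 2 : ℝ) * a R := by
    have hder : ∀ R : ℝ, HasDerivAt (fun R => R ^ (3 / 2 : ℝ) * a R)
        (3 / 2 * (R ^ (1 / 2 : ℝ) * a R) + R ^ (3 / 2 : ℝ) * deriv a R) R := by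
      intro R
      have := (Real.hasDerivAt_rpow_const (x := R) (p := 3 / 2) (Or.inr (by norm_num))).mul
        ((ha.differentiable (by simp) R).hasDerivAt)
      refine this.congr_deriv ?_
      norm_num
      ring
    have h1 := intervalIntegral.integral_eq_sub_of_hasDerivAt (a := 0) (b := 2)
      (fun R _ => hder R) (Continuous.intervalIntegrable (by fun_prop) _ _)
    rw [ha0 2 (by norm_num), ha0 0 (by norm_num), intervalIntegral.integral_add
      (Continuous.intervalIntegrable (by fun_prop) _ _)
      (Continuous.intervalIntegrable (by fun_prop) _ _),
      intervalIntegral.integral_const_mul] at h1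
    linarith
  have r4 : 0 < ∫ R in (0 : ℝ)..2, R ^ (1 / 2 : ℝ) * a R := by
    refine intervalIntegral.integral_pos (by norm_num) (by fun_prop)
      (fun R hR => mul_nonneg (Real.rpow_nonneg hR.1.le _) a.nonneg) ⟨1, by norm_num, ?_⟩
    rw [a.one_of_mem_closedBall (by norm_num)]
    norm_num
  rw [r1, r2, r3] at h0
  have h1 : (∫ R in (0 : ℝ)..2, R ^ (1 / 2 : ℝ) * a R) *
      ((∫ θ in Ioo (-π) π, U (unitVec θ) * deriv (deriv b) θ)
        - -(9 / 4) * ∫ θ in Ioo (-π) π, U (unitVec θ) * b θ) = 0 := by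
    linear_combination -h0
  rcases mul_eq_zero.1 h1 with h2 | h2
  · grind
  · linarith

end IsBlowUpLimit

/-! ### Classification of the limits -/

/-- Three values of a solution of `y'' = -k² y` are linearly dependent. -/
lemma three_point_of_hasDerivAt {y z : ℝ → ℝ} {k p q : ℝ} (hk : k ≠ 0)
    (hy : ∀ t ∈ Icc p q, HasDerivAt y (z t) t)
    (hz : ∀ t ∈ Icc p q, HasDerivAt z (-k ^ 2 * y t) t) {t₀ t t₁ : ℝ} (h0 : t₀ ∈ Icc p q)
    (h : t ∈ Icc p q) (h1 : t₁ ∈ Icc p q) :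
    y t * sin (k * (t₁ - t₀))
      = y t₀ * sin (k * (t₁ - t)) + y t₁ * sin (k * (t - t₀)) := by
  -- the Wronskian of `y` with a shifted sine is constant
  have key : ∀ s ∈ Icc p q,
      y t * (k * cos (k * (s - t))) + z t * sin (k * (s - t)) = k * y s := by
    intro s hs
    have hd : ∀ t ∈ Icc p q, HasDerivWithinAt
        (fun t => y t * (k * cos (k * (s - t))) + z t * sin (k * (s - t))) 0
        (Icc p q) t := by
      intro t ht
      have h1 : HasDerivAt (fun t => k * (s - t)) (k * -1) t :=
        ((hasDerivAt_id t).const_sub s).const_mul k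
      have h2 := ((hy t ht).mul ((h1.cos).const_mul k)).add ((hz t ht).mul h1.sin)
      refine (h2.congr_deriv ?_).hasDerivWithinAt
      ring
    have := Convex.norm_image_sub_le_of_norm_hasDerivWithin_le hd (C := 0)
      (fun x _ => by simp) (convex_Icc p q) h hs
    rw [zero_mul, norm_le_zero_iff, sub_eq_zero] at this
    simp only [sub_self, mul_zero, Real.cos_zero, Real.sin_zero, add_zero, mul_one] at this
    linarith
  have k0 := key t₀ h0
  have k1 := key t₁ h1
  have e1 : sin (k * (t₁ - t₀)) = sin (k * (t₁ - t)) * cos (k * (t₀ - t))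
      - cos (k * (t₁ - t)) * sin (k * (t₀ - t)) := by
    rw [← Real.sin_sub]; congr 1; ring
  have e2 : sin (k * (t - t₀)) = - sin (k * (t₀ - t)) := by
    rw [← Real.sin_neg]; congr 1; ring
  rw [e1, e2]
  apply mul_left_cancel₀ hk
  linear_combination sin (k * (t₁ - t)) * k0 - sin (k * (t₀ - t)) * k1

/-- A continuous function that solves `f'' = -k² f` weakly in an interval satisfies the three point
identity there: mollify. -/
lemma three_point_of_weak {f : ℝ → ℝ} (hf : Continuous f) {k p q : ℝ} (hk : k ≠ 0)
    (h : ∀ b : ℝ → ℝ, ContDiff ℝ ∞ b → HasCompactSupport b → tsupport b ⊆ Ioo p q →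
      ∫ s, f s * deriv (deriv b) s = -k ^ 2 * ∫ s, f s * b s)
    {t₀ t t₁ : ℝ} (h0 : t₀ ∈ Icc p q) (ht : t ∈ Icc p q) (h1 : t₁ ∈ Icc p q) :
    f t * sin (k * (t₁ - t₀))
      = f t₀ * sin (k * (t₁ - t)) + f t₁ * sin (k * (t - t₀)) := by
  rcases eq_or_lt_of_le (h0.1.trans h0.2) with hpq | hpq
  · simp_all
  -- interior points
  have hint : ∀ t₀ ∈ Ioo p q, ∀ t ∈ Ioo p q, ∀ t₁ ∈ Ioo p q, f t * sin (k * (t₁ - t₀))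
      = f t₀ * sin (k * (t₁ - t)) + f t₁ * sin (k * (t - t₀)) := by
    intro t₀ h0 t ht t₁ h1
    obtain ⟨p', q', hpp, hqq, hsub⟩ : ∃ p' q', p < p' ∧ q' < q ∧
        t₀ ∈ Icc p' q' ∧ t ∈ Icc p' q' ∧ t₁ ∈ Icc p' q' :=
      ⟨min t₀ (min t t₁), max t₀ (max t t₁), lt_min h0.1 (lt_min ht.1 h1.1),
        max_lt h0.2 (max_lt ht.2 h1.2), ⟨min_le_left _ _, le_max_left _ _⟩,
        ⟨(min_le_right _ _).trans (min_le_left _ _), (le_max_left _ _).trans (le_max_right _ _)⟩,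
        ⟨(min_le_right _ _).trans (min_le_right _ _), (le_max_right _ _).trans (le_max_right _ _)⟩⟩
    set ε₀ := min (p' - p) (q - q')
    let φ : ℕ → ContDiffBump (0 : ℝ) := fun n =>
      ⟨ε₀ / (4 * (n + 1)), ε₀ / (2 * (n + 1)), by positivity, by
        gcongr; norm_num⟩
    have hφ : Tendsto (fun n => (φ n).rOut) atTop (𝓝 0) := by
      have := (tendsto_one_div_add_atTop_nhds_zero_nat (𝕜 := ℝ)).const_mul (ε₀ / 2)
      rw [mul_zero] at this
      refine this.congr fun n => ?_
      simp only [φ]; field_simp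
    set y : ℕ → ℝ → ℝ := fun n =>
      MeasureTheory.convolution ((φ n).normed volume) f (ContinuousLinearMap.lsmul ℝ ℝ) volume
      with hy
    have hlim : ∀ x, Tendsto (fun n => y n x) atTop (𝓝 (f x)) := fun x =>
      ContDiffBump.convolution_tendsto_right_of_continuous hφ hf x
    have hn : ∀ n, y n t * sin (k * (t₁ - t₀))
        = y n t₀ * sin (k * (t₁ - t)) + y n t₁ * sin (k * (t - t₀)) := by
      intro n
      set ψ := (φ n).normed volume with hψ
      have hψd : ContDiff ℝ ∞ ψ := (φ n).contDiff_normed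
      have hψc : HasCompactSupport ψ := (φ n).hasCompactSupport_normed
      have hψ1 : ContDiff ℝ ∞ (deriv ψ) := ContDiff.deriv' hψd
      have hone : (1 : WithTop ℕ∞) ≤ ∞ := by exact_mod_cast le_top
      refine three_point_of_hasDerivAt hk (p := p') (q := q')
        (z := MeasureTheory.convolution (deriv ψ) f (ContinuousLinearMap.lsmul ℝ ℝ) volume)
        (fun s _ => ?_) (fun s hs => ?_) hsub.1 hsub.2.1 hsub.2.2
      · exact HasCompactSupport.hasDerivAt_convolution_left _ hψc (hψd.of_le hone)
          hf.locallyIntegrable s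
      · refine (HasCompactSupport.hasDerivAt_convolution_left _ hψc.deriv (hψ1.of_le hone)
          hf.locallyIntegrable s).congr_deriv ?_
        have e1 := h (fun r => ψ (s - r)) (by fun_prop)
          (hψc.comp_homeomorph (Homeomorph.subLeft s)) ?_
        · simp only [hy, convolution_eq_swap, ContinuousLinearMap.lsmul_apply, smul_eq_mul]
          have e2 : deriv (deriv fun r => ψ (s - r)) = fun r => deriv (deriv ψ) (s - r) := by
            have e3 : deriv (fun r => ψ (s - r)) = fun r => - deriv ψ (s - r) := by
              ext r; rw [deriv_comp_const_sub]
            rw [e3]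
            ext r
            rw [deriv.fun_neg, deriv_comp_const_sub, neg_neg]
          rw [e2] at e1
          simp only [mul_comm (f _)] at e1
          exact e1
        · intro r hr
          have e4 : s - r ∈ tsupport ψ :=
            tsupport_comp_subset_preimage ψ (continuous_const.sub continuous_id) hr
          rw [hψ, (φ n).tsupport_normed_eq, mem_closedBall, dist_eq, sub_zero] at e4
          have e5 : (φ n).rOut ≤ ε₀ / 2 := by
            simp only [φ]
            gcongr
            have : 0 ≤ n := Nat.cast_nonneg n
            linarith
          have e6 := abs_le.1 (e4.trans e5)
          have e7 : ε₀ ≤ p' - p := min_le_left _ _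
          have e8 : ε₀ ≤ q - q' := min_le_right _ _
          exact ⟨by linarith [hs.1, e6.2], by linarith [hs.2, e6.1]⟩
    refine tendsto_nhds_unique ((hlim t).mul_const _)
      ((((hlim t₀).mul_const _).add ((hlim t₁).mul_const _)).congr fun n => (hn n).symm)
  -- the end points
  have hcl : Icc p q ⊆ closure (Ioo p q) := (closure_Ioo hpq.ne).symm.subset
  have s1 : ∀ t ∈ Ioo p q, ∀ t₁ ∈ Ioo p q, EqOn (fun t₀ => f t * sin (k * (t₁ - t₀)))
      (fun t₀ => f t₀ * sin (k * (t₁ - t)) + f t₁ * sin (k * (t - t₀))) (Icc p q) :=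
    fun t ht t₁ h1 => EqOn.of_subset_closure (fun t₀ h0 => hint t₀ h0 t ht t₁ h1)
      (by fun_prop) (by fun_prop) Ioo_subset_Icc_self hcl
  have s2 : ∀ t₁ ∈ Ioo p q, EqOn (fun t => f t * sin (k * (t₁ - t₀)))
      (fun t => f t₀ * sin (k * (t₁ - t)) + f t₁ * sin (k * (t - t₀))) (Icc p q) :=
    fun t₁ h1 => EqOn.of_subset_closure (fun t ht => s1 t ht t₁ h1 h0)
      (by fun_prop) (by fun_prop) Ioo_subset_Icc_self hcl
  have s3 : EqOn (fun t₁ => f t * sin (k * (t₁ - t₀)))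
      (fun t₁ => f t₀ * sin (k * (t₁ - t)) + f t₁ * sin (k * (t - t₀))) (Icc p q) :=
    EqOn.of_subset_closure (fun t₁ h1 => s2 t₁ h1 ht)
      (by fun_prop) (by fun_prop) Ioo_subset_Icc_self hcl
  exact s3 h1

/-- `f` is the function `A sin (3/2 (θ - α))` on the interval `[α, α + 2π/3]`, contained in
`[0, π]`, and zero on the rest of `[-π, π]`. -/
structure IsWedge (f : ℝ → ℝ) (A α : ℝ) : Prop where
  A_pos : 0 < A
  α_nonneg : 0 ≤ α
  le_pi : α + 2 * π / 3 ≤ π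
  eq_sin : ∀ θ ∈ Icc α (α + 2 * π / 3), f θ = A * sin (3 / 2 * (θ - α))
  eq_zero : ∀ θ ∈ Icc (-π) π, θ ∉ Ioo α (α + 2 * π / 3) → f θ = 0

/-- A nonnegative continuous function that vanishes outside `(0, π)` and solves `f'' = -9/4 f`
weakly where it is positive, is zero or has a single arch of length `2π/3`: two arches do not
fit. -/
lemma eq_zero_or_isWedge {f : ℝ → ℝ} (hf : Continuous f) (hf0 : ∀ θ, 0 ≤ f θ)
    (hz : ∀ θ ∈ Icc (-π) π, θ ∉ Ioo 0 π → f θ = 0)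
    (h : ∀ b : ℝ → ℝ, ContDiff ℝ ∞ b → HasCompactSupport b →
      tsupport b ⊆ {θ | θ ∈ Ioo 0 π ∧ 0 < f θ} →
      ∫ s, f s * deriv (deriv b) s = -(9 / 4) * ∫ s, f s * b s) :
    (∀ θ ∈ Icc (-π) π, f θ = 0) ∨ ∃ A α, IsWedge f A α := by
  have hπ := pi_pos
  -- the arch around a point where `f` is positive
  have arch : ∀ τ ∈ Ioo 0 π, 0 < f τ → ∃ α, 0 ≤ α ∧ α + 2 * π / 3 ≤ π ∧
      τ ∈ Ioo α (α + 2 * π / 3) ∧ f α = 0 ∧ f (α + 2 * π / 3) = 0 ∧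
      (∀ θ ∈ Ioo α (α + 2 * π / 3), 0 < f θ) ∧
      ∃ A, ∀ θ ∈ Icc α (α + 2 * π / 3), f θ = A * sin (3 / 2 * (θ - α)) := by
    intro τ hτ hfτ
    have hcl : IsClosed {θ | f θ = 0} := isClosed_eq hf continuous_const
    have hc1 : IsCompact (Icc 0 τ ∩ {θ | f θ = 0}) := isCompact_Icc.inter_right hcl
    have hc2 : IsCompact (Icc τ π ∩ {θ | f θ = 0}) := isCompact_Icc.inter_right hcl
    obtain ⟨α, ⟨hα, hfα⟩, hαm⟩ := hc1.exists_isGreatest ⟨0, ⟨le_rfl, hτ.1.le⟩,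
      hz 0 ⟨by linarith, hπ.le⟩ (by simp)⟩
    obtain ⟨β, ⟨hβ, hfβ⟩, hβm⟩ := hc2.exists_isLeast ⟨π, ⟨hτ.2.le, le_rfl⟩,
      hz _ ⟨by linarith, le_rfl⟩ (by simp)⟩
    simp only [Set.mem_ofPred_eq] at hfα hfβ
    have hατ : α < τ := by grind
    have hτβ : τ < β := by grind
    have hpos : ∀ θ ∈ Ioo α β, 0 < f θ := by
      intro θ hθ
      refine lt_of_le_of_ne (hf0 θ) fun he => ?_
      rcases le_total θ τ with h1 | h1
      · exact absurd (hαm ⟨⟨hα.1.trans hθ.1.le, h1⟩, he.symm⟩) (not_le.2 hθ.1)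
      · exact absurd (hβm ⟨⟨h1, hθ.2.le.trans hβ.2⟩, he.symm⟩) (not_le.2 hθ.2)
    have h3 : ∀ {t₀ t t₁ : ℝ}, t₀ ∈ Icc α β → t ∈ Icc α β → t₁ ∈ Icc α β →
        f t * sin (3 / 2 * (t₁ - t₀)) = f t₀ * sin (3 / 2 * (t₁ - t))
          + f t₁ * sin (3 / 2 * (t - t₀)) := by
      intro t₀ t t₁ a0 a a1
      refine three_point_of_weak hf (by norm_num) (fun b b1 b2 b3 => ?_) a0 a a1
      rw [h b b1 b2 fun θ hθ => ⟨⟨hα.1.trans_lt (b3 hθ).1, (b3 hθ).2.trans_le hβ.2⟩,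
        hpos θ (b3 hθ)⟩]
      norm_num
    have mα : α ∈ Icc α β := by grind
    have mβ : β ∈ Icc α β := by grind
    have hlen : β = α + 2 * π / 3 := by
      have h4 := h3 mα ⟨hατ.le, hτβ.le⟩ mβ
      rw [hfα, hfβ, zero_mul, zero_mul, add_zero] at h4
      have h5 : sin (3 / 2 * (β - α) - π) = 0 := by
        rw [Real.sin_sub_pi, (mul_eq_zero.1 h4).resolve_left hfτ.ne', neg_zero]
      have h6 := (Real.sin_eq_zero_iff_of_lt_of_lt (by nlinarith [hατ, hτβ])
        (by nlinarith [hα.1, hβ.2])).1 h5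
      linarith
    subst hlen
    have hm : α + π / 3 ∈ Icc α (α + 2 * π / 3) := by grind
    refine ⟨α, hα.1, hβ.2, ⟨hατ, hτβ⟩, hfα, hfβ, hpos, f (α + π / 3), fun θ hθ => ?_⟩
    have e1 : sin (3 / 2 * (α + π / 3 - α)) = 1 := by simp
    have h4 := h3 mα hθ hm
    rw [e1, hfα] at h4
    linarith
  by_cases hall : ∀ θ ∈ Icc (-π) π, f θ = 0
  · exact Or.inl hall
  right
  push Not at hall
  obtain ⟨τ, hτ, hfτ⟩ := hall
  have hτ0 : τ ∈ Ioo 0 π := by grind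
  obtain ⟨α, hα0, hαπ, hτα, hfα, hfβ, hpos, A, hA⟩ :=
    arch τ hτ0 (by grind)
  have hApos : 0 < A := by
    have h1 := hA (α + π / 3) ⟨by linarith, by linarith⟩
    rw [show 3 / 2 * (α + π / 3 - α) = π / 2 by ring, Real.sin_pi_div_two,
      mul_one] at h1
    rw [← h1]
    exact hpos _ ⟨by linarith, by linarith⟩
  refine ⟨A, α, hApos, hα0, hαπ, hA, fun θ hθ hθ' => ?_⟩
  by_contra hne
  have hθ0 : θ ∈ Ioo 0 π := by grind
  obtain ⟨α', hα0', hαπ', hθα', -, -, hpos', -⟩ := arch θ hθ0 (by grind)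
  rcases le_or_gt θ α with h1 | h1
  · grind
  · have h2 : α + 2 * π / 3 ≤ θ := by grind
    exact (hpos' _ ⟨by linarith, h2.trans_lt hθα'.2⟩).ne' hfβ

namespace IsBlowUpLimit

/-- A blow-up limit is zero, or its angular part is a single arch. -/
lemma eq_zero_or_isWedge (h : IsBlowUpLimit C κ v U) :
    (∀ θ ∈ Icc (-π) π, U (unitVec θ) = 0) ∨
      ∃ A α, IsWedge (fun θ => U (unitVec θ)) A α := by
  have hu : Continuous unitVec := by fun_prop
  have hUu : Continuous fun θ => U (unitVec θ) := h.continuous.comp hu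
  refine StokesWave.eq_zero_or_isWedge hUu (fun θ => h.nonneg _) (fun θ hθ hθ' => ?_)
    fun b hb hbc hbs => ?_
  · refine h.lower _ ?_ ?_
    · rw [mem_closedBall_zero_iff, norm_unitVec]; norm_num
    · rw [unitVec_apply_one]
      by_cases h0 : 0 < θ
      · have : θ = π := by grind
        rw [this, Real.sin_pi]
      · exact Real.sin_nonpos_of_nonpos_of_neg_pi_le (not_lt.1 h0) hθ.1
  · have h1 := h.integral_deriv_deriv hb hbc hbs
    have hsub : ∀ g : ℝ → ℝ, (∀ s, s ∉ tsupport b → g s = 0) →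
        ∫ θ in Ioo (-π) π, g θ = ∫ θ, g θ := by
      intro g hg
      refine setIntegral_eq_integral_of_forall_compl_eq_zero fun s hs => hg s fun h2 => hs ?_
      exact ⟨by linarith [(hbs h2).1.1, pi_pos], (hbs h2).1.2⟩
    rw [hsub _ fun s hs => ?_, hsub _ fun s hs => ?_] at h1
    · exact h1
    · rw [image_eq_zero_of_notMem_tsupport hs, mul_zero]
    · have h2 : s ∉ tsupport (deriv (deriv b)) := fun h3 =>
        hs (tsupport_deriv_subset (tsupport_deriv_subset h3))
      rw [image_eq_zero_of_notMem_tsupport h2, mul_zero]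

end IsBlowUpLimit

/-! ### Strong convergence of the gradients -/

lemma abs_norm_sq_sub_norm_sq_le {y : Plane} {M : ℝ} (hx : ‖x‖ ≤ M) (hy : ‖y‖ ≤ M) :
    |‖x‖ ^ 2 - ‖y‖ ^ 2| ≤ 2 * M * ‖x - y‖ := by
  rw [show ‖x‖ ^ 2 - ‖y‖ ^ 2 = (‖x‖ + ‖y‖) * (‖x‖ - ‖y‖) by ring, abs_mul,
    abs_of_nonneg (by positivity)]
  exact mul_le_mul (by linarith) (abs_norm_sub_norm_le x y) (abs_nonneg _)
    (by linarith [norm_nonneg x])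

namespace IsBlowUpLimit

lemma subseq (h : IsBlowUpLimit C κ v U) {s : ℕ → ℕ} (hs : StrictMono s) :
    IsBlowUpLimit C (fun n => κ (s n)) (fun n => v (s n)) U :=
  ⟨fun _ => h.sol _, h.error.comp hs.tendsto_atTop, h.lip, h.nonneg, h.lower,
    fun t ht => hs.tendsto_atTop.eventually (h.tendsto t ht), h.homogeneous⟩

lemma apply_zero (h : IsBlowUpLimit C κ v U) : U 0 = 0 := h.lower 0 (by simp) (by simp)

lemma apply_eq (h : IsBlowUpLimit C κ v U) (hx : x ∈ ball 0 3) :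
    U x = ‖x‖ ^ (3 / 2 : ℝ) * U (unitVec (polarAngle x)) := by
  rcases eq_or_ne x 0 with rfl | hx0
  · rw [h.apply_zero, norm_zero, Real.zero_rpow (by norm_num), zero_mul]
  · rw [mem_ball_zero_iff] at hx
    rw [← h.apply_polar (norm_pos_iff.2 hx0) hx, norm_smul_unitVec_polarAngle]

lemma polarAngle_mem_Icc (x : Plane) : polarAngle x ∈ Icc (-π) π :=
  ⟨(Complex.neg_pi_lt_arg _).le, Complex.arg_le_pi _⟩

lemma polarAngle_mem_of_pos (h : IsBlowUpLimit C κ v U) {A α : ℝ}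
    (hf : IsWedge (fun θ => U (unitVec θ)) A α) (hx : x ∈ ball 0 3)
    (hpos : 0 < U x) : polarAngle x ∈ Ioo α (α + 2 * π / 3) := by
  by_contra h1
  rw [h.apply_eq hx, hf.eq_zero _ (polarAngle_mem_Icc x) h1, mul_zero] at hpos
  exact lt_irrefl _ hpos

lemma coord_pos_of_pos (h : IsBlowUpLimit C κ v U) (hx : x ∈ ball 0 3)
    (hpos : 0 < U x) : 0 < x 1 := by
  by_contra h1
  rw [h.lower x (ball_subset_closedBall hx) (not_lt.1 h1)] at hpos
  exact lt_irrefl _ hpos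

lemma contDiffOn (h : IsBlowUpLimit C κ v U) :
    ContDiffOn ℝ 1 U {x | x ∈ ball 0 3 ∧ 0 < U x} := by
  rcases h.eq_zero_or_isWedge with h0 | ⟨A, α, hf⟩
  · rintro x ⟨hx, hpos⟩
    rw [h.apply_eq hx, h0 _ (polarAngle_mem_Icc x), mul_zero] at hpos
    exact absurd hpos (lt_irrefl _)
  · rintro x ⟨hx, hpos⟩
    refine ContDiffAt.contDiffWithinAt ?_
    have hx1 := h.coord_pos_of_pos hx hpos
    have hx0 : x ≠ 0 := by rintro rfl; simp at hx1
    have heq : U =ᶠ[𝓝 x] fun y => ‖y‖ ^ (3 / 2 : ℝ)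
        * (A * sin (3 / 2 * (polarAngle y - α))) := by
      filter_upwards [isOpen_ball.mem_nhds hx,
        (isOpen_lt continuous_const h.continuous).mem_nhds hpos] with y hy hy0
      rw [h.apply_eq hy, hf.eq_sin _ (Ioo_subset_Icc_self (h.polarAngle_mem_of_pos hf hy hy0))]
    refine ContDiffAt.congr_of_eventuallyEq ?_ heq
    have h1 : ContDiffAt ℝ 1 polarAngle x :=
      (contDiffAt_polarAngle hx1).of_le (by simp)
    refine ((contDiffAt_norm ℝ hx0).rpow_const_of_ne (by positivity)).mul ?_
    exact contDiffAt_const.mul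
      (by fun_prop)

/-- The energy identity for the limit. -/
lemma energy (h : IsBlowUpLimit C κ v U) (hη : ContDiff ℝ 1 η)
    (hc : HasCompactSupport η) (hηs : tsupport η ⊆ ball 0 2) :
    ∫ x, (‖∇ U x‖ ^ 2 * η x + U x * ⟪∇ U x, ∇ η x⟫) = 0 := by
  obtain ⟨K, hK⟩ := h.lip
  have := h.almostHarmonic.energy isOpen_ball le_rfl hK h.nonneg
    (h.contDiffOn.mono fun x hx => ⟨ball_subset_ball (by norm_num) hx.1, hx.2⟩) hη hc hηs
  rw [zero_mul] at this
  exact abs_nonpos_iff.1 this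

lemma tsupport_gradient_subset (η : Plane → ℝ) : tsupport (∇ η) ⊆ tsupport η := by
  refine (closure_mono fun x hx => ?_).trans (tsupport_fderiv_subset ℝ)
  intro h0; exact hx (by simp [gradient, h0])

lemma integrable_norm_sq_mul (hK : LipschitzWith K w)
    (hη : Continuous η) (hc : HasCompactSupport η) :
    Integrable fun x => ‖∇ w x‖ ^ 2 * η x :=
  integrable_mul_test (by fun_prop)
    (continuous_const (y := (K : ℝ) ^ 2))
    (fun x => by rw [abs_pow, abs_norm]; gcongr; exact norm_gradient_le hK x) hη hc

lemma integrable_mul_inner {p : Plane → ℝ} (hK : LipschitzWith K w)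
    (hp : Continuous p) {G : Plane → Plane} (hG : Continuous G) (hc : HasCompactSupport G) :
    Integrable fun x => p x * ⟪∇ w x, G x⟫ := by
  have h1 : Integrable fun x => K * (|p x| * ‖G x‖) :=
    (hp.abs.mul hG.norm |>.integrable_of_hasCompactSupport hc.norm.mul_left).const_mul _
  refine h1.mono' (hp.measurable.mul
    (by fun_prop)).aestronglyMeasurable
    (.of_forall fun x => ?_)
  rw [norm_mul, norm_eq_abs, norm_eq_abs]
  have h2 := (abs_real_inner_le_norm (∇ w x) (G x)).trans
    (mul_le_mul_of_nonneg_right (norm_gradient_le hK x) (norm_nonneg _))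
  calc |p x| * |⟪∇ w x, G x⟫| ≤ |p x| * (K * ‖G x‖) := by gcongr
    _ = _ := by ring

/-- The local energies converge: this follows from the energy identities of `v n` and of the
limit, because the remaining terms are continuous with respect to weak convergence. -/
lemma tendsto_integral_norm_sq (h : IsBlowUpLimit C κ v U) (hη : ContDiff ℝ 1 η)
    (hc : HasCompactSupport η) (hηs : tsupport η ⊆ ball 0 2) :
    Tendsto (fun n => ∫ x, ‖∇ (v n) x‖ ^ 2 * η x) atTop
      (𝓝 (∫ x, ‖∇ U x‖ ^ 2 * η x)) := by
  obtain ⟨K, hK⟩ := h.lip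
  obtain ⟨M, hM0, hM, hMU⟩ := h.exists_gradient_bound
  have hgc := continuous_gradient hη
  have hgs := hasCompactSupport_gradient hc
  have hgz : ∀ x, x ∉ closedBall 0 2 → ∇ η x = 0 := fun x hx =>
    image_eq_zero_of_notMem_tsupport fun hx' => hx
      (ball_subset_closedBall (hηs (tsupport_gradient_subset η hx')))
  have i1 : ∀ n, Integrable fun x => ‖∇ (v n) x‖ ^ 2 * η x := fun n => by
    obtain ⟨K', hK'⟩ := (h.sol n).lip
    exact integrable_norm_sq_mul hK' hη.continuous hc
  have i2 : ∀ n p, Continuous p → Integrable fun x => p x * ⟪∇ (v n) x, ∇ η x⟫ :=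
    fun n p hp => by
      obtain ⟨K', hK'⟩ := (h.sol n).lip
      exact integrable_mul_inner hK' hp hgc hgs
  have hcont : ∀ n, Continuous (v n) := fun n => (h.sol n).continuous
  -- the lower order terms
  have l1 : Tendsto (fun n => ∫ x, U x * ⟪∇ (v n) x, ∇ η x⟫) atTop
      (𝓝 (∫ x, U x * ⟪∇ U x, ∇ η x⟫)) := by
    have := h.tendsto_integral_inner (G := fun x => U x • ∇ η x)
      ((hK.continuous.smul hgc).integrable_of_hasCompactSupport hgs.smul_left)
      (fun x hx => by rw [hgz x hx, smul_zero])
    simpa only [inner_smul_right] using this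
  have l2 : Tendsto (fun n => ∫ x, (v n x - U x) * ⟪∇ (v n) x, ∇ η x⟫)
      atTop (𝓝 0) := by
    rw [Metric.tendsto_nhds]
    intro ε hε
    set I := ∫ x, ‖∇ η x‖ with hI
    have hI0 : 0 ≤ I := by positivity
    have hε' : 0 < ε / (M * I + 1) := by positivity
    filter_upwards [Metric.tendstoUniformlyOn_iff.1 h.tendsto _ hε'] with n hn
    rw [dist_eq, sub_zero, ← norm_eq_abs]
    refine (norm_integral_le_of_norm_le ((hgc.norm.integrable_of_hasCompactSupport
      hgs.norm).const_mul (ε / (M * I + 1) * M)) ?_).trans_lt ?_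
    · filter_upwards [hM n] with x hx
      by_cases hx3 : x ∈ closedBall 0 3
      · have h1 := hn x hx3
        rw [dist_comm, dist_eq] at h1
        rw [norm_mul, norm_eq_abs, norm_eq_abs]
        have h2 := (abs_real_inner_le_norm (∇ (v n) x) (∇ η x)).trans
          (mul_le_mul_of_nonneg_right (hx hx3) (norm_nonneg _))
        calc |v n x - U x| * |⟪∇ (v n) x, ∇ η x⟫|
            ≤ ε / (M * I + 1) * (M * ‖∇ η x‖) := by gcongr
          _ = _ := by ring
      · rw [hgz x fun hx2 => hx3 (closedBall_subset_closedBall (by norm_num) hx2)]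
        simp
    · rw [integral_const_mul, ← hI, div_mul_eq_mul_div, div_mul_eq_mul_div,
        div_lt_iff₀ (by positivity)]
      nlinarith
  have l3 : Tendsto (fun n => ∫ x, (‖∇ (v n) x‖ ^ 2 * η x
      + v n x * ⟪∇ (v n) x, ∇ η x⟫)) atTop (𝓝 0) := by
    have hz : Tendsto (fun n => κ n * ∫ x, 8 * √(C * 4) * (|η x| + 4 * ‖∇ η x‖)) atTop
        (𝓝 0) := by simpa using h.error.mul_const _
    exact squeeze_zero_norm (fun n => (h.sol n).energy_le hη hc
      (hηs.trans (ball_subset_ball (by norm_num)))) hz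
  have heq : ∀ n, ∫ x, ‖∇ (v n) x‖ ^ 2 * η x
      = (∫ x, (‖∇ (v n) x‖ ^ 2 * η x
        + v n x * ⟪∇ (v n) x, ∇ η x⟫))
      - (∫ x, (v n x - U x) * ⟪∇ (v n) x, ∇ η x⟫)
      - ∫ x, U x * ⟪∇ (v n) x, ∇ η x⟫ := by
    intro n
    have i3 : Integrable fun x => (v n x - U x) * ⟪∇ (v n) x, ∇ η x⟫ :=
      i2 n _ ((hcont n).sub hK.continuous)
    rw [integral_add (i1 n) (i2 n _ (hcont n)), sub_sub,
      ← integral_add i3 (i2 n _ hK.continuous)]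
    rw [eq_sub_iff_add_eq]
    congr 2; ext x; ring
  have hU := h.energy hη hc hηs
  rw [integral_add (integrable_norm_sq_mul hK hη.continuous hc)
    (integrable_mul_inner hK hK.continuous hgc hgs)] at hU
  have := (l3.sub l2).sub l1
  rw [show 0 - 0 - ∫ x, U x * ⟪∇ U x, ∇ η x⟫
    = ∫ x, ‖∇ U x‖ ^ 2 * η x by linarith] at this
  exact this.congr fun n => (heq n).symm

lemma tendsto_integral_norm_sub_sq_mul (h : IsBlowUpLimit C κ v U)
    (hη : ContDiff ℝ 1 η) (hc : HasCompactSupport η) (hηs : tsupport η ⊆ ball 0 2) :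
    Tendsto (fun n => ∫ x, ‖∇ (v n) x - ∇ U x‖ ^ 2 * η x) atTop (𝓝 0) := by
  obtain ⟨K, hK⟩ := h.lip
  have hG : Integrable fun x => η x • ∇ U x := by
    have h1 : Integrable fun x => ‖η x‖ * K :=
      (hη.continuous.norm.integrable_of_hasCompactSupport hc.norm).mul_const _
    refine h1.mono' (hη.continuous.measurable.smul (by fun_prop)).aestronglyMeasurable
      (.of_forall fun x => ?_)
    rw [norm_smul]
    exact mul_le_mul_of_nonneg_left (norm_gradient_le hK x) (norm_nonneg _)
  have l1 := h.tendsto_integral_inner hG fun x hx => by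
    rw [image_eq_zero_of_notMem_tsupport fun hx' => hx (ball_subset_closedBall (hηs hx')),
      zero_smul]
  have l2 := h.tendsto_integral_norm_sq hη hc hηs
  have i0 := integrable_norm_sq_mul hK hη.continuous hc
  have key : ∀ w : Plane → ℝ, (∃ K, LipschitzWith K w) →
      ∫ x, ‖∇ w x - ∇ U x‖ ^ 2 * η x
        = (∫ x, ‖∇ w x‖ ^ 2 * η x) - 2 * (∫ x, ⟪∇ w x, η x • ∇ U x⟫)
          + ∫ x, ‖∇ U x‖ ^ 2 * η x := by
    rintro w ⟨K', hK'⟩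
    have i1 := integrable_norm_sq_mul hK' hη.continuous hc
    have i2 : Integrable fun x => ⟪∇ w x, η x • ∇ U x⟫ := by
      refine (hG.norm.const_mul (K' : ℝ)).mono' ((measurable_gradient w).inner
        (hη.continuous.measurable.smul (by fun_prop))).aestronglyMeasurable
        (.of_forall fun x => ?_)
      exact (norm_inner_le_norm _ _).trans
        (mul_le_mul_of_nonneg_right (norm_gradient_le hK' x) (norm_nonneg _))
    have i12 : Integrable fun x => ‖∇ w x‖ ^ 2 * η x
        - 2 * ⟪∇ w x, η x • ∇ U x⟫ := i1.sub (i2.const_mul 2)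
    rw [← integral_const_mul, ← integral_sub i1 (i2.const_mul 2), ← integral_add i12 i0]
    congr 1; ext x
    rw [norm_sub_sq_real, inner_smul_right]; ring
  have := (l2.sub (l1.const_mul 2)).add_const (∫ x, ‖∇ U x‖ ^ 2 * η x)
  rw [← key U h.lip] at this
  simp only [sub_self, norm_zero, ne_eq, OfNat.ofNat_ne_zero, not_false_eq_true, zero_pow, zero_mul,
    integral_zero] at this
  exact this.congr fun n => (key (v n) (h.sol n).lip).symm

/-- Strong convergence of the gradients in `L²`. -/
lemma tendsto_integral_norm_sub_sq (h : IsBlowUpLimit C κ v U) :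
    Tendsto (fun n => ∫ x in closedBall (0 : Plane) (3 / 2),
      ‖∇ (v n) x - ∇ U x‖ ^ 2) atTop (𝓝 0) := by
  let χ : ContDiffBump (0 : Plane) := ⟨3 / 2, 7 / 4, by norm_num, by norm_num⟩
  have h1 := h.tendsto_integral_norm_sub_sq_mul χ.contDiff χ.hasCompactSupport
    (by rw [χ.tsupport_eq]; exact closedBall_subset_ball (by norm_num))
  refine squeeze_zero (fun n => integral_nonneg fun x => sq_nonneg _) (fun n => ?_) h1
  obtain ⟨K, hK⟩ := h.lip
  obtain ⟨K', hK'⟩ := (h.sol n).lip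
  have hi : Integrable fun x => ‖∇ (v n) x - ∇ U x‖ ^ 2 * χ x := by
    refine integrable_mul_test (((measurable_gradient _).sub (measurable_gradient _)).norm.pow_const 2)
      (continuous_const (y := ((K' : ℝ) + K) ^ 2)) (fun x => ?_) χ.continuous χ.hasCompactSupport
    rw [abs_pow, abs_norm]
    gcongr
    exact (norm_sub_le _ _).trans (add_le_add (norm_gradient_le hK' x) (norm_gradient_le hK x))
  calc ∫ x in closedBall (0 : Plane) (3 / 2), ‖∇ (v n) x - ∇ U x‖ ^ 2
      = ∫ x in closedBall (0 : Plane) (3 / 2), ‖∇ (v n) x - ∇ U x‖ ^ 2 * χ x := by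
        refine setIntegral_congr_fun measurableSet_closedBall fun x hx => ?_
        rw [χ.one_of_mem_closedBall hx, mul_one]
    _ ≤ _ := setIntegral_le_integral hi
        (.of_forall fun x => mul_nonneg (sq_nonneg _) χ.nonneg)

/-- Strong convergence of the gradients in `L¹`. -/
lemma tendsto_integral_norm_sub (h : IsBlowUpLimit C κ v U) :
    Tendsto (fun n => ∫ x in closedBall (0 : Plane) (3 / 2),
      ‖∇ (v n) x - ∇ U x‖) atTop (𝓝 0) := by
  set S := closedBall (0 : Plane) (3 / 2)
  set V := (volume S).toReal
  have hV0 : 0 ≤ V := ENNReal.toReal_nonneg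
  have hSf : volume S ≠ ⊤ := measure_closedBall_lt_top.ne
  have h2 := h.tendsto_integral_norm_sub_sq
  have hbd : ∀ ε > 0, ∀ n, ∫ x in S, ‖∇ (v n) x - ∇ U x‖
      ≤ ε * V + (∫ x in S, ‖∇ (v n) x - ∇ U x‖ ^ 2) / ε := by
    intro ε hε n
    obtain ⟨K, hK⟩ := h.lip
    obtain ⟨K', hK'⟩ := (h.sol n).lip
    have hm : Measurable fun x => ∇ (v n) x - ∇ U x := by fun_prop
    have hb : ∀ x, ‖∇ (v n) x - ∇ U x‖ ≤ K' + K := fun x =>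
      (norm_sub_le _ _).trans (add_le_add (norm_gradient_le hK' x) (norm_gradient_le hK x))
    have i1 : IntegrableOn (fun x => ‖∇ (v n) x - ∇ U x‖) S :=
      Measure.integrableOn_of_bounded (M := (K' : ℝ) + K) hSf hm.norm.aestronglyMeasurable
        (.of_forall fun x => by rw [norm_norm]; exact hb x)
    have i2 : IntegrableOn (fun x => ‖∇ (v n) x - ∇ U x‖ ^ 2) S :=
      Measure.integrableOn_of_bounded (M := ((K' : ℝ) + K) ^ 2) hSf
        (hm.norm.pow_const 2).aestronglyMeasurable
        (.of_forall fun x => by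
          rw [norm_pow, norm_norm]; gcongr; exact hb x)
    have i3 : IntegrableOn (fun _ : Plane => ε) S := integrableOn_const hSf
    calc ∫ x in S, ‖∇ (v n) x - ∇ U x‖
        ≤ ∫ x in S, (ε + ‖∇ (v n) x - ∇ U x‖ ^ 2 / ε) := by
          refine integral_mono i1 (i3.add (i2.div_const ε)) fun x => ?_
          simp only
          set q := ‖∇ (v n) x - ∇ U x‖
          rw [← sub_nonneg]
          have : ε + q ^ 2 / ε - q = ((ε - q / 2) ^ 2 + 3 / 4 * q ^ 2) / ε := by
            field_simp; ring
          rw [this]; positivity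
      _ = _ := by
          rw [integral_add i3 (i2.div_const ε), setIntegral_const, integral_div, smul_eq_mul,
            mul_comm]
          rfl
  rw [Metric.tendsto_nhds]
  intro η hη
  set ε := η / (2 * (V + 1)) with hε
  have hε0 : 0 < ε := by positivity
  have h3 : ε * V < η / 2 := by
    have : ε * (V + 1) = η / 2 := by rw [hε]; field_simp
    nlinarith
  have h4 := h2.div_const ε
  rw [zero_div] at h4
  filter_upwards [h4.eventually (gt_mem_nhds (half_pos hη))] with n hn
  rw [dist_eq, sub_zero, abs_of_nonneg (integral_nonneg fun x => norm_nonneg _)]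
  linarith [hbd ε hε0 n]

end IsBlowUpLimit

/-! ### Characteristic functions with bounded variation and vanishing gradient -/

/-- A translation difference `ψ - ψ(· - h)` is the divergence of the field
`h ∫₀¹ ψ(· - τ h) dτ`. -/
lemma exists_divergence_eq_sub {G : Set Plane} (hψ : ContDiff ℝ 1 ψ)
    (hc : HasCompactSupport ψ) {h : Plane} {S : Set Plane} (hS : IsCompact S)
    (hseg : ∀ x ∈ tsupport ψ, ∀ τ ∈ Icc (0 : ℝ) 1, x + τ • h ∈ S) (hSG : S ⊆ G) {M : ℝ}
    (hM : ∀ x, |ψ x| ≤ M) :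
    ∃ φ, IsTestField G φ ∧ tsupport φ ⊆ S ∧ (∀ x, ‖φ x‖ ≤ M * ‖h‖) ∧
      ∀ x, divergence φ x = ψ x - ψ (x - h) := by
  set Ψ : Plane → ℝ := fun x => ∫ τ in (0 : ℝ)..1, ψ (x - τ • h) with hΨ
  have hM0 : 0 ≤ M := (abs_nonneg _).trans (hM 0)
  have hfd : Continuous (fderiv ℝ ψ) := by fun_prop
  obtain ⟨B, hB⟩ := (hc.fderiv (𝕜 := ℝ)).exists_bound_of_continuous hfd
  have hcont : Continuous (Function.uncurry fun (x : Plane) (τ : ℝ) => fderiv ℝ ψ (x - τ • h)) :=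
    hfd.comp (by fun_prop)
  have hder : ∀ x, HasFDerivAt Ψ (∫ τ in (0 : ℝ)..1, fderiv ℝ ψ (x - τ • h)) x := by
    intro x
    have hψc := hψ.continuous
    refine intervalIntegral.hasFDerivAt_integral_of_dominated_of_fderiv_le
      (bound := fun _ => B) (F' := fun x τ => fderiv ℝ ψ (x - τ • h)) univ_mem ?_ ?_ ?_ ?_ ?_ ?_
    · exact .of_forall fun y =>
        (hψc.comp (by fun_prop : Continuous fun τ : ℝ => y - τ • h)).aestronglyMeasurable
    · exact (hψc.comp (by fun_prop : Continuous fun τ : ℝ => x - τ • h)).intervalIntegrable _ _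
    · fun_prop
    · simp_all
    · simp
    · refine .of_forall fun τ _ y _ => ?_
      have h1 := ((hψ.differentiable (by norm_num)) (y - τ • h)).hasFDerivAt.comp y
        ((hasFDerivAt_id y).sub_const (τ • h))
      rw [ContinuousLinearMap.comp_id] at h1
      exact h1
  have hΨd : ContDiff ℝ 1 Ψ := by
    rw [contDiff_one_iff_fderiv]
    refine ⟨fun x => (hder x).differentiableAt, ?_⟩
    rw [show fderiv ℝ Ψ = fun x => ∫ τ in (0 : ℝ)..1, fderiv ℝ ψ (x - τ • h) from
      funext fun x => (hder x).fderiv]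
    exact intervalIntegral.continuous_parametric_intervalIntegral_of_continuous' hcont _ _
  have hsupp : tsupport (fun x => Ψ x • h) ⊆ S := by
    refine closure_minimal (fun x hx => ?_) hS.isClosed
    by_contra h1
    have h2 : Ψ x = 0 := by
      have : ∀ τ ∈ uIcc (0 : ℝ) 1, ψ (x - τ • h) = 0 := by
        intro τ hτ
        rw [uIcc_of_le zero_le_one] at hτ
        refine image_eq_zero_of_notMem_tsupport fun h3 => h1 ?_
        simpa using hseg _ h3 τ hτ
      simp only [hΨ]
      rw [intervalIntegral.integral_congr this, intervalIntegral.integral_zero]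
    exact hx (by simp [h2])
  refine ⟨fun x => Ψ x • h, ⟨hΨd.smul contDiff_const,
    hS.of_isClosed_subset (isClosed_tsupport _) hsupp, hsupp.trans hSG⟩, hsupp, fun x => ?_,
    fun x => ?_⟩
  · rw [norm_smul]
    refine mul_le_mul_of_nonneg_right ?_ (norm_nonneg _)
    have := intervalIntegral.norm_integral_le_of_norm_le_const (a := 0) (b := 1)
      (f := fun τ => ψ (x - τ • h)) (C := M) fun τ _ => hM _
    simpa using this
  · have h1 : divergence (fun x => Ψ x • h) x = fderiv ℝ Ψ x h := by
      rw [divergence_smul (hder x).differentiableAt (differentiableAt_const h)]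
      simp [divergence]
    rw [h1, (hder x).fderiv]
    have hi : IntervalIntegrable (fun τ : ℝ => fderiv ℝ ψ (x - τ • h)) volume 0 1 :=
      (hfd.comp (by fun_prop : Continuous fun τ : ℝ => x - τ • h)).intervalIntegrable _ _
    rw [ContinuousLinearMap.intervalIntegral_apply hi]
    have hfdh : Continuous fun y => fderiv ℝ ψ y h := by fun_prop
    have h4 : ∀ τ : ℝ, HasDerivAt (fun τ : ℝ => - ψ (x - τ • h)) (fderiv ℝ ψ (x - τ • h) h) τ := by
      intro τ
      have h5 : HasDerivAt (fun τ : ℝ => x - τ • h) (-((1 : ℝ) • h)) τ :=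
        ((hasDerivAt_id τ).smul_const h).const_sub x
      have h6 := (((hψ.differentiable (by norm_num)) (x - τ • h)).hasFDerivAt.comp_hasDerivAt τ
        h5).neg
      refine h6.congr_deriv ?_
      simp
    rw [intervalIntegral.integral_eq_sub_of_hasDerivAt (fun τ _ => h4 τ)
      ((hfdh.comp (by fun_prop : Continuous fun τ : ℝ => x - τ • h)).intervalIntegrable _ _)]
    simp; ring

/-- Translation estimate for functions of bounded variation, in dual form. -/
lemma abs_integral_mul_sub_translate_le {χ : Plane → ℝ} (hm : Measurable χ)
    (h0 : ∀ x, |χ x| ≤ 1) {K S G : Set Plane} {B δ : ℝ} (hK : IsCompact K)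
    (hS : IsCompact S) (hSG : S ⊆ G)
    (hKS : ∀ x ∈ K, ∀ z, ‖z‖ ≤ 2 * δ → x + z ∈ S)
    (hB : ∀ φ M, IsTestField G φ → tsupport φ ⊆ S → (∀ x, ‖φ x‖ ≤ M) →
      |∫ x, χ x * divergence φ x| ≤ M * B) {F : Plane → ℝ} (hF : Measurable F)
    (hF1 : ∀ x, |F x| ≤ 1) (hF0 : ∀ x, x ∉ K → F x = 0) (hδ : 0 < δ) {h : Plane} (hh : ‖h‖ ≤ δ) :
    |∫ x, χ x * (F x - F (x - h))| ≤ ‖h‖ * B := by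
  have hFi : Integrable F := by
    have h1 : Integrable (K.indicator fun _ => (1 : ℝ)) :=
      (integrable_indicator_iff hK.measurableSet).2 (integrableOn_const hK.measure_lt_top.ne)
    refine h1.mono' hF.aestronglyMeasurable (.of_forall fun x => ?_)
    by_cases hx : x ∈ K
    · simp_all
    · simp_all
  let ϖ : ℕ → ContDiffBump (0 : Plane) := fun n =>
    ⟨δ / (2 * (n + 1)), δ / (n + 1), by positivity, by
      rw [div_lt_div_iff_of_pos_left hδ (by positivity) (by positivity)]
      have : 0 ≤ n := Nat.cast_nonneg n
      linarith⟩
  have hϖ : Tendsto (fun n => (ϖ n).rOut) atTop (𝓝 0) := by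
    have := (tendsto_one_div_add_atTop_nhds_zero_nat).const_mul δ
    rw [mul_zero] at this
    refine this.congr fun n => ?_
    simp only [ϖ]; ring
  have hϖδ : ∀ n, (ϖ n).rOut ≤ δ := fun n => by
    simp only [ϖ]
    rw [div_le_iff₀ (by positivity)]
    have : (0 : ℝ) ≤ n := Nat.cast_nonneg n
    nlinarith
  set f : ℕ → Plane → ℝ := fun n =>
    MeasureTheory.convolution ((ϖ n).normed volume) F (ContinuousLinearMap.lsmul ℝ ℝ) volume
    with hf
  have hfd : ∀ n, ContDiff ℝ 1 (f n) := fun n =>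
    HasCompactSupport.contDiff_convolution_left _ (n := 1) (ϖ n).hasCompactSupport_normed
      (ϖ n).contDiff_normed hFi.locallyIntegrable
  have hf1 : ∀ n x, |f n x| ≤ 1 := by
    intro n x
    have h1 : ∀ t, ‖(ϖ n).normed volume t * F (x - t)‖ ≤ (ϖ n).normed volume t := by
      intro t
      rw [norm_mul, norm_of_nonneg ((ϖ n).nonneg_normed t)]
      exact mul_le_of_le_one_right ((ϖ n).nonneg_normed t) (hF1 _)
    have h2 := norm_integral_le_of_norm_le ((ϖ n).integrable_normed (μ := volume))
      (.of_forall h1)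
    rw [(ϖ n).integral_normed] at h2
    exact h2
  have hfs : ∀ n x, f n x ≠ 0 → ∃ y ∈ K, ‖x - y‖ ≤ δ := by
    intro n x hx
    obtain ⟨a, ha, b, hb, hab⟩ := support_convolution_subset_swap _ hx
    refine ⟨a, ?_, ?_⟩
    · by_contra h1; exact ha (hF0 a h1)
    · simp only at hab
      rw [← hab, add_sub_cancel_left]
      have h1 : b ∈ tsupport ((ϖ n).normed volume) := subset_tsupport _ hb
      rw [(ϖ n).tsupport_normed_eq, mem_closedBall_zero_iff] at h1
      exact h1.trans (hϖδ n)
  have hts : ∀ n, ∀ x ∈ tsupport (f n), ∃ y ∈ K, ‖x - y‖ ≤ δ := by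
    intro n x hx
    have h1 : IsClosed (cthickening δ K) := Metric.isClosed_cthickening
    have h2 : tsupport (f n) ⊆ cthickening δ K := by
      refine closure_minimal (fun z hz => ?_) h1
      obtain ⟨y, hy, hzy⟩ := hfs n z hz
      exact mem_cthickening_of_dist_le z y δ K hy (by rwa [dist_eq_norm])
    have h3 := h2 hx
    rw [hK.cthickening_eq_biUnion_closedBall hδ.le] at h3
    obtain ⟨y, hy, hxy⟩ := mem_iUnion₂.1 h3
    exact ⟨y, hy, by rwa [mem_closedBall, dist_eq_norm] at hxy⟩
  have hfc : ∀ n, HasCompactSupport (f n) := fun n => by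
    refine hK.cthickening (r := δ) |>.of_isClosed_subset (isClosed_tsupport _) fun x hx => ?_
    obtain ⟨y, hy, hxy⟩ := hts n x hx
    exact mem_cthickening_of_dist_le x y δ K hy (by rwa [dist_eq_norm])
  have hbd : ∀ n, |∫ x, χ x * (f n x - f n (x - h))| ≤ ‖h‖ * B := by
    intro n
    obtain ⟨φ, hφ, hφS, hφM, hφd⟩ := exists_divergence_eq_sub (h := h) (hfd n) (hfc n) hS
      (fun x hx τ hτ => by
        obtain ⟨y, hy, hxy⟩ := hts n x hx
        have := hKS y hy (x - y + τ • h) ((norm_add_le _ _).trans (by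
          rw [norm_smul, norm_of_nonneg hτ.1]
          have := mul_le_mul hτ.2 hh (norm_nonneg _) zero_le_one
          linarith))
        convert! this using 1
        abel) hSG (hf1 n)
    have := hB φ (1 * ‖h‖) hφ hφS hφM
    simp only [hφd, one_mul] at this
    exact this
  -- pass to the limit almost everywhere
  have hae := ContDiffBump.ae_convolution_tendsto_right_of_locallyIntegrable (μ := volume) (K := 2)
    (φ := ϖ) hϖ (.of_forall fun n => by
      simp only [ϖ]
      apply le_of_eq; field_simp) hFi.locallyIntegrable
  have hae' : ∀ᵐ x, Tendsto (fun n => f n (x - h)) atTop (𝓝 (F (x - h))) :=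
    (measurePreserving_sub_right volume h).quasiMeasurePreserving.ae hae
  have hlim : Tendsto (fun n => ∫ x, χ x * (f n x - f n (x - h))) atTop
      (𝓝 (∫ x, χ x * (F x - F (x - h)))) := by
    set T := cthickening (2 * δ) K with hT
    have hTc : IsCompact T := hK.cthickening
    have h1 : Integrable (T.indicator fun _ => (2 : ℝ)) :=
      (integrable_indicator_iff hTc.measurableSet).2 (integrableOn_const hTc.measure_lt_top.ne)
    refine tendsto_integral_of_dominated_convergence _ (fun n => ?_) h1 (fun n => ?_) ?_
    · exact (hm.mul (((hfd n).continuous.sub ((hfd n).continuous.comp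
        (continuous_id.sub continuous_const))).measurable)).aestronglyMeasurable
    · refine .of_forall fun x => ?_
      have h2 : ‖χ x * (f n x - f n (x - h))‖ ≤ 2 := by
        rw [norm_mul]
        have a1 := h0 x
        have a2 := (norm_sub_le (f n x) (f n (x - h))).trans (add_le_add (hf1 n x) (hf1 n (x - h)))
        calc ‖χ x‖ * ‖f n x - f n (x - h)‖ ≤ 1 * (1 + 1) :=
              mul_le_mul a1 a2 (norm_nonneg _) zero_le_one
          _ = 2 := by norm_num
      by_cases hx : x ∈ T
      · simp_all
      · rw [indicator_of_notMem hx]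
        have h3 : f n x = 0 := by
          by_contra h4
          obtain ⟨y, hy, hxy⟩ := hfs n x h4
          exact hx (mem_cthickening_of_dist_le x y _ K hy (by rw [dist_eq_norm]; linarith))
        have h4 : f n (x - h) = 0 := by
          by_contra h4
          obtain ⟨y, hy, hxy⟩ := hfs n _ h4
          refine hx (mem_cthickening_of_dist_le x y _ K hy ?_)
          rw [dist_eq_norm, show x - y = x - h - y + h by abel]
          exact (norm_add_le _ _).trans (by linarith)
        simp [h3, h4]
    · filter_upwards [hae, hae'] with x h2 h3
      exact (h2.sub h3).const_mul _
  exact le_of_tendsto hlim.abs (.of_forall hbd)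

/-- The previous estimate, averaged over the translations with a mollifier. -/
lemma abs_integral_mul_sub_mollify_le {χ : Plane → ℝ} (hm : Measurable χ)
    (h0 : ∀ x, |χ x| ≤ 1) {K S G : Set Plane} {B δ : ℝ} (hK : IsCompact K)
    (hS : IsCompact S) (hSG : S ⊆ G)
    (hKS : ∀ x ∈ K, ∀ z, ‖z‖ ≤ 2 * δ → x + z ∈ S)
    (hB : ∀ φ M, IsTestField G φ → tsupport φ ⊆ S → (∀ x, ‖φ x‖ ≤ M) →
      |∫ x, χ x * divergence φ x| ≤ M * B) {F : Plane → ℝ} (hF : Measurable F)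
    (hF1 : ∀ x, |F x| ≤ 1) (hF0 : ∀ x, x ∉ K → F x = 0) (hB0 : 0 ≤ B)
    (ϖ : ContDiffBump (0 : Plane)) (hϖ : ϖ.rOut ≤ δ) :
    |∫ y, F y * (χ y - ∫ z, χ (y - z) * ϖ.normed volume z)| ≤ δ * B := by
  have hδ : 0 < δ := ϖ.rOut_pos.trans_le hϖ
  have hF' : Integrable F := by
    have h1 : Integrable (K.indicator fun _ => (1 : ℝ)) :=
      (integrable_indicator_iff hK.measurableSet).2 (integrableOn_const hK.measure_lt_top.ne)
    refine h1.mono' hF.aestronglyMeasurable (.of_forall fun x => ?_)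
    by_cases hx : x ∈ K
    · simp_all
    · simp_all
  have hϖi : Integrable (ϖ.normed volume) := ϖ.integrable_normed
  have hϖm : Measurable (ϖ.normed volume) := ϖ.continuous_normed.measurable
  have hi : Integrable (Function.uncurry fun y z => F y * (χ y - χ (y - z)) * ϖ.normed volume z)
      (volume.prod volume) := by
    have h1 := (hF'.norm.mul_prod hϖi.norm).const_mul 2
    refine h1.mono' ?_ (.of_forall fun p => ?_)
    · fun_prop
    · simp only [Function.uncurry]
      rw [norm_mul, norm_mul]
      have a1 : ‖χ p.1 - χ (p.1 - p.2)‖ ≤ 2 :=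
        (norm_sub_le _ _).trans (by
          have := add_le_add (h0 p.1) (h0 (p.1 - p.2))
          simp only [norm_eq_abs]; linarith)
      calc ‖F p.1‖ * ‖χ p.1 - χ (p.1 - p.2)‖ * ‖ϖ.normed volume p.2‖
          ≤ ‖F p.1‖ * 2 * ‖ϖ.normed volume p.2‖ := by gcongr
        _ = _ := by ring
  have e1 : ∀ y, F y * (χ y - ∫ z, χ (y - z) * ϖ.normed volume z)
      = ∫ z, F y * (χ y - χ (y - z)) * ϖ.normed volume z := by
    intro y
    have i1 : Integrable fun z => χ (y - z) * ϖ.normed volume z :=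
      hϖi.bdd_mul (hm.comp (measurable_const.sub measurable_id)).aestronglyMeasurable (c := 1)
        (.of_forall fun z => h0 _)
    have e2 : χ y = ∫ z, χ y * ϖ.normed volume z := by
      rw [integral_const_mul, ϖ.integral_normed, mul_one]
    conv_lhs => rw [e2]
    rw [← integral_sub (hϖi.const_mul _) i1, ← integral_const_mul]
    congr 1; ext z; ring
  have e3 : ∀ z, ∫ y, F y * (χ y - χ (y - z)) * ϖ.normed volume z
      = ϖ.normed volume z * ∫ y, χ y * (F y - F (y - -z)) := by
    intro z
    have hsh : ∫ y, χ (y - z) * F y = ∫ y, χ y * F (y + z) := by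
      rw [← integral_add_right_eq_self (fun y => χ (y - z) * F y) z]
      simp
    have i1 : Integrable fun y => χ y * F y :=
      hF'.bdd_mul hm.aestronglyMeasurable (c := 1) (.of_forall h0)
    have i2 : Integrable fun y => χ (y - z) * F y :=
      hF'.bdd_mul (hm.comp (measurable_id.sub measurable_const)).aestronglyMeasurable (c := 1)
        (.of_forall fun y => h0 _)
    have i3 : Integrable fun y => χ y * F (y + z) :=
      (hF'.comp_add_right z).bdd_mul hm.aestronglyMeasurable (c := 1) (.of_forall h0)
    have e4 : ∫ y, χ y * (F y - F (y - -z)) = (∫ y, χ y * F y) - ∫ y, χ y * F (y + z) := by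
      rw [← integral_sub i1 i3]
      congr 1; ext y; rw [sub_neg_eq_add]; ring
    rw [e4, ← hsh, ← integral_sub i1 i2, ← integral_const_mul]
    congr 1; ext y; ring
  simp only [e1]
  rw [integral_integral_swap hi]
  simp only [e3]
  rw [← norm_eq_abs]
  refine (norm_integral_le_of_norm_le (hϖi.mul_const (δ * B)) (.of_forall fun z => ?_)).trans
    (le_of_eq ?_)
  · rw [norm_mul, norm_of_nonneg (ϖ.nonneg_normed z)]
    by_cases hz : z ∈ tsupport (ϖ.normed volume)
    · rw [ϖ.tsupport_normed_eq, mem_closedBall_zero_iff] at hz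
      refine mul_le_mul_of_nonneg_left ?_ (ϖ.nonneg_normed z)
      have h1 : ‖-z‖ ≤ δ := by rw [norm_neg]; exact hz.trans hϖ
      exact (abs_integral_mul_sub_translate_le hm h0 hK hS hSG hKS hB hF hF1 hF0 hδ h1).trans
        (mul_le_mul_of_nonneg_right h1 hB0)
    · rw [image_eq_zero_of_notMem_tsupport hz, zero_mul, zero_mul]
  · rw [integral_mul_const, ϖ.integral_normed, one_mul]

lemma setIntegral_nonneg_le {χ : Plane → ℝ} (hm : Measurable χ) (h01 : ∀ x, χ x = 0 ∨ χ x = 1)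
    {S : Set Plane} (hS : volume S ≠ ⊤) :
    IntegrableOn χ S ∧ 0 ≤ ∫ x in S, χ x ∧ ∫ x in S, χ x ≤ (volume S).toReal := by
  have hi : IntegrableOn χ S := Measure.integrableOn_of_bounded (M := 1) hS hm.aestronglyMeasurable
    (.of_forall fun x => by rcases h01 x with h | h <;> simp [h])
  refine ⟨hi, integral_nonneg fun x => by rcases h01 x with h | h <;> simp [h], ?_⟩
  have := integral_mono hi (integrableOn_const hS (C := (1 : ℝ))) (fun x => by
    rcases h01 x with h | h <;> simp [h])
  simpa [Measure.real] using this

/-- Let `χ n` be characteristic functions whose variation in the convex open set `G` is locally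
bounded and whose gradients tend to zero as distributions. Then, on compact subsets of `G`,
`χ n` is close to `0` or to `1`: it is close to its mollification, which is nearly constant. -/
lemma tendsto_setIntegral_mul_sub_of_isCompact {χ : ℕ → Plane → ℝ} (hm : ∀ n, Measurable (χ n))
    (h01 : ∀ n x, χ n x = 0 ∨ χ n x = 1) {G : Set Plane} (hG : IsOpen G) (hGc : Convex ℝ G)
    (hB : ∀ S ⊆ G, IsCompact S → ∃ B : ℝ, ∀ n φ M, IsTestField G φ → tsupport φ ⊆ S →
      (∀ x, ‖φ x‖ ≤ M) → |∫ x, χ n x * divergence φ x| ≤ M * B)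
    (hdiv : ∀ φ, IsTestField G φ → Tendsto (fun n => ∫ x, χ n x * divergence φ x) atTop (𝓝 0))
    {K : Set Plane} (hK : IsCompact K) (hKG : K ⊆ G) :
    Tendsto (fun n => (∫ x in K, χ n x) * ((volume K).toReal - ∫ x in K, χ n x)) atTop (𝓝 0) := by
  rcases K.eq_empty_or_nonempty with rfl | ⟨y₀, hy₀⟩
  · simp
  have h0 : ∀ n x, |χ n x| ≤ 1 := by grind
  -- the union of the segments from `y₀` to the points of `K`
  set K' : Set Plane := (fun p : Plane × ℝ => p.1 + p.2 • (y₀ - p.1)) '' (K ×ˢ Icc (0 : ℝ) 1)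
    with hK'
  have hK'c : IsCompact K' := (hK.prod isCompact_Icc).image (by fun_prop)
  have hK'G : K' ⊆ G := by
    rintro _ ⟨⟨x, τ⟩, ⟨hx, hτ⟩, rfl⟩
    exact hGc.add_smul_sub_mem (hKG hx) (hKG hy₀) hτ
  have hKK' : K ⊆ K' := fun x hx => ⟨(x, 0), ⟨hx, by simp⟩, by simp⟩
  obtain ⟨d, hd, hdG⟩ := hK'c.exists_cthickening_subset_open hG hK'G
  set S := cthickening d K' with hS
  have hSc : IsCompact S := hK'c.cthickening
  have hmemS : ∀ x ∈ K', ∀ z, ‖z‖ ≤ d → x + z ∈ S := fun x hx z hz =>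
    mem_cthickening_of_dist_le _ x d K' hx (by rwa [dist_eq_norm, add_sub_cancel_left])
  obtain ⟨B, hB⟩ := hB S hdG hSc
  have hB' : ∀ n φ M, IsTestField G φ → tsupport φ ⊆ S → (∀ x, ‖φ x‖ ≤ M) →
      |∫ x, χ n x * divergence φ x| ≤ M * |B| := fun n φ M a b c =>
    (hB n φ M a b c).trans (mul_le_mul_of_nonneg_left (le_abs_self B) ((norm_nonneg _).trans (c 0)))
  set T := (volume K).toReal
  have hT0 : 0 ≤ T := ENNReal.toReal_nonneg
  have hKf : volume K ≠ ⊤ := hK.measure_lt_top.ne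
  have hA := fun n => (setIntegral_nonneg_le (hm n) (h01 n) hKf).2
  rw [Metric.tendsto_nhds]
  intro ε hε
  set δ := min (d / 2) (ε / (8 * (T * |B| + 1))) with hδ
  have hδ0 : 0 < δ := by positivity
  have hδd : 2 * δ ≤ d := by grind
  have hδε : 2 * T * (δ * |B|) < ε / 2 := by
    have h1 : δ * (8 * (T * |B| + 1)) ≤ ε := by
      have := min_le_right (d / 2) (ε / (8 * (T * |B| + 1)))
      rwa [← hδ, le_div_iff₀ (by positivity)] at this
    nlinarith [mul_nonneg hT0 (abs_nonneg B)]
  let ϖ : ContDiffBump (0 : Plane) := ⟨δ / 2, δ, by positivity, by linarith⟩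
  have hϖi : Integrable (ϖ.normed volume) := ϖ.integrable_normed
  set g : ℕ → Plane → ℝ := fun n y => ∫ z, χ n (y - z) * ϖ.normed volume z with hg
  have hge : ∀ n y, g n y = ∫ z, χ n z * ϖ.normed volume (y - z) := by
    intro n y
    simp only [hg]
    rw [← integral_sub_left_eq_self (fun z => χ n (y - z) * ϖ.normed volume z) volume y]
    simp
  have hgm : ∀ n, Measurable (g n) := fun n => by
    have : StronglyMeasurable (Function.uncurry fun y z => χ n (y - z) * ϖ.normed volume z) :=
      (((hm n).comp (by fun_prop)).mul
        (ϖ.continuous_normed.measurable.comp measurable_snd)).stronglyMeasurable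
    exact this.integral_prod_right.measurable
  have hg1 : ∀ n y, |g n y| ≤ 1 := by
    intro n y
    have := norm_integral_le_of_norm_le (f := fun z => χ n (y - z) * ϖ.normed volume z) hϖi
      (.of_forall fun z => by
        rw [norm_mul, norm_of_nonneg (ϖ.nonneg_normed z)]
        exact mul_le_of_le_one_left (ϖ.nonneg_normed z) (h0 n _))
    rwa [ϖ.integral_normed] at this
  -- the mollifications are asymptotically constant on `K`
  have hconst : ∀ x ∈ K, Tendsto (fun n => g n x - g n y₀) atTop (𝓝 0) := by
    intro x hx
    have hψ : ContDiff ℝ 1 fun z => ϖ.normed volume (x - z) :=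
      (ϖ.contDiff_normed).comp (by fun_prop)
    have hψc : HasCompactSupport fun z => ϖ.normed volume (x - z) :=
      ϖ.hasCompactSupport_normed.comp_homeomorph (Homeomorph.subLeft x)
    obtain ⟨M, hM⟩ := hψc.exists_bound_of_continuous hψ.continuous
    obtain ⟨φ, hφ, -, -, hφd⟩ := exists_divergence_eq_sub hψ hψc hSc
      (fun z hz τ hτ => by
        have h1 : x - z ∈ tsupport (ϖ.normed volume) :=
          tsupport_comp_subset_preimage (ϖ.normed volume) (continuous_const.sub continuous_id) hz
        rw [ϖ.tsupport_normed_eq, mem_closedBall_zero_iff] at h1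
        have h2 := hmemS (x + τ • (y₀ - x)) ⟨(x, τ), ⟨hx, hτ⟩, rfl⟩ (z - x) (by
          rw [← norm_neg, neg_sub]
          exact h1.trans (by simp only [ϖ]; linarith))
        convert! h2 using 1
        abel) hdG hM
    refine (hdiv φ hφ).congr fun n => ?_
    have i1 : ∀ y, Integrable fun z => χ n z * ϖ.normed volume (y - z) := fun y =>
      (hϖi.comp_sub_left y).bdd_mul (hm n).aestronglyMeasurable
        (.of_forall (h0 n))
    rw [hge, hge, ← integral_sub (i1 x) (i1 y₀)]
    congr 1; ext z
    rw [hφd, show x - (z - (y₀ - x)) = y₀ - z by abel]; ring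
  have hE : Tendsto (fun n => ∫ x in K, |g n x - g n y₀|) atTop (𝓝 0) := by
    have := tendsto_integral_of_dominated_convergence (μ := volume.restrict K)
      (F := fun n x => |g n x - g n y₀|) (f := fun _ => 0) (fun _ => (2 : ℝ))
      (by fun_prop)
      (integrableOn_const hKf) (fun n => .of_forall fun x => by
        rw [norm_eq_abs, abs_abs]
        have a1 := abs_sub (g n x) (g n y₀)
        have a2 := hg1 n x
        have a3 := hg1 n y₀
        linarith)
      ((ae_restrict_iff' hK.measurableSet).2 (.of_forall fun x hx => by
        simpa using (hconst x hx).abs))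
    simpa using this
  have hE' := hE.const_mul (2 * T)
  rw [mul_zero] at hE'
  filter_upwards [hE'.eventually (gt_mem_nhds (half_pos hε))] with n hn
  set A := ∫ x in K, χ n x
  set E := ∫ x in K, |g n x - g n y₀|
  set c := g n y₀
  -- testing with a function `F` that vanishes outside `K`
  have test : ∀ F : Plane → ℝ, Measurable F → (∀ x, |F x| ≤ 1) → (∀ x, x ∉ K → F x = 0) →
      |(∫ x in K, F x * χ n x) - c * ∫ x in K, F x| ≤ δ * |B| + E := by
    intro F hF hF1 hF0
    have h1 := abs_integral_mul_sub_mollify_le (hm n) (h0 n) hK hSc hdG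
      (fun x hx z hz => hmemS x (hKK' hx) z (hz.trans hδd)) (hB' n) hF hF1 hF0 (abs_nonneg B)
      ϖ le_rfl
    have hFi : IntegrableOn F K := Measure.integrableOn_of_bounded hKf
      hF.aestronglyMeasurable (.of_forall hF1)
    have hFχ : IntegrableOn (fun x => F x * χ n x) K := Measure.integrableOn_of_bounded hKf
      (hF.mul (hm n)).aestronglyMeasurable (.of_forall fun x => by
        rw [norm_mul]; exact mul_le_one₀ (hF1 x) (norm_nonneg _) (h0 n x))
    have hFg : IntegrableOn (fun x => F x * g n x) K := Measure.integrableOn_of_bounded hKf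
      (hF.mul (hgm n)).aestronglyMeasurable (.of_forall fun x => by
        rw [norm_mul]; exact mul_le_one₀ (hF1 x) (norm_nonneg _) (hg1 n x))
    have h2 : ∫ y, F y * (χ n y - g n y)
        = (∫ x in K, F x * χ n x) - ∫ x in K, F x * g n x := by
      rw [← integral_sub hFχ hFg, ← setIntegral_eq_integral_of_forall_compl_eq_zero
        fun x hx => by rw [hF0 x hx, zero_mul]]
      congr 1; ext x; ring
    have h3 : |(∫ x in K, F x * g n x) - c * ∫ x in K, F x| ≤ E := by
      rw [← integral_const_mul, ← integral_sub hFg (hFi.const_mul c), ← norm_eq_abs]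
      refine norm_integral_le_of_norm_le ?_ (.of_forall fun x => ?_)
      · exact Measure.integrableOn_of_bounded (M := 2) hKf
          ((hgm n).sub_const _).abs.aestronglyMeasurable (.of_forall fun x => by
            rw [norm_eq_abs, abs_abs]
            have a1 := abs_sub (g n x) c
            have a2 := hg1 n x
            have a3 := hg1 n y₀
            linarith)
      · rw [show F x * g n x - c * F x = F x * (g n x - c) by ring, norm_mul]
        exact mul_le_of_le_one_left (norm_nonneg _) (hF1 x)
    rw [h2] at h1
    rw [abs_le] at h1 h3 ⊢
    constructor <;> linarith [h1.1, h1.2, h3.1, h3.2]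
  have t1 := test (K.indicator (χ n)) ((hm n).indicator hK.measurableSet) (fun x => by
    by_cases hx : x ∈ K <;> simp [hx, h0 n x]) fun x hx => indicator_of_notMem hx _
  have t2 := test (K.indicator fun _ => 1) (measurable_const.indicator hK.measurableSet) (fun x => by
    by_cases hx : x ∈ K <;> simp [hx]) fun x hx => indicator_of_notMem hx _
  have e1 : ∫ x in K, K.indicator (χ n) x * χ n x = A :=
    setIntegral_congr_fun hK.measurableSet fun x hx => by
      simp only [indicator_of_mem hx]
      rcases h01 n x with h | h <;> simp [h]
  have e2 : ∫ x in K, K.indicator (χ n) x = A :=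
    setIntegral_congr_fun hK.measurableSet fun x hx => by simp only [indicator_of_mem hx]
  have e3 : ∫ x in K, K.indicator (fun _ => 1) x * χ n x = A :=
    setIntegral_congr_fun hK.measurableSet fun x hx => by simp only [indicator_of_mem hx, one_mul]
  have e4 : ∫ x in K, K.indicator (fun _ => (1 : ℝ)) x = T := by
    rw [setIntegral_congr_fun hK.measurableSet (g := fun _ => (1 : ℝ)) fun x hx => by
      simp only [indicator_of_mem hx], setIntegral_const, smul_eq_mul, mul_one]
    rfl
  rw [e1, e2] at t1
  rw [e3, e4] at t2
  rw [dist_eq, sub_zero]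
  have hfin : A * (T - A) = T * (A - c * A) - A * (A - c * T) := by ring
  rw [hfin]
  have b1 : |T * (A - c * A)| ≤ T * (δ * |B| + E) := by
    rw [abs_mul, abs_of_nonneg hT0]; exact mul_le_mul_of_nonneg_left t1 hT0
  have b2 : |A * (A - c * T)| ≤ T * (δ * |B| + E) := by
    rw [abs_mul, abs_of_nonneg (hA n).1]
    exact mul_le_mul (hA n).2 t2 (abs_nonneg _) hT0
  have b3 := abs_sub (T * (A - c * A)) (A * (A - c * T))
  linarith

/-- The same statement on the whole set `G`, if it has finite measure. -/
lemma tendsto_setIntegral_mul_sub {χ : ℕ → Plane → ℝ} (hm : ∀ n, Measurable (χ n))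
    (h01 : ∀ n x, χ n x = 0 ∨ χ n x = 1) {G : Set Plane} (hG : IsOpen G) (hGc : Convex ℝ G)
    (hGf : volume G ≠ ⊤)
    (hB : ∀ S ⊆ G, IsCompact S → ∃ B : ℝ, ∀ n φ M, IsTestField G φ → tsupport φ ⊆ S →
      (∀ x, ‖φ x‖ ≤ M) → |∫ x, χ n x * divergence φ x| ≤ M * B)
    (hdiv : ∀ φ, IsTestField G φ → Tendsto (fun n => ∫ x, χ n x * divergence φ x) atTop (𝓝 0)) :
    Tendsto (fun n => (∫ x in G, χ n x) * ((volume G).toReal - ∫ x in G, χ n x)) atTop (𝓝 0) := by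
  set T := (volume G).toReal with hT
  have hT0 : 0 ≤ T := ENNReal.toReal_nonneg
  have h0 : ∀ n x, |χ n x| ≤ 1 := by grind
  have hχi := fun n => (setIntegral_nonneg_le (hm n) (h01 n) hGf).1
  have hbd := fun n S (hS : S ⊆ G) => (setIntegral_nonneg_le (hm n) (h01 n)
    ((measure_mono hS).trans_lt hGf.lt_top).ne).2
  rw [Metric.tendsto_nhds]
  intro ε hε
  set e := ε / (4 * (T + 1)) with he
  have he0 : 0 < e := by positivity
  obtain ⟨K, hKG, hK, hKe⟩ := hG.measurableSet.exists_isCompact_sdiff_lt hGf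
    (ε := ENNReal.ofReal e) (by simpa using he0)
  have h1 := tendsto_setIntegral_mul_sub_of_isCompact hm h01 hG hGc hB hdiv hK hKG
  have hdm : MeasurableSet (G \ K) := hG.measurableSet.diff hK.measurableSet
  have hde : (volume (G \ K)).toReal ≤ e := ENNReal.toReal_le_of_le_ofReal he0.le hKe.le
  filter_upwards [Metric.tendsto_nhds.1 h1 (ε / 2) (half_pos hε)] with n hn
  have e1 : ∫ x in G, χ n x = (∫ x in K, χ n x) + ∫ x in G \ K, χ n x := by
    rw [← setIntegral_union disjoint_sdiff_right hdm ((hχi n).mono_set hKG)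
      ((hχi n).mono_set sdiff_subset), union_sdiff_cancel hKG]
  have e2 : T = (volume K).toReal + (volume (G \ K)).toReal := by
    rw [hT, ← ENNReal.toReal_add hK.measure_lt_top.ne
      (measure_mono sdiff_subset |>.trans_lt hGf.lt_top).ne,
      ← measure_union disjoint_sdiff_right hdm, union_sdiff_cancel hKG]
  obtain ⟨a1, a2⟩ := hbd n K hKG
  obtain ⟨b1, b2⟩ := hbd n (G \ K) sdiff_subset
  obtain ⟨c1, c2⟩ := hbd n G le_rfl
  rw [dist_eq, sub_zero] at hn ⊢
  set A := ∫ x in K, χ n x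
  set R := ∫ x in G \ K, χ n x
  set V := (volume (G \ K)).toReal
  set TK := (volume K).toReal
  have e3 : e * (T + 1) = ε / 4 := by rw [he]; field_simp
  rw [e1]
  have h3 : (A + R) * (T - (A + R)) = A * (TK - A) + (A * (V - R) + R * (T - (A + R))) := by
    rw [e2]; ring
  rw [h3]
  have h4 : A * (V - R) ≤ T * e := by
    refine mul_le_mul ?_ ?_ ?_ hT0 <;> linarith
  have h5 : R * (T - (A + R)) ≤ e * T := by
    refine mul_le_mul ?_ ?_ ?_ he0.le <;> linarith
  have h6 : 0 ≤ A * (V - R) := mul_nonneg a1 (by linarith)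
  have h7 : 0 ≤ R * (T - (A + R)) := mul_nonneg b1 (by linarith)
  rw [abs_lt] at hn ⊢
  constructor <;> nlinarith [hn.1, hn.2]

/-! ### Limits of the characteristic functions -/

lemma chi_eq_zero_or_one (w : Plane → ℝ) (x : Plane) : chi w x = 0 ∨ chi w x = 1 := by
  unfold chi
  by_cases h : 0 < w x
  · simp_all
  · simp_all

lemma chi_of_pos (h : 0 < w x) : chi w x = 1 :=
  indicator_of_mem (by exact h) _

lemma chi_of_eq_zero (h : w x = 0) : chi w x = 0 :=
  indicator_of_notMem (by simp [h]) _

lemma integrableOn_chi_sub (hw : Continuous w) {f : Plane → ℝ} (hf : Measurable f)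
    (hf0 : ∀ x, |f x| ≤ 1) {E : Set Plane} (hE : volume E ≠ ⊤) :
    IntegrableOn (fun x => |chi w x - f x|) E := by
  refine Measure.integrableOn_of_bounded (M := 2) hE
    ((measurable_chi hw).sub hf).abs.aestronglyMeasurable (.of_forall fun x => ?_)
  rw [norm_eq_abs, abs_abs]
  have h1 := abs_sub (chi w x) (f x)
  rw [abs_of_nonneg (chi_nonneg w x)] at h1
  linarith [chi_le_one w x, hf0 x]

lemma abs_divergence_le (φ : Plane → Plane) (x : Plane) : |divergence φ x| ≤ 2 * ‖fderiv ℝ φ x‖ := by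
  have h : ∀ i : Fin 2, |fderiv ℝ φ x (single i 1) i| ≤ ‖fderiv ℝ φ x‖ := by
    intro i
    have h1 := (PiLp.norm_apply_le (fderiv ℝ φ x (single i 1)) i).trans
      ((fderiv ℝ φ x).le_opNorm _)
    simpa using h1
  unfold divergence
  rw [Fin.sum_univ_two]
  refine (abs_add_le _ _).trans ?_
  linarith [h 0, h 1]

lemma abs_inner_apply_self_le (L : Plane →L[ℝ] Plane) (a : Plane) :
    |⟪a, L a⟫| ≤ ‖L‖ * ‖a‖ ^ 2 := by
  refine (abs_real_inner_le_norm _ _).trans ?_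
  have := mul_le_mul_of_nonneg_left (L.le_opNorm a) (norm_nonneg a)
  linarith

namespace IsBlowUpLimit

lemma gradient_eq_zero_of_isOpen {G : Set Plane} (hG : IsOpen G) (hU : ∀ x ∈ G, U x = 0)
    (hx : x ∈ G) : ∇ U x = 0 := by
  have : U =ᶠ[𝓝 x] fun _ => 0 := by
    filter_upwards [hG.mem_nhds hx] with y hy using hU y hy
  rw [gradient, this.fderiv_eq]; simp

/-- In open sets of the upper half plane in which the limit vanishes, the distributional gradients
of the characteristic functions tend to zero. -/
lemma tendsto_integral_chi_mul_divergence (h : IsBlowUpLimit C κ v U) {G : Set Plane}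
    (hG : IsOpen G) (hGs : G ⊆ ball 0 (3 / 2) ∩ {x | 0 < x 1}) (hU : ∀ x ∈ G, U x = 0)
    (hφ : IsTestField G φ) :
    Tendsto (fun n => ∫ x, chi (v n) x * divergence φ x) atTop (𝓝 0) := by
  obtain ⟨hφd, hφc, hφs⟩ := hφ
  -- the domain variation in direction `φ / x₂`
  set ψ : Plane → Plane := fun x => (x 1)⁻¹ • φ x with hψ
  have hψs : tsupport ψ ⊆ tsupport φ := by
    refine closure_mono fun x hx h0 => hx ?_
    simp [hψ, h0]
  have hψd : ContDiff ℝ 1 ψ := by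
    rw [contDiff_iff_contDiffAt]
    intro x
    by_cases hx : x ∈ tsupport φ
    · have h1 : (x 1) ≠ 0 := (hGs (hφs hx)).2.ne'
      have h2 : ContDiff ℝ 1 fun x : Plane => x 1 := contDiff_piLp_apply (p := 2)
      exact (h2.contDiffAt.inv h1).smul hφd.contDiffAt
    · exact contDiffAt_const.congr_of_eventuallyEq
        (notMem_tsupport_iff_eventuallyEq.1 fun h1 => hx (hψs h1))
  have hψc : HasCompactSupport ψ := hφc.of_isClosed_subset (isClosed_tsupport _) hψs
  have hψt : IsTestField (ball 0 4) ψ := ⟨hψd, hψc, fun x hx =>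
    ball_subset_ball (by norm_num) (hGs (hφs (hψs hx))).1⟩
  have hφψ : φ = fun x => x 1 • ψ x := by
    ext1 x
    by_cases hx : x ∈ tsupport φ
    · have h1 : (x 1) ≠ 0 := (hGs (hφs hx)).2.ne'
      rw [hψ, smul_smul, mul_inv_cancel₀ h1, one_smul]
    · rw [image_eq_zero_of_notMem_tsupport hx, image_eq_zero_of_notMem_tsupport
        fun h1 => hx (hψs h1), smul_zero]
  have hdiv : ∀ x, divergence φ x = x 1 * divergence ψ x + ψ x 1 := by
    intro x
    rw [hφψ, divergence_smul (by fun_prop) (hψd.differentiable (by norm_num) x)]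
    have h2 : HasFDerivAt (fun x : Plane => x 1) (proj (𝕜 := ℝ) (1 : Fin 2)) x :=
      (proj (𝕜 := ℝ) (1 : Fin 2)).hasFDerivAt
    rw [h2.fderiv]; rfl
  have hψf : Continuous (fderiv ℝ ψ) := by fun_prop
  obtain ⟨B, hB⟩ := (hψc.fderiv (𝕜 := ℝ)).exists_bound_of_continuous hψf
  have hdc : Continuous (divergence φ) := by fun_prop
  have hds : HasCompactSupport (divergence φ) := by
    refine (hφc.fderiv (𝕜 := ℝ)).mono fun x hx h0 => hx ?_
    simp [divergence, h0]
  set S := closedBall (0 : Plane) (3 / 2) with hS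
  have hbd : ∀ n, ‖∫ x, chi (v n) x * divergence φ x‖
      ≤ κ n * (∫ x, (‖x‖ ^ 2 * ‖fderiv ℝ ψ x‖ + ‖x‖ * ‖ψ x‖))
        + 4 * B * ∫ x in S, ‖∇ (v n) x - ∇ U x‖ ^ 2 := by
    intro n
    obtain ⟨K, hK⟩ := (h.sol n).lip
    obtain ⟨K', hK'⟩ := h.lip
    have h1 := (h.sol n).var ψ hψt
    have i1 : Integrable fun x => chi (v n) x * divergence φ x :=
      integrable_mul_test (measurable_chi hK.continuous) (continuous_const)
        (fun x => by rw [abs_of_nonneg (chi_nonneg _ _)]; exact chi_le_one _ _) hdc hds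
    set q : Plane → ℝ := fun x => ‖∇ (v n) x‖ ^ 2 * divergence ψ x
      - 2 * ⟪∇ (v n) x, fderiv ℝ ψ x (∇ (v n) x)⟫ with hq
    have hm : Measurable fun x => ∇ (v n) x - ∇ U x := by fun_prop
    have hSf : volume S ≠ ⊤ := measure_closedBall_lt_top.ne
    have i2 : IntegrableOn (fun x => ‖∇ (v n) x - ∇ U x‖ ^ 2) S :=
      Measure.integrableOn_of_bounded (M := ((K : ℝ) + K') ^ 2) hSf
        (hm.norm.pow_const 2).aestronglyMeasurable
        (.of_forall fun x => by
          rw [norm_pow, norm_norm]; gcongr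
          exact (norm_sub_le _ _).trans (add_le_add (norm_gradient_le hK x) (norm_gradient_le hK' x)))
    have i3 : Integrable (S.indicator fun x =>
        4 * B * ‖∇ (v n) x - ∇ U x‖ ^ 2) :=
      (integrable_indicator_iff measurableSet_closedBall).2 (i2.const_mul _)
    have hqle : ∀ x, ‖q x‖ ≤ S.indicator (fun x =>
        4 * B * ‖∇ (v n) x - ∇ U x‖ ^ 2) x := by
      intro x
      by_cases hx : x ∈ tsupport φ
      · have hxG := hφs hx
        have hxS : x ∈ S := ball_subset_closedBall (hGs hxG).1
        rw [indicator_of_mem hxS, gradient_eq_zero_of_isOpen hG hU hxG, sub_zero, norm_eq_abs]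
        have a1 := abs_divergence_le ψ x
        have a2 := abs_inner_apply_self_le (fderiv ℝ ψ x) (∇ (v n) x)
        have a3 := hB x
        set N := ‖∇ (v n) x‖ ^ 2 with hN
        have hN0 : 0 ≤ N := sq_nonneg _
        have a4 : ‖fderiv ℝ ψ x‖ * N ≤ B * N := by gcongr
        have a5 : |N * divergence ψ x| ≤ N * (2 * ‖fderiv ℝ ψ x‖) := by
          rw [abs_mul, abs_of_nonneg hN0]; exact mul_le_mul_of_nonneg_left a1 hN0
        have a6 := abs_sub (N * divergence ψ x)
          (2 * ⟪∇ (v n) x, fderiv ℝ ψ x (∇ (v n) x)⟫)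
        rw [abs_mul 2, abs_of_pos (by norm_num : (0 : ℝ) < 2)] at a6
        linarith
      · have hxψ : x ∉ tsupport (fderiv ℝ ψ) := fun h1 => hx (hψs (tsupport_fderiv_subset ℝ h1))
        have e1 : fderiv ℝ ψ x = 0 := image_eq_zero_of_notMem_tsupport hxψ
        have e2 : q x = 0 := by simp [hq, divergence, e1]
        rw [e2, norm_zero]
        refine indicator_nonneg (fun x _ => ?_) x
        have : 0 ≤ B := (norm_nonneg _).trans (hB 0)
        positivity
    have hqm : AEStronglyMeasurable q := Measurable.aestronglyMeasurable (by fun_prop)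
    have i4 : Integrable q := i3.mono' hqm (.of_forall hqle)
    have e3 : ∫ x, varIntegrand (v n) ψ x = (∫ x, q x) + ∫ x, chi (v n) x * divergence φ x := by
      rw [← integral_add i4 i1]
      congr 1; ext x
      simp only [varIntegrand, hq, hdiv]; ring
    have h2 := norm_integral_le_of_norm_le i3 (.of_forall hqle)
    rw [integral_indicator measurableSet_closedBall, integral_const_mul] at h2
    rw [e3] at h1
    rw [norm_eq_abs] at h2 ⊢
    rw [abs_le] at h1 h2 ⊢
    constructor <;> linarith [h1.1, h1.2, h2.1, h2.2]
  refine squeeze_zero_norm hbd ?_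
  have h1 := (h.error.mul_const (∫ x, (‖x‖ ^ 2 * ‖fderiv ℝ ψ x‖ + ‖x‖ * ‖ψ x‖))).add
    (h.tendsto_integral_norm_sub_sq.const_mul (4 * B))
  simpa using h1

/-- In convex open sets of the upper half plane in which the limit vanishes, the characteristic
functions converge, along a subsequence, to `0` or to `1`. -/
lemma exists_subseq_chi (h : IsBlowUpLimit C κ v U) {G : Set Plane} (hG : IsOpen G)
    (hGc : Convex ℝ G) (hGs : G ⊆ ball 0 (3 / 2) ∩ {x | 0 < x 1})
    (hU : ∀ x ∈ G, U x = 0) :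
    ∃ (s : ℕ → ℕ) (c : ℝ), StrictMono s ∧ (c = 0 ∨ c = 1) ∧
      Tendsto (fun n => ∫ x in G, |chi (v (s n)) x - c|) atTop (𝓝 0) := by
  have hGf : volume G ≠ ⊤ :=
    ((measure_mono (hGs.trans inter_subset_left)).trans_lt measure_ball_lt_top).ne
  have hC : 0 ≤ C := (h.sol 0).C_nonneg
  have hm : ∀ n, Measurable (chi (v n)) := fun n => measurable_chi (h.sol n).continuous
  have hmain := tendsto_setIntegral_mul_sub (χ := fun n => chi (v n)) hm
    (fun n x => chi_eq_zero_or_one _ _) hG hGc hGf (fun S hSG hS => ?_) fun φ hφ =>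
      h.tendsto_integral_chi_mul_divergence hG hGs hU hφ
  swap
  · rcases S.eq_empty_or_nonempty with rfl | hne
    · refine ⟨0, fun n φ M hφ hφS hM => ?_⟩
      have : ∀ x, φ x = 0 := fun x => image_eq_zero_of_notMem_tsupport fun hx => hφS hx
      have h1 : φ = fun _ => 0 := funext this
      simp [h1, divergence]
    obtain ⟨x₀, hx₀, hmin⟩ := hS.exists_isMinOn hne (continuous_coord 1).continuousOn
    have hx₀1 : 0 < x₀ 1 := (hGs (hSG hx₀)).2
    refine ⟨C * (3 / 2 : ℝ) ^ (3 / 2 : ℝ) / √(x₀ 1), fun n φ M hφ hφS hM => ?_⟩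
    have h1 := (h.sol n).bv φ (M / √(x₀ 1)) (3 / 2) (by norm_num)
      ⟨hφ.1, hφ.2.1, hφ.2.2.trans hGs⟩ (by norm_num) (fun x => ?_)
    · refine h1.trans (le_of_eq ?_); ring
    · have hM0 : 0 ≤ M := (norm_nonneg _).trans (hM 0)
      by_cases hx : x ∈ tsupport φ
      · have h2 : √(x₀ 1) ≤ √(x 1) := Real.sqrt_le_sqrt (hmin (hφS hx))
        have h3 : 0 < √(x₀ 1) := Real.sqrt_pos.2 hx₀1
        refine (hM x).trans ?_
        rw [div_mul_eq_mul_div, le_div_iff₀ h3]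
        exact mul_le_mul_of_nonneg_left h2 hM0
      · rw [image_eq_zero_of_notMem_tsupport hx, norm_zero]; positivity
  set T := (volume G).toReal with hT
  have hχi : ∀ n, IntegrableOn (chi (v n)) G := fun n =>
    Measure.integrableOn_of_bounded (M := 1) hGf (hm n).aestronglyMeasurable
      (.of_forall fun x => by
        rw [norm_of_nonneg (chi_nonneg _ _)]; exact chi_le_one _ _)
  have h1i : IntegrableOn (fun _ : Plane => (1 : ℝ)) G := integrableOn_const hGf
  have h1T : ∫ _ in G, (1 : ℝ) = T := by
    rw [setIntegral_const, smul_eq_mul, mul_one]; rfl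
  have hbd : ∀ n, ∫ x in G, chi (v n) x ∈ Icc 0 T := fun n =>
    ⟨integral_nonneg fun x => chi_nonneg _ _, by
      rw [← h1T]; exact integral_mono (hχi n) h1i fun x => chi_le_one _ _⟩
  obtain ⟨a, -, s, hs, ha⟩ := isCompact_Icc.tendsto_subseq hbd
  have ha' : Tendsto (fun n => ∫ x in G, chi (v (s n)) x) atTop (𝓝 a) := ha
  have h2 := tendsto_nhds_unique (hmain.comp hs.tendsto_atTop) (ha'.mul (ha'.const_sub T))
  rcases mul_eq_zero.1 h2.symm with h3 | h3
  · refine ⟨s, 0, hs, Or.inl rfl, ?_⟩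
    rw [h3] at ha'
    refine ha'.congr fun n => integral_congr_ae (.of_forall fun x => ?_)
    simp only
    rw [sub_zero, abs_of_nonneg (chi_nonneg _ _)]
  · refine ⟨s, 1, hs, Or.inr rfl, ?_⟩
    have h4 : Tendsto (fun n => T - ∫ x in G, chi (v (s n)) x) atTop (𝓝 0) := by
      rw [← h3]; exact ha'.const_sub T
    refine h4.congr fun n => ?_
    rw [← h1T, ← integral_sub h1i (hχi _)]
    refine integral_congr_ae (.of_forall fun x => ?_)
    simp only
    rw [abs_sub_comm, abs_of_nonneg (sub_nonneg.2 (chi_le_one _ _))]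

end IsBlowUpLimit

/-- The values on rays of the possible limits of the characteristic functions: `1` between the
angles `α` and `β`, the constants `c₁` and `c₂` in the rest of the upper half plane. -/
noncomputable def angularPhase (α β c₁ c₂ θ : ℝ) : ℝ :=
  if θ ≤ 0 ∨ π ≤ θ then 0 else if θ ≤ α then c₁ else if θ < β then 1 else c₂

@[fun_prop] lemma measurable_angularPhase (α β c₁ c₂ : ℝ) : Measurable (angularPhase α β c₁ c₂) := by
  unfold angularPhase
  refine Measurable.ite (measurableSet_Iic.union measurableSet_Ici) measurable_const ?_
  exact Measurable.ite measurableSet_Iic measurable_const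
    (Measurable.ite measurableSet_Iio measurable_const measurable_const)

lemma abs_angularPhase_le {c₁ c₂ : ℝ} (h1 : c₁ = 0 ∨ c₁ = 1) (h2 : c₂ = 0 ∨ c₂ = 1) (α β θ : ℝ) :
    |angularPhase α β c₁ c₂ θ| ≤ 1 := by
  unfold angularPhase
  rcases h1 with rfl | rfl <;> rcases h2 with rfl | rfl <;> split_ifs <;> simp

@[fun_prop] lemma measurable_polarAngle : Measurable polarAngle := by
  have : Measurable toComplex := by
    have h : toComplex = fun x => (x 0 : ℂ) + (x 1 : ℂ) * Complex.I := by
      ext x; exact (Complex.mk_eq_add_mul_I _ _)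
    rw [h]
    exact (Complex.measurable_ofReal.comp (measurable_coord 0)).add
      (by fun_prop)
  exact Complex.measurable_arg.comp this

lemma volume_line_eq_zero {a b : ℝ} (h : a ≠ 0 ∨ b ≠ 0) :
    volume {x : Plane | a * x 0 + b * x 1 = 0} = 0 := by
  set L : Plane →ₗ[ℝ] ℝ := a • (proj (0 : Fin 2)).toLinearMap
    + b • (proj (1 : Fin 2)).toLinearMap with hL
  have h1 : {x : Plane | a * x 0 + b * x 1 = 0} = (LinearMap.ker L : Set Plane) := by
    ext x; simp [hL]
  rw [h1]
  refine Measure.addHaar_submodule _ _ fun htop => ?_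
  have h2 : ∀ x, L x = 0 := by simp_all
  have e0 := h2 (single 0 1)
  have e1 := h2 (single 1 1)
  simp [hL] at e0 e1
  rcases h with h | h
  · exact h e0
  · exact h e1

/-- A blow-up limit together with the limit of the phases: the characteristic functions converge in
`L¹` to `angularPhase α β c₁ c₂`. -/
structure IsPhaseLimit (C : ℝ) (κ : ℕ → ℝ) (v : ℕ → Plane → ℝ) (U : Plane → ℝ)
    (α β c₁ c₂ : ℝ) : Prop extends IsBlowUpLimit C κ v U where
  c₁_eq : c₁ = 0 ∨ c₁ = 1
  c₂_eq : c₂ = 0 ∨ c₂ = 1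
  tendsto_chi : Tendsto (fun n => ∫ x in closedBall 0 (3 / 2),
    |chi (v n) x - angularPhase α β c₁ c₂ (polarAngle x)|) atTop (𝓝 0)

/-! ### Existence of limits of the phases -/

lemma tendsto_setIntegral_union {g : ℕ → Plane → ℝ} (hg : ∀ n x, 0 ≤ g n x) {E F : Set Plane}
    (hE : ∀ n, IntegrableOn (g n) E) (hF : ∀ n, IntegrableOn (g n) F)
    (h1 : Tendsto (fun n => ∫ x in E, g n x) atTop (𝓝 0))
    (h2 : Tendsto (fun n => ∫ x in F, g n x) atTop (𝓝 0)) :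
    Tendsto (fun n => ∫ x in E ∪ F, g n x) atTop (𝓝 0) := by
  have h3 := h1.add h2
  rw [add_zero] at h3
  refine squeeze_zero (fun n => integral_nonneg (hg n)) (fun n => ?_) h3
  rw [← integral_add_measure (hE n) (hF n)]
  exact integral_mono_measure (Measure.restrict_union_le E F) (.of_forall (hg n))
    ((hE n).integrable.add_measure (hF n).integrable)

lemma convex_halfPlane (a b : ℝ) : Convex ℝ {x : Plane | 0 < a * x 0 + b * x 1} :=
  convex_halfSpace_gt
    ⟨fun x y => by simp; ring, fun c x => by simp; ring⟩ 0

lemma isOpen_halfPlane (a b : ℝ) : IsOpen {x : Plane | 0 < a * x 0 + b * x 1} :=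
  isOpen_lt continuous_const
    (by fun_prop)

/-- The sign of `sin (γ - θ)`, where `θ` is the polar angle, in coordinates. -/
lemma coord_eq_norm_mul_sin (γ : ℝ) (x : Plane) : sin γ * x 0 + -cos γ * x 1
    = ‖x‖ * sin (γ - polarAngle x) := by
  have h0 := congrArg (fun y : Plane => y 0) (norm_smul_unitVec_polarAngle x)
  have h1 := congrArg (fun y : Plane => y 1) (norm_smul_unitVec_polarAngle x)
  simp only [PiLp.smul_apply, unitVec_apply_zero, unitVec_apply_one, smul_eq_mul] at h0 h1
  rw [← h0, ← h1, Real.sin_sub]; ring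

lemma polarAngle_notMem_Ioo (hx : x 1 ≤ 0) :
    polarAngle x ≤ 0 ∨ π ≤ polarAngle x := by
  by_contra! h
  have h1 := coord_eq_norm_mul_sin 0 x
  have h2 := Real.sin_pos_of_mem_Ioo ⟨h.1, h.2⟩
  rw [zero_sub, Real.sin_neg, Real.sin_zero, Real.cos_zero] at h1
  have h3 : ‖x‖ ≤ 0 := by
    by_contra! h4
    have := mul_pos h4 h2
    linarith
  rw [norm_le_zero_iff] at h3
  subst h3
  have : polarAngle 0 = 0 := by
    have h0 : toComplex 0 = 0 := by apply Complex.ext <;> simp [toComplex]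
    rw [polarAngle, h0, Complex.arg_zero]
  linarith [h.1]

/-- Every blow-up limit which is positive exactly between the angles `α` and `β` is, along a
subsequence, accompanied by a limit of the characteristic functions. -/
lemma IsBlowUpLimit.exists_isPhaseLimit
    (h : IsBlowUpLimit C κ v U) {α β : ℝ} (hα : 0 ≤ α) (hαβ : α ≤ β) (hβ : β ≤ π)
    (hpos : ∀ θ ∈ Ioo α β, 0 < U (unitVec θ))
    (hzero : ∀ θ ∈ Icc (-π) π, θ ∉ Ioo α β → U (unitVec θ) = 0) :
    ∃ (s : ℕ → ℕ) (c₁ c₂ : ℝ), StrictMono s ∧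
      IsPhaseLimit C (fun n => κ (s n)) (fun n => v (s n)) U α β c₁ c₂ := by
  set B := ball (0 : Plane) (3 / 2)
  have hB3 : B ⊆ ball 0 3 := ball_subset_ball (by norm_num)
  have hUzero : ∀ x ∈ B, polarAngle x ∉ Ioo α β → U x = 0 := fun x hx hθ => by
    rw [h.apply_eq (hB3 hx), hzero _ (IsBlowUpLimit.polarAngle_mem_Icc x) hθ, mul_zero]
  -- the parts of the upper half disc on the two sides of the wedge
  set G₁ := B ∩ ({x : Plane | 0 < 0 * x 0 + 1 * x 1} ∩
    {x | 0 < sin α * x 0 + -cos α * x 1})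
  set G₂ := B ∩ ({x : Plane | 0 < 0 * x 0 + 1 * x 1} ∩
    {x | 0 < -sin β * x 0 + cos β * x 1})
  have hmem1 : ∀ x ∈ G₁, 0 < x 1 ∧ polarAngle x < α := by
    rintro x ⟨hx, h1, h2⟩
    rw [mem_ofPred_eq, zero_mul, zero_add, one_mul] at h1
    rw [mem_ofPred_eq, coord_eq_norm_mul_sin] at h2
    refine ⟨h1, not_le.1 fun h3 => ?_⟩
    have h4 := polarAngle_mem_Ioo h1
    have h5 : sin (α - polarAngle x) ≤ 0 :=
      Real.sin_nonpos_of_nonpos_of_neg_pi_le (by linarith) (by linarith [h4.2])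
    nlinarith [norm_nonneg x]
  have hmem2 : ∀ x ∈ G₂, 0 < x 1 ∧ β < polarAngle x := by
    rintro x ⟨hx, h1, h2⟩
    rw [mem_ofPred_eq, zero_mul, zero_add, one_mul] at h1
    rw [mem_ofPred_eq, show -sin β * x 0 + cos β * x 1
      = -(sin β * x 0 + -cos β * x 1) by ring, coord_eq_norm_mul_sin] at h2
    refine ⟨h1, not_le.1 fun h3 => ?_⟩
    have h4 := polarAngle_mem_Ioo h1
    have h5 : 0 ≤ sin (β - polarAngle x) :=
      Real.sin_nonneg_of_nonneg_of_le_pi (by linarith) (by linarith [h4.1])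
    nlinarith [norm_nonneg x]
  have hop : ∀ a b, IsOpen (B ∩ ({x : Plane | 0 < 0 * x 0 + 1 * x 1} ∩
      {x | 0 < a * x 0 + b * x 1})) := fun a b =>
    isOpen_ball.inter ((isOpen_halfPlane _ _).inter (isOpen_halfPlane _ _))
  have hco : ∀ a b, Convex ℝ (B ∩ ({x : Plane | 0 < 0 * x 0 + 1 * x 1} ∩
      {x | 0 < a * x 0 + b * x 1})) := fun a b =>
    (convex_ball _ _).inter ((convex_halfPlane _ _).inter (convex_halfPlane _ _))
  obtain ⟨s₁, c₁, hs₁, hc₁, ht₁⟩ := h.exists_subseq_chi (hop _ _) (hco _ _)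
    (fun x hx => ⟨hx.1, (hmem1 x hx).1⟩) fun x hx =>
      hUzero x hx.1 fun h1 => (h1.1.trans (hmem1 x hx).2).false
  obtain ⟨s₂, c₂, hs₂, hc₂, ht₂⟩ := (h.subseq hs₁).exists_subseq_chi (hop _ _) (hco _ _)
    (fun x hx => ⟨hx.1, (hmem2 x hx).1⟩) fun x hx =>
      hUzero x hx.1 fun h1 => (h1.2.trans (hmem2 x hx).2).false
  have hlim := (h.subseq hs₁).subseq hs₂
  refine ⟨fun n => s₁ (s₂ n), c₁, c₂, hs₁.comp hs₂, hlim, hc₁, hc₂, ?_⟩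
  set f : Plane → ℝ := fun x => angularPhase α β c₁ c₂ (polarAngle x) with hf
  have hfm : Measurable f := by fun_prop
  have hf1 : ∀ x, |f x| ≤ 1 := fun x => abs_angularPhase_le hc₁ hc₂ _ _ _
  set g : ℕ → Plane → ℝ := fun n x => |chi (v (s₁ (s₂ n))) x - f x| with hg
  have hg0 : ∀ n x, 0 ≤ g n x := fun n x => abs_nonneg _
  have hgi : ∀ n, ∀ E : Set Plane, volume E ≠ ⊤ → IntegrableOn (g n) E := fun n E hE =>
    integrableOn_chi_sub (h.sol _).continuous hfm hf1 hE
  have hBf : volume B ≠ ⊤ := measure_ball_lt_top.ne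
  have hfin : ∀ E ⊆ B, volume E ≠ ⊤ := fun E hE => ((measure_mono hE).trans_lt hBf.lt_top).ne
  -- the wedge and the lower half plane
  set P := B ∩ {x | 0 < U x}
  set N := B ∩ {x | x 1 ≤ 0}
  have hPm : MeasurableSet P := measurableSet_ball.inter
    (isOpen_lt continuous_const h.continuous).measurableSet
  have hNm : MeasurableSet N := measurableSet_ball.inter
    (isClosed_le (continuous_coord 1) continuous_const).measurableSet
  have tP : Tendsto (fun n => ∫ x in P, g n x) atTop (𝓝 0) := by
    have h0 : (0 : ℝ) = ∫ x in P, (0 : ℝ) := by simp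
    rw [h0]
    refine tendsto_integral_of_dominated_convergence (fun _ => 2)
      (fun n => (hgi n P (hfin P inter_subset_left)).aestronglyMeasurable)
      (integrableOn_const (hfin P inter_subset_left)) (fun n => .of_forall fun x => ?_)
      ((ae_restrict_iff' hPm).2 (.of_forall fun x hx => ?_))
    · rw [norm_of_nonneg (hg0 n x)]
      have h1 := abs_sub (chi (v (s₁ (s₂ n))) x) (f x)
      rw [abs_of_nonneg (chi_nonneg _ x)] at h1
      exact h1.trans (by linarith [chi_le_one (v (s₁ (s₂ n))) x, hf1 x])
    · have h1 := hlim.tendsto.tendsto_at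
        (ball_subset_closedBall (hB3 hx.1))
      have hθ : polarAngle x ∈ Ioo α β := by
        by_contra h2
        exact (hx.2.trans_eq (hUzero x hx.1 h2)).false
      have hfx : f x = 1 := by
        have h2 := hθ.1; have h3 := hθ.2
        simp only [hf, angularPhase]
        rw [if_neg (by rintro (h4 | h4) <;> linarith), if_neg (by linarith), if_pos h3]
      refine tendsto_const_nhds.congr' ?_
      filter_upwards [h1.eventually (lt_mem_nhds hx.2)] with n hn
      simp only [hg]
      rw [chi_of_pos hn, hfx, sub_self, abs_zero]
  have tN : Tendsto (fun n => ∫ x in N, g n x) atTop (𝓝 0) := by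
    refine tendsto_const_nhds.congr fun n => ?_
    rw [setIntegral_congr_fun (g := fun _ => (0 : ℝ)) hNm fun x hx => ?_]
    · simp
    · have h1 : v (s₁ (s₂ n)) x = 0 := (h.sol _).lower x
        (ball_subset_ball (by norm_num) hx.1) hx.2
      simp only [hg, hf, angularPhase]
      rw [chi_of_eq_zero h1, if_pos (polarAngle_notMem_Ioo hx.2), sub_self, abs_zero]
  have t1 : Tendsto (fun n => ∫ x in G₁, g n x) atTop (𝓝 0) := by
    refine (ht₁.comp hs₂.tendsto_atTop).congr fun n => ?_
    refine setIntegral_congr_fun (hop _ _).measurableSet fun x hx => ?_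
    obtain ⟨h1, h2⟩ := hmem1 x hx
    have h3 := polarAngle_mem_Ioo h1
    simp only [hg, hf, angularPhase]
    rw [if_neg (by rintro (h4 | h4) <;> linarith [h3.1, h3.2]), if_pos h2.le]
  have t2 : Tendsto (fun n => ∫ x in G₂, g n x) atTop (𝓝 0) := by
    refine ht₂.congr fun n => ?_
    refine setIntegral_congr_fun (hop _ _).measurableSet fun x hx => ?_
    obtain ⟨h1, h2⟩ := hmem2 x hx
    have h3 := polarAngle_mem_Ioo h1
    simp only [hg, hf, angularPhase]
    rw [if_neg (by rintro (h4 | h4) <;> linarith [h3.1, h3.2]), if_neg (by linarith),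
      if_neg (by linarith)]
  -- the rest is contained in two lines and a circle
  set Z := ({x : Plane | sin α * x 0 + -cos α * x 1 = 0} ∪
    {x : Plane | sin β * x 0 + -cos β * x 1 = 0}) ∪ Metric.sphere 0 (3 / 2) with hZ
  have hsc : ∀ γ : ℝ, sin γ ≠ 0 ∨ -cos γ ≠ 0 := by
    intro γ
    by_contra! h1
    have := Real.sin_sq_add_cos_sq γ
    rw [h1.1, neg_eq_zero.1 h1.2] at this
    norm_num at this
  have hZ0 : volume Z = 0 := by
    rw [hZ, measure_union_null_iff, measure_union_null_iff]
    exact ⟨⟨volume_line_eq_zero (hsc α), volume_line_eq_zero (hsc β)⟩,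
      Measure.addHaar_sphere _ _ _⟩
  have tZ : Tendsto (fun n => ∫ x in Z, g n x) atTop (𝓝 0) :=
    tendsto_const_nhds.congr fun n => (setIntegral_measure_zero _ hZ0).symm
  have iZ : ∀ n, IntegrableOn (g n) Z := fun n => hgi n Z (by rw [hZ0]; exact ENNReal.zero_ne_top)
  have iP := fun n => hgi n P (hfin P inter_subset_left)
  have iN := fun n => hgi n N (hfin N inter_subset_left)
  have i1 := fun n => hgi n G₁ (hfin G₁ inter_subset_left)
  have i2 := fun n => hgi n G₂ (hfin G₂ inter_subset_left)
  have iPN := fun n => (iP n).union (iN n)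
  have i12 := fun n => (i1 n).union (i2 n)
  have t := tendsto_setIntegral_union hg0 (fun n => (iPN n).union (i12 n)) iZ
    (tendsto_setIntegral_union hg0 iPN i12 (tendsto_setIntegral_union hg0 iP iN tP tN)
      (tendsto_setIntegral_union hg0 i1 i2 t1 t2)) tZ
  refine squeeze_zero (fun n => integral_nonneg (hg0 n)) (fun n => ?_) t
  refine setIntegral_mono_set (((iPN n).union (i12 n)).union (iZ n))
    (.of_forall (hg0 n)) (LE.le.eventuallyLE fun x hx => ?_)
  by_contra hxn
  have hxZ : x ∉ Z := fun h1 => hxn (Or.inr h1)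
  have hxr : x ∉ (P ∪ N) ∪ (G₁ ∪ G₂) := fun h1 => hxn (Or.inl h1)
  have hxB : x ∈ B := by
    rcases lt_or_eq_of_le (mem_closedBall_zero_iff.1 hx) with h1 | h1
    · exact mem_ball_zero_iff.2 h1
    · exact absurd (Or.inr (mem_sphere_zero_iff_norm.2 h1)) hxZ
  have hx1 : 0 < x 1 := not_le.1 fun h1 => hxr (Or.inl (Or.inr ⟨hxB, h1⟩))
  have hx1' : 0 < 0 * x 0 + 1 * x 1 := by linarith
  obtain ⟨hθ0, hθπ⟩ := polarAngle_mem_Ioo hx1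
  have hn : 0 < ‖x‖ := norm_pos_iff.2 fun h0 => by simp [h0] at hx1
  rcases lt_trichotomy (polarAngle x) α with h1 | h1 | h1
  · refine hxr (Or.inr (Or.inl ⟨hxB, hx1', ?_⟩))
    rw [mem_ofPred_eq, coord_eq_norm_mul_sin]
    exact mul_pos hn (Real.sin_pos_of_pos_of_lt_pi (by linarith) (by linarith))
  · refine hxZ (Or.inl (Or.inl ?_))
    rw [mem_ofPred_eq, coord_eq_norm_mul_sin, h1, sub_self, Real.sin_zero, mul_zero]
  rcases lt_trichotomy (polarAngle x) β with h2 | h2 | h2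
  · refine hxr (Or.inl (Or.inl ⟨hxB, ?_⟩))
    rw [mem_ofPred_eq, h.apply_eq (hB3 hxB)]
    exact mul_pos (by positivity) (hpos _ ⟨h1, h2⟩)
  · refine hxZ (Or.inl (Or.inr ?_))
    rw [mem_ofPred_eq, coord_eq_norm_mul_sin, h2, sub_self, Real.sin_zero, mul_zero]
  · refine hxr (Or.inr (Or.inr ⟨hxB, hx1', ?_⟩))
    rw [mem_ofPred_eq, show -sin β * x 0 + cos β * x 1
      = -(sin β * x 0 + -cos β * x 1) by ring, coord_eq_norm_mul_sin]
    have := mul_neg_of_pos_of_neg hn (Real.sin_neg_of_neg_of_neg_pi_lt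
      (by linarith : β - polarAngle x < 0) (by linarith))
    linarith

/-! ### Passage to the limit in the variational identities -/

/-- `angularPhase` as a function on the plane, homogeneous of degree zero. -/
noncomputable def sectorPhase (α β c₁ c₂ : ℝ) (x : Plane) : ℝ :=
  angularPhase α β c₁ c₂ (polarAngle x)

@[fun_prop] lemma measurable_sectorPhase (α β c₁ c₂ : ℝ) : Measurable (sectorPhase α β c₁ c₂) :=
  (measurable_angularPhase _ _ _ _).comp measurable_polarAngle

lemma abs_inner_apply_sub_le (L : Plane →L[ℝ] Plane) {a b : Plane} {M : ℝ} (ha : ‖a‖ ≤ M)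
    (hb : ‖b‖ ≤ M) : |⟪a, L a⟫ - ⟪b, L b⟫| ≤ 2 * M * ‖L‖ * ‖a - b‖ := by
  have h1 : ⟪a, L a⟫ - ⟪b, L b⟫ = ⟪a - b, L a⟫ + ⟪b, L (a - b)⟫ := by
    rw [map_sub, inner_sub_left, inner_sub_right]; ring
  have h2 := (abs_real_inner_le_norm (a - b) (L a)).trans
    (mul_le_mul_of_nonneg_left (L.le_opNorm a) (norm_nonneg _))
  have h3 := (abs_real_inner_le_norm b (L (a - b))).trans
    (mul_le_mul_of_nonneg_left (L.le_opNorm (a - b)) (norm_nonneg _))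
  have h4 : ‖a - b‖ * (‖L‖ * ‖a‖) ≤ ‖a - b‖ * (‖L‖ * M) := by gcongr
  have h5 : ‖b‖ * (‖L‖ * ‖a - b‖) ≤ M * (‖L‖ * ‖a - b‖) := by gcongr
  rw [h1]
  refine (abs_add_le _ _).trans ?_
  linarith

namespace IsPhaseLimit

variable {α β c₁ c₂ : ℝ}

lemma abs_sectorPhase_le (h : IsPhaseLimit C κ v U α β c₁ c₂) (x : Plane) :
    |sectorPhase α β c₁ c₂ x| ≤ 1 := abs_angularPhase_le h.c₁_eq h.c₂_eq _ _ _

/-- Integrands which are locally Lipschitz in the gradient and in the phase pass to the limit. -/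
lemma tendsto_integral_integrand (h : IsPhaseLimit C κ v U α β c₁ c₂)
    {V : Plane → ℝ → Plane → ℝ}
    (hm : Measurable fun p : Plane × ℝ × Plane => V p.1 p.2.1 p.2.2)
    (h0 : ∀ a q, ∀ x ∉ closedBall 0 (3 / 2), V a q x = 0)
    (hz : ∀ x, V 0 0 x = 0)
    (hL : ∀ M, 0 ≤ M → ∃ A, 0 ≤ A ∧ ∀ x ∈ closedBall 0 (3 / 2), ∀ a b q q',
      ‖a‖ ≤ M → ‖b‖ ≤ M → |V a q x - V b q' x| ≤ A * (‖a - b‖ + |q - q'|)) :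
    Integrable (fun x => V (∇ U x) (sectorPhase α β c₁ c₂ x) x) ∧
    Tendsto (fun n => ∫ x, V (∇ (v n) x) (chi (v n) x) x) atTop
      (𝓝 (∫ x, V (∇ U x) (sectorPhase α β c₁ c₂ x) x)) := by
  obtain ⟨M, hM0, hM, hMU⟩ := h.exists_gradient_bound
  obtain ⟨A, hA0, hA⟩ := hL M hM0
  set S := closedBall (0 : Plane) (3 / 2)
  have hSm : MeasurableSet S := measurableSet_closedBall
  have hSf : volume S ≠ ⊤ := measure_closedBall_lt_top.ne
  have hint : ∀ (G : Plane → Plane) (q : Plane → ℝ), Measurable G → Measurable q →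
      (∀ᵐ x, x ∈ S → ‖G x‖ ≤ M) → (∀ x, |q x| ≤ 1) → Integrable fun x => V (G x) (q x) x := by
    intro G q hG hq hGM hq1
    have i1 : Integrable (S.indicator fun _ => A * (M + 1)) :=
      (integrable_indicator_iff hSm).2 (integrableOn_const hSf)
    refine i1.mono' (hm.comp (hG.prodMk (hq.prodMk measurable_id))).aestronglyMeasurable ?_
    filter_upwards [hGM] with x hx
    by_cases hxS : x ∈ S
    · have h1 := hA x hxS (G x) 0 (q x) 0 (hx hxS) (by rwa [norm_zero])
      rw [hz, sub_zero, sub_zero, sub_zero] at h1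
      rw [indicator_of_mem hxS, norm_eq_abs]
      refine h1.trans (mul_le_mul_of_nonneg_left (add_le_add (hx hxS) (hq1 x)) hA0)
    · rw [indicator_of_notMem hxS, h0 _ _ x hxS, norm_zero]
  have hS3 : S ⊆ closedBall 0 3 := closedBall_subset_closedBall (by norm_num)
  have i0 := hint (∇ U) _ (by fun_prop) (by fun_prop)
    (.of_forall fun x _ => hMU x) h.abs_sectorPhase_le
  have hn := fun n => hint (∇ (v n)) _ (by fun_prop)
    (measurable_chi (h.sol n).continuous) ((hM n).mono fun x hx hxS => hx (hS3 hxS))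
    (fun x => by rw [abs_of_nonneg (chi_nonneg _ _)]; exact chi_le_one _ _)
  refine ⟨i0, ?_⟩
  rw [tendsto_iff_norm_sub_tendsto_zero]
  have h1 := (h.tendsto_integral_norm_sub.add h.tendsto_chi).const_mul A
  rw [add_zero, mul_zero] at h1
  refine squeeze_zero (by simp) (fun n => ?_) h1
  have i1 : IntegrableOn (fun x => ‖∇ (v n) x - ∇ U x‖) S := by
    refine Measure.integrableOn_of_bounded (M := 2 * M) hSf
      ((measurable_gradient _).sub (measurable_gradient _)).norm.aestronglyMeasurable ?_
    rw [ae_restrict_iff' hSm]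
    filter_upwards [hM n] with x hx hxS
    rw [norm_norm]
    refine (norm_sub_le _ _).trans ?_
    linarith [hx (hS3 hxS), hMU x]
  have i2 : IntegrableOn (fun x => |chi (v n) x - sectorPhase α β c₁ c₂ x|) S :=
    integrableOn_chi_sub (h.sol n).continuous (measurable_sectorPhase _ _ _ _)
      h.abs_sectorPhase_le hSf
  rw [← integral_sub (hn n) i0]
  have i3 : Integrable (S.indicator fun x => A * (‖∇ (v n) x - ∇ U x‖
      + |chi (v n) x - sectorPhase α β c₁ c₂ x|)) :=
    (integrable_indicator_iff hSm).2 ((i1.add i2).const_mul A)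
  refine (norm_integral_le_of_norm_le i3 ?_).trans (le_of_eq ?_)
  · filter_upwards [hM n] with x hx
    by_cases hxS : x ∈ S
    · rw [indicator_of_mem hxS]
      exact hA x hxS _ _ _ _ (hx (hS3 hxS)) (hMU x)
    · rw [indicator_of_notMem hxS, h0 _ _ x hxS, h0 _ _ x hxS, sub_self, norm_zero]
  · rw [integral_indicator hSm, integral_const_mul, integral_add i1 i2]
    rfl

lemma exists_energy_lipschitz {m : Plane → ℝ} {B : ℝ} (hB : ∀ x, |m x| ≤ B) {M : ℝ} (hM : 0 ≤ M) :
    ∃ A, 0 ≤ A ∧ ∀ x ∈ closedBall 0 (3 / 2), ∀ (a b : Plane) (q q' : ℝ),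
      ‖a‖ ≤ M → ‖b‖ ≤ M → |(‖a‖ ^ 2 + x 1 * q) * m x - (‖b‖ ^ 2 + x 1 * q') * m x|
        ≤ A * (‖a - b‖ + |q - q'|) := by
  have hB0 : 0 ≤ B := (abs_nonneg _).trans (hB 0)
  refine ⟨(2 * M + 3 / 2) * B, by positivity, fun x hx a b q q' ha hb => ?_⟩
  have h1 := abs_norm_sq_sub_norm_sq_le ha hb
  have h2 : |x 1| ≤ 3 / 2 := by
    have := PiLp.norm_apply_le x 1
    rw [mem_closedBall_zero_iff] at hx
    exact this.trans hx
  rw [← sub_mul, abs_mul, mul_right_comm]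
  refine mul_le_mul ?_ (hB x) (abs_nonneg _) (by positivity)
  rw [show ‖a‖ ^ 2 + x 1 * q - (‖b‖ ^ 2 + x 1 * q') = (‖a‖ ^ 2 - ‖b‖ ^ 2) + x 1 * (q - q') by ring]
  refine (abs_add_le _ _).trans ?_
  rw [abs_mul (x 1)]
  have h3 : |x 1| * |q - q'| ≤ 3 / 2 * |q - q'| := by gcongr
  nlinarith [norm_nonneg (a - b), abs_nonneg (q - q')]

lemma measurable_energy_mul {m : Plane → ℝ} (hm : Measurable m) :
    Measurable fun p : Plane × ℝ × Plane => (‖p.1‖ ^ 2 + p.2.2 1 * p.2.1) * m p.2.2 := by fun_prop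

/-- Convergence of localized energies. -/
lemma tendsto_integral_energyDensity (h : IsPhaseLimit C κ v U α β c₁ c₂) {m : Plane → ℝ}
    (hm : Measurable m) {B : ℝ} (hB : ∀ x, |m x| ≤ B)
    (h0 : ∀ x ∉ closedBall 0 (3 / 2), m x = 0) :
    Integrable (fun x => (‖∇ U x‖ ^ 2 + x 1 * sectorPhase α β c₁ c₂ x) * m x) ∧
    Tendsto (fun n => ∫ x, energyDensity (v n) x * m x) atTop
      (𝓝 (∫ x, (‖∇ U x‖ ^ 2 + x 1 * sectorPhase α β c₁ c₂ x) * m x)) :=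
  h.tendsto_integral_integrand
    (by fun_prop) (fun a q x hx => by simp [h0 x hx]) (fun x => by simp)
    fun _ hM => exists_energy_lipschitz hB hM

/-- The limit satisfies the first variation identity exactly. -/
lemma integral_variation_eq_zero (h : IsPhaseLimit C κ v U α β c₁ c₂)
    (hφ : IsTestField (ball 0 (3 / 2)) φ) :
    ∫ x, ((‖∇ U x‖ ^ 2 + x 1 * sectorPhase α β c₁ c₂ x) * divergence φ x
      - 2 * ⟪∇ U x, fderiv ℝ φ x (∇ U x)⟫
      + sectorPhase α β c₁ c₂ x * φ x 1) = 0 := by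
  obtain ⟨hφd, hφc, hφs⟩ := hφ
  have hfc : Continuous (fderiv ℝ φ) := by fun_prop
  obtain ⟨B, hB⟩ := (hφc.fderiv (𝕜 := ℝ)).exists_bound_of_continuous hfc
  obtain ⟨B', hB'⟩ := hφc.exists_bound_of_continuous hφd.continuous
  have hB0 : 0 ≤ B := (norm_nonneg _).trans (hB 0)
  have hB0' : 0 ≤ B' := (norm_nonneg _).trans (hB' 0)
  have hdiv : ∀ x, |divergence φ x| ≤ 2 * B := fun x =>
    (abs_divergence_le φ x).trans (by linarith [hB x])
  have hdm : Measurable (divergence φ) := by fun_prop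
  have hzero : ∀ x ∉ closedBall 0 (3 / 2), φ x = 0 ∧ fderiv ℝ φ x = 0 := by
    intro x hx
    have h1 : x ∉ tsupport φ := fun h2 => hx (ball_subset_closedBall (hφs h2))
    exact ⟨image_eq_zero_of_notMem_tsupport h1,
      image_eq_zero_of_notMem_tsupport fun h2 => h1 (tsupport_fderiv_subset ℝ h2)⟩
  have h2 := (h.tendsto_integral_integrand (V := fun a q x =>
    (‖a‖ ^ 2 + x 1 * q) * divergence φ x - 2 * ⟪a, fderiv ℝ φ x a⟫ + q * φ x 1)
    ?_ ?_ (fun x => by simp) ?_).2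
  · refine tendsto_nhds_unique h2 (squeeze_zero_norm (fun n => (h.sol n).var φ
      ⟨hφd, hφc, hφs.trans (ball_subset_ball (by norm_num))⟩) ?_)
    simpa using h.error.mul_const _
  · refine ((measurable_energy_mul hdm).sub (Measurable.const_mul ?_ 2)).add
      ((measurable_fst.comp measurable_snd).mul ((measurable_coord 1).comp
        (hφd.continuous.measurable.comp (by fun_prop))))
    have h3 : Continuous fun p : Plane × ℝ × Plane => ⟪p.1, fderiv ℝ φ p.2.2 p.1⟫ := by
      fun_prop
    exact h3.measurable
  · intro a q x hx
    obtain ⟨h3, h4⟩ := hzero x hx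
    simp [divergence, h3, h4]
  · intro M hM
    obtain ⟨A, hA0, hA⟩ := exists_energy_lipschitz hdiv hM
    refine ⟨A + 4 * M * B + B', by positivity, fun x hx a b q q' ha hb => ?_⟩
    have h3 := hA x hx a b q q' ha hb
    have h4 := abs_inner_apply_sub_le (fderiv ℝ φ x) ha hb
    have h5 : 2 * M * ‖fderiv ℝ φ x‖ * ‖a - b‖ ≤ 2 * M * B * ‖a - b‖ := by
      have := hB x
      gcongr
    have h6 : |(q - q') * φ x 1| ≤ |q - q'| * B' := by
      rw [abs_mul]
      exact mul_le_mul_of_nonneg_left ((PiLp.norm_apply_le (φ x) 1).trans (hB' x)) (abs_nonneg _)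
    have h7 : ∀ p r s p' r' s' : ℝ, |p - r * 2 + s - (p' - r' * 2 + s')|
        ≤ |p - p'| + 2 * |r - r'| + |s - s'| := by
      intro p r s p' r' s'
      rw [show p - r * 2 + s - (p' - r' * 2 + s') = (p - p') - 2 * (r - r') + (s - s') by ring]
      refine (abs_add_le _ _).trans (add_le_add ((abs_sub _ _).trans ?_) le_rfl)
      rw [abs_mul 2, abs_of_pos (by norm_num : (0 : ℝ) < 2)]
    have h8 := h7 ((‖a‖ ^ 2 + x 1 * q) * divergence φ x) ⟪a, fderiv ℝ φ x a⟫ (q * φ x 1)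
      ((‖b‖ ^ 2 + x 1 * q') * divergence φ x) ⟪b, fderiv ℝ φ x b⟫ (q' * φ x 1)
    rw [← sub_mul q] at h8
    simp only [mul_comm (2 : ℝ) ⟪_, _⟫]
    refine h8.trans ?_
    have h9 := mul_nonneg (mul_nonneg hM hB0) (abs_nonneg (q - q'))
    have h10 := mul_nonneg hB0' (norm_nonneg (a - b))
    linarith

lemma integral_norm_sq_mul_cut (h : IsPhaseLimit C κ v U α β c₁ c₂) :
    ∫ x, ‖∇ U x‖ ^ 2 * cut x ^ 3 = 9 * ∫ x, U x ^ 2 * cut x ^ 2 := by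
  obtain ⟨K, hK⟩ := h.lip
  have h1 := h.energy (contDiff_cut_pow 1) (hasCompactSupport_cut_pow 2)
    ((tsupport_cut_pow 2).trans (closedBall_subset_ball (by norm_num)))
  have i1 := IsBlowUpLimit.integrable_norm_sq_mul hK (contDiff_cut_pow 1).continuous (hasCompactSupport_cut_pow 2)
  have i2 : Integrable fun x => U x ^ 2 * cut x ^ 2 :=
    ((hK.continuous.pow 2).mul (contDiff_cut_pow 0).continuous).integrable_of_hasCompactSupport
      (hasCompactSupport_cut_pow 1).mul_left
  have h2 : ∀ x, ‖∇ U x‖ ^ 2 * cut x ^ 3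
      + U x * ⟪∇ U x, ∇ (fun x => cut x ^ 3) x⟫
      = ‖∇ U x‖ ^ 2 * cut x ^ 3 - 9 * (U x ^ 2 * cut x ^ 2) := by
    intro x
    have h3 := gradient_cut_pow 1 x
    norm_num at h3
    rw [h3, ← neg_smul, inner_smul_right, inner_gradient]
    rcases (h.nonneg x).eq_or_lt with h4 | h4
    · rw [← h4]; ring
    by_cases hx : ‖x‖ < 1
    · have hx3 : x ∈ ball 0 3 := mem_ball_zero_iff.2 (by linarith)
      have h5 : DifferentiableAt ℝ U x :=
        (h.contDiffOn.contDiffAt ((isOpen_ball.inter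
          (isOpen_lt continuous_const h.continuous)).mem_nhds ⟨hx3, h4⟩)).differentiableAt
          (by norm_num)
      rw [h.fderiv_self hx3 h5]; ring
    · rw [cut_eq_zero (not_lt.1 hx)]; ring
  simp only [h2] at h1
  rw [integral_sub i1 (i2.const_mul 9), integral_const_mul] at h1
  linarith

/-- The Weiss energies converge to the energy of the limit, which depends on the phase only. -/
lemma tendsto_weissEnergy (h : IsPhaseLimit C κ v U α β c₁ c₂) :
    Tendsto (fun n => weissEnergy (v n)) atTop
      (𝓝 (∫ x, x 1 * sectorPhase α β c₁ c₂ x * cut x ^ 3)) := by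
  obtain ⟨K, hK⟩ := h.lip
  have hcut3 : ∀ x ∉ closedBall 0 (3 / 2), cut x ^ 3 = 0 := fun x hx => by
    rw [mem_closedBall_zero_iff, not_le] at hx
    rw [cut_eq_zero (by linarith)]; norm_num
  obtain ⟨i0, h1⟩ := h.tendsto_integral_energyDensity (contDiff_cut_pow 1).continuous.measurable
    (B := 1) (fun x => by
      rw [abs_of_nonneg (pow_nonneg (cut_nonneg x) _)]
      exact pow_le_one₀ (cut_nonneg x) (cut_le_one x)) hcut3
  have h2 : Tendsto (fun n => ∫ x, v n x ^ 2 * cut x ^ 2) atTop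
      (𝓝 (∫ x, U x ^ 2 * cut x ^ 2)) := by
    refine tendsto_integral_of_dominated_convergence
      (fun x => (√(C * 4) * 4) ^ 2 * cut x ^ 2) (fun n => ?_) ?_ (fun n => ?_) ?_
    · exact (((h.sol n).continuous.pow 2).mul
        (contDiff_cut_pow 0).continuous).aestronglyMeasurable
    · exact ((contDiff_cut_pow 0).continuous.integrable_of_hasCompactSupport
        (hasCompactSupport_cut_pow 1)).const_mul _
    · refine .of_forall fun x => ?_
      rw [norm_of_nonneg (mul_nonneg (sq_nonneg _) (sq_nonneg _))]
      by_cases hx : ‖x‖ < 1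
      · have h3 := (h.sol n).le_on_ball le_rfl (mem_ball_zero_iff.2 (by linarith) :
          x ∈ ball 0 4)
        have h4 := (h.sol n).nonneg x
        gcongr
      · rw [cut_eq_zero (not_lt.1 hx)]; simp
    · refine .of_forall fun x => ?_
      by_cases hx : ‖x‖ < 1
      · exact ((h.tendsto.tendsto_at (mem_closedBall_zero_iff.2 (by linarith))).pow 2).mul_const _
      · rw [cut_eq_zero (not_lt.1 hx)]; simp
  have h3 := h1.sub (h2.const_mul 9)
  refine h3.trans (le_of_eq ?_)
  congr 1
  have i1 := IsBlowUpLimit.integrable_norm_sq_mul hK (contDiff_cut_pow 1).continuous (hasCompactSupport_cut_pow 2)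
  have e1 : ∫ x, x 1 * sectorPhase α β c₁ c₂ x * cut x ^ 3
      = (∫ x, (‖∇ U x‖ ^ 2 + x 1 * sectorPhase α β c₁ c₂ x) * cut x ^ 3)
        - ∫ x, ‖∇ U x‖ ^ 2 * cut x ^ 3 := by
    rw [← integral_sub i0 i1]
    congr 1; ext x; ring
  rw [e1, h.integral_norm_sq_mul_cut]

end IsPhaseLimit

/-! ### Integrals in polar coordinates -/

lemma integral_eq_of_polar {g : Plane → ℝ} {a b : ℝ → ℝ}
    (h : ∀ R θ, 0 < R → θ ∈ Ioo (-π) π → R * g (R • unitVec θ) = a R * b θ) :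
    ∫ x, g x = (∫ R in Ioi 0, a R) * ∫ θ in Ioo (-π) π, b θ := by
  rw [← integral_polar, ← setIntegral_prod_mul]
  exact setIntegral_congr_fun (measurableSet_Ioi.prod measurableSet_Ioo) fun p hp =>
    h _ _ hp.1 hp.2

lemma integral_eq_of_polar_add {g : Plane → ℝ} {a₁ a₂ b₁ b₂ : ℝ → ℝ}
    (ha₁ : IntegrableOn a₁ (Ioi 0)) (ha₂ : IntegrableOn a₂ (Ioi 0))
    (hb₁ : IntegrableOn b₁ (Ioo (-π) π))
    (hb₂ : IntegrableOn b₂ (Ioo (-π) π))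
    (h : ∀ R θ, 0 < R → θ ∈ Ioo (-π) π →
      R * g (R • unitVec θ) = a₁ R * b₁ θ + a₂ R * b₂ θ) :
    ∫ x, g x = (∫ R in Ioi 0, a₁ R) * (∫ θ in Ioo (-π) π, b₁ θ)
      + (∫ R in Ioi 0, a₂ R) * ∫ θ in Ioo (-π) π, b₂ θ := by
  have hi : ∀ a b : ℝ → ℝ, IntegrableOn a (Ioi 0) → IntegrableOn b (Ioo (-π) π) →
      IntegrableOn (fun p : ℝ × ℝ => a p.1 * b p.2) (Ioi 0 ×ˢ Ioo (-π) π)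
        (volume.prod volume) := by
    intro a b ha hb
    have := Integrable.mul_prod ha hb
    rwa [Measure.prod_restrict] at this
  rw [← integral_polar, ← setIntegral_prod_mul, ← setIntegral_prod_mul]
  rw [← integral_add (hi _ _ ha₁ hb₁) (hi _ _ ha₂ hb₂)]
  exact setIntegral_congr_fun (measurableSet_Ioi.prod measurableSet_Ioo) fun p hp =>
    h _ _ hp.1 hp.2

/-- The cutoff `cut` as a function of the radius. -/
noncomputable def radialCut (R : ℝ) : ℝ := max (1 - R ^ 2) 0

lemma cut_smul_unitVec {R : ℝ} (hR : 0 < R) (θ : ℝ) : cut (R • unitVec θ) = radialCut R := by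
  rw [cut, radialCut, norm_smul, norm_unitVec, mul_one, norm_of_nonneg hR.le]

lemma pow_mul_radialCut_eq_indicator (m n : ℕ) {R : ℝ} (hR : R ∈ Ioi 0) :
    R ^ m * radialCut R ^ (n + 1)
      = (Ioc 0 1).indicator (fun R : ℝ => R ^ m * (1 - R ^ 2) ^ (n + 1)) R := by
  have hR : 0 < R := hR
  unfold radialCut
  by_cases h1 : R ≤ 1
  · rw [indicator_of_mem (by exact ⟨hR, h1⟩), max_eq_left (by nlinarith)]
  · rw [indicator_of_notMem (fun h => h1 h.2), max_eq_right (by nlinarith)]; simp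

lemma integrableOn_pow_mul_radialCut (m n : ℕ) :
    IntegrableOn (fun R => R ^ m * radialCut R ^ (n + 1)) (Ioi 0) := by
  refine IntegrableOn.congr_fun ?_ (fun R hR => (pow_mul_radialCut_eq_indicator m n hR).symm)
    measurableSet_Ioi
  refine Integrable.integrableOn ((integrable_indicator_iff measurableSet_Ioc).2 ?_)
  exact (by fun_prop : Continuous fun R : ℝ => R ^ m * (1 - R ^ 2) ^ (n + 1)).integrableOn_Ioc

lemma integral_pow_mul_radialCut (m n : ℕ) : ∫ R in Ioi 0, R ^ m * radialCut R ^ (n + 1)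
    = ∫ R in 0..1, R ^ m * (1 - R ^ 2) ^ (n + 1) := by
  rw [setIntegral_congr_fun measurableSet_Ioi fun R hR => pow_mul_radialCut_eq_indicator m n hR,
    setIntegral_indicator measurableSet_Ioc, intervalIntegral.integral_of_le zero_le_one]
  congr 2
  exact inter_eq_right.2 fun R hR => hR.1

lemma integral_pow_mul_radialCut_pos (m n : ℕ) :
    0 < ∫ R in Ioi 0, R ^ m * radialCut R ^ (n + 1) := by
  rw [integral_pow_mul_radialCut]
  refine intervalIntegral.intervalIntegral_pos_of_pos_on
    ((by fun_prop : Continuous fun R : ℝ => R ^ m * (1 - R ^ 2) ^ (n + 1)).intervalIntegrable _ _)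
    (fun R hR => ?_) zero_lt_one
  have h1 : 0 < 1 - R ^ 2 := by nlinarith [hR.1, hR.2]
  have := hR.1
  positivity

lemma integral_cube_mul_radialCut : ∫ R in Ioi 0, R ^ 3 * radialCut R ^ 2 = 1 / 24 := by
  rw [integral_pow_mul_radialCut 3 1]
  have h : ∀ R ∈ uIcc 0 1,
      HasDerivAt (fun R : ℝ => R ^ 4 / 4 - R ^ 6 / 3 + R ^ 8 / 8) (R ^ 3 * (1 - R ^ 2) ^ (1 + 1)) R := by
    intro R _
    convert! ((hasDerivAt_pow 4 R).div_const 4).sub ((hasDerivAt_pow 6 R).div_const 3) |>.add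
      ((hasDerivAt_pow 8 R).div_const 8) using 1
    norm_num; ring
  rw [intervalIntegral.integral_eq_sub_of_hasDerivAt h
    ((by fun_prop : Continuous fun R : ℝ => R ^ 3 * (1 - R ^ 2) ^ (1 + 1)).intervalIntegrable _ _)]
  norm_num

lemma integral_fifth_mul_radialCut : ∫ R in Ioi 0, R ^ 5 * radialCut R = 1 / 24 := by
  have h0 := integral_pow_mul_radialCut 5 0
  simp only [zero_add, pow_one] at h0
  rw [h0]
  have h : ∀ R ∈ uIcc 0 1,
      HasDerivAt (fun R : ℝ => R ^ 6 / 6 - R ^ 8 / 8) (R ^ 5 * (1 - R ^ 2)) R := by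
    intro R _
    convert! ((hasDerivAt_pow 6 R).div_const 6).sub ((hasDerivAt_pow 8 R).div_const 8) using 1
    norm_num; ring
  rw [intervalIntegral.integral_eq_sub_of_hasDerivAt h
    ((by fun_prop : Continuous fun R : ℝ => R ^ 5 * (1 - R ^ 2)).intervalIntegrable _ _)]
  norm_num

lemma integrableOn_and_integral_of_eqOn_Ioo {g k K : ℝ → ℝ} {c p q : ℝ} (hpq : p ≤ q)
    (hK : ∀ θ, HasDerivAt K (k θ) θ) (hk : Continuous k)
    (hg : ∀ θ ∈ Ioo p q, g θ = c * k θ) :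
    IntervalIntegrable g volume p q ∧ ∫ θ in p..q, g θ = c * (K q - K p) := by
  have hi : IntervalIntegrable (fun θ => c * k θ) volume p q :=
    (continuous_const.mul hk).intervalIntegrable _ _
  have hint : ∫ θ in p..q, c * k θ = c * (K q - K p) := by
    rw [intervalIntegral.integral_const_mul, intervalIntegral.integral_eq_sub_of_hasDerivAt
      (fun θ _ => hK θ) (hk.intervalIntegrable _ _)]
  constructor
  · rw [intervalIntegrable_iff_integrableOn_Ioo_of_le hpq] at hi ⊢
    exact hi.congr_fun (fun θ hθ => (hg θ hθ).symm) measurableSet_Ioo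
  · rw [← hint, intervalIntegral.integral_of_le hpq, intervalIntegral.integral_of_le hpq,
      integral_Ioc_eq_integral_Ioo, integral_Ioc_eq_integral_Ioo]
    exact setIntegral_congr_fun measurableSet_Ioo hg

lemma integral_angularPhase_mul {α β c₁ c₂ : ℝ} (hα : 0 ≤ α) (hαβ : α ≤ β) (hβ : β ≤ π)
    {k K : ℝ → ℝ} (hK : ∀ θ, HasDerivAt K (k θ) θ) (hk : Continuous k) :
    IntegrableOn (fun θ => angularPhase α β c₁ c₂ θ * k θ) (Ioo (-π) π) ∧
    ∫ θ in Ioo (-π) π, angularPhase α β c₁ c₂ θ * k θ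
      = c₁ * (K α - K 0) + (K β - K α) + c₂ * (K π - K β) := by
  have hππ : -π ≤ π := by linarith
  obtain ⟨i1, e1⟩ := integrableOn_and_integral_of_eqOn_Ioo (p := -π) (q := 0) (c := 0)
    (g := fun θ => angularPhase α β c₁ c₂ θ * k θ) (by linarith) hK hk fun θ hθ => by
      simp only [angularPhase]; rw [if_pos (Or.inl hθ.2.le)]
  obtain ⟨i2, e2⟩ := integrableOn_and_integral_of_eqOn_Ioo (p := 0) (q := α) (c := c₁)
    (g := fun θ => angularPhase α β c₁ c₂ θ * k θ) hα hK hk fun θ hθ => by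
      have := hθ.1; have := hθ.2
      simp only [angularPhase]
      rw [if_neg (by rintro (h | h) <;> linarith), if_pos hθ.2.le]
  obtain ⟨i3, e3⟩ := integrableOn_and_integral_of_eqOn_Ioo
    (g := fun θ => angularPhase α β c₁ c₂ θ * k θ) hαβ hK hk fun θ hθ => by
      have := hθ.1; have := hθ.2
      simp only [angularPhase]
      rw [if_neg (by rintro (h | h) <;> linarith), if_neg (by linarith), if_pos hθ.2]
  obtain ⟨i4, e4⟩ := integrableOn_and_integral_of_eqOn_Ioo
    (g := fun θ => angularPhase α β c₁ c₂ θ * k θ) hβ hK hk fun θ hθ => by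
      have := hθ.1; have := hθ.2
      simp only [angularPhase]
      rw [if_neg (by rintro (h | h) <;> linarith), if_neg (by linarith), if_neg (by linarith)]
  refine ⟨(intervalIntegrable_iff_integrableOn_Ioo_of_le hππ).1 (((i1.trans i2).trans i3).trans i4),
    ?_⟩
  rw [← integral_Ioc_eq_integral_Ioo, ← intervalIntegral.integral_of_le hππ,
    ← intervalIntegral.integral_add_adjacent_intervals ((i1.trans i2).trans i3) i4,
    ← intervalIntegral.integral_add_adjacent_intervals (i1.trans i2) i3,
    ← intervalIntegral.integral_add_adjacent_intervals i1 i2, e1, e2, e3, e4]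
  ring

lemma integral_indicator_mul {α β : ℝ} (hα : 0 ≤ α) (hαβ : α ≤ β) (hβ : β ≤ π)
    {k K : ℝ → ℝ} (hK : ∀ θ, HasDerivAt K (k θ) θ) (hk : Continuous k) :
    IntegrableOn ((Ioo α β).indicator k) (Ioo (-π) π) ∧
    ∫ θ in Ioo (-π) π, (Ioo α β).indicator k θ = K β - K α := by
  constructor
  · exact ((integrable_indicator_iff measurableSet_Ioo).2
      (hk.integrableOn_Icc.mono_set Ioo_subset_Icc_self)).integrableOn
  · rw [setIntegral_indicator measurableSet_Ioo, inter_eq_right.2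
      (Ioo_subset_Ioo (by linarith) hβ), ← integral_Ioc_eq_integral_Ioo,
      ← intervalIntegral.integral_of_le hαβ]
    exact intervalIntegral.integral_eq_sub_of_hasDerivAt (fun θ _ => hK θ) (hk.intervalIntegrable _ _)

/-! ### The corner angle -/

lemma inner_self_perp (x : Plane) : ⟪x, perp x⟫ = 0 := by
  simp only [inner_plane, perp_apply_zero, perp_apply_one]; ring

namespace IsWedge

variable {f : ℝ → ℝ} {A α : ℝ}

lemma apply_pos (h : IsWedge f A α) {θ : ℝ} (hθ : θ ∈ Ioo α (α + 2 * π / 3)) : 0 < f θ := by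
  rw [h.eq_sin θ (by grind)]
  refine mul_pos h.A_pos (Real.sin_pos_of_pos_of_lt_pi ?_ ?_)
  · linarith [hθ.1]
  · linarith [hθ.2]

end IsWedge

namespace IsBlowUpLimit

variable {A α : ℝ}

lemma fderiv_perp (h : IsBlowUpLimit C κ v U) (hf : IsWedge (fun θ => U (unitVec θ)) A α) {R θ : ℝ}
    (hR : 0 < R) (hR3 : R < 3) (hθ : θ ∈ Ioo α (α + 2 * π / 3)) :
    DifferentiableAt ℝ U (R • unitVec θ) ∧
    fderiv ℝ U (R • unitVec θ) (R • unitVec θ)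
      = 3 / 2 * (R ^ (3 / 2 : ℝ) * (A * sin (3 / 2 * (θ - α)))) ∧
    fderiv ℝ U (R • unitVec θ) (perp (R • unitVec θ))
      = 3 / 2 * (R ^ (3 / 2 : ℝ) * (A * cos (3 / 2 * (θ - α)))) := by
  have hx3 : R • unitVec θ ∈ ball 0 3 := by
    rw [mem_ball_zero_iff, norm_smul, norm_unitVec, norm_of_nonneg hR.le, mul_one]
    exact hR3
  have hfθ := hf.eq_sin θ (by grind)
  have hUx : 0 < U (R • unitVec θ) := by
    rw [h.apply_polar hR hR3]
    exact mul_pos (by positivity) (hf.apply_pos hθ)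
  have hd : DifferentiableAt ℝ U (R • unitVec θ) :=
    (h.contDiffOn.contDiffAt ((isOpen_ball.inter
      (isOpen_lt continuous_const h.continuous)).mem_nhds ⟨hx3, hUx⟩)).differentiableAt
      (by norm_num)
  refine ⟨hd, ?_, ?_⟩
  · rw [h.fderiv_self hx3 hd, h.apply_polar hR hR3, hfθ]
  · have h1 : HasDerivAt (fun t => R • unitVec t) (R • perp (unitVec θ)) θ :=
      (hasDerivAt_unitVec θ).const_smul R
    have h2 : HasDerivAt (fun t => U (R • unitVec t)) _ θ := hd.hasFDerivAt.comp_hasDerivAt θ h1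
    have h3 : (fun t => U (R • unitVec t)) =ᶠ[𝓝 θ]
        fun t => R ^ (3 / 2 : ℝ) * (A * sin (3 / 2 * (t - α))) := by
      filter_upwards [isOpen_Ioo.mem_nhds hθ] with t ht
      have := hf.eq_sin t (Ioo_subset_Icc_self ht)
      rw [h.apply_polar hR hR3, this]
    have h4 : HasDerivAt (fun t => R ^ (3 / 2 : ℝ) * (A * sin (3 / 2 * (t - α))))
        (R ^ (3 / 2 : ℝ) * (A * (cos (3 / 2 * (θ - α)) * (3 / 2 * 1)))) θ :=
      ((((hasDerivAt_id θ).sub_const α).const_mul (3 / 2)).sin.const_mul A).const_mul _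
    rw [map_smul, h2.unique (h4.congr_of_eventuallyEq h3)]
    ring

lemma sq_rpow_three_halves {R : ℝ} (hR : 0 ≤ R) : (R ^ (3 / 2 : ℝ)) ^ 2 = R ^ 3 := by
  rw [rpow_three_halves hR, mul_pow, sq_sqrt hR]; ring

/-- Inside the wedge, `|∇U|²` depends on the radius only. -/
lemma norm_gradient_sq (h : IsBlowUpLimit C κ v U) (hf : IsWedge (fun θ => U (unitVec θ)) A α)
    {R θ : ℝ} (hR : 0 < R) (hR3 : R < 3) (hθ : θ ∈ Ioo α (α + 2 * π / 3)) :
    ‖∇ U (R • unitVec θ)‖ ^ 2 = 9 / 4 * A ^ 2 * R := by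
  obtain ⟨-, h1, h2⟩ := h.fderiv_perp hf hR hR3 hθ
  set x := R • unitVec θ with hx
  have h3 := norm_sq_mul_inner x (∇ U x) (∇ U x)
  rw [real_inner_self_eq_norm_sq, inner_gradient, inner_gradient, h1, h2, hx, norm_smul,
    norm_unitVec, mul_one, norm_of_nonneg hR.le, ← hx] at h3
  have h4 := sq_rpow_three_halves hR.le
  have h5 := Real.sin_sq_add_cos_sq (3 / 2 * (θ - α))
  have h6 : R ^ 2 * (‖∇ U x‖ ^ 2 - 9 / 4 * A ^ 2 * R) = 0 := by grind
  have h7 : R ^ 2 ≠ 0 := by positivity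
  linarith [(mul_eq_zero.1 h6).resolve_left h7]

lemma gradient_eq_zero_of_notMem (h : IsBlowUpLimit C κ v U)
    (hf : ∀ θ ∈ Icc (-π) π, θ ∉ Ioo α (α + 2 * π / 3) → U (unitVec θ) = 0)
    {R θ : ℝ} (hR : 0 < R) (hR3 : R < 3) (hθ : θ ∈ Ioo (-π) π)
    (hθ' : θ ∉ Ioo α (α + 2 * π / 3)) : ∇ U (R • unitVec θ) = 0 := by
  refine gradient_eq_zero_of_nonneg h.nonneg ?_
  rw [h.apply_polar hR hR3, hf θ (by grind) hθ', mul_zero]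

end IsBlowUpLimit

namespace IsPhaseLimit

variable {A α β c₁ c₂ : ℝ}

/-- The first variation identity for rotations, localized with `cut ^ 2` and a weight `q`. -/
lemma integral_rotation (h : IsPhaseLimit C κ v U α β c₁ c₂) {q : Plane → ℝ}
    (hq : ContDiff ℝ 1 q) :
    ∫ x, ((‖∇ U x‖ ^ 2 + x 1 * sectorPhase α β c₁ c₂ x)
        * (cut x ^ 2 * fderiv ℝ q x (perp x))
      - 2 * ((cut x ^ 2 * fderiv ℝ q x (∇ U x)
        - 4 * cut x * fderiv ℝ U x x * q x) * fderiv ℝ U x (perp x))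
      + sectorPhase α β c₁ c₂ x * (cut x ^ 2 * q x * x 0)) = 0 := by
  set g : Plane → ℝ := fun x => cut x ^ 2 * q x with hg
  have hgd : ContDiff ℝ 1 g := (contDiff_cut_pow 0).mul hq
  have hs : tsupport (fun x => g x • perp x) ⊆ closedBall 0 1 := by
    refine (closure_mono fun x hx => ?_).trans (tsupport_cut_pow 1)
    intro h0
    exact hx (by simp only [hg]; rw [show cut x ^ 2 = 0 from h0]; simp)
  have hφ : IsTestField (ball 0 (3 / 2)) fun x => g x • perp x :=
    ⟨hgd.smul perp.contDiff, (isCompact_closedBall _ _).of_isClosed_subset (isClosed_tsupport _) hs,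
      hs.trans (closedBall_subset_ball (by norm_num))⟩
  have h1 := h.integral_variation_eq_zero hφ
  rw [← h1]
  refine integral_congr_ae (.of_forall fun x => ?_)
  have hgx : DifferentiableAt ℝ g x := hgd.differentiable (by norm_num) x
  have hgf : ∀ a, fderiv ℝ g x a
      = cut x ^ 2 * fderiv ℝ q x a - 4 * cut x * ⟪x, a⟫ * q x := by
    intro a
    have h2 : HasFDerivAt g _ x :=
      (hasFDerivAt_cut_pow 0 x).mul (hq.differentiable (by norm_num) x).hasFDerivAt
    rw [h2.fderiv]
    simp
    ring
  have hpf : HasFDerivAt (fun x => g x • perp x) _ x := hgx.hasFDerivAt.smul perp.hasFDerivAt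
  have e1 : ∀ a : Plane, ⟪a, fderiv ℝ (fun x => g x • perp x) x a⟫
      = fderiv ℝ g x a * ⟪a, perp x⟫ := by
    intro a
    rw [hpf.fderiv]
    simp [inner_add_right, inner_smul_right, inner_self_perp]
  simp only
  rw [divergence_smul_perp hgx, e1, hgf, hgf, inner_self_perp, real_inner_comm, inner_gradient,
    inner_gradient]
  simp only [hg, PiLp.smul_apply, perp_apply_one, smul_eq_mul]
  ring

end IsPhaseLimit

lemma sectorPhase_smul_unitVec (α β c₁ c₂ : ℝ) {R θ : ℝ} (hR : 0 < R)
    (hθ : θ ∈ Ioo (-π) π) :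
    sectorPhase α β c₁ c₂ (R • unitVec θ) = angularPhase α β c₁ c₂ θ := by
  rw [sectorPhase, polarAngle_smul_unitVec hR ⟨hθ.1, hθ.2.le⟩]

lemma hasDerivAt_three_halves_mul_sub (α θ : ℝ) :
    HasDerivAt (fun t => 3 / 2 * (t - α)) (3 / 2) θ := by
  simpa using ((hasDerivAt_id θ).sub_const α).const_mul (3 / 2)

namespace IsPhaseLimit

variable {A α c₁ c₂ : ℝ}

/-- The rotation identity with constant weight. -/
lemma sin_balance (h : IsPhaseLimit C κ v U α (α + 2 * π / 3) c₁ c₂)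
    (hf : IsWedge (fun θ => U (unitVec θ)) A α) :
    (1 - c₁) * sin α = (1 - c₂) * sin (α + 2 * π / 3) := by
  have hπ := pi_pos
  have hβ := hf.le_pi
  set β := α + 2 * π / 3 with hβd
  have hαβ : α ≤ β := by linarith
  have h1 := h.integral_rotation (q := fun _ => 1) contDiff_const
  obtain ⟨j1, e1⟩ := integral_indicator_mul hf.α_nonneg hαβ hβ
    (k := fun θ => 18 * A ^ 2 * (sin (3 / 2 * (θ - α)) * cos (3 / 2 * (θ - α))))
    (K := fun θ => 6 * A ^ 2 * sin (3 / 2 * (θ - α)) ^ 2) (fun θ => by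
      have := ((hasDerivAt_three_halves_mul_sub α θ).sin.pow 2).const_mul (6 * A ^ 2)
      refine this.congr_deriv ?_
      norm_num; ring) (by fun_prop)
  obtain ⟨j2, e2⟩ := integral_angularPhase_mul (c₁ := c₁) (c₂ := c₂) hf.α_nonneg hαβ hβ
    Real.hasDerivAt_sin Real.continuous_cos
  rw [integral_eq_of_polar_add
    (a₂ := fun R => R ^ 2 * radialCut R ^ (1 + 1)) (integrableOn_pow_mul_radialCut 4 0)
    (integrableOn_pow_mul_radialCut 2 1) j1 j2, e1, e2] at h1
  · have h2 := integral_pow_mul_radialCut_pos 2 1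
    have h3 : 3 / 2 * (β - α) = π := by rw [hβd]; ring
    simp only [h3, sub_self, mul_zero, Real.sin_zero, Real.sin_pi, sub_zero, zero_add] at h1
    norm_num at h1
    norm_num at h2
    have := h1.resolve_left h2.ne'
    linarith
  · intro R θ hR hθ
    simp only [zero_add, pow_one]
    rw [sectorPhase_smul_unitVec _ _ _ _ hR hθ, cut_smul_unitVec hR]
    simp only [PiLp.smul_apply, unitVec_apply_zero, unitVec_apply_one, smul_eq_mul,
      fderiv_const_apply, _root_.zero_apply, mul_zero, zero_sub, mul_one]
    by_cases hR1 : R < 1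
    · by_cases hθ' : θ ∈ Ioo α β
      · obtain ⟨-, h2, h3⟩ := h.fderiv_perp hf hR (by linarith) hθ'
        have h4 := IsBlowUpLimit.sq_rpow_three_halves hR.le
        rw [indicator_of_mem hθ', h2, h3]
        linear_combination 18 * R * radialCut R * A ^ 2 * sin (3 / 2 * (θ - α))
          * cos (3 / 2 * (θ - α)) * h4
      · have h2 := h.gradient_eq_zero_of_notMem hf.eq_zero hR (by linarith) hθ hθ'
        rw [indicator_of_notMem hθ', ← inner_gradient, h2, inner_zero_left]
        ring
    · have : radialCut R = 0 := max_eq_right (by nlinarith)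
      rw [this]; ring

/-- The rotation identity with weight `x₁`. -/
lemma cos_balance (h : IsPhaseLimit C κ v U α (α + 2 * π / 3) c₁ c₂)
    (hf : IsWedge (fun θ => U (unitVec θ)) A α) :
    (9 / 4 * A ^ 2 - (1 - c₁) * sin α) * cos α
      = (9 / 4 * A ^ 2 - (1 - c₂) * sin (α + 2 * π / 3))
        * cos (α + 2 * π / 3) := by
  have hπ := pi_pos
  have hβ := hf.le_pi
  set β := α + 2 * π / 3 with hβd
  have hαβ : α ≤ β := by linarith
  set E := 9 / 4 * A ^ 2 with hE
  have h1 := h.integral_rotation (q := fun x => x 0)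
    (by fun_prop)
  set k₁ : ℝ → ℝ := fun θ => 8 * E * (sin (3 / 2 * (θ - α)) * cos (3 / 2 * (θ - α))
    * cos θ) with hk₁
  set k₂ : ℝ → ℝ := fun θ => E * (-sin θ - 2 * (sin (3 / 2 * (θ - α))
    * cos (3 / 2 * (θ - α)) * cos θ) + 2 * (cos (3 / 2 * (θ - α)) ^ 2 * sin θ))
    with hk₂
  have hk₁c : Continuous k₁ := by fun_prop
  have hk₂c : Continuous k₂ := by fun_prop
  have hind : ∀ k : ℝ → ℝ, Continuous k →
      IntegrableOn ((Ioo α β).indicator k) (Ioo (-π) π) := fun k hk =>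
    ((integrable_indicator_iff measurableSet_Ioo).2
      (hk.integrableOn_Icc.mono_set Ioo_subset_Icc_self)).integrableOn
  obtain ⟨-, e1⟩ := integral_indicator_mul hf.α_nonneg hαβ hβ (k := fun θ => k₁ θ + k₂ θ)
    (K := fun θ => -E * ((2 * cos (3 / 2 * (θ - α)) ^ 2 - 1) * cos θ)) (fun θ => by
      have h2 := ((((hasDerivAt_three_halves_mul_sub α θ).cos.pow 2).const_mul 2).sub_const 1).mul
        (Real.hasDerivAt_cos θ) |>.const_mul (-E)
      refine h2.congr_deriv ?_
      simp only [hk₁, hk₂]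
      norm_num; ring) (hk₁c.add hk₂c)
  obtain ⟨j2, e2⟩ := integral_angularPhase_mul (c₁ := c₁) (c₂ := c₂) hf.α_nonneg hαβ hβ
    (k := fun θ => cos θ ^ 2 - sin θ ^ 2) (K := fun θ => sin θ * cos θ)
    (fun θ => ((Real.hasDerivAt_sin θ).mul (Real.hasDerivAt_cos θ)).congr_deriv (by ring))
    (by fun_prop)
  have e3 : (∫ θ in Ioo (-π) π, (Ioo α β).indicator k₁ θ)
      + ∫ θ in Ioo (-π) π, (Ioo α β).indicator k₂ θ
      = ∫ θ in Ioo (-π) π, (Ioo α β).indicator (fun θ => k₁ θ + k₂ θ) θ := by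
    rw [← integral_add (hind _ hk₁c) (hind _ hk₂c)]
    congr 1; ext θ
    by_cases hθ : θ ∈ Ioo α β
    · simp only [indicator_of_mem hθ]
    · simp only [indicator_of_notMem hθ, add_zero]
  have i5 := integrableOn_pow_mul_radialCut 5 0
  have i3 := integrableOn_pow_mul_radialCut 3 1
  have j2' : IntegrableOn (fun θ => (Ioo α β).indicator k₂ θ + angularPhase α β c₁ c₂ θ
      * (cos θ ^ 2 - sin θ ^ 2)) (Ioo (-π) π) := (hind _ hk₂c).add j2
  simp only [zero_add, pow_one, Nat.reduceAdd] at i5 i3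
  rw [integral_eq_of_polar_add (a₁ := fun R => R ^ 5 * radialCut R)
    (a₂ := fun R => R ^ 3 * radialCut R ^ 2) i5 i3 (hind _ hk₁c) j2',
    integral_fifth_mul_radialCut, integral_cube_mul_radialCut,
    integral_add (hind _ hk₂c) j2, ← mul_add, ← add_assoc, e3, e1, e2] at h1
  · have h3 : 3 / 2 * (β - α) = π := by rw [hβd]; ring
    simp only [h3, sub_self, mul_zero, Real.sin_zero, Real.sin_pi, Real.cos_zero, Real.cos_pi] at h1
    linarith
  · intro R θ hR hθ
    have hp : ∀ a : Plane, fderiv ℝ (fun x : Plane => x 0) (R • unitVec θ) a = a 0 := fun a => by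
      rw [(proj (𝕜 := ℝ) (0 : Fin 2)).hasFDerivAt.fderiv (x := R • unitVec θ) |>
        fun h : fderiv ℝ (fun x : Plane => x 0) (R • unitVec θ) = _ => h]
      rfl
    rw [sectorPhase_smul_unitVec _ _ _ _ hR hθ, cut_smul_unitVec hR, hp, hp]
    by_cases hR1 : R < 1
    · by_cases hθ' : θ ∈ Ioo α β
      · obtain ⟨-, h2, h3⟩ := h.fderiv_perp hf hR (by linarith) hθ'
        have h4 := IsBlowUpLimit.sq_rpow_three_halves hR.le
        have h5 := h.norm_gradient_sq hf hR (by linarith) hθ'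
        -- the first component of the gradient, times the angular derivative
        have h6 : R ^ 2 * ∇ U (R • unitVec θ) 0
            = fderiv ℝ U (R • unitVec θ) (R • unitVec θ) * (R * cos θ)
              - fderiv ℝ U (R • unitVec θ) (perp (R • unitVec θ)) * (R * sin θ) := by
          have h7 := norm_sq_mul_inner (R • unitVec θ) (∇ U (R • unitVec θ))
            (single 0 1)
          rw [norm_smul, norm_unitVec, mul_one, norm_of_nonneg hR.le, inner_gradient,
            inner_gradient, inner_gradient, ← gradient_apply] at h7
          rw [h7, inner_plane, inner_plane]
          simp
          ring
        have h8 : ∇ U (R • unitVec θ) 0 * (3 / 2 * (R ^ (3 / 2 : ℝ)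
            * (A * cos (3 / 2 * (θ - α))))) = R ^ 2 * (E * (sin (3 / 2 * (θ - α))
              * cos (3 / 2 * (θ - α)) * cos θ
              - cos (3 / 2 * (θ - α)) ^ 2 * sin θ)) := by
          rw [h2, h3] at h6
          refine mul_left_cancel₀ (pow_ne_zero 2 hR.ne') ?_
          simp only [hE]
          linear_combination (3 / 2 * (R ^ (3 / 2 : ℝ) * (A * cos (3 / 2 * (θ - α))))) * h6
            + 9 / 4 * A ^ 2 * R * (sin (3 / 2 * (θ - α))
              * cos (3 / 2 * (θ - α)) * cos θ
              - cos (3 / 2 * (θ - α)) ^ 2 * sin θ) * h4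
        simp only [indicator_of_mem hθ', hk₁, hk₂]
        rw [h2, h3, h5]
        simp only [PiLp.smul_apply, unitVec_apply_zero, unitVec_apply_one, smul_eq_mul,
          perp_apply_zero]
        simp only [hE] at h8 ⊢
        linear_combination -2 * R * radialCut R ^ 2 * h8 + 18 * A ^ 2 * R ^ 2 * radialCut R
          * sin (3 / 2 * (θ - α)) * cos (3 / 2 * (θ - α)) * cos θ * h4
      · have h2 := h.gradient_eq_zero_of_notMem hf.eq_zero hR (by linarith) hθ hθ'
        rw [indicator_of_notMem hθ', indicator_of_notMem hθ', ← inner_gradient, ← inner_gradient,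
          h2, inner_zero_left, inner_zero_left]
        simp only [PiLp.smul_apply, unitVec_apply_zero, unitVec_apply_one, smul_eq_mul,
          perp_apply_zero, norm_zero]
        ring
    · have : radialCut R = 0 := max_eq_right (by nlinarith)
      rw [this]; ring

/-- A wedge of angle `2π/3` can only be the Stokes corner, without phase outside the wedge. -/
lemma eq_of_isWedge (h : IsPhaseLimit C κ v U α (α + 2 * π / 3) c₁ c₂)
    (hf : IsWedge (fun θ => U (unitVec θ)) A α) :
    α = π / 6 ∧ A = √2 / 3 ∧ c₁ = 0 ∧ c₂ = 0 := by
  have hπ := pi_pos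
  have h1 := h.sin_balance hf
  have h2 := h.cos_balance hf
  have hα := hf.α_nonneg
  have hβ := hf.le_pi
  have hA := hf.A_pos
  have hcos : cos (α + 2 * π / 3) < cos α :=
    Real.cos_lt_cos_of_nonneg_of_le_pi hα hβ (by linarith)
  have h3 : (9 / 4 * A ^ 2 - (1 - c₁) * sin α)
      * (cos α - cos (α + 2 * π / 3)) = 0 := by grind
  have h4 : 9 / 4 * A ^ 2 = (1 - c₁) * sin α := by grind
  have h5 : 0 < 9 / 4 * A ^ 2 := by positivity
  have hc1 : c₁ = 0 := h.c₁_eq.resolve_right fun h6 => by rw [h6] at h4; linarith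
  have hc2 : c₂ = 0 := h.c₂_eq.resolve_right fun h6 => by rw [h6] at h1; linarith
  rw [hc1, hc2] at h1
  rw [hc1] at h4
  have h6 : sin α = sin (π - (α + 2 * π / 3)) := by simp_all
  have h7 : α = π - (α + 2 * π / 3) :=
    Real.injOn_sin ⟨by linarith, by linarith⟩ ⟨by linarith, by linarith⟩ h6
  have h8 : α = π / 6 := by linarith
  refine ⟨h8, ?_, hc1, hc2⟩
  rw [h8, Real.sin_pi_div_six] at h4
  have h9 : (√2 / 3) ^ 2 = 2 / 9 := by grind
  exact (pow_left_inj₀ hA.le (by positivity) two_ne_zero).1 (by rw [h9]; linarith)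

end IsPhaseLimit

/-! ### The energies of the possible limits -/

/-- The normalized energy of the incompressible problem in the unit disc. -/
noncomputable def unitEnergy (w : Plane → ℝ) : ℝ :=
  (∫ x in ball 0 1, energyDensity w x) - 3 / 2 * ∫ θ in 0..2 * π, w (unitVec θ) ^ 2

/-- The integral of `sin θ` against the phase. -/
noncomputable def phaseMass (α β c₁ c₂ : ℝ) : ℝ :=
  c₁ * (1 - cos α) + (cos α - cos β) + c₂ * (1 + cos β)

lemma integral_angularPhase_mul_sin {α β c₁ c₂ : ℝ} (hα : 0 ≤ α) (hαβ : α ≤ β) (hβ : β ≤ π) :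
    IntegrableOn (fun θ => angularPhase α β c₁ c₂ θ * sin θ) (Ioo (-π) π) ∧
    ∫ θ in Ioo (-π) π, angularPhase α β c₁ c₂ θ * sin θ
      = phaseMass α β c₁ c₂ := by
  obtain ⟨h1, h2⟩ := integral_angularPhase_mul hα hαβ hβ
    (K := fun θ => -cos θ) (fun θ => (Real.hasDerivAt_cos θ).neg.congr_deriv (neg_neg _))
    Real.continuous_sin
  refine ⟨h1, h2.trans ?_⟩
  rw [phaseMass, Real.cos_zero, Real.cos_pi]; ring

namespace IsPhaseLimit

variable {α β c₁ c₂ : ℝ}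

lemma tendsto_weissEnergy_phaseMass (h : IsPhaseLimit C κ v U α β c₁ c₂) (hα : 0 ≤ α)
    (hαβ : α ≤ β) (hβ : β ≤ π) : Tendsto (fun n => weissEnergy (v n)) atTop
      (𝓝 ((∫ R in Ioi 0, R ^ 2 * radialCut R ^ (2 + 1)) * phaseMass α β c₁ c₂)) := by
  have h1 := h.tendsto_weissEnergy
  rw [integral_eq_of_polar
   ,
    (integral_angularPhase_mul_sin hα hαβ hβ).2] at h1
  · exact h1
  · intro R θ hR hθ
    rw [sectorPhase_smul_unitVec _ _ _ _ hR hθ, cut_smul_unitVec hR]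
    simp only [PiLp.smul_apply, unitVec_apply_one, smul_eq_mul]
    ring

lemma tendsto_integral_circle (h : IsBlowUpLimit C κ v U) :
    Tendsto (fun n => ∫ θ in 0..2 * π, v n (unitVec θ) ^ 2) atTop
      (𝓝 (∫ θ in 0..2 * π, U (unitVec θ) ^ 2)) := by
  have hu : Continuous unitVec := by fun_prop
  refine intervalIntegral.tendsto_integral_filter_of_dominated_convergence
    (fun _ => (√(C * 4) * 4) ^ 2) (.of_forall fun n => ?_)
    (.of_forall fun n => .of_forall fun θ _ => ?_)
    intervalIntegrable_const (.of_forall fun θ _ => ?_)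
  · exact (((h.sol n).continuous.comp hu).pow 2).aestronglyMeasurable
  · rw [norm_pow, norm_of_nonneg ((h.sol n).nonneg _)]
    have h1 := (h.sol n).le_on_ball le_rfl (mem_ball_zero_iff.2 (by rw [norm_unitVec]; norm_num) :
      unitVec θ ∈ ball 0 4)
    have h2 := (h.sol n).nonneg (unitVec θ)
    gcongr
  · exact (h.tendsto.tendsto_at (mem_closedBall_zero_iff.2
      (by rw [norm_unitVec]; norm_num))).pow 2

lemma tendsto_unitEnergy (h : IsPhaseLimit C κ v U α β c₁ c₂) (hα : 0 ≤ α)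
    (hαβ : α ≤ β) (hβ : β ≤ π) {E : ℝ}
    (hE : ∀ R θ, 0 < R → R < 1 → θ ∈ Ioo (-π) π →
      ‖∇ U (R • unitVec θ)‖ ^ 2 = R * (Ioo α β).indicator (fun _ => E) θ)
    (hS : 1 / 3 * (E * (β - α)) = 3 / 2 * ∫ θ in 0..2 * π, U (unitVec θ) ^ 2) :
    Tendsto (fun n => unitEnergy (v n)) atTop (𝓝 (1 / 3 * phaseMass α β c₁ c₂)) := by
  set m : Plane → ℝ := (ball 0 1).indicator fun _ => 1 with hm
  have hmm : Measurable m := measurable_const.indicator measurableSet_ball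
  have hm1 : ∀ x, |m x| ≤ 1 := fun x => by
    rw [abs_of_nonneg (indicator_nonneg (fun _ _ => zero_le_one) x)]
    exact indicator_le_self' (fun _ _ => zero_le_one) x
  obtain ⟨-, h1⟩ := h.tendsto_integral_energyDensity hmm hm1 fun x hx =>
    indicator_of_notMem (fun h2 => hx (ball_subset_closedBall
      (ball_subset_ball (by norm_num) h2))) _
  obtain ⟨j1, e1⟩ := integral_angularPhase_mul_sin hα hαβ hβ
  obtain ⟨j2, e2⟩ := integral_indicator_mul hα hαβ hβ
    (fun θ => by simpa using (hasDerivAt_id θ).const_mul E) continuous_const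
  have ha : ∫ R in Ioi 0, (Ioo 0 1).indicator (fun R : ℝ => R ^ 2) R = 1 / 3 := by
    rw [setIntegral_indicator measurableSet_Ioo, inter_eq_right.2 fun R hR => hR.1,
      ← integral_Ioc_eq_integral_Ioo, ← intervalIntegral.integral_of_le zero_le_one, integral_pow]
    norm_num
  rw [integral_eq_of_polar
   ,
    integral_add j2 j1, e1, e2, ha] at h1
  · have h2 := h1.sub ((tendsto_integral_circle h.toIsBlowUpLimit).const_mul (3 / 2))
    rw [← hS] at h2
    have e3 : ∀ n, unitEnergy (v n) = (∫ x, energyDensity (v n) x * m x)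
        - 3 / 2 * ∫ θ in 0..2 * π, v n (unitVec θ) ^ 2 := by
      intro n
      rw [unitEnergy, ← integral_indicator measurableSet_ball]
      congr 2
      ext x
      by_cases hx : x ∈ ball 0 1
      · rw [hm, indicator_of_mem hx, indicator_of_mem hx, mul_one]
      · rw [hm, indicator_of_notMem hx, indicator_of_notMem hx, mul_zero]
    simp only [e3]
    refine h2.trans (le_of_eq ?_)
    congr 1; ring
  · intro R θ hR hθ
    have hn : ‖R • unitVec θ‖ = R := by
      rw [norm_smul, norm_unitVec, mul_one, norm_of_nonneg hR.le]
    by_cases hR1 : R < 1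
    · rw [hm, indicator_of_mem (by exact mem_ball_zero_iff.2 (hn.trans_lt hR1)),
        indicator_of_mem (by exact ⟨hR, hR1⟩), hE R θ hR hR1 hθ,
        sectorPhase_smul_unitVec _ _ _ _ hR hθ]
      simp only [PiLp.smul_apply, unitVec_apply_one, smul_eq_mul]
      ring
    · rw [hm, indicator_of_notMem (fun h2 => hR1 (hn ▸ mem_ball_zero_iff.1 h2)),
        indicator_of_notMem (fun h2 => hR1 h2.2)]
      ring

/-- The energy of a vanishing limit. -/
lemma tendsto_unitEnergy_of_eq_zero (h : IsPhaseLimit C κ v U π π c₁ c₂)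
    (h0 : ∀ θ ∈ Icc (-π) π, U (unitVec θ) = 0) :
    Tendsto (fun n => unitEnergy (v n)) atTop (𝓝 (1 / 3 * phaseMass π π c₁ c₂)) := by
  have hU : ∀ x ∈ ball 0 3, U x = 0 := fun x hx => by
    rw [h.apply_eq hx, h0 _ (IsBlowUpLimit.polarAngle_mem_Icc x), mul_zero]
  refine h.tendsto_unitEnergy Real.pi_pos.le le_rfl le_rfl (E := 0) (fun R θ hR hR1 _ => ?_) ?_
  · have hn : R • unitVec θ ∈ ball 0 3 := by
      rw [mem_ball_zero_iff, norm_smul, norm_unitVec, mul_one, norm_of_nonneg hR.le]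
      linarith
    rw [gradient_eq_zero_of_nonneg h.nonneg (hU _ hn)]
    simp
  · have : ∀ θ, U (unitVec θ) = 0 := fun θ =>
      hU _ (mem_ball_zero_iff.2 (by rw [norm_unitVec]; norm_num))
    simp [this]

lemma integral_circle_of_isWedge {f : ℝ → ℝ} {A α : ℝ} (hf : IsWedge f A α)
    (hper : Function.Periodic f (2 * π)) :
    ∫ θ in 0..2 * π, f θ ^ 2 = A ^ 2 * (π / 3) := by
  have hπ := pi_pos
  have h1 : Function.Periodic (fun θ => f θ ^ 2) (2 * π) := by simp_all
  have h2 := h1.intervalIntegral_add_eq (-π) 0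
  rw [zero_add, show -π + 2 * π = π by ring] at h2
  rw [← h2, intervalIntegral.integral_of_le (by linarith), integral_Ioc_eq_integral_Ioo]
  have h3 := (integral_indicator_mul hf.α_nonneg (by linarith) hf.le_pi
    (k := fun θ => A ^ 2 * sin (3 / 2 * (θ - α)) ^ 2)
    (K := fun θ => A ^ 2 * (θ / 2
      - sin (3 / 2 * (θ - α)) * cos (3 / 2 * (θ - α)) / 3)) (fun θ => by
      have h4 := hasDerivAt_three_halves_mul_sub α θ
      have h5 := (((hasDerivAt_id θ).div_const 2).sub ((h4.sin.mul h4.cos).div_const 3)).const_mul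
        (A ^ 2)
      refine h5.congr_deriv ?_
      have := Real.sin_sq_add_cos_sq (3 / 2 * (θ - α))
      linear_combination A ^ 2 / 2 * (-this)) (by fun_prop)).2
  rw [setIntegral_congr_fun measurableSet_Ioo fun θ hθ => ?_, h3]
  · rw [show 3 / 2 * (α + 2 * π / 3 - α) = π by ring]
    simp
    ring
  · by_cases hθ' : θ ∈ Ioo α (α + 2 * π / 3)
    · rw [indicator_of_mem hθ', hf.eq_sin _ (by grind)]; ring
    · rw [indicator_of_notMem hθ', hf.eq_zero _ (by grind) hθ']; norm_num

lemma periodic_comp_unitVec (U : Plane → ℝ) :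
    Function.Periodic (fun θ => U (unitVec θ)) (2 * π) := fun θ => by
  simp only [unitVec, Real.cos_add_two_pi, Real.sin_add_two_pi]

/-- The energy of a wedge. -/
lemma tendsto_unitEnergy_of_isWedge {A : ℝ}
    (h : IsPhaseLimit C κ v U α (α + 2 * π / 3) c₁ c₂)
    (hf : IsWedge (fun θ => U (unitVec θ)) A α) :
    Tendsto (fun n => unitEnergy (v n)) atTop
      (𝓝 (1 / 3 * phaseMass α (α + 2 * π / 3) c₁ c₂)) := by
  have hπ := pi_pos
  refine h.tendsto_unitEnergy hf.α_nonneg (by linarith) hf.le_pi (E := 9 / 4 * A ^ 2)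
    (fun R θ hR hR1 hθ => ?_) ?_
  · by_cases hθ' : θ ∈ Ioo α (α + 2 * π / 3)
    · rw [indicator_of_mem hθ', h.norm_gradient_sq hf hR (by linarith) hθ']; ring
    · rw [indicator_of_notMem hθ', h.gradient_eq_zero_of_notMem hf.eq_zero hR (by linarith) hθ hθ']
      simp
  · rw [integral_circle_of_isWedge hf (periodic_comp_unitVec U)]
    ring

end IsPhaseLimit

/-! ### The trichotomy for almost solutions -/

lemma IsBlowUpLimit.eqOn_stokesProfile
    (h : IsBlowUpLimit C κ v U) (hf : IsWedge (fun θ => U (unitVec θ)) (√2 / 3) (π / 6)) :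
    EqOn U stokesProfile (ball 0 3) := by
  have hπ := pi_pos
  intro x hx
  rw [h.apply_eq hx, stokesProfile]
  have h1 : Complex.arg ⟨x 0, x 1⟩ = polarAngle x := rfl
  have hθ := polarAngle_mem_Icc x
  rw [h1]
  set θ := polarAngle x with hθd
  have hs : ∀ t, cos (3 / 2 * (t - π / 2)) = sin (3 / 2 * (t - π / 6)) := by
    intro t
    rw [← Real.sin_add_pi_div_two]; congr 1; ring
  rw [hs]
  have h2 : U (unitVec θ) = √2 / 3 * sin (3 / 2 *
      (min (max θ (π / 6)) (5 * π / 6) - π / 6)) := by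
    rcases le_total θ (π / 6) with h3 | h3
    · rw [hf.eq_zero θ hθ fun h4 => h3.not_gt h4.1, max_eq_right h3, min_eq_left (by linarith),
        sub_self, mul_zero, Real.sin_zero, mul_zero]
    rcases le_total θ (5 * π / 6) with h4 | h4
    · rw [hf.eq_sin θ ⟨h3, by linarith⟩, max_eq_left h3, min_eq_left h4]
    · rw [hf.eq_zero θ hθ fun h5 => by have := h5.2; linarith, max_eq_left h3, min_eq_right h4,
        show 3 / 2 * (5 * π / 6 - π / 6) = π by ring, Real.sin_pi, mul_zero]
  rw [h2]; ring

/-- Convergence of the blow-ups of `w` at the origin to `U`, on the unit disc, uniformly and with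
the gradients in `L²`. -/
structure BlowUpTendsto (w U : Plane → ℝ) : Prop where
  uniform : TendstoUniformlyOn (fun r => blowUp w 0 r) U (𝓝[>] 0) (closedBall 0 1)
  grad : Tendsto (fun r => ∫ x in ball 0 1,
    ‖∇ (blowUp w 0 r) x - ∇ U x‖ ^ 2) (𝓝[>] 0) (𝓝 0)

namespace AlmostSolution

variable {κ : ℝ}

/-- The possible limits of the energies together with the corresponding limits of the blow-ups. -/
lemma exists_subseq (h : AlmostSolution 4 C κ w) {r : ℕ → ℝ} (hr : Tendsto r atTop (𝓝[>] 0)) :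
    ∃ (s : ℕ → ℕ) (T : ℝ) (V : Plane → ℝ), Tendsto s atTop atTop ∧
      Tendsto (fun n => weissEnergy (blowUp w 0 (r (s n)))) atTop
        (𝓝 ((∫ R in Ioi 0, R ^ 2 * radialCut R ^ (2 + 1)) * T)) ∧
      Tendsto (fun n => unitEnergy (blowUp w 0 (r (s n)))) atTop (𝓝 (1 / 3 * T)) ∧
      TendstoUniformlyOn (fun n => blowUp w 0 (r (s n))) V atTop
        (closedBall 0 1) ∧
      Tendsto (fun n => ∫ x in ball 0 1,
        ‖∇ (blowUp w 0 (r (s n))) x - ∇ V x‖ ^ 2) atTop (𝓝 0) ∧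
      ((V = stokesProfile ∧ T = √3) ∨ (V = (fun _ => 0) ∧ (T = 0 ∨ T = 2))) := by
  have hπ := pi_pos
  obtain ⟨N, hN⟩ := eventually_atTop.1 (hr.eventually (Ioc_mem_nhdsGT (zero_lt_one' ℝ)))
  have hr' : Tendsto (fun n => r (n + N)) atTop (𝓝 0) :=
    (tendsto_nhds_of_tendsto_nhdsWithin hr).comp (tendsto_add_atTop_nat N)
  obtain ⟨U, s, hs, hU⟩ := h.exists_isBlowUpLimit (by grind) hr'
  -- passage from a phase limit to the conclusion
  have key : ∀ {s' : ℕ → ℕ} {α β c₁ c₂ : ℝ} {V : Plane → ℝ}, StrictMono s' → 0 ≤ α → α ≤ β →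
      β ≤ π →
      IsPhaseLimit C (fun n => κ * r (s (s' n) + N))
        (fun n => blowUp w 0 (r (s (s' n) + N))) U α β c₁ c₂ →
      EqOn U V (ball 0 3) →
      Tendsto (fun n => s (s' n) + N) atTop atTop ∧
      Tendsto (fun n => weissEnergy (blowUp w 0 (r (s (s' n) + N)))) atTop
        (𝓝 ((∫ R in Ioi 0, R ^ 2 * radialCut R ^ (2 + 1)) * phaseMass α β c₁ c₂)) ∧
      TendstoUniformlyOn (fun n => blowUp w 0 (r (s (s' n) + N))) V atTop
        (closedBall 0 1) ∧
      Tendsto (fun n => ∫ x in ball 0 1,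
        ‖∇ (blowUp w 0 (r (s (s' n) + N))) x - ∇ V x‖ ^ 2) atTop
        (𝓝 0) := by
    intro s' α β c₁ c₂ V hs' hα hαβ hβ hp hUV
    refine ⟨(tendsto_add_atTop_nat N).comp
      (hs.tendsto_atTop.comp hs'.tendsto_atTop), hp.tendsto_weissEnergy_phaseMass hα hαβ hβ,
      (hp.tendsto.mono (closedBall_subset_closedBall (by norm_num))).congr_right
        (hUV.mono (closedBall_subset_ball (by norm_num))), ?_⟩
    refine squeeze_zero (fun n => integral_nonneg fun x => sq_nonneg _) (fun n => ?_)
      hp.tendsto_integral_norm_sub_sq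
    have e1 : ∫ x in ball 0 1,
        ‖∇ (blowUp w 0 (r (s (s' n) + N))) x - ∇ V x‖ ^ 2
        = ∫ x in ball 0 1,
        ‖∇ (blowUp w 0 (r (s (s' n) + N))) x - ∇ U x‖ ^ 2 := by
      refine setIntegral_congr_fun measurableSet_ball fun x hx => ?_
      have : ∇ V x = ∇ U x := gradient_congr (Filter.Eventually.mono
        (isOpen_ball.mem_nhds (ball_subset_ball (by norm_num) hx))
        fun y hy => (hUV hy).symm)
      simp only [this]
    rw [e1]
    obtain ⟨K, hK⟩ := (hp.sol n).lip
    obtain ⟨K', hK'⟩ := hp.lip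
    refine setIntegral_mono_set ?_ (.of_forall fun x => sq_nonneg _)
      (ball_subset_closedBall.trans
        (closedBall_subset_closedBall (by norm_num))).eventuallyLE
    refine Measure.integrableOn_of_bounded (M := ((K : ℝ) + K') ^ 2) measure_closedBall_lt_top.ne
      (((measurable_gradient _).sub (measurable_gradient _)).norm.pow_const 2).aestronglyMeasurable
      (.of_forall fun x => ?_)
    rw [norm_pow, norm_norm]
    gcongr
    exact (norm_sub_le _ _).trans (add_le_add (norm_gradient_le hK x) (norm_gradient_le hK' x))
  rcases hU.eq_zero_or_isWedge with h0 | ⟨A, α, hf⟩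
  · obtain ⟨s', c₁, c₂, hs', hp⟩ := hU.exists_isPhaseLimit hπ.le le_rfl le_rfl
      (by simp) fun θ hθ _ => h0 θ hθ
    obtain ⟨k2, k3, k4, k5⟩ := key hs' hπ.le le_rfl le_rfl hp fun x hx => by
      rw [hU.apply_eq hx, h0 _ (IsBlowUpLimit.polarAngle_mem_Icc x), mul_zero]
    refine ⟨_, _, _, k2, k3, hp.tendsto_unitEnergy_of_eq_zero h0, k4, k5, Or.inr ⟨rfl, ?_⟩⟩
    simp only [phaseMass, Real.cos_pi]
    rcases hp.c₁_eq with h1 | h1 <;> rw [h1] <;> norm_num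
  · have hβ := hf.le_pi
    obtain ⟨s', c₁, c₂, hs', hp⟩ := hU.exists_isPhaseLimit hf.α_nonneg
      (by linarith : α ≤ α + 2 * π / 3) hf.le_pi (fun θ hθ => hf.apply_pos hθ) hf.eq_zero
    obtain ⟨hα, hA, hc1, hc2⟩ := hp.eq_of_isWedge hf
    rw [hα, hA] at hf
    obtain ⟨k2, k3, k4, k5⟩ := key hs' (by rw [hα]; linarith) (by linarith) hβ hp
      (hU.eqOn_stokesProfile hf)
    refine ⟨_, _, _, k2, k3, hp.tendsto_unitEnergy_of_isWedge (by rwa [hα]), k4, k5,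
      Or.inl ⟨rfl, ?_⟩⟩
    rw [phaseMass, hα, hc1, hc2, show π / 6 + 2 * π / 3 = π - π / 6 by ring,
      Real.cos_pi_sub, Real.cos_pi_div_six]
    ring

/-- Uniqueness of the limit: the limit of the Weiss energies determines the blow-up limit. -/
theorem trichotomy (h : AlmostSolution 4 C κ w) :
    ∃ T : ℝ, Tendsto (fun r => unitEnergy (blowUp w 0 r)) (𝓝[>] 0) (𝓝 (1 / 3 * T)) ∧
      (T = 0 ∨ T = √3 ∨ T = 2) ∧
      (T = √3 → BlowUpTendsto w stokesProfile) ∧ (T = 0 → BlowUpTendsto w fun _ => 0) := by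
  obtain ⟨m, hm⟩ := h.exists_tendsto_weissEnergy
  set I := ∫ R in Ioi 0, R ^ 2 * radialCut R ^ (2 + 1)
  have hI0 : 0 < I := integral_pow_mul_radialCut_pos 2 2
  set T := m / I with hT
  have hsub : ∀ r : ℕ → ℝ, Tendsto r atTop (𝓝[>] 0) →
    ∃ (s : ℕ → ℕ) (V : Plane → ℝ), Tendsto s atTop atTop ∧
      Tendsto (fun n => unitEnergy (blowUp w 0 (r (s n)))) atTop (𝓝 (1 / 3 * T)) ∧
      TendstoUniformlyOn (fun n => blowUp w 0 (r (s n))) V atTop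
        (closedBall 0 1) ∧
      Tendsto (fun n => ∫ x in ball 0 1,
        ‖∇ (blowUp w 0 (r (s n))) x - ∇ V x‖ ^ 2) atTop (𝓝 0) ∧
      ((V = stokesProfile ∧ T = √3) ∨ (V = (fun _ => 0) ∧ (T = 0 ∨ T = 2))) := by
    intro r hr
    obtain ⟨s, T', V, h1, h2, h3, h4, h5, h6⟩ := h.exists_subseq hr
    have h7 : T' = T := by
      rw [hT, eq_div_iff hI0.ne', mul_comm]
      exact tendsto_nhds_unique h2 (hm.comp (hr.comp h1))
    rw [h7] at h3 h6
    exact ⟨s, V, h1, h3, h4, h5, h6⟩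
  have h3 : √3 ≠ 0 := by positivity
  -- uniqueness turns convergence of subsequences into convergence
  have hconv : ∀ V₀ : Plane → ℝ, (∀ V : Plane → ℝ,
      ((V = stokesProfile ∧ T = √3) ∨ (V = (fun _ => 0) ∧ (T = 0 ∨ T = 2))) → V = V₀) →
      BlowUpTendsto w V₀ := by
    intro V₀ hV₀
    constructor
    · by_contra hc
      rw [Metric.tendstoUniformlyOn_iff] at hc
      push Not at hc
      obtain ⟨ε, hε, hfr⟩ := hc
      obtain ⟨r, hr, hrf⟩ := exists_seq_forall_of_frequently hfr
      obtain ⟨s, V, h1, -, h4, -, h6⟩ := hsub r hr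
      rw [hV₀ V h6, Metric.tendstoUniformlyOn_iff] at h4
      obtain ⟨n, hn⟩ := (h4 ε hε).exists
      obtain ⟨x, hx, hxε⟩ := hrf (s n)
      exact (hn x hx).not_ge hxε
    · refine tendsto_of_subseq_tendsto fun r hr => ?_
      obtain ⟨s, V, h1, -, -, h5, h6⟩ := hsub r hr
      rw [hV₀ V h6] at h5
      exact ⟨s, h5⟩
  refine ⟨T, tendsto_of_subseq_tendsto fun r hr => ?_, ?_, fun hT3 => hconv _ ?_,
    fun hT0 => hconv _ ?_⟩
  · obtain ⟨s, V, h1, h2, -⟩ := hsub r hr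
    exact ⟨s, h2⟩
  · have hr : Tendsto (fun n : ℕ => 1 / ((n : ℝ) + 1)) atTop (𝓝[>] 0) :=
      tendsto_nhdsWithin_iff.2 ⟨tendsto_one_div_add_atTop_nhds_zero_nat,
        .of_forall fun n => by rw [mem_Ioi]; positivity⟩
    obtain ⟨s, V, -, -, -, -, h6⟩ := hsub _ hr
    tauto
  · grind
  · grind

end AlmostSolution

/-! ### From the compressible problem to almost solutions -/

/-- The integrand of the first variation for the constitutive functions `J = 1 / H`, `F`, `λ`. -/
noncomputable def lawIntegrand (J F : ℝ × ℝ → ℝ) (l : ℝ → ℝ) (w : Plane → ℝ) (φ : Plane → Plane)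
    (x : Plane) : ℝ :=
  (F (‖∇ w x‖ ^ 2, x 1) + l (x 1) * chi w x) * divergence φ x
    - 2 * J (‖∇ w x‖ ^ 2, x 1) * ⟪∇ w x, fderiv ℝ φ x (∇ w x)⟫
    + (deriv l (x 1) * chi w x + fderiv ℝ F (‖∇ w x‖ ^ 2, x 1) (0, 1)) * φ x 1

/-- A nonnegative Lipschitz function which, in the disc of radius `R` about the origin, is a
variational solution for the constitutive functions `J`, `F`, `l` with the growth bound. -/
structure LawSolution (R B : ℝ) (J F : ℝ × ℝ → ℝ) (l : ℝ → ℝ) (w : Plane → ℝ) : Prop where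
  B_nonneg : 0 ≤ B
  lip : ∃ K, LipschitzWith K w
  nonneg : ∀ x, 0 ≤ w x
  lower : ∀ x ∈ ball 0 R, x 1 ≤ 0 → w x = 0
  grad : ∀ᵐ x, x ∈ ball 0 R → ‖∇ w x‖ ^ 2 ≤ B * max (x 1) 0
  smooth : ContDiffOn ℝ 2 w {x | x ∈ ball 0 R ∧ 0 < w x}
  var : ∀ φ, IsTestField (ball 0 R) φ → ∫ x, lawIntegrand J F l w φ x = 0

lemma abs_coord_le (x : Plane) (i : Fin 2) : |x i| ≤ ‖x‖ := PiLp.norm_apply_le x i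

/-- The comparison of the compressible and the incompressible integrands. -/
lemma abs_varIntegrand_sub_le {d : ℝ} {J F : ℝ × ℝ → ℝ} {l : ℝ → ℝ}
    (hL : L.LocalLaw d C J F l) {B : ℝ} (hB : 0 ≤ B)
    (hx : ‖∇ w x‖ ^ 2 ≤ B * ‖x‖) (φ : Plane → Plane) :
    |varIntegrand w φ x - L.ρ₀ * lawIntegrand J F l w φ x|
      ≤ L.ρ₀ * C * (4 * (B + 1) ^ 2) * (‖x‖ ^ 2 * ‖fderiv ℝ φ x‖ + ‖x‖ * ‖φ x‖) := by
  have hρ := L.ρ₀_pos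
  have hC := hL.C_nonneg
  have hin := abs_inner_apply_self_le (fderiv ℝ φ x) (∇ w x)
  have hdv := abs_divergence_le φ x
  have hp := abs_coord_le (φ x) 1
  have hs := abs_coord_le x 1
  have hχ0 := chi_nonneg w x
  have hχ1 := chi_le_one w x
  have ht0 : 0 ≤ ‖∇ w x‖ ^ 2 := sq_nonneg _
  have hn := norm_nonneg x
  have hD := norm_nonneg (fderiv ℝ φ x)
  unfold varIntegrand lawIntegrand
  set t := ‖∇ w x‖ ^ 2
  set n := ‖x‖
  set D := ‖fderiv ℝ φ x‖
  set χ := chi w x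
  have hJ := hL.J_bound t (x 1)
  have hF := hL.F_bound t (x 1)
  have h2 := hL.dF₂_bound t (x 1)
  have hl := hL.lam_bound (x 1)
  have hl' := hL.deriv_lam_bound (x 1)
  rw [abs_of_nonneg ht0] at hJ hF h2
  -- multiply the bounds of the constitutive functions by the surface density
  have scale : ∀ a b c : ℝ, |a - b / L.ρ₀| ≤ c → |b - L.ρ₀ * a| ≤ L.ρ₀ * c := by
    intro a b c h
    rw [show b - L.ρ₀ * a = -(L.ρ₀ * (a - b / L.ρ₀)) by field_simp; ring, abs_neg, abs_mul,
      abs_of_pos hρ]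
    exact mul_le_mul_of_nonneg_left h hρ.le
  have m : ∀ {a b c e : ℝ}, |a| ≤ c → |b| ≤ e → |a * b| ≤ c * e := fun h h' => by
    rw [abs_mul]; exact mul_le_mul h h' (abs_nonneg _) ((abs_nonneg _).trans h)
  have hχ : |χ| ≤ 1 := by rwa [abs_of_nonneg hχ0]
  have ht1 : t * (t + |x 1|) ≤ B * (B + 1) * n ^ 2 := by
    have : t * (t + |x 1|) ≤ (B * n) * (B * n + n) := by gcongr
    linarith
  have b1 : |t - L.ρ₀ * F (t, x 1)| ≤ L.ρ₀ * C * (B * (B + 1) * n ^ 2) := by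
    refine (scale _ _ _ hF).trans ?_
    rw [mul_assoc, mul_assoc]; gcongr
  have b2 : |x 1 - L.ρ₀ * l (x 1)| ≤ L.ρ₀ * C * n ^ 2 := by
    refine (scale _ _ _ hl).trans ?_
    rw [mul_assoc, ← sq_abs (x 1)]; gcongr
  have b3 : |(1 - L.ρ₀ * J (t, x 1)) * ⟪∇ w x, fderiv ℝ φ x (∇ w x)⟫|
      ≤ L.ρ₀ * C * (B * (B + 1) * n ^ 2) * D := by
    refine (m (scale _ _ _ hJ) hin).trans ?_
    rw [show L.ρ₀ * (C * (t + |x 1|)) * (D * t) = L.ρ₀ * C * (t * (t + |x 1|)) * D by ring]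
    gcongr
  have b4 : |1 - L.ρ₀ * deriv l (x 1)| ≤ L.ρ₀ * C * n := by
    refine (scale _ _ _ hl').trans ?_
    rw [mul_assoc]; gcongr
  have b5 : |L.ρ₀ * fderiv ℝ F (t, x 1) (0, 1)| ≤ L.ρ₀ * C * (B * n) := by
    rw [abs_mul, abs_of_pos hρ, mul_assoc]
    refine mul_le_mul_of_nonneg_left (h2.trans ?_) hρ.le
    gcongr
  have c1 := m ((abs_add_le _ _).trans (add_le_add b1 (m b2 hχ))) hdv
  have c2 := m ((abs_sub _ _).trans (add_le_add (m b4 hχ) b5)) hp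
  rw [show ∀ i : ℝ, (t + x 1 * χ) * divergence φ x - 2 * i + χ * φ x 1
      - L.ρ₀ * ((F (t, x 1) + l (x 1) * χ) * divergence φ x - 2 * J (t, x 1) * i
        + (deriv l (x 1) * χ + fderiv ℝ F (t, x 1) (0, 1)) * φ x 1)
    = (t - L.ρ₀ * F (t, x 1) + (x 1 - L.ρ₀ * l (x 1)) * χ) * divergence φ x
      - 2 * ((1 - L.ρ₀ * J (t, x 1)) * i)
      + ((1 - L.ρ₀ * deriv l (x 1)) * χ - L.ρ₀ * fderiv ℝ F (t, x 1) (0, 1)) * φ x 1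
    from fun i => by ring]
  refine (abs_add_le _ _).trans ((add_le_add ((abs_sub _ _).trans (add_le_add c1
    ((abs_mul _ _).trans_le (mul_le_mul_of_nonneg_left b3 (abs_nonneg 2))))) c2).trans ?_)
  rw [abs_of_pos (by norm_num : (0 : ℝ) < 2)]
  have q1 : 0 ≤ L.ρ₀ * C * (n ^ 2 * D) := by positivity
  have q2 : 0 ≤ L.ρ₀ * C * (n * ‖φ x‖) := by positivity
  nlinarith [mul_nonneg q1 hB, mul_nonneg q2 hB, mul_nonneg q2 (sq_nonneg B)]

namespace LawSolution

variable {d R B : ℝ} {J F : ℝ × ℝ → ℝ} {l : ℝ → ℝ}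

lemma grad_le (h : LawSolution R B J F l w) :
    ∀ᵐ x, x ∈ ball 0 R → ‖∇ w x‖ ^ 2 ≤ B * ‖x‖ := by
  filter_upwards [h.grad] with x hx hxR
  exact (hx hxR).trans (mul_le_mul_of_nonneg_left
    (max_le ((le_abs_self _).trans (abs_coord_le x 1)) (norm_nonneg x)) h.B_nonneg)

lemma abs_integral_varIntegrand_le (h : LawSolution R B J F l w) (hL : L.LocalLaw d C J F l)
    (hφ : IsTestField (ball 0 R) φ) :
    Integrable (lawIntegrand J F l w φ) ∧
    |∫ x, varIntegrand w φ x| ≤ L.ρ₀ * C * (4 * (B + 1) ^ 2)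
      * ∫ x, (‖x‖ ^ 2 * ‖fderiv ℝ φ x‖ + ‖x‖ * ‖φ x‖) := by
  have h0 := h.var φ hφ
  obtain ⟨hφd, hφc, hφs⟩ := hφ
  obtain ⟨K, hK⟩ := h.lip
  have hfc : Continuous (fderiv ℝ φ) := by fun_prop
  have hfs : HasCompactSupport (fderiv ℝ φ) := hφc.fderiv (𝕜 := ℝ)
  have hint : ∀ a b : Plane → ℝ, Continuous a → Continuous b →
      Integrable fun x => a x * ‖fderiv ℝ φ x‖ + b x * ‖φ x‖ := fun a b ha hb =>
    ((ha.mul hfc.norm).integrable_of_hasCompactSupport hfs.norm.mul_left).add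
      ((hb.mul hφd.continuous.norm).integrable_of_hasCompactSupport hφc.norm.mul_left)
  have hgm := measurable_gradient w
  have hχm := measurable_chi hK.continuous
  have htm : Measurable fun x => (‖∇ w x‖ ^ 2, x 1) := by fun_prop
  have hdm := (continuous_divergence hφd).measurable
  have him : Measurable fun x => ⟪∇ w x, fderiv ℝ φ x (∇ w x)⟫ :=
    hgm.inner (measurable_fderiv_apply hgm)
  have hpm : Measurable fun x => φ x 1 := (measurable_coord 1).comp hφd.continuous.measurable
  have hvm : Measurable (varIntegrand w φ) :=
    ((((hgm.norm.pow_const 2).add (by fun_prop)).mul hdm).sub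
      (him.const_mul 2)).add (hχm.mul hpm)
  have hlm : Measurable (lawIntegrand J F l w φ) :=
    (((((hL.contDiff_F.continuous.measurable.comp htm).add
      ((hL.contDiff_lam.continuous.measurable.comp (measurable_coord 1)).mul hχm)).mul hdm).sub
      (((hL.contDiff_J.continuous.measurable.comp htm).const_mul 2).mul him)).add
      (((((hL.contDiff_lam.continuous_deriv (by simp)).measurable.comp (measurable_coord 1)).mul
        hχm).add ((((hL.contDiff_F.continuous_fderiv (by norm_num)).clm_apply
          continuous_const).measurable).comp htm)).mul hpm))
  have iv : Integrable (varIntegrand w φ) := by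
    refine (hint (fun x => 4 * K ^ 2 + 2 * ‖x‖) (fun _ => 1) (by fun_prop) (by fun_prop)).mono'
      hvm.aestronglyMeasurable (.of_forall fun x => ?_)
    have a1 := abs_energyDensity_le hK x
    have a2 := abs_divergence_le φ x
    have a3 := abs_inner_apply_self_le (fderiv ℝ φ x) (∇ w x)
    have a4 : ‖∇ w x‖ ^ 2 ≤ K ^ 2 := by have := norm_gradient_le hK x; gcongr
    have a5 := mul_le_mul_of_nonneg_left a4 (norm_nonneg (fderiv ℝ φ x))
    have a6 := mul_le_mul (a1.trans (add_le_add le_rfl (abs_coord_le x 1))) a2 (abs_nonneg _)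
      (by positivity)
    have a7 : |chi w x * φ x 1| ≤ 1 * ‖φ x‖ := by
      rw [abs_mul, abs_of_nonneg (chi_nonneg w x)]
      exact mul_le_mul (chi_le_one w x) (abs_coord_le _ 1) (abs_nonneg _) zero_le_one
    rw [← abs_mul] at a6
    refine (abs_add_le _ _).trans ((add_le_add ((abs_sub _ _).trans (add_le_add a6
      ((abs_mul _ _).trans_le (mul_le_mul_of_nonneg_left (a3.trans a5) (abs_nonneg 2))))) a7).trans ?_)
    rw [abs_of_pos (by norm_num : (0 : ℝ) < 2)]
    linarith
  set κ := L.ρ₀ * C * (4 * (B + 1) ^ 2)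
  have ib := (hint (fun x => ‖x‖ ^ 2) (fun x => ‖x‖) (by fun_prop) (by fun_prop)).const_mul κ
  have hle : ∀ᵐ x, ‖varIntegrand w φ x - L.ρ₀ * lawIntegrand J F l w φ x‖
      ≤ κ * (‖x‖ ^ 2 * ‖fderiv ℝ φ x‖ + ‖x‖ * ‖φ x‖) := by
    filter_upwards [h.grad_le] with x hx
    by_cases hxs : x ∈ tsupport φ
    · exact abs_varIntegrand_sub_le hL h.B_nonneg (hx (hφs hxs)) φ
    · have e1 : φ x = 0 := image_eq_zero_of_notMem_tsupport hxs
      have e2 : fderiv ℝ φ x = 0 :=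
        image_eq_zero_of_notMem_tsupport fun h2 => hxs (tsupport_fderiv_subset ℝ h2)
      simp [varIntegrand, lawIntegrand, divergence, e1, e2]
  have ie : Integrable fun x => varIntegrand w φ x - L.ρ₀ * lawIntegrand J F l w φ x :=
    ib.mono' (hvm.sub (hlm.const_mul _)).aestronglyMeasurable hle
  have il : Integrable (lawIntegrand J F l w φ) := by
    refine ((iv.sub ie).const_mul L.ρ₀⁻¹).congr (.of_forall fun x => ?_)
    have := L.ρ₀_pos.ne'
    simp only [Pi.sub_apply]
    field_simp; ring
  refine ⟨il, ?_⟩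
  have h1 := norm_integral_le_of_norm_le ib hle
  rwa [integral_sub iv (il.const_mul _), integral_const_mul, h0, mul_zero, sub_zero,
    integral_const_mul] at h1

end LawSolution

lemma integral_divergence_eq_zero (hφ : ContDiff ℝ 1 φ)
    (hc : HasCompactSupport φ) : Integrable (divergence φ) ∧ ∫ x, divergence φ x = 0 := by
  constructor
  · refine Continuous.integrable_of_hasCompactSupport (by fun_prop) ?_
    exact (hc.fderiv (𝕜 := ℝ)).mono fun x hx h0 => hx (by simp [divergence, h0])
  · have h := integral_inner_gradient (LipschitzWith.const (1 : ℝ)) hφ hc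
    simpa [gradient] using h.symm

namespace LawSolution

variable {d R B : ℝ} {J F : ℝ × ℝ → ℝ} {l : ℝ → ℝ}

lemma isOpen_pos (h : LawSolution R B J F l w) :
    IsOpen {x | x ∈ ball 0 R ∧ 0 < w x} :=
  isOpen_ball.inter (isOpen_lt continuous_const h.lip.choose_spec.continuous)

lemma contDiffOn_gradient (h : LawSolution R B J F l w) :
    ContDiffOn ℝ 1 (∇ w) {x | x ∈ ball 0 R ∧ 0 < w x} := fun x hx =>
  ((InnerProductSpace.toDual ℝ Plane).symm.contDiff.contDiffAt.comp x
    ((h.smooth.contDiffAt (h.isOpen_pos.mem_nhds hx)).fderiv_right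
      (by norm_num))).contDiffWithinAt

/-- Domain variations in the direction `η ∇w` amount to testing the equation with `η |∇w|²`. -/
lemma integral_fderiv_eq_zero (h : LawSolution R B J F l w) (hL : L.LocalLaw d C J F l)
    (hη : ContDiff ℝ 1 η) (hc : HasCompactSupport η)
    (hs : tsupport η ⊆ {x | x ∈ ball 0 R ∧ 0 < w x}) :
    ∫ x, J (‖∇ w x‖ ^ 2, x 1)
      * fderiv ℝ (fun x => η x * ‖∇ w x‖ ^ 2) x (∇ w x) = 0 := by
  have hV := h.isOpen_pos
  set V := {x | x ∈ ball 0 R ∧ 0 < w x}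
  set a := ∇ w with ha
  have had : ∀ x ∈ V, ContDiffAt ℝ 1 a x := fun x hx =>
    h.contDiffOn_gradient.contDiffAt (hV.mem_nhds hx)
  -- compactly supported fields with a factor `η` are smooth as soon as they are smooth on `V`
  have glue : ∀ G : Plane → Plane, (∀ x ∈ V, ContDiffAt ℝ 1 G x) →
      ContDiff ℝ 1 (fun x => η x • G x) ∧ HasCompactSupport (fun x => η x • G x) ∧
      tsupport (fun x => η x • G x) ⊆ tsupport η := by
    intro G hG
    refine ⟨contDiff_iff_contDiffAt.2 fun x => ?_, hc.smul_right, tsupport_smul_subset_left η G⟩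
    by_cases hx : x ∈ tsupport η
    · exact hη.contDiffAt.smul (hG x (hs hx))
    · exact contDiffAt_const.congr_of_eventuallyEq (notMem_tsupport_iff_eventuallyEq.1
        fun h1 => hx (tsupport_smul_subset_left η G h1))
  set Γ : Plane → ℝ := fun x => F (‖a x‖ ^ 2, x 1) + l (x 1) with hΓ
  have hp : ∀ x : Plane, HasFDerivAt (fun x : Plane => x 1) (proj (𝕜 := ℝ) (1 : Fin 2)) x :=
    fun x => (proj (𝕜 := ℝ) (1 : Fin 2)).hasFDerivAt
  have hΓc : ∀ x ∈ V, ContDiffAt ℝ 1 Γ x := fun x hx =>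
    (hL.contDiff_F.contDiffAt.comp x (((had x hx).norm_sq ℝ).prodMk
      (proj (𝕜 := ℝ) (1 : Fin 2)).contDiff.contDiffAt)).add
      (hL.contDiff_lam.contDiffAt.comp x (proj (𝕜 := ℝ) (1 : Fin 2)).contDiff.contDiffAt)
  obtain ⟨g1, g2, g3⟩ := glue a had
  obtain ⟨g4, g5, -⟩ := glue (fun x => Γ x • a x) fun x hx => (hΓc x hx).smul (had x hx)
  have hφ : IsTestField (ball 0 R) fun x => η x • a x :=
    ⟨g1, g2, fun x hx => (hs (g3 hx)).1⟩
  obtain ⟨i1, e1⟩ := integral_divergence_eq_zero g4 g5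
  have i2 := (h.abs_integral_varIntegrand_le hL hφ).1
  have key : ∀ x, J (‖a x‖ ^ 2, x 1) * fderiv ℝ (fun x => η x * ‖a x‖ ^ 2) x (a x)
      = -(1 / 2) * (lawIntegrand J F l w (fun x => η x • a x) x
        - divergence (fun x => η x • Γ x • a x) x) := by
    intro x
    by_cases hx : x ∈ tsupport η
    · have hxV := hs hx
      have hax := ((had x hxV).differentiableAt (by norm_num)).hasFDerivAt
      have hηx := (hη.differentiable (by norm_num) x).hasFDerivAt
      have ht : HasFDerivAt (fun x => ‖a x‖ ^ 2) _ x := hax.norm_sq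
      have hφx : HasFDerivAt (fun x => η x • a x) _ x := hηx.smul hax
      have hqx : HasFDerivAt (fun x => η x * ‖a x‖ ^ 2) _ x := hηx.mul ht
      have hΓx : HasFDerivAt Γ _ x :=
        ((hL.contDiff_F.differentiable (by norm_num) _).hasFDerivAt.comp x
          (ht.prodMk (hp x))).add (((hL.contDiff_lam.differentiable (by norm_num)
            (x 1)).hasDerivAt).comp_hasFDerivAt x (hp x))
      have e2 : (fun x => η x • Γ x • a x) = fun x => Γ x • (η x • a x) := by
        ext1 y; rw [smul_comm]
      obtain ⟨D, hD⟩ : ∃ D, D = fderiv ℝ F (‖a x‖ ^ 2, x 1) (0, 1) := ⟨_, rfl⟩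
      have e3 : ∀ p q : ℝ, fderiv ℝ F (‖a x‖ ^ 2, x 1) (p, q)
          = p * J (‖a x‖ ^ 2, x 1) + q * D := by
        intro p q
        rw [hD, ← hL.dF₁_eq, ← smul_eq_mul, ← smul_eq_mul, ← map_smul, ← map_smul, ← map_add]
        simp
      rw [e2, divergence_smul hΓx.differentiableAt hφx.differentiableAt, lawIntegrand, hqx.fderiv,
        hΓx.fderiv, chi_of_pos hxV.2, ← ha, hφx.fderiv]
      simp [e3, inner_add_right, inner_smul_right, hΓ]
      ring
    · have z1 : (fun x => η x • a x) =ᶠ[𝓝 x] fun _ => 0 :=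
        notMem_tsupport_iff_eventuallyEq.1 fun h1 => hx (g3 h1)
      have z0 := notMem_tsupport_iff_eventuallyEq.1 hx
      have z2 : (fun x => η x * ‖a x‖ ^ 2) =ᶠ[𝓝 x] fun _ => 0 := by
        filter_upwards [z0] with y hy; rw [hy]; simp
      have z3 : (fun x => η x • Γ x • a x) =ᶠ[𝓝 x] fun _ => 0 := by
        filter_upwards [z0] with y hy; rw [hy]; simp
      rw [z2.fderiv_eq, lawIntegrand, divergence, divergence, z1.fderiv_eq, z3.fderiv_eq, z1.eq_of_nhds]
      simp
  simp only [key]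
  rw [integral_const_mul, integral_sub i2 i1, h.var _ hφ, e1]
  simp

/-- The weak form of the equation in `{w > 0}`: it follows by testing with
`ψ |∇w|² / (|∇w|² + δ)` and letting `δ → 0`. -/
lemma integral_weak_eq_zero (h : LawSolution R B J F l w) (hL : L.LocalLaw d C J F l)
    (hψ : ContDiff ℝ 1 ψ) (hc : HasCompactSupport ψ)
    (hs : tsupport ψ ⊆ {x | x ∈ ball 0 R ∧ 0 < w x}) :
    ∫ x, J (‖∇ w x‖ ^ 2, x 1) * fderiv ℝ ψ x (∇ w x) = 0 := by
  have hV := h.isOpen_pos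
  have hgV := h.contDiffOn_gradient
  set V := {x | x ∈ ball 0 R ∧ 0 < w x}
  set a := ∇ w with ha
  have had : ∀ x ∈ V, ContDiffAt ℝ 1 a x := fun x hx => hgV.contDiffAt (hV.mem_nhds hx)
  have hδ : ∀ n : ℕ, (0 : ℝ) < 1 / (n + 1) := fun n => by positivity
  set η : ℕ → Plane → ℝ := fun n x => ψ x * (‖a x‖ ^ 2 + 1 / ((n : ℝ) + 1))⁻¹ with hη
  have hden : ∀ (n : ℕ) x, 0 < ‖a x‖ ^ 2 + 1 / ((n : ℝ) + 1) := fun n x => by positivity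
  have hηs : ∀ n, tsupport (η n) ⊆ tsupport ψ := fun n => tsupport_mul_subset_left
  have hηd : ∀ n, ContDiff ℝ 1 (η n) := fun n => contDiff_iff_contDiffAt.2 fun x => by
    by_cases hx : x ∈ tsupport ψ
    · exact hψ.contDiffAt.mul ((((had x (hs hx)).norm_sq ℝ).add contDiffAt_const).inv (hden n x).ne')
    · exact contDiffAt_const.congr_of_eventuallyEq
        (notMem_tsupport_iff_eventuallyEq.1 fun h1 => hx (hηs n h1))
  have hzero := fun n => h.integral_fderiv_eq_zero hL (hηd n)
    (hc.of_isClosed_subset (isClosed_tsupport _) (hηs n)) ((hηs n).trans hs)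
  -- the derivative of the test function
  have hder : ∀ (n : ℕ), ∀ x ∈ tsupport ψ, fderiv ℝ (fun x => η n x * ‖a x‖ ^ 2) x (a x)
      = ‖a x‖ ^ 2 / (‖a x‖ ^ 2 + 1 / ((n : ℝ) + 1)) * fderiv ℝ ψ x (a x)
        + ψ x * (1 / ((n : ℝ) + 1) / (‖a x‖ ^ 2 + 1 / ((n : ℝ) + 1)) ^ 2
          * (2 * ⟪a x, fderiv ℝ a x (a x)⟫)) := by
    intro n x hx
    have ht : HasFDerivAt (fun x => ‖a x‖ ^ 2) _ x :=
      ((had x (hs hx)).differentiableAt (by norm_num)).hasFDerivAt.norm_sq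
    have hi := (hasDerivAt_inv (hden n x).ne').comp_hasFDerivAt x (ht.add_const (1 / ((n : ℝ) + 1)))
    have hq : HasFDerivAt (fun x => η n x * ‖a x‖ ^ 2) _ x :=
      ((hψ.differentiable (by norm_num) x).hasFDerivAt.mul hi).mul ht
    rw [hq.fderiv]
    have := (hden n x).ne'
    simp
    field_simp
    ring
  have hcomp : ContinuousOn (fun x => J (‖a x‖ ^ 2, x 1)
      * (fderiv ℝ ψ x (a x))) (tsupport ψ) ∧ ContinuousOn (fun x => J (‖a x‖ ^ 2, x 1)
      * (ψ x * (2 * ‖fderiv ℝ a x‖))) (tsupport ψ) := by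
    have k1 : ContinuousOn a (tsupport ψ) := hgV.continuousOn.mono hs
    have k2 : ContinuousOn (fderiv ℝ a) (tsupport ψ) :=
      (hgV.continuousOn_fderiv_of_isOpen hV le_rfl).mono hs
    have k3 : ContinuousOn (fun x => J (‖a x‖ ^ 2, x 1)) (tsupport ψ) :=
      hL.contDiff_J.continuous.comp_continuousOn (by fun_prop)
    exact ⟨k3.mul (by fun_prop),
      k3.mul (hψ.continuous.continuousOn.mul (by fun_prop))⟩
  obtain ⟨M₁, hM₁⟩ := hc.isCompact.exists_bound_of_continuousOn hcomp.1
  obtain ⟨M₂, hM₂⟩ := hc.isCompact.exists_bound_of_continuousOn hcomp.2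
  have hSm := (isClosed_tsupport ψ).measurableSet
  have hoff : ∀ x ∉ tsupport ψ, fderiv ℝ ψ x = 0 ∧
      ∀ n, fderiv ℝ (fun x => η n x * ‖a x‖ ^ 2) x = 0 := fun x hx => by
    refine ⟨image_eq_zero_of_notMem_tsupport fun h1 => hx (tsupport_fderiv_subset ℝ h1), fun n => ?_⟩
    have : (fun x => η n x * ‖a x‖ ^ 2) =ᶠ[𝓝 x] fun _ => 0 := by
      filter_upwards [notMem_tsupport_iff_eventuallyEq.1 hx] with y hy; simp [hη, hy]
    rw [this.fderiv_eq]; simp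
  have hlim : Tendsto (fun n : ℕ => ∫ x, J (‖a x‖ ^ 2, x 1)
      * fderiv ℝ (fun x => η n x * ‖a x‖ ^ 2) x (a x)) atTop
      (𝓝 (∫ x, J (‖a x‖ ^ 2, x 1) * fderiv ℝ ψ x (a x))) := by
    refine tendsto_integral_of_dominated_convergence
      ((tsupport ψ).indicator fun _ => M₁ + M₂) (fun n => ?_)
      ((integrable_indicator_iff hSm).2 (integrableOn_const hc.isCompact.measure_lt_top.ne))
      (fun n => .of_forall fun x => ?_) (.of_forall fun x => ?_)
    · have hJ := hL.contDiff_J.continuous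
      exact Measurable.aestronglyMeasurable (by fun_prop)
    · by_cases hx : x ∈ tsupport ψ
      · rw [indicator_of_mem hx, hder n x hx, mul_add]
        have hd := hden n x
        set δ := 1 / ((n : ℝ) + 1) with hδd
        have hδ0 : 0 < δ := hδ n
        set t := ‖a x‖ ^ 2 with htd
        have ht0 : 0 ≤ t := sq_nonneg _
        refine (norm_add_le _ _).trans (add_le_add ?_ ?_)
        · rw [mul_left_comm, norm_mul]
          refine (mul_le_of_le_one_left (norm_nonneg _) ?_).trans (hM₁ x hx)
          rw [norm_of_nonneg (by positivity)]
          exact (div_le_one hd).2 (by linarith)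
        · refine le_trans ?_ (hM₂ x hx)
          rw [norm_mul, norm_mul, norm_mul (J _), norm_mul (ψ x)]
          gcongr
          have h1 := abs_inner_apply_self_le (fderiv ℝ a x) (a x)
          rw [norm_mul, norm_mul, norm_of_nonneg (by positivity), norm_eq_abs,
            norm_eq_abs, abs_of_pos (by norm_num : (0 : ℝ) < 2), norm_mul, norm_norm,
            norm_of_nonneg (by norm_num : (0 : ℝ) ≤ 2), div_mul_eq_mul_div, div_le_iff₀ (by positivity)]
          have h2 : δ * t ≤ (t + δ) ^ 2 := by nlinarith
          have h3 := mul_le_mul_of_nonneg_left h2 (norm_nonneg (fderiv ℝ a x))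
          have h4 := mul_le_mul_of_nonneg_left h1 hδ0.le
          linarith
      · simp_all
    · by_cases hx : x ∈ tsupport ψ
      · simp only [hder _ x hx]
        refine Tendsto.const_mul _ ?_
        rcases eq_or_ne (a x) 0 with h0 | h0
        · simp [h0]
        · have ht0 : ‖a x‖ ^ 2 ≠ 0 := by positivity
          have l0 := tendsto_one_div_add_atTop_nhds_zero_nat (𝕜 := ℝ)
          have l1 : Tendsto (fun n : ℕ => ‖a x‖ ^ 2 + 1 / ((n : ℝ) + 1)) atTop (𝓝 (‖a x‖ ^ 2)) := by
            simpa using l0.const_add (‖a x‖ ^ 2)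
          have l2 := (((tendsto_const_nhds (x := ‖a x‖ ^ 2)).div l1 ht0).mul_const (fderiv ℝ ψ x (a x))).add
            (((l0.div (l1.pow 2) (pow_ne_zero 2 ht0)).mul_const
              (2 * ⟪a x, fderiv ℝ a x (a x)⟫)).const_mul (ψ x))
          rwa [div_self ht0, one_mul, zero_div, zero_mul, mul_zero, add_zero] at l2
      · simp_all
  exact tendsto_nhds_unique hlim (tendsto_const_nhds.congr fun n => (hzero n).symm)

lemma almostHarmonic (h : LawSolution R B J F l w) (hL : L.LocalLaw d C J F l) :
    AlmostHarmonic (ball 0 R) (L.ρ₀ * C * (4 * (B + 1) ^ 2)) w := by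
  intro ψ hψ hc hs
  obtain ⟨K, hK⟩ := h.lip
  have hρ := L.ρ₀_pos
  have hC := hL.C_nonneg
  have hB := h.B_nonneg
  have h0 := h.integral_weak_eq_zero hL hψ hc hs
  have hgψ := continuous_gradient hψ
  have hgs := hasCompactSupport_gradient hc
  set κ := L.ρ₀ * C * (4 * (B + 1) ^ 2) with hκ
  have i1 : Integrable fun x => ⟪∇ w x, ∇ ψ x⟫ := by
    simpa using IsBlowUpLimit.integrable_mul_inner hK (continuous_const (y := (1 : ℝ))) hgψ hgs
  have ib : Integrable fun x => κ * (‖x‖ ^ (3 / 2 : ℝ) * ‖∇ ψ x‖) := by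
    refine (Continuous.integrable_of_hasCompactSupport ?_ hgs.norm.mul_left).const_mul _
    exact (continuous_norm.rpow_const fun _ => Or.inr (by norm_num)).mul hgψ.norm
  have hm : Measurable fun x => J (‖∇ w x‖ ^ 2, x 1)
      * ⟪∇ w x, ∇ ψ x⟫ :=
    have hJ := hL.contDiff_J.continuous
    by fun_prop
  have hle : ∀ᵐ x, ‖⟪∇ w x, ∇ ψ x⟫ - L.ρ₀ * (J (‖∇ w x‖ ^ 2, x 1)
      * ⟪∇ w x, ∇ ψ x⟫)‖ ≤ κ * (‖x‖ ^ (3 / 2 : ℝ) * ‖∇ ψ x‖) := by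
    filter_upwards [h.grad_le] with x hx
    by_cases hxs : x ∈ tsupport ψ
    · have hx := hx (hs hxs).1
      set t := ‖∇ w x‖ ^ 2 with ht
      have hn := norm_nonneg x
      have b1 := hL.J_bound t (x 1)
      rw [abs_of_nonneg (sq_nonneg _ : 0 ≤ t)] at b1
      have b2 : |1 - L.ρ₀ * J (t, x 1)| ≤ L.ρ₀ * (C * ((B + 1) * ‖x‖)) := by
        rw [show 1 - L.ρ₀ * J (t, x 1) = -(L.ρ₀ * (J (t, x 1) - 1 / L.ρ₀)) by field_simp; ring,
          abs_neg, abs_mul, abs_of_pos hρ]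
        refine mul_le_mul_of_nonneg_left (b1.trans (mul_le_mul_of_nonneg_left ?_ hC)) hρ.le
        linarith [abs_coord_le x 1]
      have b3 : ‖∇ w x‖ ≤ (B + 1) * √‖x‖ := by
        refine abs_le_of_sq_le_sq' ?_ (by positivity) |>.2
        rw [mul_pow, sq_sqrt hn]
        exact hx.trans (mul_le_mul_of_nonneg_right (by nlinarith) hn)
      have b4 := (abs_real_inner_le_norm (∇ w x) (∇ ψ x)).trans
        (mul_le_mul_of_nonneg_right b3 (norm_nonneg _))
      rw [show ∀ i : ℝ, i - L.ρ₀ * (J (t, x 1) * i) = (1 - L.ρ₀ * J (t, x 1)) * i from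
        fun i => by ring, norm_mul, norm_eq_abs, norm_eq_abs, rpow_three_halves hn]
      refine (mul_le_mul b2 b4 (abs_nonneg _) (by positivity)).trans ?_
      have : 0 ≤ L.ρ₀ * C * (B + 1) ^ 2 * (‖x‖ * √‖x‖ * ‖∇ ψ x‖) := by positivity
      rw [hκ]; linarith
    · have : ∇ ψ x = 0 := image_eq_zero_of_notMem_tsupport fun h1 =>
        hxs (IsBlowUpLimit.tsupport_gradient_subset ψ h1)
      simp [this]
  have ie := ib.mono' ((i1.aestronglyMeasurable).sub (hm.const_mul _).aestronglyMeasurable) hle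
  have i2 : Integrable fun x => J (‖∇ w x‖ ^ 2, x 1)
      * ⟪∇ w x, ∇ ψ x⟫ := by
    refine ((i1.sub ie).const_mul L.ρ₀⁻¹).congr (.of_forall fun x => ?_)
    simp only [Pi.sub_apply]
    field_simp; ring
  have h1 := norm_integral_le_of_norm_le ib hle
  have e0 : ∀ x, ⟪∇ w x, ∇ ψ x⟫ = fderiv ℝ ψ x (∇ w x) := by simp
  rw [integral_sub i1 (i2.const_mul _), integral_const_mul, integral_const_mul] at h1
  simp only [e0] at h1 ⊢
  rwa [h0, mul_zero, sub_zero] at h1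

end LawSolution

/-! ### Localization at a stagnation point -/

lemma MemW12Loc.mono {U V : Set Plane}
    (h : MemW12Loc U u Du) (hVU : V ⊆ U) : MemW12Loc V u Du :=
  ⟨fun K hK => h.memLp K (hK.trans hVU), fun K hK => h.memLp_grad K (hK.trans hVU),
    fun η hη hc hs => h.weak η hη hc (hs.trans hVU)⟩

lemma gradient_comp_const_add (w : Plane → ℝ) (a x : Plane) :
    ∇ (fun y => w (a + y)) x = ∇ w (a + x) := by
  rw [gradient, gradient, fderiv_comp_add_left]

/-- Test fields and their derivatives under translation. -/
lemma IsTestField.comp_sub {U V : Set Plane} (hφ : IsTestField V φ)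
    {a : Plane} (hV : ∀ x ∈ V, a + x ∈ U) : IsTestField U fun y => φ (y - a) := by
  refine ⟨hφ.1.comp (by fun_prop),
    hφ.2.1.comp_homeomorph (Homeomorph.subRight a), fun y hy => ?_⟩
  have := hV _ (hφ.2.2 (tsupport_comp_subset_preimage φ (continuous_id.sub continuous_const) hy))
  simpa using this

lemma divergence_comp_sub (φ : Plane → Plane) (a x : Plane) :
    divergence (fun y => φ (y - a)) (a + x) = divergence φ x := by
  unfold divergence
  simp only [fderiv_comp_sub, add_sub_cancel_left]

lemma divergence_eq_zero_of_notMem_tsupport (hx : x ∉ tsupport φ) :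
    divergence φ x = 0 := by
  simp [divergence, fderiv_of_notMem_tsupport (𝕜 := ℝ) hx]

lemma ae_const_add {P : Plane → Prop} (h : ∀ᵐ x, P x) (a : Plane) : ∀ᵐ x, P (a + x) :=
  (quasiMeasurePreserving_add_left volume a).ae h

/-- A solution with the growth bound is Lipschitz continuous near `x₀`; truncating a Lipschitz
extension gives a globally defined function. -/
lemma exists_lipschitz_extension {Ω : Set Plane}
    (hsob : MemW12Loc Ω u Du) (hcont : ContinuousOn u Ω) (hpos : ∀ x ∈ Ω, 0 ≤ u x)
    {x₀ : Plane} (hline : x₀ 1 = 0) {R B : ℝ} (hB : 0 ≤ B)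
    (hR : ball x₀ R ⊆ Ω)
    (hgr : ∀ᵐ x, x ∈ ball x₀ R → ‖Du x‖ ^ 2 ≤ B * max (x 1) 0) :
    ∃ w : Plane → ℝ, (∃ K, LipschitzWith K w) ∧ (∀ x, 0 ≤ w x) ∧
      (∀ x ∈ ball 0 R, w x = u (x₀ + x)) ∧
      ∀ᵐ x, x ∈ ball 0 R → ∇ w x = Du (x₀ + x) := by
  have hmem : ∀ x, x ∈ ball 0 R ↔ x₀ + x ∈ ball x₀ R := by simp
  have hlip : LipschitzOnWith (toNNReal √(B * R)) u (ball x₀ R) := by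
    refine LipschitzOnWith.of_dist_le_mul fun x hx y hy => ?_
    rw [coe_toNNReal _ (sqrt_nonneg _), dist_eq, dist_eq_norm]
    refine MemW12Loc.abs_sub_le isOpen_ball (convex_ball x₀ R) (hsob.mono hR)
      (hcont.mono hR) ?_ hx hy
    rw [ae_restrict_iff' measurableSet_ball]
    filter_upwards [hgr] with z hz hzR
    refine Real.le_sqrt_of_sq_le ((hz hzR).trans (mul_le_mul_of_nonneg_left ?_ hB))
    rw [mem_ball_iff_norm] at hzR
    refine max_le ?_ ((norm_nonneg _).trans hzR.le)
    have := (le_abs_self _).trans (abs_coord_le (z - x₀) 1)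
    rw [PiLp.sub_apply, hline, sub_zero] at this
    exact this.trans hzR.le
  obtain ⟨g, hg, hgu⟩ := hlip.extend_real
  set W := fun x => max (g x) 0 with hW
  have hWl : LipschitzWith _ W := hg.max_const 0
  have hWu : EqOn u W (ball x₀ R) := fun x hx => by
    rw [hW]
    simp only
    rw [← hgu hx, max_eq_left (hpos x (hR hx))]
  have hgrad := (hsob.mono hR).ae_eq isOpen_ball (memW12Loc_of_lipschitzWith hWl _) hWu
  refine ⟨fun x => W (x₀ + x), ⟨_, hWl.comp (isometry_add_left x₀).lipschitz⟩,
    fun x => le_max_right _ _, fun x hx => (hWu ((hmem x).1 hx)).symm, ?_⟩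
  filter_upwards [ae_const_add hgrad x₀] with x hx hxR
  rw [gradient_comp_const_add, hx ((hmem x).1 hxR)]

namespace IsSubsonicVariationalSolution

variable {Ω : Set Plane} {x₀ : Plane}
  {d R B : ℝ} {J F : ℝ × ℝ → ℝ} {l : ℝ → ℝ}

/-- Near a stagnation point the constitutive functions of the liquid agree with those of a local
law; for `x 1 ≤ 0`, where the former are not controlled, all terms vanish. -/
lemma lawSolution (hu : IsSubsonicVariationalSolution L Ω u Du) (hL : L.LocalLaw d C J F l)
    (hline : x₀ 1 = 0) (hB : 0 ≤ B) (hRΩ : ball x₀ R ⊆ Ω) (hRd : R ≤ d) (hBd : B * R < d)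
    (hgr : ∀ᵐ x, x ∈ ball x₀ R → ‖Du x‖ ^ 2 ≤ B * max (x 1) 0)
    (hlip : ∃ K, LipschitzWith K w) (hw0 : ∀ x, 0 ≤ w x)
    (hwu : ∀ x ∈ ball 0 R, w x = u (x₀ + x))
    (hgw : ∀ᵐ x, x ∈ ball 0 R → ∇ w x = Du (x₀ + x)) :
    LawSolution R B J F l w := by
  have hmem : ∀ x ∈ ball 0 R, x₀ + x ∈ Ω := fun x hx => hRΩ <| by
    rwa [mem_ball_iff_norm, add_sub_cancel_left, ← mem_ball_zero_iff]
  have h1 : ∀ x, (x₀ + x) 1 = x 1 := by simp_all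
  have hlow : ∀ x ∈ ball 0 R, x 1 ≤ 0 → w x = 0 := fun x hx hx1 => by
    rw [hwu x hx, hu.eq_zero _ (hmem x hx) (by rwa [h1])]
  have hgrad : ∀ᵐ x, x ∈ ball 0 R → ‖∇ w x‖ ^ 2 ≤ B * max (x 1) 0 := by
    filter_upwards [hgw, ae_const_add hgr x₀] with x hx hx' hxR
    rw [hx hxR, ← h1 x]
    exact hx' (by rwa [mem_ball_iff_norm, add_sub_cancel_left, ← mem_ball_zero_iff])
  have hchi : ∀ x ∈ ball 0 R, chi w x = chi u (x₀ + x) := fun x hx => by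
    simp only [chi, indicator, Set.mem_ofPred_eq, hwu x hx]
  refine ⟨hB, hlip, hw0, hlow, hgrad, ?_, fun φ hφ => ?_⟩
  · have : ContDiffOn ℝ 2 (fun x => u (x₀ + x)) {x | x ∈ ball 0 R ∧ 0 < w x} :=
      hu.contDiffOn.comp (contDiff_const.add contDiff_id).contDiffOn fun x hx =>
        ⟨hmem x hx.1, by rw [← hwu x hx.1]; exact hx.2⟩
    exact this.congr fun x hx => hwu x hx.1
  · have h0 := hu.domain_variation _ (hφ.comp_sub hmem)
    rw [setIntegral_eq_integral_of_forall_compl_eq_zero, ← integral_add_left_eq_self _ x₀] at h0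
    · rw [← h0]
      refine integral_congr_ae ?_
      filter_upwards [hgw, hgrad] with x hx hxg
      simp only [lawIntegrand, divergence_comp_sub, fderiv_comp_sub, add_sub_cancel_left, h1]
      by_cases hxR : x ∈ ball 0 R
      · rw [hx hxR, hchi x hxR] at *
        specialize hxg hxR
        have ha := abs_coord_le x 1
        rw [mem_ball_zero_iff] at hxR
        rcases le_or_gt (x 1) 0 with hx1 | hx1
        · rw [max_eq_right hx1, mul_zero] at hxg
          have hD : ‖Du (x₀ + x)‖ = 0 := by simp_all
          have hχ : chi u (x₀ + x) = 0 := by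
            rw [← hchi x (by rwa [mem_ball_zero_iff]), chi, indicator_of_notMem]
            simp [hlow x (by rwa [mem_ball_zero_iff]) hx1]
          have hF0 := hL.F_bound 0 (x 1)
          have hF2 := hL.dF₂_bound 0 (x 1)
          simp only [abs_zero, mul_zero, zero_mul, zero_div, sub_zero, abs_nonpos_iff] at hF0 hF2
          have hL0 : ∀ s, L.F 0 s = 0 := fun s => by simp [Liquid.F]
          have hL2 : L.dF₂ 0 (x 1) = 0 := by simp [Liquid.dF₂, hL0]
          rw [norm_eq_zero.1 hD]
          simp [hχ, hF0, hF2, hL0, hL2]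
        · rw [max_eq_left hx1.le] at hxg
          have hxd : x 1 < d := by grind
          have ht : |‖Du (x₀ + x)‖ ^ 2| < d := by
            rw [abs_of_nonneg (sq_nonneg _)]
            refine (hxg.trans (mul_le_mul_of_nonneg_left ?_ hB)).trans_lt hBd
            exact ((le_abs_self _).trans ha).trans hxR.le
          rw [hL.J_eq _ _ ht hx1.le hxd, hL.F_eq _ _ ht hx1.le hxd, hL.dF₂_eq _ _ ht hx1 hxd,
            hL.lam_eq _ hx1.le hxd, hL.deriv_lam_eq _ hx1 hxd]
      · have hxs : x ∉ tsupport φ := fun h => hxR (hφ.2.2 h)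
        simp [divergence_eq_zero_of_notMem_tsupport hxs, fderiv_of_notMem_tsupport (𝕜 := ℝ) hxs,
          image_eq_zero_of_notMem_tsupport hxs]
    · intro x hx
      have hxs : x ∉ tsupport fun y => φ (y - x₀) := fun h => hx ((hφ.comp_sub hmem).2.2 h)
      have := image_eq_zero_of_notMem_tsupport hxs
      simp [divergence_eq_zero_of_notMem_tsupport hxs, fderiv_of_notMem_tsupport (𝕜 := ℝ) hxs,
        this]

end IsSubsonicVariationalSolution

/-- The weighted bound of the variation measure, tested with vector fields. -/
lemma IsVariationMeasure.abs_integral_le {Ω : Set Plane} {μ : Measure Plane}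
    {x₀ : Plane} {C₀ R : ℝ} (hμ : IsVariationMeasure (Ω ∩ {x | 0 < x 1}) (chi u) μ)
    (hline : x₀ 1 = 0)
    (hper : ∀ r : ℝ, 0 < r → closedBall x₀ r ⊆ Ω →
      ENNReal.ofReal (r ^ (-(3 / 2) : ℝ)) *
        ∫⁻ x in ball x₀ r ∩ {x | 0 < x 1}, ENNReal.ofReal (Real.sqrt (x 1)) ∂μ
          ≤ ENNReal.ofReal C₀)
    (hR : closedBall x₀ R ⊆ Ω)
    (hwu : ∀ x ∈ ball 0 R, w x = u (x₀ + x)) {M ρ : ℝ}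
    (hρ : 0 < ρ) (hρR : ρ ≤ R) (hφ : IsTestField (ball 0 ρ ∩ {x | 0 < x 1}) φ)
    (hM : ∀ x, ‖φ x‖ ≤ M * √(x 1)) :
    |∫ x, chi w x * divergence φ x| ≤ M * (|C₀| * ρ ^ (3 / 2 : ℝ)) := by
  have hM0 : 0 ≤ M := by
    simpa using (norm_nonneg _).trans (hM !₂[0, 1])
  have hmem : ∀ x ∈ ball 0 ρ ∩ {x | 0 < x 1},
      x₀ + x ∈ ball x₀ ρ ∩ {x | 0 < x 1} := by simp_all
  have hsub : ball x₀ ρ ∩ {x : Plane | 0 < x 1} ⊆ Ω ∩ {x | 0 < x 1} :=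
    inter_subset_inter_left _
      ((ball_subset_closedBall.trans (closedBall_subset_closedBall hρR)).trans hR)
  set ψ := fun y => φ (y - x₀) with hψ
  have hψt : IsTestField (ball x₀ ρ ∩ {x | 0 < x 1}) ψ := hφ.comp_sub hmem
  obtain ⟨σ, -, hσ, hpol⟩ := hμ.polar
  have h0 := hpol ψ ⟨hψt.1, hψt.2.1, hψt.2.2.trans hsub⟩
  rw [setIntegral_eq_integral_of_forall_compl_eq_zero, ← integral_add_left_eq_self _ x₀] at h0
  swap
  · intro x hx
    rw [divergence_eq_zero_of_notMem_tsupport fun h => hx (hsub (hψt.2.2 h)), mul_zero]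
  simp only [hψ, divergence_comp_sub] at h0
  have e1 : ∫ x, chi w x * divergence φ x = ∫ x, chi u (x₀ + x) * divergence φ x := by
    refine integral_congr_ae (.of_forall fun x => ?_)
    by_cases hx : x ∈ tsupport φ
    · simp only [chi, indicator, Set.mem_ofPred_eq,
        hwu x (ball_subset_ball hρR (hφ.2.2 hx).1)]
    · simp only [divergence_eq_zero_of_notMem_tsupport hx, mul_zero]
  rw [e1, h0, abs_neg, ← norm_eq_abs]
  have hUm : MeasurableSet (ball x₀ ρ ∩ {x : Plane | 0 < x 1}) :=
    (isOpen_ball.inter (by simpa using isOpen_halfPlane 0 1)).measurableSet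
  have hpρ : ρ ^ (-(3 / 2) : ℝ) * ρ ^ (3 / 2 : ℝ) = 1 := by
    rw [← rpow_add hρ]; norm_num
  have hp0 : 0 < ρ ^ (3 / 2 : ℝ) := rpow_pos_of_pos hρ _
  -- outside the support of the test field the integrand vanishes
  have h2 : ∫⁻ x in Ω ∩ {x | 0 < x 1}, ‖(⟪φ (x - x₀), σ x⟫ : ℝ)‖ₑ ∂μ
      ≤ ∫⁻ x in ball x₀ ρ ∩ {x | 0 < x 1},
        ENNReal.ofReal M * ENNReal.ofReal (√(x 1)) ∂μ := by
    rw [← inter_eq_self_of_subset_left hsub, ← Measure.restrict_restrict hUm,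
      ← lintegral_indicator hUm]
    refine lintegral_mono_ae ?_
    filter_upwards [hσ] with x hx
    by_cases hxs : x ∈ tsupport ψ
    · rw [indicator_of_mem (hψt.2.2 hxs), ← ENNReal.ofReal_mul hM0, ← ofReal_norm]
      refine ENNReal.ofReal_le_ofReal ((norm_inner_le_norm _ _).trans ?_)
      have := hM (x - x₀)
      rw [PiLp.sub_apply, hline, sub_zero] at this
      rwa [hx, mul_one]
    · have : φ (x - x₀) = 0 := image_eq_zero_of_notMem_tsupport (f := ψ) hxs
      simp [this]
  have h3 : ∫⁻ x in ball x₀ ρ ∩ {x | 0 < x 1}, ENNReal.ofReal (√(x 1)) ∂μ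
      ≤ ENNReal.ofReal (|C₀| * ρ ^ (3 / 2 : ℝ)) := by
    have := hper ρ hρ ((closedBall_subset_closedBall hρR).trans hR)
    calc _ = ENNReal.ofReal (ρ ^ (3 / 2 : ℝ)) * (ENNReal.ofReal (ρ ^ (-(3 / 2) : ℝ)) *
          ∫⁻ x in ball x₀ ρ ∩ {x | 0 < x 1}, ENNReal.ofReal (√(x 1)) ∂μ) := by
          rw [← mul_assoc, ← ENNReal.ofReal_mul hp0.le, mul_comm (ρ ^ (3 / 2 : ℝ)), hpρ,
            ENNReal.ofReal_one, one_mul]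
      _ ≤ ENNReal.ofReal (ρ ^ (3 / 2 : ℝ)) * ENNReal.ofReal C₀ := by gcongr
      _ ≤ _ := by
          rw [← ENNReal.ofReal_mul hp0.le]
          exact ENNReal.ofReal_le_ofReal (by
            rw [mul_comm]; exact mul_le_mul_of_nonneg_right (le_abs_self _) hp0.le)
  rw [lintegral_const_mul _ (by fun_prop)] at h2
  rw [← ENNReal.ofReal_le_ofReal_iff (by positivity), ENNReal.ofReal_mul hM0, ofReal_norm]
  exact (enorm_integral_le_lintegral_enorm _).trans (h2.trans (by gcongr))

/-- After a translation, a subsonic variational solution is an almost solution near a stagnation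
point. -/
lemma IsSubsonicVariationalSolution.exists_almostSolution {Ω : Set Plane}
    {x₀ : Plane} {μ : Measure Plane} {C₀ : ℝ}
    (hu : IsSubsonicVariationalSolution L Ω u Du) (hgrowth : GrowthBound Ω Du) (hx₀ : x₀ ∈ Ω)
    (hline : x₀ 1 = 0) (hμ : IsVariationMeasure (Ω ∩ {x | 0 < x 1}) (chi u) μ)
    (hper : ∀ r : ℝ, 0 < r → closedBall x₀ r ⊆ Ω →
      ENNReal.ofReal (r ^ (-(3 / 2) : ℝ)) *
        ∫⁻ x in ball x₀ r ∩ {x | 0 < x 1}, ENNReal.ofReal (Real.sqrt (x 1)) ∂μ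
          ≤ ENNReal.ofReal C₀) {d : ℝ} {J F : ℝ × ℝ → ℝ} {l : ℝ → ℝ}
    (hL : L.LocalLaw d C J F l) :
    ∃ R c κ w, AlmostSolution R c κ w ∧ R ≤ d ∧ c * R < d ∧
      (∀ x ∈ ball 0 R, w x = u (x₀ + x)) ∧
      ∀ᵐ x, x ∈ ball 0 R → ∇ w x = Du (x₀ + x) := by
  obtain ⟨R₀, hR₀, hsub⟩ := Metric.nhds_basis_closedBall.mem_iff.1 (hu.isOpen.mem_nhds hx₀)
  obtain ⟨B, hB⟩ := hgrowth _ hsub (isCompact_closedBall x₀ R₀)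
  have hd := hL.d_pos
  have hC := hL.C_nonneg
  have hρ := L.ρ₀_pos
  set c := |B| + |C₀| with hc
  have hc0 : 0 ≤ c := by positivity
  set R := min R₀ (d / (2 * (c + 1))) with hR
  have hR0 : 0 < R := by positivity
  have hRc : (c + 1) * R < d := by
    have : R ≤ d / (2 * (c + 1)) := min_le_right _ _
    rw [le_div_iff₀ (by positivity)] at this
    linarith
  have hRs : closedBall x₀ R ⊆ Ω :=
    (closedBall_subset_closedBall (min_le_left _ _)).trans hsub
  have hgr : ∀ᵐ x, x ∈ ball x₀ R → ‖Du x‖ ^ 2 ≤ |B| * max (x 1) 0 := by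
    filter_upwards [(ae_restrict_iff' measurableSet_closedBall).1 hB] with x hx hxR
    exact (hx (closedBall_subset_closedBall (min_le_left _ _)
      (ball_subset_closedBall hxR))).trans
      (mul_le_mul_of_nonneg_right (le_abs_self _) (le_max_right _ _))
  have hRb := ball_subset_closedBall.trans hRs
  have hRd : R ≤ d := by nlinarith
  have hBc : |B| ≤ c := by linarith [abs_nonneg C₀]
  obtain ⟨w, hlip, hw0, hwu, hgw⟩ := exists_lipschitz_extension hu.sobolev hu.continuousOn hu.nonneg
    hline (abs_nonneg B) hRb hgr
  have h := hu.lawSolution hL hline (abs_nonneg B) hRb hRd (by nlinarith) hgr hlip hw0 hwu hgw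
  refine ⟨R, c, L.ρ₀ * C * (4 * (|B| + 1) ^ 2), w, ⟨hR0, hc0, by positivity, hlip, hw0, h.lower,
    ?_, h.smooth.of_le (by norm_num), fun φ hφ => (h.abs_integral_varIntegrand_le hL hφ).2,
    h.almostHarmonic hL, fun φ M ρ hρ hφ hρR hM => ?_⟩, hRd, by linarith, hwu, hgw⟩
  · filter_upwards [h.grad] with x hx hxR
    exact (hx hxR).trans (mul_le_mul_of_nonneg_right hBc (le_max_right _ _))
  · have hM0 : 0 ≤ M := by simpa using (norm_nonneg _).trans (hM !₂[0, 1])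
    refine (hμ.abs_integral_le hline hper hRs hwu hρ hρR hφ hM).trans ?_
    gcongr
    linarith [abs_nonneg B]

/-! ### The weighted density and the blow-ups at a stagnation point -/

lemma setIntegral_ball_eq_mul (f : Plane → ℝ) (hr : 0 < r) :
    ∫ x in ball 0 r, f x = r ^ 2 * ∫ x in ball 0 1, f (r • x) := by
  rw [Measure.setIntegral_comp_smul_of_pos _ _ _ hr, smul_unitBall_of_pos hr,
    finrank_euclideanSpace_fin, smul_eq_mul, mul_inv_cancel_left₀ (by positivity)]

lemma blowUp_blowUp (w : Plane → ℝ) {a b : ℝ} (ha : 0 ≤ a) (hb : 0 ≤ b) :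
    blowUp (blowUp w 0 a) 0 b = blowUp w 0 (a * b) := by
  ext x
  rw [blowUp_zero_apply, blowUp_zero_apply, blowUp_zero_apply, mul_rpow ha hb, smul_smul,
    div_div]

lemma blowUp_stokesProfile (hr : 0 < r) : blowUp stokesProfile 0 r = stokesProfile := by
  ext x
  have h : (⟨(r • x) 0, (r • x) 1⟩ : ℂ) = (r : ℂ) * ⟨x 0, x 1⟩ := by
    apply Complex.ext <;> simp
  rw [blowUp_zero_apply, stokesProfile, stokesProfile, h, Complex.arg_real_mul _ hr, norm_smul,
    norm_of_nonneg hr.le, mul_rpow hr.le (norm_nonneg x)]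
  have := (rpow_pos_of_pos hr (3 / 2)).ne'
  field_simp

lemma MemW12Loc.congr {U : Set Plane}
    {Dw : Plane → Plane} (h : MemW12Loc U w Dw) (hu : EqOn w u U) (hD : EqOn Dw Du U) :
    MemW12Loc U u Du := by
  refine ⟨fun K hK hc => (h.memLp K hK hc).ae_eq ?_, fun K hK hc => (h.memLp_grad K hK hc).ae_eq ?_,
    fun η hη hc hs i => ?_⟩
  · exact (ae_restrict_iff' hc.measurableSet).2 (.of_forall fun x hx => hu (hK hx))
  · exact (ae_restrict_iff' hc.measurableSet).2 (.of_forall fun x hx => hD (hK hx))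
  · have h1 := h.weak η hη hc hs i
    convert! h1 using 1
    · refine integral_congr_ae (.of_forall fun x => ?_)
      by_cases hx : x ∈ tsupport η
      · simp only [hu (hs hx)]
      · simp [fderiv_of_notMem_tsupport (𝕜 := ℝ) hx]
    · congr 1
      refine integral_congr_ae (.of_forall fun x => ?_)
      by_cases hx : x ∈ tsupport η
      · simp only [hD (hs hx)]
      · simp [image_eq_zero_of_notMem_tsupport hx]

lemma MemW12Loc.univ_of_lipschitzOn
    (h : ∀ ρ : ℝ, 0 < ρ → ∃ K, LipschitzOnWith K U (ball 0 ρ)) :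
    MemW12Loc univ U (∇ U) := by
  have hball : ∀ ρ : ℝ, 0 < ρ → MemW12Loc (ball 0 ρ) U (∇ U) := fun ρ hρ => by
    obtain ⟨K, hK⟩ := h ρ hρ
    obtain ⟨g, hg, hgU⟩ := hK.extend_real
    refine (memW12Loc_of_lipschitzWith hg _).congr
      hgU.symm fun x hx => gradient_congr ?_
    exact (hgU.symm.eventuallyEq_of_mem (isOpen_ball.mem_nhds hx))
  have hex : ∀ K : Set Plane, IsCompact K → ∃ ρ, 0 < ρ ∧ K ⊆ ball 0 ρ := fun K hK => by
    obtain ⟨ρ, hρ⟩ := hK.isBounded.subset_ball 0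
    exact ⟨max ρ 1, by positivity, hρ.trans (ball_subset_ball (le_max_left _ _))⟩
  refine ⟨fun K _ hK => ?_, fun K _ hK => ?_, fun η hη hc _ => ?_⟩
  · obtain ⟨ρ, hρ, hs⟩ := hex K hK
    exact (hball ρ hρ).memLp K hs hK
  · obtain ⟨ρ, hρ, hs⟩ := hex K hK
    exact (hball ρ hρ).memLp_grad K hs hK
  · obtain ⟨ρ, hρ, hs⟩ := hex _ hc.isCompact
    exact (hball ρ hρ).weak η hη hc hs

/-- A homogeneous limit of blow-ups on the unit disc is their limit on every disc. -/
lemma BlowUpTendsto.on_ball {a : ℝ} (ha : 0 < a)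
    (h : BlowUpTendsto (blowUp w 0 a) U) (hU : ∀ r, 0 < r → blowUp U 0 r = U) {ρ : ℝ}
    (hρ : 0 < ρ) :
    TendstoUniformlyOn (fun r => blowUp w 0 r) U (𝓝[>] 0) (closedBall 0 ρ) ∧
    Tendsto (fun r => ∫ x in ball 0 ρ,
      ‖∇ (blowUp w 0 r) x - ∇ U x‖ ^ 2) (𝓝[>] 0) (𝓝 0) := by
  have hρp := rpow_pos_of_pos hρ (3 / 2)
  have ht := tendsto_const_mul_nhdsGT (div_pos hρ ha)
  have hb : ∀ r : ℝ, 0 < r →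
      blowUp (blowUp w 0 a) 0 (ρ / a * r) = blowUp (blowUp w 0 r) 0 ρ := fun r hr => by
    rw [blowUp_blowUp _ ha.le (by positivity), blowUp_blowUp _ hr.le hρ.le]
    congr 1; field_simp
  constructor
  · rw [Metric.tendstoUniformlyOn_iff]
    intro ε hε
    filter_upwards [ht.eventually (Metric.tendstoUniformlyOn_iff.1 h.uniform _ (div_pos hε hρp)),
      self_mem_nhdsWithin] with r hr hr0 x hx
    have hy : ρ⁻¹ • x ∈ closedBall 0 1 := by
      rw [mem_closedBall_zero_iff] at hx ⊢
      rw [norm_smul, norm_inv, norm_of_nonneg hρ.le, inv_mul_le_iff₀ hρ]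
      linarith
    have h1 := hr _ hy
    rw [hb r hr0, ← hU ρ hρ, blowUp_zero_apply, blowUp_zero_apply, smul_smul,
      mul_inv_cancel₀ hρ.ne', one_smul, dist_eq, ← sub_div, abs_div, abs_of_pos hρp,
      div_lt_div_iff_of_pos_right hρp] at h1
    rwa [dist_eq]
  · have h1 := (h.grad.comp ht).const_mul (ρ ^ 3)
    rw [mul_zero] at h1
    refine h1.congr' ?_
    filter_upwards [self_mem_nhdsWithin] with r hr
    simp only [Function.comp_apply]
    rw [setIntegral_ball_eq_mul _ hρ, hb r hr, ← integral_const_mul, ← integral_const_mul]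
    refine integral_congr_ae (.of_forall fun x => ?_)
    have h2 : ∇ U x = (ρ / ρ ^ (3 / 2 : ℝ)) • ∇ U (ρ • x) := by
      rw [← gradient_blowUp, hU ρ hρ]
    simp only
    rw [gradient_blowUp (blowUp w 0 r), h2, ← smul_sub, norm_smul, mul_pow, norm_eq_abs,
      sq_abs, sq_div_rpow hρ]
    field_simp

/-- The modes of convergence of the blow-ups. -/
lemma AlmostSolution.tendsto_blowUp {R c κ : ℝ} {x₀ : Plane}
    (h : AlmostSolution R c κ w) (hwu : ∀ x ∈ ball 0 R, w x = u (x₀ + x))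
    (hU : ∀ r, 0 < r → blowUp U 0 r = U) {a : ℝ} (ha : 0 < a)
    (hlim : BlowUpTendsto (blowUp w 0 a) U) :
    TendstoW12Loc (blowUp u x₀) U ∧
      TendstoLocallyUniformly (blowUp u x₀) U (𝓝[>] 0) := by
  have hR := h.R_pos
  have hev : ∀ ρ : ℝ, 0 < ρ → ∀ᶠ r in 𝓝[>] 0, 0 < r ∧ r * ρ < R := fun ρ hρ => by
    filter_upwards [Ioo_mem_nhdsGT (div_pos hR hρ)] with r hr
    exact ⟨hr.1, (lt_div_iff₀ hρ).1 hr.2⟩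
  have heq : ∀ {r ρ : ℝ}, 0 < r → r * ρ < R → EqOn (blowUp w 0 r)
      (blowUp u x₀ r) (closedBall 0 ρ) := fun {r ρ} hr hrρ x hx => by
    rw [blowUp_zero_apply, blowUp, hwu]
    rw [mem_closedBall_zero_iff] at hx
    rw [mem_ball_zero_iff, norm_smul, norm_of_nonneg hr.le]
    exact (mul_le_mul_of_nonneg_left hx hr.le).trans_lt hrρ
  have hunif : ∀ ρ : ℝ, 0 < ρ →
      TendstoUniformlyOn (blowUp u x₀) U (𝓝[>] 0) (closedBall 0 ρ) :=
    fun ρ hρ => (hlim.on_ball ha hU hρ).1.congr ((hev ρ hρ).mono fun r hr => heq hr.1 hr.2)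
  have hUlip : ∀ ρ : ℝ, 0 < ρ → ∃ K, LipschitzOnWith K U (ball 0 ρ) := fun ρ hρ => by
    refine ⟨toNNReal √(c * ρ), LipschitzOnWith.of_dist_le_mul fun x hx y hy => ?_⟩
    rw [coe_toNNReal _ (sqrt_nonneg _), dist_eq, dist_eq_norm]
    have h1 : ∀ z ∈ ball 0 ρ,
        Tendsto (fun r => blowUp w 0 r z) (𝓝[>] 0) (𝓝 (U z)) := fun z hz =>
      (hlim.on_ball ha hU hρ).1.tendsto_at (ball_subset_closedBall hz)
    refine le_of_tendsto ((h1 x hx).sub (h1 y hy)).abs ?_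
    filter_upwards [hev ρ hρ] with r hr
    exact (h.rescale hr.1).abs_sub_le ((le_div_iff₀ hr.1).2 (by rw [mul_comm]; exact hr.2.le)) hx hy
  have hUW := MemW12Loc.univ_of_lipschitzOn hUlip
  refine ⟨⟨fun r => ∇ (blowUp w 0 r), ∇ U, hUW, fun ρ hρ =>
    ⟨?_, ?_, ?_⟩⟩, ?_⟩
  · filter_upwards [hev ρ hρ] with r hr
    obtain ⟨K, hK⟩ := (h.rescale hr.1).lip
    exact (memW12Loc_of_lipschitzWith hK _).congr
      ((heq hr.1 hr.2).mono ball_subset_closedBall) fun _ _ => rfl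
  · rw [ENNReal.tendsto_nhds_zero]
    intro ε hε
    set V := (volume.restrict (ball (0 : Plane) ρ)) univ ^ (2 : ENNReal).toReal⁻¹ with hV
    have hVt : V ≠ ⊤ := by
      rw [hV, Measure.restrict_apply_univ]
      exact ENNReal.rpow_ne_top_of_nonneg (by simp) measure_ball_lt_top.ne
    have h1 : Tendsto (fun δ : ℝ => V * ENNReal.ofReal δ) (𝓝[>] 0) (𝓝 0) := by
      have := ENNReal.Tendsto.const_mul (ENNReal.tendsto_ofReal (tendsto_id (x := 𝓝 (0 : ℝ))))
        (Or.inr hVt)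
      simp only [ENNReal.ofReal_zero, mul_zero] at this
      exact this.mono_left nhdsWithin_le_nhds
    obtain ⟨δ, hδ, hδ0⟩ := ((ENNReal.tendsto_nhds_zero.1 h1 ε hε).and self_mem_nhdsWithin).exists
    filter_upwards [Metric.tendstoUniformlyOn_iff.1 (hunif ρ hρ) δ hδ0] with r hr
    refine (eLpNorm_le_of_ae_bound ((ae_restrict_iff' measurableSet_ball).2
      (.of_forall fun x hx => ?_))).trans hδ
    have := (hr x (ball_subset_closedBall hx)).le
    rwa [dist_comm, dist_eq] at this
  · have h1 := (hlim.on_ball ha hU hρ).2.rpow_const (p := (2 : ℝ)⁻¹) (by simp)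
    rw [Real.zero_rpow (by norm_num)] at h1
    have h2 := ENNReal.tendsto_ofReal h1
    rw [ENNReal.ofReal_zero] at h2
    refine h2.congr' ?_
    filter_upwards [self_mem_nhdsWithin] with r hr
    obtain ⟨K, hK⟩ := (h.rescale hr).lip
    have hm : ∀ {v : Plane → ℝ}, MemW12Loc univ v (∇ v) →
        MemLp (∇ v) 2 (volume.restrict (ball 0 ρ)) := fun hv =>
      (hv.memLp_grad _ (subset_univ _) (isCompact_closedBall 0 ρ)).mono_measure
        (Measure.restrict_mono ball_subset_closedBall le_rfl)
    have h3 := ((hm (memW12Loc_of_lipschitzWith hK _)).sub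
      (hm hUW)).eLpNorm_eq_integral_rpow_norm (by norm_num) (by norm_num)
    simp only [ENNReal.toReal_ofNat, Real.rpow_ofNat, Pi.sub_apply] at h3
    exact h3.symm
  · rw [tendstoLocallyUniformly_iff_forall_isCompact]
    intro K hK
    obtain ⟨ρ, hρ⟩ := hK.isBounded.subset_closedBall 0
    exact (hunif _ (by positivity : 0 < max ρ 1)).mono
      (hρ.trans (closedBall_subset_closedBall (le_max_left _ _)))

/-- The weighted density is, up to a vanishing error, the energy of the blow-ups. -/
lemma AlmostSolution.tendsto_Phi
    {x₀ : Plane} {d R c κ m : ℝ} {J F : ℝ × ℝ → ℝ} {l : ℝ → ℝ}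
    (hL : L.LocalLaw d C J F l) (hline : x₀ 1 = 0)
    (h : AlmostSolution R c κ w) (hRd : R ≤ d) (hcd : c * R < d)
    (hwu : ∀ x ∈ ball 0 R, w x = u (x₀ + x))
    (hgw : ∀ᵐ x, x ∈ ball 0 R → ∇ w x = Du (x₀ + x))
    (hm : Tendsto (fun r => unitEnergy (blowUp w 0 r)) (𝓝[>] 0) (𝓝 m)) :
    Tendsto (fun r => Phi L u Du x₀ r) (𝓝[>] 0) (𝓝 (m / L.ρ₀)) := by
  have hc := h.C_nonneg
  have hC := hL.C_nonneg
  have hρ := L.ρ₀_pos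
  obtain ⟨K, hK⟩ := h.lip
  set G : Plane → ℝ := fun x => F (‖∇ w x‖ ^ 2, x 1) + l (x 1) * chi w x with hG
  set A := C * (c * (c + 1)) + C with hA
  have hA0 : 0 ≤ A := by positivity
  -- the density of the energy in terms of the local law
  have hGeq : ∀ᵐ x, x ∈ ball 0 R →
      L.F (‖Du (x₀ + x)‖ ^ 2) ((x₀ + x) 1) + L.lam ((x₀ + x) 1) * chi u (x₀ + x) = G x ∧
      |G x - energyDensity w x / L.ρ₀| ≤ A * ‖x‖ ^ 2 := by
    filter_upwards [hgw, h.grad] with x hx hxg hxR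
    have hg := hxg hxR
    have hχ : chi u (x₀ + x) = chi w x := by
      simp only [chi, indicator, Set.mem_ofPred_eq, hwu x hxR]
    have ha := abs_coord_le x 1
    have hxR' := mem_ball_zero_iff.1 hxR
    have hχ1 := chi_le_one w x
    have hχ0 := chi_nonneg w x
    have ht0 : 0 ≤ ‖∇ w x‖ ^ 2 := sq_nonneg _
    have htx : ‖∇ w x‖ ^ 2 ≤ c * ‖x‖ :=
      hg.trans (mul_le_mul_of_nonneg_left (max_le ((le_abs_self _).trans ha) (norm_nonneg x)) hc)
    refine ⟨?_, ?_⟩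
    · rw [hχ, PiLp.add_apply, hline, zero_add, ← hx hxR]
      simp only [hG]
      have ht : |‖∇ w x‖ ^ 2| < d := by
        rw [abs_of_nonneg ht0]
        exact (htx.trans (mul_le_mul_of_nonneg_left hxR'.le hc)).trans_lt hcd
      rcases le_or_gt (x 1) 0 with hx1 | hx1
      · rw [max_eq_right hx1, mul_zero] at hg
        have hF0 := hL.F_bound 0 (x 1)
        simp only [abs_zero, mul_zero, zero_mul, zero_div, sub_zero, abs_nonpos_iff] at hF0
        have hχ2 : chi w x = 0 := by
          rw [chi, indicator_of_notMem]
          simp [h.lower x hxR hx1]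
        rw [le_antisymm hg ht0, hF0, hχ2]
        simp [Liquid.F]
      · have hxd : x 1 < d := by grind
        rw [hL.F_eq _ _ ht hx1.le hxd, hL.lam_eq _ hx1.le hxd]
    · have hF := hL.F_bound (‖∇ w x‖ ^ 2) (x 1)
      have hl := hL.lam_bound (x 1)
      rw [abs_of_nonneg ht0] at hF
      rw [show G x - energyDensity w x / L.ρ₀
        = (F (‖∇ w x‖ ^ 2, x 1) - ‖∇ w x‖ ^ 2 / L.ρ₀)
          + (l (x 1) - x 1 / L.ρ₀) * chi w x by simp only [hG, energyDensity]; ring]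
      refine (abs_add_le _ _).trans ?_
      rw [abs_mul, abs_of_nonneg hχ0, hA, add_mul]
      refine add_le_add (hF.trans ?_) ((mul_le_of_le_one_right (abs_nonneg _) hχ1).trans (hl.trans ?_))
      · calc C * ‖∇ w x‖ ^ 2 * (‖∇ w x‖ ^ 2 + |x 1|)
            ≤ C * (c * ‖x‖) * (c * ‖x‖ + ‖x‖) := by gcongr
          _ = _ := by ring
      · rw [← sq_abs]; gcongr
  have hem := measurable_energyDensity hK.continuous
  have hGm : Measurable G := by
    have hF := hL.contDiff_F.continuous
    have hl := hL.contDiff_lam.continuous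
    have hw := hK.continuous
    simp only [hG]
    fun_prop
  have hGr : ∀ r ≤ R, ∀ᵐ x, x ∈ ball 0 r → ‖G x - energyDensity w x / L.ρ₀‖ ≤ A * r ^ 2 := by
    intro r hr
    filter_upwards [hGeq] with x hx hxr
    refine (hx (ball_subset_ball hr hxr)).2.trans ?_
    rw [mem_ball_zero_iff] at hxr
    gcongr
  set E : ℝ → ℝ := fun r => (r ^ 3)⁻¹ * ∫ x in ball 0 r,
    (G x - energyDensity w x / L.ρ₀) with hE
  have hE0 : Tendsto E (𝓝[>] 0) (𝓝 0) := by
    have h1 : Tendsto (fun r : ℝ => r * (A * volume.real (ball (0 : Plane) 1))) (𝓝[>] 0)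
        (𝓝 0) :=
      ((continuous_mul_const _).tendsto' 0 0 (zero_mul _)).mono_left nhdsWithin_le_nhds
    refine squeeze_zero_norm' ?_ h1
    filter_upwards [Ioo_mem_nhdsGT h.R_pos] with r hr
    have hr0 := hr.1
    have h2 : ‖∫ x in ball (0 : Plane) r, (G x - energyDensity w x / L.ρ₀)‖
        ≤ A * r ^ 2 * volume.real (ball (0 : Plane) r) :=
      norm_setIntegral_le_of_norm_le_const_ae measure_ball_lt_top
        ((ae_restrict_iff' measurableSet_ball).2 (hGr r hr.2.le))
    have h3 : volume.real (ball (0 : Plane) r)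
        = r ^ 2 * volume.real (ball (0 : Plane) 1) := by
      have := setIntegral_ball_eq_mul (fun _ => 1) hr0
      simpa using this
    rw [hE, norm_mul, norm_inv, norm_of_nonneg (by positivity)]
    rw [h3] at h2
    refine (mul_le_mul_of_nonneg_left h2 (by positivity)).trans (le_of_eq ?_)
    field_simp
  have hlim := (hm.div_const L.ρ₀).add hE0
  rw [add_zero] at hlim
  refine hlim.congr' ?_
  filter_upwards [Ioo_mem_nhdsGT h.R_pos] with r hr
  have hr0 := hr.1
  have hsq := IsBlowUpLimit.sq_rpow_three_halves hr0.le
  have e1 : ∫ x in ball x₀ r, (L.F (‖Du x‖ ^ 2) (x 1) + L.lam (x 1) * chi u x)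
      = ∫ x in ball 0 r, G x := by
    rw [← integral_indicator measurableSet_ball, ← integral_add_left_eq_self _ x₀,
      ← integral_indicator measurableSet_ball]
    refine integral_congr_ae ?_
    filter_upwards [hGeq] with x hx
    by_cases hxr : x ∈ ball 0 r
    · rw [indicator_of_mem hxr, indicator_of_mem
        (by rwa [mem_ball_iff_norm, add_sub_cancel_left, ← mem_ball_zero_iff]),
        (hx (ball_subset_ball hr.2.le hxr)).1]
    · simp_all
  have hen : ∀ x, ‖energyDensity w x‖ ≤ K ^ 2 + ‖x‖ := fun x =>
    (abs_energyDensity_le hK x).trans (by gcongr; exact abs_coord_le x 1)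
  have ie : IntegrableOn (fun x => energyDensity w x / L.ρ₀) (ball 0 r) := by
    refine (Measure.integrableOn_of_bounded (M := (K : ℝ) ^ 2 + r) measure_ball_lt_top.ne
      hem.aestronglyMeasurable ?_).div_const _
    rw [ae_restrict_iff' measurableSet_ball]
    refine .of_forall fun x hx => (hen x).trans ?_
    rw [mem_ball_zero_iff] at hx
    gcongr
  have id : IntegrableOn (fun x => G x - energyDensity w x / L.ρ₀) (ball 0 r) :=
    Measure.integrableOn_of_bounded measure_ball_lt_top.ne
      (Measurable.aestronglyMeasurable (by fun_prop))
      ((ae_restrict_iff' measurableSet_ball).2 (hGr r hr.2.le))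
  have e2 : ∫ x in ball 0 r, G x
      = (∫ x in ball 0 r, (G x - energyDensity w x / L.ρ₀))
        + (∫ x in ball 0 r, energyDensity w x) / L.ρ₀ := by
    rw [← MeasureTheory.integral_div, ← integral_add id ie]
    simp only [sub_add_cancel]
  have e3 : ∫ x in ball 0 r, energyDensity w x
      = r ^ 3 * ∫ x in ball 0 1, energyDensity (blowUp w 0 r) x := by
    rw [setIntegral_ball_eq_mul _ hr0]
    simp only [AlmostSolution.energyDensity_smul w hr0, integral_const_mul]
    ring
  have e4 : energyW L u x₀ r
      = (∫ θ in 0..2 * π, blowUp w 0 r (unitVec θ) ^ 2) / L.ρ₀ := by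
    rw [energyW, circleIntegral, ← intervalIntegral.integral_const_mul,
      ← intervalIntegral.integral_div]
    refine intervalIntegral.integral_congr fun θ _ => ?_
    rw [blowUp_zero_apply, hwu _ (by
      rw [mem_ball_zero_iff, norm_smul, norm_unitVec, mul_one, norm_of_nonneg hr0.le]
      exact hr.2), div_pow, hsq]
    field_simp
  rw [Phi, energyU, e1, e2, e3, e4, unitEnergy, hE]
  field_simp
  ring

end StokesWave

theorem mainTheorem8 (L : StokesWave.Liquid) (Ω : Set StokesWave.Plane)
    (u : StokesWave.Plane → ℝ) (Du : StokesWave.Plane → StokesWave.Plane)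
    (hu : StokesWave.IsSubsonicVariationalSolution L Ω u Du)
    (hgrowth : StokesWave.GrowthBound Ω Du)
    (x₀ : StokesWave.Plane) (hx₀ : x₀ ∈ Ω) (hux₀ : u x₀ = 0) (hline : x₀ 1 = 0)
    (μ : Measure StokesWave.Plane)
    (hμ : StokesWave.IsVariationMeasure (Ω ∩ {x | 0 < x 1}) (StokesWave.chi u) μ)
    (C₀ : ℝ)
    (hper : ∀ r : ℝ, 0 < r → Metric.closedBall x₀ r ⊆ Ω →
      ENNReal.ofReal (r ^ (-(3 / 2) : ℝ)) *
        ∫⁻ x in Metric.ball x₀ r ∩ {x | 0 < x 1}, ENNReal.ofReal (Real.sqrt (x 1)) ∂μ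
          ≤ ENNReal.ofReal C₀) :
    ∃ Φ₀ : ℝ,
      Tendsto (fun r => StokesWave.Phi L u Du x₀ r) (𝓝[>] 0) (𝓝 Φ₀) ∧
      (Φ₀ = 0 ∨ Φ₀ = Real.sqrt 3 / (3 * L.ρ₀) ∨ Φ₀ = 2 / (3 * L.ρ₀)) ∧
      (Φ₀ = Real.sqrt 3 / (3 * L.ρ₀) →
        StokesWave.TendstoW12Loc (StokesWave.blowUp u x₀) StokesWave.stokesProfile ∧
        TendstoLocallyUniformly (StokesWave.blowUp u x₀) StokesWave.stokesProfile (𝓝[>] 0)) ∧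
      (Φ₀ = 0 →
        StokesWave.TendstoW12Loc (StokesWave.blowUp u x₀) (fun _ => 0) ∧
        TendstoLocallyUniformly (StokesWave.blowUp u x₀) (fun _ => 0) (𝓝[>] 0)) := by
  have hρ := L.ρ₀_pos
  obtain ⟨d, C, J, F, l, hL⟩ := L.exists_localLaw
  obtain ⟨R, c, κ, w, h, hRd, hcd, hwu, hgw⟩ :=
    hu.exists_almostSolution hgrowth hx₀ hline hμ hper hL
  have hR := h.R_pos
  have ha : 0 < R / 4 := by positivity
  have h4 := h.rescale ha
  rw [show R / (R / 4) = 4 by field_simp] at h4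
  obtain ⟨T, hT, hcases, hS, hZ⟩ := h4.trichotomy
  have hlim : Tendsto (fun r => StokesWave.unitEnergy (StokesWave.blowUp w 0 r)) (𝓝[>] 0)
      (𝓝 (1 / 3 * T)) := by
    refine (hT.comp (StokesWave.tendsto_const_mul_nhdsGT (inv_pos.2 ha))).congr' ?_
    filter_upwards [self_mem_nhdsWithin] with r hr
    rw [Function.comp_apply, StokesWave.blowUp_blowUp _ ha.le (mul_pos (inv_pos.2 ha) hr).le]
    congr 2
    field_simp
  have hinj : ∀ t : ℝ, 1 / 3 * T / L.ρ₀ = t / (3 * L.ρ₀) → T = t := fun t ht => by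
    field_simp at ht
    exact ht
  refine ⟨1 / 3 * T / L.ρ₀, h.tendsto_Phi hL hline hRd hcd
    hwu hgw hlim, ?_, fun hΦ => ?_, fun hΦ => ?_⟩
  · rcases hcases with rfl | rfl | rfl
    · left; simp
    · right; left; field_simp
    · right; right; field_simp
  · exact h.tendsto_blowUp hwu (fun r hr => StokesWave.blowUp_stokesProfile hr) ha (hS (hinj _ hΦ))
  · refine h.tendsto_blowUp hwu (fun r _ => ?_) ha (hZ (hinj 0 (by rw [hΦ, zero_div])))
    ext x
    rw [StokesWave.blowUp_zero_apply, zero_div]
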